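/- **Setting.** Let $\mathbb T=\mathbb R/\mathbb Z$ and $G=\mathbb T^a\times\mathbb Z^b\times\mathbb Z_{N_1}\times\dots\times\mathbb Z_{N_c}$ with $a,b,c\ge 0$, $N_i\ge 1$, and $m=a+b+c$. For $g\in G$ let $\|g\|_G$ be the Euclidean norm of the tuple obtained from $g$ by replacing each coordinate in $\mathbb T$ or $\mathbb Z_{N_i}$ by a real, respectively integer, representative of least absolute value. A rational $m\times(\alpha+\beta)$ matrix $E$ is a *matrix representation* of a homomorphism $\varphi:\mathbb R^\alpha\times\mathbb Z^\beta\to G$ if, for every $x$, $Ex\equiv\varphi(x)$ coordinatewise, modulo $1$ in the factors $\mathbb T$, modulo $0$ in the factors $\mathbb Z$ and modulo $N_i$ in the factors $\mathbb Z_{N_i}$. Let $\|E\|_{\mathbf b}$ be such that $\log\|E\|_{\mathbf b}$ is the largest number of bits needed to store a coefficient of $E$ as a fraction. Let $H\le G$ be a closed subgroup. An *$\varepsilon$-net* of $H$ is a finitely generated subgroup $\mathcal N\le H$ such that every $h\in H$ has some $n\in\mathcal N$ with $\|h-n\|_G\le\varepsilon$. It is considered with a decomposition $\mathcal N=\mathcal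 N_{\rm comp}\oplus\mathcal N_{\rm free}$ for which there is a decomposition $H=H_{\rm comp}\oplus H_{\rm free}$, with $H_{\rm comp}$ compact and $H_{\rm free}$ either trivial or unbounded and torsion-free, such that $\mathcal N_{\rm comp}$ is a finite subgroup of $H_{\rm comp}$ and $\mathcal N_{\rm free}$ is a finitely generated torsion-free subgroup of $H_{\rm free}$. Given a $\mathbb Z$-basis $b_1,\dots,b_r$ of $\mathcal N_{\rm free}$ and a tuple $\Delta=(\Delta_1,\dots,\Delta_r)$ of non-negative integers, the corresponding *$(\Delta,\varepsilon)$-net* is $$\mathcal N_{\Delta,\varepsilon}=\mathcal N_{\rm comp}\oplus\mathcal P_\Delta,\qquad \mathcal P_\Delta=\Big\{\sum_{i=1}^r n_ib_i:\ n_i\in\{0,\pm1,\dots,\pm\Delta_i\}\Big\}.$$ Algorithms are programs for a random access machine with integer arithmetic and with an instruction that draws a uniformly random element of $\{0,\dots,n-1\}$ for a computed $n$. Time is the number of bit operations (logarithmic cost), memory is the number of bits in use. Group elements are written as tuples of $m$ fractions, modulo $G$, and the precision is given to the machine as the integer $\lceil 1/\varepsilon\rceil$. **Theorem.** There are two programs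 and polynomials $p$, $q$ such that the following holds for all $a,b,c,\alpha,\beta\ge 0$, $N_i\ge1$, every rational matrix representation $E$ of a homomorphism $\mathbb R^\alpha\times\mathbb Z^\beta\to G$ whose image is a closed subgroup $H$ of $G$, and every real $\varepsilon>0$. There are an $\varepsilon$-net $\mathcal N$ of $H$ with a decomposition $\mathcal N=\mathcal N_{\rm comp}\oplus\mathcal N_{\rm free}$ as above, a finite tuple $f$ of generators of $\mathcal N_{\rm comp}$ and a $\mathbb Z$-basis $b_1,\dots,b_r$ of $\mathcal N_{\rm free}$ such that: 1. (*Construction*) The first program is deterministic and, on the input $a,b,c,\alpha,\beta,(N_i),E,\lceil1/\varepsilon\rceil$, outputs $f$ and $b_1,\dots,b_r$, in time and with a number of bits of memory at most $p\big(m,\alpha,\beta,\max_i\log N_i,\log\|E\|_{\mathbf b},\log\lceil1/\varepsilon\rceil\big)$. 2. (*Sampling*) For every tuple $\Delta=(\Delta_1,\dots,\Delta_r)$ of non-negative integers, the second program is randomized and, on the same input together with $\Delta$, outputs an exactly uniformly distributed element of the $(\Delta,\varepsilon)$-net $\mathcal N_{\Delta,\varepsilon}=\mathcal N_{\rm comp}\oplus\mathcal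 P_\Delta$. It is collision-free: runs with different random draws output different elements. Every run uses time and a number of bits of memory at most $q\big(m,\alpha,\beta,\max_i\log N_i,\log\|E\|_{\mathbf b},\log\lceil1/\varepsilon\rceil,\max_i\log\Delta_i\big)$. Here $\log$ of a non-negative integer stands for its number of bits. -/

import Mathlib

open scoped ENNReal

noncomputable section

namespace NetSampling

/-! ### Elementary groups, norms, and matrix representations -/

/-- The elementary Abelian group `𝕋^a × ℤ^b × ℤ_{N_1} × ⋯ × ℤ_{N_c}`, with `𝕋 = ℝ/ℤ`. -/
abbrev ElemGroup (a b : ℕ) {c : ℕ} (N : Fin c → ℕ) : Type :=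
  (Fin a → UnitAddCircle) × (Fin b → ℤ) × ((i : Fin c) → ZMod (N i))

/-- The indices of the `m = a + b + c` primitive factors of `𝕋^a × ℤ^b × ℤ_{N_1} × ⋯ × ℤ_{N_c}`. -/
abbrev Row (a b c : ℕ) : Type := Fin a ⊕ Fin b ⊕ Fin c

/-- The indices of the coordinates of `ℝ^α × ℤ^β`. -/
abbrev Col (α β : ℕ) : Type := Fin α ⊕ Fin β

/-- The group `2`-norm: the Euclidean norm of the tuple in which every coordinate in `ℝ/ℤ` or in
`ℤ_N` is replaced by a representative of least absolute value. The norm of `ℝ/ℤ` is the distance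
of a representative to the nearest integer, `ZMod.valMinAbs` is a representative of least
absolute value. -/
def groupNorm {a b c : ℕ} {N : Fin c → ℕ} (g : ElemGroup a b N) : ℝ :=
  Real.sqrt ((∑ i, ‖g.1 i‖ ^ 2) + (∑ i, (g.2.1 i : ℝ) ^ 2)
    + ∑ i, (((g.2.2 i).valMinAbs : ℤ) : ℝ) ^ 2)

/-- The real tuple `y` is congruent to the group element `g`: `y_i ≡ g_i` modulo `1` for a factor
`𝕋`, modulo `0` for a factor `ℤ`, and modulo `N_i` for a factor `ℤ_{N_i}`. -/
def Congruent {a b c : ℕ} {N : Fin c → ℕ} (y : Row a b c → ℝ) (g : ElemGroup a b N) : Prop :=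
  (∀ i, ((y (.inl i) : ℝ) : UnitAddCircle) = g.1 i) ∧
  (∀ i, y (.inr (.inl i)) = (g.2.1 i : ℝ)) ∧
  (∀ i, ∃ k : ℤ, y (.inr (.inr i)) = (k : ℝ) ∧ (k : ZMod (N i)) = g.2.2 i)

/-- An element of `ℝ^α × ℤ^β` as a tuple of `α + β` real numbers. -/
def realTuple {α β : ℕ} (x : (Fin α → ℝ) × (Fin β → ℤ)) : Col α β → ℝ :=
  Sum.elim x.1 (fun j => (x.2 j : ℝ))

/-- The rational matrix `E` is a matrix representation of the homomorphism
`φ : ℝ^α × ℤ^β → 𝕋^a × ℤ^b × ℤ_{N_1} × ⋯ × ℤ_{N_c}`, that is, `φ x ≡ E x` for all `x`. -/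
def IsMatrixRep {a b c α β : ℕ} {N : Fin c → ℕ} (E : Matrix (Row a b c) (Col α β) ℚ)
    (φ : (Fin α → ℝ) × (Fin β → ℤ) →+ ElemGroup a b N) : Prop :=
  ∀ x, Congruent ((E.map (fun q : ℚ => (q : ℝ))).mulVec (realTuple x)) (φ x)

/-! ### Nets -/

section Nets

variable {a b c : ℕ} {N : Fin c → ℕ}

/-- `M` is an `ε`-net of `H`: a finitely generated subgroup of `H` that comes `ε`-close to every
element of `H`. -/
def IsEpsNet (ε : ℝ) (H M : AddSubgroup (ElemGroup a b N)) : Prop :=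
  M ≤ H ∧ M.FG ∧ ∀ h ∈ H, ∃ x ∈ M, groupNorm (h - x) ≤ ε

/-- `0` is the only element of finite order. -/
def TorsionFree (K : AddSubgroup (ElemGroup a b N)) : Prop :=
  ∀ x ∈ K, ∀ n : ℕ, 0 < n → n • x = 0 → x = 0

/-- `K = A ⊕ B`, an internal direct sum of subgroups. -/
def IsDirectSum (K A B : AddSubgroup (ElemGroup a b N)) : Prop :=
  A ⊔ B = K ∧ A ⊓ B = ⊥

/-- `H = Hc ⊕ Hf` with `Hc` compact and with `Hf` trivial, or unbounded and torsion-free. -/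
def IsCompactFreeDecomp (H Hc Hf : AddSubgroup (ElemGroup a b N)) : Prop :=
  IsDirectSum H Hc Hf ∧ IsCompact (Hc : Set (ElemGroup a b N)) ∧
  (Hf = ⊥ ∨ (TorsionFree Hf ∧ ∀ R : ℝ, ∃ h ∈ Hf, R < groupNorm h))

/-- `M = Mc ⊕ Mf` where, for some decomposition `H = Hc ⊕ Hf` as above, `Mc` is a finite subgroup
of `Hc`, and `Mf` is a finitely generated torsion-free subgroup of `Hf`. -/
def IsNetDecomp (H M Mc Mf : AddSubgroup (ElemGroup a b N)) : Prop :=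
  ∃ Hc Hf, IsCompactFreeDecomp H Hc Hf ∧ IsDirectSum M Mc Mf ∧
    Mc ≤ Hc ∧ (Mc : Set (ElemGroup a b N)).Finite ∧ Mf ≤ Hf ∧ Mf.FG ∧ TorsionFree Mf

/-- `v` is a `ℤ`-basis of the subgroup `K`. -/
def IsZBasis {r : ℕ} (v : Fin r → ElemGroup a b N) (K : AddSubgroup (ElemGroup a b N)) : Prop :=
  LinearIndependent ℤ v ∧ AddSubgroup.closure (Set.range v) = K

/-- The parallelotope of all `∑ n_i v_i` with `n_i ∈ {0, ±1, …, ±Δ_i}`. -/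
def parallelotope {r : ℕ} (v : Fin r → ElemGroup a b N) (Δ : Fin r → ℕ) :
    Set (ElemGroup a b N) :=
  {x | ∃ n : Fin r → ℤ, (∀ i, |n i| ≤ (Δ i : ℤ)) ∧ x = ∑ i, n i • v i}

/-- The set `Mc ⊕ P_Δ`, where `P_Δ` is the parallelotope with index `Δ` on the basis `v`. -/
def deltaNet {r : ℕ} (Mc : AddSubgroup (ElemGroup a b N)) (v : Fin r → ElemGroup a b N)
    (Δ : Fin r → ℕ) : Set (ElemGroup a b N) :=
  {x | ∃ g ∈ Mc, ∃ p ∈ parallelotope v Δ, x = g + p}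

end Nets

/-! ### The machine model

A program acts on finitely many integer arrays with two indices (a random access machine). The
entry of array `A` at `(i, j)` is the cell `(A, i, j)`; the array names in a program are constants,
the indices are computed. The cost is logarithmic: every operation is charged the number of bits
that it handles, products and quotients are charged the number of bit operations of the schoolbook
methods. -/

/-- The number of bits of `|z|`. -/
def bitLen (z : ℤ) : ℕ := z.natAbs.size

abbrev Cell : Type := ℕ × ℤ × ℤ

/-- The contents of the arrays; all but finitely many cells hold `0`. -/
abbrev Mem : Type := Cell →₀ ℤ

/-- The bits that are needed to store all non-zero cells with their indices and a sign. -/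
def memBits (m : Mem) : ℕ :=
  m.sum (fun p v => bitLen p.2.1 + bitLen p.2.2 + bitLen v + 1)

/-- Integer expressions. Division rounds so that the remainder is non-negative. -/
inductive Expr : Type
  | lit (z : ℤ)
  | get (A : ℕ) (i j : Expr)
  | add (x y : Expr)
  | sub (x y : Expr)
  | mul (x y : Expr)
  | div (x y : Expr)
  | mod (x y : Expr)

/-- The value of an expression. -/
def Expr.eval (m : Mem) : Expr → ℤ
  | .lit z => z
  | .get A i j => m (A, i.eval m, j.eval m)
  | .add x y => x.eval m + y.eval m
  | .sub x y => x.eval m - y.eval m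
  | .mul x y => x.eval m * y.eval m
  | .div x y => x.eval m / y.eval m
  | .mod x y => x.eval m % y.eval m

/-- The number of bit operations charged for the evaluation of an expression. -/
def Expr.cost (m : Mem) : Expr → ℕ
  | .lit z => bitLen z + 1
  | .get A i j => i.cost m + j.cost m
      + (bitLen (i.eval m) + bitLen (j.eval m) + bitLen (m (A, i.eval m, j.eval m)) + 1)
  | .add x y => x.cost m + y.cost m + (bitLen (x.eval m) + bitLen (y.eval m) + 1)
  | .sub x y => x.cost m + y.cost m + (bitLen (x.eval m) + bitLen (y.eval m) + 1)
  | .mul x y => x.cost m + y.cost m + (bitLen (x.eval m) + 1) * (bitLen (y.eval m) + 1)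
  | .div x y => x.cost m + y.cost m + (bitLen (x.eval m) + 1) * (bitLen (y.eval m) + 1)
  | .mod x y => x.cost m + y.cost m + (bitLen (x.eval m) + 1) * (bitLen (y.eval m) + 1)

/-- Programs: `set A i j e` writes the value of `e` into the cell `(A, i, j)`; `rand A i j e` writes
a uniformly random element of `{0, …, n - 1}` there, where `n` is the value of `e` (and `0` if
`n ≤ 0`); a test of `ite` and `loop` succeeds if the value of the expression is positive. -/
inductive Cmd : Type
  | skip
  | set (A : ℕ) (i j e : Expr)
  | rand (A : ℕ) (i j e : Expr)
  | seq (p q : Cmd)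
  | ite (e : Expr) (p q : Cmd)
  | loop (e : Expr) (p : Cmd)

/-- The memory, together with a record of the run so far: the number of bit operations, the largest
number of bits in use, and the outcomes of the random draws (last one first). The record is not
accessible to the program. -/
structure State : Type where
  mem : Mem
  time : ℕ
  peak : ℕ
  draws : List ℕ

/-- Charge `k` bit operations, and up to `k` bits of working space in addition to the memory. -/
def State.charge (s : State) (k : ℕ) : State :=
  { s with time := s.time + k, peak := max s.peak (memBits s.mem + k) }

def State.write (s : State) (p : Cell) (v : ℤ) : State :=
  { s with mem := s.mem.update p v }

def State.record (s : State) (x : ℕ) : State :=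
  { s with draws := x :: s.draws }

/-- The cost of evaluating the indices `i`, `j` and the expression `e` and of writing a number `v`
into a cell with these indices. -/
def writeCost (m : Mem) (i j e : Expr) (v : ℤ) : ℕ :=
  i.cost m + j.cost m + e.cost m + (bitLen (i.eval m) + bitLen (j.eval m) + bitLen v + 1)

/-- A loop with test `e` and body `body`, cut off (`none`) after `n` tests. -/
def loopExec (e : Expr) (body : State → PMF (Option State)) : ℕ → State → PMF (Option State)
  | 0, _ => PMF.pure none
  | n + 1, s =>
    if 0 < e.eval s.mem then
      (body (s.charge (e.cost s.mem + 1))).bind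
        (fun o => o.elim (PMF.pure none) (loopExec e body n))
    else PMF.pure (some (s.charge (e.cost s.mem + 1)))

/-- The distribution of the final state of a program; `none` if some loop is still running after
`fuel` tests. -/
def exec (fuel : ℕ) : Cmd → State → PMF (Option State)
  | .skip, s => PMF.pure (some (s.charge 1))
  | .set A i j e, s =>
    PMF.pure (some ((s.charge (writeCost s.mem i j e (e.eval s.mem))).write
      (A, i.eval s.mem, j.eval s.mem) (e.eval s.mem)))
  | .rand A i j e, s =>
    (PMF.uniformOfFintype (Fin ((e.eval s.mem - 1).toNat + 1))).map (fun x =>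
      some (((s.charge (writeCost s.mem i j e (e.eval s.mem))).write
        (A, i.eval s.mem, j.eval s.mem) (x.val : ℤ)).record x.val))
  | .seq p q, s => (exec fuel p s).bind (fun o => o.elim (PMF.pure none) (exec fuel q))
  | .ite e p q, s =>
    if 0 < e.eval s.mem then exec fuel p (s.charge (e.cost s.mem + 1))
    else exec fuel q (s.charge (e.cost s.mem + 1))
  | .loop e p, s => loopExec e (exec fuel p) fuel s

/-- The state in which a program is started on the memory `m`. -/
def start (m : Mem) : State := ⟨m, 0, memBits m, []⟩

/-! ### Input and output -/

def rowIndex {a b c : ℕ} : Row a b c → ℤ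
  | .inl i => (i.val : ℤ)
  | .inr (.inl i) => (a : ℤ) + (i.val : ℤ)
  | .inr (.inr i) => (a : ℤ) + (b : ℤ) + (i.val : ℤ)

def colIndex {α β : ℕ} : Col α β → ℤ
  | .inl j => (j.val : ℤ)
  | .inr j => (α : ℤ) + (j.val : ℤ)

/-- The input: array `0` holds `a, b, c, α, β` and the precision `k` (for nets of mesh `1 / k`),
array `1` holds `N`, arrays `2` and `3` hold the numerators and denominators of `E`. -/
def inputMem {a b c α β : ℕ} (N : Fin c → ℕ) (E : Matrix (Row a b c) (Col α β) ℚ) (k : ℕ) : Mem :=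
  Finsupp.single (0, 0, 0) (a : ℤ) + Finsupp.single (0, 1, 0) (b : ℤ)
  + Finsupp.single (0, 2, 0) (c : ℤ) + Finsupp.single (0, 3, 0) (α : ℤ)
  + Finsupp.single (0, 4, 0) (β : ℤ) + Finsupp.single (0, 5, 0) (k : ℤ)
  + (∑ i, Finsupp.single (1, (i.val : ℤ), 0) (N i : ℤ))
  + (∑ i, ∑ j, Finsupp.single (2, rowIndex i, colIndex j) (E i j).num)
  + ∑ i, ∑ j, Finsupp.single (3, rowIndex i, colIndex j) ((E i j).den : ℤ)

/-- The additional input of the sampling program: array `4` holds the edge lengths `Δ`. -/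
def edgeMem {r : ℕ} (Δ : Fin r → ℕ) : Mem :=
  ∑ i, Finsupp.single (4, (i.val : ℤ), 0) (Δ i : ℤ)

/-- Column `j` of the arrays `A` (numerators) and `A + 1` (denominators) holds a tuple of fractions
that is congruent to the group element `g`. -/
def Holds {a b c : ℕ} {N : Fin c → ℕ} (m : Mem) (A : ℕ) (j : ℤ) (g : ElemGroup a b N) : Prop :=
  (∀ i : Row a b c, 0 < m (A + 1, rowIndex i, j)) ∧
  Congruent (fun i : Row a b c =>
    (m (A, rowIndex i, j) : ℝ) / (m (A + 1, rowIndex i, j) : ℝ)) g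

/-- The output of the construction: array `5` holds the numbers of elements of the tuples `f` and
`v`, the arrays `6` and `7` hold `f`, the arrays `8` and `9` hold `v`. -/
def HoldsNet {a b c n r : ℕ} {N : Fin c → ℕ} (m : Mem) (f : Fin n → ElemGroup a b N)
    (v : Fin r → ElemGroup a b N) : Prop :=
  m (5, 0, 0) = (n : ℤ) ∧ m (5, 1, 0) = (r : ℤ) ∧
  (∀ j : Fin n, Holds m 6 (j.val : ℤ) (f j)) ∧ (∀ j : Fin r, Holds m 8 (j.val : ℤ) (v j))

/-- The largest number of bits of a component of a tuple of natural numbers. -/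
def maxBits {n : ℕ} (x : Fin n → ℕ) : ℕ := Finset.univ.sup (fun i => (x i).size)

/-- The largest number of bits needed to store a coefficient of `E` as a fraction. -/
def matrixBits {a b c α β : ℕ} (E : Matrix (Row a b c) (Col α β) ℚ) : ℕ :=
  Finset.univ.sup (fun i => Finset.univ.sup (fun j => bitLen (E i j).num + (E i j).den.size))

/-- The sum of `m = a + b + c`, `α`, `β`, the largest number of bits of the `N_i`, the number of
bits of a coefficient of `E`, and the number of bits of the precision `k`. -/
def inputSize {a b c α β : ℕ} (N : Fin c → ℕ) (E : Matrix (Row a b c) (Col α β) ℚ) (k : ℕ) : ℕ :=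
  (a + b + c) + α + β + maxBits N + matrixBits E + k.size

/-- `μ` is the uniform distribution on the finite non-empty set `S`. -/
def IsUniformOn {X : Type} (μ : PMF X) (S : Set X) : Prop :=
  S.Finite ∧ S.Nonempty ∧ ∀ x, μ x = S.indicator (fun _ => (S.ncard : ℝ≥0∞)⁻¹) x

/-- Started on the memory `m₀`, the deterministic program `p` constructs `f` and `v` within `T` bit
operations and `T` bits of memory. -/
def Constructs {a b c n r : ℕ} {N : Fin c → ℕ} (p : Cmd) (m₀ : Mem) (T : ℕ)
    (f : Fin n → ElemGroup a b N) (v : Fin r → ElemGroup a b N) : Prop :=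
  ∃ (fuel : ℕ) (s : State), exec fuel p (start m₀) = PMF.pure (some s) ∧
    s.time ≤ T ∧ s.peak ≤ T ∧ HoldsNet s.mem f v

/-- Started on the memory `m₀`, the randomized program `p` writes a uniformly distributed element of
`S` into column `0` of the arrays `10` and `11`. Every run takes at most `T` bit operations and `T`
bits of memory, and there are no collisions: runs with different random draws produce different
elements. -/
def Samples {a b c : ℕ} {N : Fin c → ℕ} (p : Cmd) (m₀ : Mem) (T : ℕ)
    (S : Set (ElemGroup a b N)) : Prop :=
  ∃ (fuel : ℕ) (μ : PMF State) (out : State → ElemGroup a b N),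
    exec fuel p (start m₀) = μ.map some ∧
    (∀ s ∈ μ.support, s.time ≤ T ∧ s.peak ≤ T ∧ Holds s.mem 10 0 (out s)) ∧
    IsUniformOn (μ.map out) S ∧
    ∀ s ∈ μ.support, ∀ s' ∈ μ.support, out s = out s' → s.draws = s'.draws

end NetSampling

end

/-!
The real columns of a matrix representation `E` only meet the rows of the factors `𝕋`, since a
homomorphism from `ℝ` to a discrete group vanishes; the entries in the other rows are integers.
Replace every real variable by `z / K` with `z ∈ ℤ`. If `K` is at least the sum of the absolute
values of the real columns divided by `ε`, then the images of the integral tuples `z` form an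
`ε`-net of `H` (`IsScaled.isEpsNet`). After multiplication of the rows of the factors `𝕋` by a
common denominator `q`, the net is the image of an integer matrix `X` in
`ℤ^b × ∏ ℤ_{N_i} × (ℤ / q)^a`. In this *inner* order the rows of `ℤ` come first, the rows of `𝕋`
last, and the inner row `t` is the row `(a + t) % (a + b + c)` of the input.

The decomposition of the net comes from a basis in triangular form, that is computed without large
intermediate numbers in two steps.

* Fraction-free elimination (`CramerInv`) on the rows of `ℤ` finds rows (`T p p ≠ 0`) that determine
  all other rows of `ℤ`. Its entries are minors of `X`, which bounds their size.
* The lattice spanned by the columns of `X` and by multiples `D u` of the unit vectors is brought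
  into triangular form by Euclid's algorithm, in which all entries are reduced modulo the `D u`
  (`IsTriangular`). In the rows `p` with `T p p ≠ 0`, `D p` is `Q d²`, where `d` is the last pivot of
  the elimination and `Q` a common multiple of all moduli; in the other rows `D u` is the modulus of
  the row, or `1` in a row of `ℤ`, whose entries are recovered by `completeCoords`. The added vectors
  in the rows `p` do not enlarge the net: the columns of `X` have a combination with entry `d` in row
  `p` and zero in the other such rows, and `Q d` times it vanishes modulo the moduli
  (`exists_represents`).

The basis vectors of the rows `p` with `T p p ≠ 0` form a `ℤ`-basis `v` of the free part, the basis
vectors of the rows of `𝕋` and `ℤ_{N_i}` generate the finite part. The triangular form gives every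
element of the net a unique expansion in which the coefficient of a vector of the finite part is a
non-negative digit, less than `D u` divided by the diagonal entry (`digitSystem_of_isTriangular`). A
`DigitSystem` yields everything that is claimed about the net: independence, the direct sum,
finiteness, and collision-free uniform sampling, by drawing the digits and the coefficients of `v`
independently. `IsScaled.isNetDecomp` adds the decomposition of `H`, whose free part is the span of
`v`.

For the machine, `Run W p m m'` says that the deterministic program `p` turns the memory `m` into
`m'` while all numbers written have at most `W` bits and all loops have at most `W` rounds; time and
memory are then polynomial in `W` (`Run.exec_eq`, `Cmd.exists_timeBound_le`). `Draws` is the same for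
programs with random draws. What remains is to verify the programs by loop invariants
(`constructCmd_run`, `Constructed.exists_draws`), where `W` is a constant times the third power of
the input size.
-/

namespace NetSampling

/-! ### Sizes of integers and of memories -/

theorem bitLen_le_iff {z : ℤ} {W : ℕ} : bitLen z ≤ W ↔ |z| < 2 ^ W := by
  rw [bitLen, Nat.size_le, Int.abs_eq_natAbs]
  exact_mod_cast Iff.rfl

theorem bitLen_mono {x y : ℤ} (h : |x| ≤ |y|) : bitLen x ≤ bitLen y :=
  bitLen_le_iff.2 (h.trans_lt (bitLen_le_iff.1 le_rfl))

@[simp] theorem bitLen_zero : bitLen 0 = 0 := by simp [bitLen]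

theorem bitLen_add (x y : ℤ) : bitLen (x + y) ≤ bitLen x + bitLen y + 1 := by
  rw [bitLen_le_iff]
  have hx := bitLen_le_iff.1 (le_refl (bitLen x))
  have hy := bitLen_le_iff.1 (le_refl (bitLen y))
  have h1 : (2 : ℤ) ^ bitLen x ≤ 2 ^ (bitLen x + bitLen y) :=
    pow_le_pow_right₀ (by norm_num) (by omega)
  have h2 : (2 : ℤ) ^ bitLen y ≤ 2 ^ (bitLen x + bitLen y) :=
    pow_le_pow_right₀ (by norm_num) (by omega)
  have h3 := abs_add_le x y
  rw [pow_succ]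
  linarith

theorem bitLen_sub (x y : ℤ) : bitLen (x - y) ≤ bitLen x + bitLen y + 1 := by
  have h := bitLen_add x (-y)
  have h2 : bitLen (-y) = bitLen y := by simp [bitLen]
  rwa [h2, ← sub_eq_add_neg] at h

theorem bitLen_mul (x y : ℤ) : bitLen (x * y) ≤ bitLen x + bitLen y := by
  rw [bitLen_le_iff, abs_mul, pow_add]
  exact mul_lt_mul'' (bitLen_le_iff.1 le_rfl) (bitLen_le_iff.1 le_rfl) (abs_nonneg _) (abs_nonneg _)

theorem bitLen_div (x y : ℤ) : bitLen (x / y) ≤ bitLen x :=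
  bitLen_mono (by
    rw [Int.abs_eq_natAbs, Int.abs_eq_natAbs]
    exact_mod_cast Int.natAbs_ediv_le_natAbs x y)

theorem bitLen_mod (x y : ℤ) : bitLen (x % y) ≤ bitLen x + bitLen y := by
  rcases eq_or_ne y 0 with rfl | hy
  · simp
  · refine (bitLen_mono ?_).trans (Nat.le_add_left _ _)
    rw [abs_of_nonneg (Int.emod_nonneg _ hy)]
    exact (Int.emod_lt_abs x hy).le

theorem bitLen_natCast_le (k : ℕ) : bitLen (k : ℤ) ≤ k := by
  rw [bitLen_le_iff, Nat.abs_cast]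
  exact_mod_cast k.lt_two_pow_self

theorem memBits_update (m : Mem) (p : Cell) (v : ℤ) :
    memBits (m.update p v) ≤ memBits m + (bitLen p.2.1 + bitLen p.2.2 + bitLen v + 1) := by
  classical
  have h1 := Finsupp.update_eq_erase_add_single m p v
  rw [h1, memBits, memBits]
  rw [Finsupp.sum_add_index_of_disjoint]
  · have h2 : (Finsupp.erase p m).sum (fun p v => bitLen p.2.1 + bitLen p.2.2 + bitLen v + 1)
        ≤ m.sum (fun p v => bitLen p.2.1 + bitLen p.2.2 + bitLen v + 1) := by
      rw [Finsupp.sum, Finsupp.sum, Finsupp.support_erase]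
      refine (Finset.sum_le_sum fun q hq => ?_).trans
        (Finset.sum_le_sum_of_subset (Finset.erase_subset _ _))
      rw [Finsupp.erase_ne (Finset.ne_of_mem_erase hq)]
    rcases eq_or_ne v 0 with rfl | hv
    · simp only [Finsupp.single_zero, Finsupp.sum_zero_index]; omega
    · have h3 : (Finsupp.single p v).sum (fun p v => bitLen p.2.1 + bitLen p.2.2 + bitLen v + 1)
          = bitLen p.2.1 + bitLen p.2.2 + bitLen v + 1 := by
        rw [Finsupp.sum, Finsupp.support_single p hv, Finset.sum_singleton,
          Finsupp.single_eq_same]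
      omega
  · rw [Finsupp.support_erase]
    refine Finset.disjoint_of_subset_right Finsupp.support_single_subset ?_
    simp

/-! ### Cost of commands on memories with short entries -/

/-- A factor `K` such that the value of the expression has at most `K (W + 1)` bits if every cell
of the memory has at most `W` bits. -/
def Expr.sizeFactor : Expr → ℕ
  | .lit z => bitLen z
  | .get _ _ _ => 1
  | .add x y => x.sizeFactor + y.sizeFactor + 1
  | .sub x y => x.sizeFactor + y.sizeFactor + 1
  | .mul x y => x.sizeFactor + y.sizeFactor
  | .div x _ => x.sizeFactor
  | .mod x y => x.sizeFactor + y.sizeFactor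

/-- A factor `K` such that the evaluation of the expression costs at most `K (W + 1) ^ 2` if every
cell of the memory has at most `W` bits. -/
def Expr.costFactor : Expr → ℕ
  | .lit z => bitLen z + 1
  | .get _ i j => i.costFactor + j.costFactor + (i.sizeFactor + j.sizeFactor + 2)
  | .add x y => x.costFactor + y.costFactor + (x.sizeFactor + y.sizeFactor + 1)
  | .sub x y => x.costFactor + y.costFactor + (x.sizeFactor + y.sizeFactor + 1)
  | .mul x y => x.costFactor + y.costFactor + (x.sizeFactor + 1) * (y.sizeFactor + 1)
  | .div x y => x.costFactor + y.costFactor + (x.sizeFactor + 1) * (y.sizeFactor + 1)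
  | .mod x y => x.costFactor + y.costFactor + (x.sizeFactor + 1) * (y.sizeFactor + 1)

theorem Expr.bitLen_eval_le {m : Mem} {W : ℕ} (hm : ∀ p, bitLen (m p) ≤ W) (e : Expr) :
    bitLen (e.eval m) ≤ e.sizeFactor * (W + 1) := by
  induction e with
  | lit z => simp only [eval, sizeFactor]; nlinarith [Nat.zero_le (bitLen z * W)]
  | get A i j => simp only [eval, sizeFactor]; linarith [hm (A, i.eval m, j.eval m)]
  | add x y hx hy => simp only [eval, sizeFactor]; linarith [bitLen_add (x.eval m) (y.eval m)]
  | sub x y hx hy => simp only [eval, sizeFactor]; linarith [bitLen_sub (x.eval m) (y.eval m)]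
  | mul x y hx hy => simp only [eval, sizeFactor]; linarith [bitLen_mul (x.eval m) (y.eval m)]
  | div x y hx hy => simp only [eval, sizeFactor]; linarith [bitLen_div (x.eval m) (y.eval m)]
  | mod x y hx hy => simp only [eval, sizeFactor]; linarith [bitLen_mod (x.eval m) (y.eval m)]

theorem Expr.cost_le {m : Mem} {W : ℕ} (hm : ∀ p, bitLen (m p) ≤ W) (e : Expr) :
    e.cost m ≤ e.costFactor * (W + 1) ^ 2 := by
  have hlin : ∀ x : Expr, bitLen (x.eval m) ≤ x.sizeFactor * (W + 1) ^ 2 := fun x =>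
    (bitLen_eval_le hm x).trans (Nat.mul_le_mul_left _ (Nat.le_self_pow (by norm_num) _))
  have h1 : 1 ≤ (W + 1) ^ 2 := Nat.one_le_pow _ _ (by omega)
  have hprod : ∀ x y : Expr, (bitLen (x.eval m) + 1) * (bitLen (y.eval m) + 1)
      ≤ (x.sizeFactor + 1) * (y.sizeFactor + 1) * (W + 1) ^ 2 := fun x y =>
    calc _ ≤ ((x.sizeFactor + 1) * (W + 1)) * ((y.sizeFactor + 1) * (W + 1)) :=
          Nat.mul_le_mul (by linarith [bitLen_eval_le hm x]) (by linarith [bitLen_eval_le hm y])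
      _ = _ := by ring
  induction e with
  | lit z => simp only [cost, costFactor]; nlinarith [Nat.zero_le (bitLen z)]
  | get A i j hi hj =>
    simp only [cost, costFactor]
    have h2 : bitLen (m (A, i.eval m, j.eval m)) ≤ (W + 1) ^ 2 :=
      (hm _).trans ((Nat.le_succ W).trans (Nat.le_self_pow (by norm_num) _))
    linarith [hlin i, hlin j]
  | add x y hx hy => simp only [cost, costFactor]; linarith [hlin x, hlin y]
  | sub x y hx hy => simp only [cost, costFactor]; linarith [hlin x, hlin y]
  | mul x y hx hy => simp only [cost, costFactor]; linarith [hprod x y]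
  | div x y hx hy => simp only [cost, costFactor]; linarith [hprod x y]
  | mod x y hx hy => simp only [cost, costFactor]; linarith [hprod x y]

/-- The factor of the cost of `set A i j e` and of `rand A i j e`. -/
def writeFactor (i j e : Expr) : ℕ :=
  i.costFactor + j.costFactor + e.costFactor
    + (i.sizeFactor + j.sizeFactor + e.sizeFactor + 1)

theorem writeCost_le {m : Mem} {W : ℕ} (hm : ∀ p, bitLen (m p) ≤ W) (i j e : Expr) :
    writeCost m i j e (e.eval m) ≤ writeFactor i j e * (W + 1) ^ 2 := by
  have hlin : ∀ x : Expr, bitLen (x.eval m) ≤ x.sizeFactor * (W + 1) ^ 2 := fun x =>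
    (x.bitLen_eval_le hm).trans (Nat.mul_le_mul_left _ (Nat.le_self_pow (by norm_num) _))
  have h1 : 1 ≤ (W + 1) ^ 2 := Nat.one_le_pow _ _ (by omega)
  rw [writeCost, writeFactor]
  linarith [hlin i, hlin j, hlin e, i.cost_le hm, j.cost_le hm, e.cost_le hm]

/-- A bound for the running time of a command in runs in which no cell ever holds more than `W`
bits and every loop makes at most `W` iterations. -/
def Cmd.timeBound : Cmd → ℕ → ℕ
  | .skip, _ => 1
  | .set _ i j e, W => writeFactor i j e * (W + 1) ^ 2
  | .rand _ i j e, W => writeFactor i j e * (W + 1) ^ 2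
  | .seq p q, W => p.timeBound W + q.timeBound W
  | .ite e p q, W => (e.costFactor + 1) * (W + 1) ^ 2 + (p.timeBound W + q.timeBound W)
  | .loop e p, W => W * ((e.costFactor + 1) * (W + 1) ^ 2 + p.timeBound W)
      + (e.costFactor + 1) * (W + 1) ^ 2

theorem Cmd.exists_timeBound_le (c : Cmd) :
    ∃ C d : ℕ, ∀ W, c.timeBound W ≤ C * (W + 1) ^ d := by
  have hmono : ∀ C d d' W : ℕ, d ≤ d' → C * (W + 1) ^ d ≤ C * (W + 1) ^ d' := fun C d d' W h =>
    Nat.mul_le_mul_left _ (Nat.pow_le_pow_right (by omega) h)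
  induction c with
  | skip => exact ⟨1, 0, fun W => by simp [timeBound]⟩
  | set A i j e => exact ⟨_, 2, fun W => le_rfl⟩
  | rand A i j e => exact ⟨_, 2, fun W => le_rfl⟩
  | seq p q hp hq =>
    obtain ⟨C, d, h⟩ := hp
    obtain ⟨C', d', h'⟩ := hq
    refine ⟨C + C', d + d', fun W => ?_⟩
    rw [timeBound, add_mul]
    exact add_le_add ((h W).trans (hmono _ _ _ _ (by omega)))
      ((h' W).trans (hmono _ _ _ _ (by omega)))
  | ite e p q hp hq =>
    obtain ⟨C, d, h⟩ := hp
    obtain ⟨C', d', h'⟩ := hq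
    refine ⟨(e.costFactor + 1) + (C + C'), d + d' + 2, fun W => ?_⟩
    have h1 := hmono (e.costFactor + 1) 2 (d + d' + 2) W (by omega)
    have h2 := (h W).trans (hmono C d (d + d' + 2) W (by omega))
    have h3 := (h' W).trans (hmono C' d' (d + d' + 2) W (by omega))
    rw [timeBound, add_mul _ (C + C'), add_mul C]
    exact add_le_add h1 (add_le_add h2 h3)
  | loop e p hp =>
    obtain ⟨C, d, h⟩ := hp
    refine ⟨((e.costFactor + 1) + C) + (e.costFactor + 1), d + 3, fun W => ?_⟩
    have h1 := hmono (e.costFactor + 1) 2 (d + 2) W (by omega)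
    have h2 := (h W).trans (hmono C d (d + 2) W (by omega))
    rw [timeBound, add_mul (e.costFactor + 1 + C)]
    refine add_le_add ?_ (hmono _ 2 (d + 3) _ (by omega))
    calc _ ≤ (W + 1) * ((e.costFactor + 1) * (W + 1) ^ (d + 2) + C * (W + 1) ^ (d + 2)) :=
          Nat.mul_le_mul (by omega) (add_le_add h1 h2)
      _ = _ := by ring

/-! ### Deterministic runs -/

/-- `Run W c m m'`: started on the memory `m`, the command `c` ends with the memory `m'`, without
random draws; every number written has at most `W` bits, and every execution of a loop makes at
most `W` iterations. -/
inductive Run (W : ℕ) : Cmd → Mem → Mem → Prop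
  | skip (m : Mem) : Run W .skip m m
  | set {m : Mem} {A : ℕ} {i j e : Expr} (h : bitLen (e.eval m) ≤ W) :
      Run W (.set A i j e) m (m.update (A, i.eval m, j.eval m) (e.eval m))
  | seq {p q : Cmd} {m m₁ m₂ : Mem} (hp : Run W p m m₁) (hq : Run W q m₁ m₂) :
      Run W (.seq p q) m m₂
  | ite_pos {e : Expr} {p q : Cmd} {m m' : Mem} (he : 0 < e.eval m) (hp : Run W p m m') :
      Run W (.ite e p q) m m'
  | ite_neg {e : Expr} {p q : Cmd} {m m' : Mem} (he : ¬ 0 < e.eval m) (hq : Run W q m m') :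
      Run W (.ite e p q) m m'
  | loop {e : Expr} {p : Cmd} (k : ℕ) (M : ℕ → Mem) (hk : k ≤ W)
      (hpos : ∀ i < k, 0 < e.eval (M i)) (hrun : ∀ i < k, Run W p (M i) (M (i + 1)))
      (hend : ¬ 0 < e.eval (M k)) : Run W (.loop e p) (M 0) (M k)

/-- The memory in use, and its peak so far, exceed `b` by at most the time spent. -/
def State.MemLe (b : ℕ) (s : State) : Prop :=
  memBits s.mem ≤ b + s.time ∧ s.peak ≤ b + s.time

theorem State.MemLe.charge {b : ℕ} {s : State} (h : s.MemLe b) (k : ℕ) : (s.charge k).MemLe b := by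
  obtain ⟨h1, h2⟩ := h
  simp only [State.MemLe, State.charge]
  omega

/-- A write is paid for by the charge that precedes it. -/
theorem State.MemLe.charge_write {b : ℕ} {s : State} (h : s.MemLe b) (A : ℕ) (i j e : Expr)
    {v : ℤ} (hv : bitLen v ≤ bitLen (e.eval s.mem)) :
    ((s.charge (writeCost s.mem i j e (e.eval s.mem))).write
      (A, i.eval s.mem, j.eval s.mem) v).MemLe b := by
  obtain ⟨h1, h2⟩ := h
  have h3 := memBits_update s.mem (A, i.eval s.mem, j.eval s.mem) v
  simp only [State.MemLe, State.charge, State.write, writeCost] at *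
  omega

/-- A run bounds the execution on the machine: the final state does not depend on the fuel, once
this exceeds the bound for the number of iterations. -/
theorem Run.exec_eq {W : ℕ} {c : Cmd} {m m' : Mem} (h : Run W c m m')
    (hm : ∀ p, bitLen (m p) ≤ W) :
    (∀ p, bitLen (m' p) ≤ W) ∧ ∀ s : State, s.mem = m → ∃ s' : State, s'.mem = m' ∧
      s'.draws = s.draws ∧ s'.time ≤ s.time + c.timeBound W ∧ (∀ b, s.MemLe b → s'.MemLe b) ∧
      ∀ fuel > W, exec fuel c s = PMF.pure (some s') := by
  induction h with
  | skip m =>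
    exact ⟨hm, fun s hs => ⟨s.charge 1, hs, rfl, le_rfl, fun b hb => hb.charge 1,
      fun fuel _ => rfl⟩⟩
  | @set m A i j e h =>
    refine ⟨fun p => ?_, ?_⟩
    · classical
      rw [Finsupp.update_apply]
      split_ifs
      exacts [h, hm p]
    · rintro s rfl
      exact ⟨(s.charge (writeCost s.mem i j e (e.eval s.mem))).write
        (A, i.eval s.mem, j.eval s.mem) (e.eval s.mem), rfl, rfl,
        Nat.add_le_add_left (writeCost_le hm i j e) s.time,
        fun b hb => hb.charge_write A i j e le_rfl, fun fuel _ => by rw [exec]⟩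
  | seq hp hq ihp ihq =>
    obtain ⟨hm₁, h1⟩ := ihp hm
    obtain ⟨hm₂, h2⟩ := ihq hm₁
    refine ⟨hm₂, fun s hs => ?_⟩
    obtain ⟨s₁, hs₁, hd₁, ht₁, hb₁, he₁⟩ := h1 s hs
    obtain ⟨s₂, hs₂, hd₂, ht₂, hb₂, he₂⟩ := h2 s₁ hs₁
    refine ⟨s₂, hs₂, hd₂.trans hd₁, ?_, fun b hb => hb₂ b (hb₁ b hb), fun fuel hf => ?_⟩
    · rw [Cmd.timeBound]; omega
    · rw [exec, he₁ fuel hf, PMF.pure_bind, Option.elim, he₂ fuel hf]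
  | @ite_pos e p q m m' he hp ihp =>
    obtain ⟨hm₁, h1⟩ := ihp hm
    refine ⟨hm₁, ?_⟩
    rintro s rfl
    obtain ⟨s₁, hs₁, hd₁, ht₁, hb₁, he₁⟩ := h1 (s.charge (e.cost s.mem + 1)) rfl
    refine ⟨s₁, hs₁, hd₁, ?_, fun b hb => hb₁ b (hb.charge _), fun fuel hf => ?_⟩
    · have h2 := e.cost_le hm
      have h3 : 1 ≤ (W + 1) ^ 2 := Nat.one_le_pow _ _ (by omega)
      simp only [State.charge] at ht₁
      rw [Cmd.timeBound, add_mul, one_mul]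
      omega
    · rw [exec, if_pos he, he₁ fuel hf]
  | @ite_neg e p q m m' he hp ihp =>
    obtain ⟨hm₁, h1⟩ := ihp hm
    refine ⟨hm₁, ?_⟩
    rintro s rfl
    obtain ⟨s₁, hs₁, hd₁, ht₁, hb₁, he₁⟩ := h1 (s.charge (e.cost s.mem + 1)) rfl
    refine ⟨s₁, hs₁, hd₁, ?_, fun b hb => hb₁ b (hb.charge _), fun fuel hf => ?_⟩
    · have h2 := e.cost_le hm
      have h3 : 1 ≤ (W + 1) ^ 2 := Nat.one_le_pow _ _ (by omega)
      simp only [State.charge] at ht₁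
      rw [Cmd.timeBound, add_mul, one_mul]
      omega
    · rw [exec, if_neg he, he₁ fuel hf]
  | @loop e p k M hk hpos hrun hend ih =>
    have hbits : ∀ i ≤ k, ∀ p, bitLen (M i p) ≤ W := by
      intro i
      induction i with
      | zero => exact fun _ => hm
      | succ i hi => exact fun h => (ih i h (hi (by omega))).1
    have h1 : 1 ≤ (W + 1) ^ 2 := Nat.one_le_pow _ _ (by omega)
    refine ⟨hbits k le_rfl, ?_⟩
    have key : ∀ r i, i + r = k → ∀ s : State, s.mem = M i → ∃ s' : State, s'.mem = M k ∧
        s'.draws = s.draws ∧ s'.time ≤ s.time + (r * ((e.costFactor + 1) * (W + 1) ^ 2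
          + p.timeBound W) + (e.costFactor + 1) * (W + 1) ^ 2) ∧
        (∀ b, s.MemLe b → s'.MemLe b) ∧
        ∀ fuel > W, ∀ n > r, loopExec e (exec fuel p) n s = PMF.pure (some s') := by
      intro r
      induction r with
      | zero =>
        rintro i rfl s hs
        refine ⟨s.charge (e.cost s.mem + 1), hs, rfl, ?_, fun b hb => hb.charge _, ?_⟩
        · have := e.cost_le (hbits i (by omega))
          rw [← hs] at this
          simp only [State.charge, add_mul, one_mul, zero_mul]
          omega
        · intro fuel hf n hn
          obtain ⟨n, rfl⟩ := Nat.exists_eq_succ_of_ne_zero (by omega : n ≠ 0)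
          rw [loopExec, if_neg]
          rw [hs]; exact hend
      | succ r hr =>
        intro i hi s hs
        obtain ⟨s₁, hs₁, hd₁, ht₁, hb₁, he₁⟩ := (ih i (by omega) (hbits i (by omega))).2
          (s.charge (e.cost s.mem + 1)) hs
        obtain ⟨s₂, hs₂, hd₂, ht₂, hb₂, he₂⟩ := hr (i + 1) (by omega) s₁ hs₁
        refine ⟨s₂, hs₂, hd₂.trans hd₁, ?_, fun b hb => hb₂ b (hb₁ b (hb.charge _)), ?_⟩
        · have := e.cost_le (hbits i (by omega))
          rw [← hs] at this
          simp only [State.charge] at ht₁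
          simp only [add_mul, one_mul] at ht₂ ⊢
          omega
        · intro fuel hf n hn
          obtain ⟨n, rfl⟩ := Nat.exists_eq_succ_of_ne_zero (by omega : n ≠ 0)
          rw [loopExec, if_pos (by rw [hs]; exact hpos i (by omega)), he₁ fuel hf, PMF.pure_bind,
            Option.elim, he₂ fuel hf n (by omega)]
    intro s hs
    obtain ⟨s', h1, h2, h3, h4, h5⟩ := key k 0 (by omega) s hs
    refine ⟨s', h1, h2, h3.trans ?_, h4, fun fuel hf => ?_⟩
    · rw [Cmd.timeBound]
      gcongr
    · rw [exec, h5 fuel hf fuel (by omega)]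

theorem Run.mono {W W' : ℕ} (hW : W ≤ W') {c : Cmd} {m m' : Mem} (h : Run W c m m') :
    Run W' c m m' := by
  induction h with
  | skip m => exact .skip m
  | set h => exact .set (h.trans hW)
  | seq _ _ h1 h2 => exact .seq h1 h2
  | ite_pos he _ h => exact .ite_pos he h
  | ite_neg he _ h => exact .ite_neg he h
  | loop k M hk hpos _ hend ih => exact .loop k M (hk.trans hW) hpos ih hend

/-! ### Arrays that a command does not touch -/

/-- Whether the expression reads the array `A`. -/
def Expr.reads : Expr → ℕ → Bool
  | .lit _, _ => false
  | .get B i j, A => B == A || i.reads A || j.reads A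
  | .add x y, A => x.reads A || y.reads A
  | .sub x y, A => x.reads A || y.reads A
  | .mul x y, A => x.reads A || y.reads A
  | .div x y, A => x.reads A || y.reads A
  | .mod x y, A => x.reads A || y.reads A

/-- Whether the command contains a write to the array `A`. -/
def Cmd.writes : Cmd → ℕ → Bool
  | .skip, _ => false
  | .set B _ _ _, A => B == A
  | .rand B _ _ _, A => B == A
  | .seq p q, A => p.writes A || q.writes A
  | .ite _ p q, A => p.writes A || q.writes A
  | .loop _ p, A => p.writes A

/-- Whether the array `A` occurs in the command. -/
def Cmd.mentions : Cmd → ℕ → Bool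
  | .skip, _ => false
  | .set B i j e, A => B == A || i.reads A || j.reads A || e.reads A
  | .rand B i j e, A => B == A || i.reads A || j.reads A || e.reads A
  | .seq p q, A => p.mentions A || q.mentions A
  | .ite e p q, A => e.reads A || p.mentions A || q.mentions A
  | .loop e p, A => e.reads A || p.mentions A

theorem Expr.eval_congr {m m' : Mem} {e : Expr}
    (h : ∀ A, e.reads A = true → ∀ i j, m (A, i, j) = m' (A, i, j)) : e.eval m = e.eval m' := by
  induction e with
  | lit z => rfl
  | get B i j hi hj =>
    simp only [reads, Bool.or_eq_true, beq_iff_eq] at h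
    rw [eval, eval, hi fun A hA => h A (by simp [hA]), hj fun A hA => h A (by simp [hA]),
      h B (by simp)]
  | add x y hx hy | sub x y hx hy | mul x y hx hy | div x y hx hy | mod x y hx hy =>
    simp only [reads, Bool.or_eq_true] at h
    rw [eval, eval, hx fun A hA => h A (by simp [hA]), hy fun A hA => h A (by simp [hA])]

theorem Run.frame {W : ℕ} {c : Cmd} {m m' : Mem} (h : Run W c m m') {A : ℕ}
    (hA : c.writes A = false) (i j : ℤ) : m' (A, i, j) = m (A, i, j) := by
  induction h with
  | skip m => rfl
  | set h =>
    classical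
    simp only [Cmd.writes, beq_eq_false_iff_ne, ne_eq] at hA
    rw [Finsupp.update_apply, if_neg]
    simp [Ne.symm hA]
  | seq _ _ h1 h2 =>
    simp only [Cmd.writes, Bool.or_eq_false_iff] at hA
    rw [h2 hA.2, h1 hA.1]
  | ite_pos he _ h =>
    simp only [Cmd.writes, Bool.or_eq_false_iff] at hA
    exact h hA.1
  | ite_neg he _ h =>
    simp only [Cmd.writes, Bool.or_eq_false_iff] at hA
    exact h hA.2
  | loop k M hk hpos hrun hend ih =>
    have : ∀ r ≤ k, M r (A, i, j) = M 0 (A, i, j) := by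
      intro r
      induction r with
      | zero => exact fun _ => rfl
      | succ r hr => exact fun h => (ih r h hA).trans (hr (by omega))
    exact this k le_rfl

/-- A command runs in the same way on memories that differ only in an array that it does not
mention. -/
theorem Run.congr {W : ℕ} {c : Cmd} {m m' : Mem} (h : Run W c m m') {B : ℕ}
    (hB : c.mentions B = false) {n : Mem} (hn : ∀ A ≠ B, ∀ i j, n (A, i, j) = m (A, i, j)) :
    ∃ n', Run W c n n' ∧ (∀ A ≠ B, ∀ i j, n' (A, i, j) = m' (A, i, j)) := by
  have heval : ∀ {m n : Mem} (e : Expr), e.reads B = false →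
      (∀ A ≠ B, ∀ i j, n (A, i, j) = m (A, i, j)) → e.eval n = e.eval m := by
    intro m n e he hn
    refine Expr.eval_congr fun A hA => hn A ?_
    rintro rfl
    simp [he] at hA
  induction h generalizing n with
  | skip m => exact ⟨n, .skip n, hn⟩
  | @set m A i j e h =>
    simp only [Cmd.mentions, Bool.or_eq_false_iff] at hB
    refine ⟨_, .set (by rwa [heval e hB.2 hn]), fun A hA i' j' => ?_⟩
    classical
    rw [Finsupp.update_apply, Finsupp.update_apply, heval e hB.2 hn, heval i hB.1.1.2 hn,
      heval j hB.1.2 hn, hn A hA]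
  | seq _ _ h1 h2 =>
    simp only [Cmd.mentions, Bool.or_eq_false_iff] at hB
    obtain ⟨n₁, hr₁, hn₁⟩ := h1 hB.1 hn
    obtain ⟨n₂, hr₂, hn₂⟩ := h2 hB.2 hn₁
    exact ⟨n₂, .seq hr₁ hr₂, hn₂⟩
  | @ite_pos e p q m m' he _ h =>
    simp only [Cmd.mentions, Bool.or_eq_false_iff] at hB
    obtain ⟨n₁, hr₁, hn₁⟩ := h hB.1.2 hn
    exact ⟨n₁, .ite_pos (by rwa [heval e hB.1.1 hn]) hr₁, hn₁⟩
  | @ite_neg e p q m m' he _ h =>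
    simp only [Cmd.mentions, Bool.or_eq_false_iff] at hB
    obtain ⟨n₁, hr₁, hn₁⟩ := h hB.2 hn
    exact ⟨n₁, .ite_neg (by rwa [heval e hB.1.1 hn]) hr₁, hn₁⟩
  | @loop e p k M hk hpos hrun hend ih =>
    simp only [Cmd.mentions, Bool.or_eq_false_iff] at hB
    have hex : ∀ i : ℕ, ∀ x : Mem, ∃ y : Mem, i < k →
        (∀ A ≠ B, ∀ u v, x (A, u, v) = M i (A, u, v)) →
        Run W p x y ∧ ∀ A ≠ B, ∀ u v, y (A, u, v) = M (i + 1) (A, u, v) := by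
      intro i x
      by_cases hi : i < k ∧ ∀ A ≠ B, ∀ u v, x (A, u, v) = M i (A, u, v)
      · obtain ⟨y, hy⟩ := ih i hi.1 hB.2 hi.2
        exact ⟨y, fun _ _ => hy⟩
      · exact ⟨x, fun h1 h2 => absurd ⟨h1, h2⟩ hi⟩
    choose F hF using hex
    let R : ℕ → Mem := fun i => Nat.rec n (fun i x => F i x) i
    have hR : ∀ i ≤ k, ∀ A ≠ B, ∀ u v, R i (A, u, v) = M i (A, u, v) := by
      intro i
      induction i with
      | zero => exact fun _ => hn
      | succ i hi => exact fun h => (hF i (R i) (by omega) (hi (by omega))).2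
    refine ⟨R k, .loop k R hk (fun i hi => ?_) (fun i hi => (hF i (R i) hi (hR i hi.le)).1) ?_,
      hR k le_rfl⟩
    · rw [heval e hB.1 (hR i hi.le)]; exact hpos i hi
    · rw [heval e hB.1 (hR k le_rfl)]; exact hend

/-! ### Counting loops -/

/-- The scalar variable `A`, held in the cell `(A, 0, 0)`. -/
abbrev Expr.var (A : ℕ) : Expr := .get A (.lit 0) (.lit 0)

instance : Add Expr := ⟨.add⟩
instance : Sub Expr := ⟨.sub⟩
instance : Mul Expr := ⟨.mul⟩
instance : Div Expr := ⟨.div⟩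
instance : Mod Expr := ⟨.mod⟩
instance (n : ℕ) : OfNat Expr n := ⟨.lit n⟩

@[simp] theorem Expr.eval_add (m : Mem) (x y : Expr) : (x + y).eval m = x.eval m + y.eval m := rfl
@[simp] theorem Expr.eval_sub (m : Mem) (x y : Expr) : (x - y).eval m = x.eval m - y.eval m := rfl
@[simp] theorem Expr.eval_mul (m : Mem) (x y : Expr) : (x * y).eval m = x.eval m * y.eval m := rfl
@[simp] theorem Expr.eval_div (m : Mem) (x y : Expr) : (x / y).eval m = x.eval m / y.eval m := rfl
@[simp] theorem Expr.eval_mod (m : Mem) (x y : Expr) : (x % y).eval m = x.eval m % y.eval m := rfl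
@[simp] theorem Expr.eval_get (m : Mem) (A : ℕ) (i j : Expr) :
    (Expr.get A i j).eval m = m (A, i.eval m, j.eval m) := rfl
@[simp] theorem Expr.eval_lit (m : Mem) (z : ℤ) : (Expr.lit z).eval m = z := rfl
@[simp] theorem Expr.eval_ofNat (m : Mem) (n : ℕ) :
    (no_index (OfNat.ofNat n : Expr)).eval m = (n : ℤ) := rfl
@[simp] theorem Expr.eval_zero (m : Mem) : (0 : Expr).eval m = 0 := rfl
@[simp] theorem Expr.eval_one (m : Mem) : (1 : Expr).eval m = 1 := rfl

/-- Assignment to a scalar variable. -/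
abbrev Cmd.assign (A : ℕ) (e : Expr) : Cmd := .set A (.lit 0) (.lit 0) e

/-- The memory `m` with `v` written into the cell `(A, i, j)`. -/
noncomputable def wr (m : Mem) (A : ℕ) (i j v : ℤ) : Mem := m.update (A, i, j) v

@[simp] theorem wr_apply (m : Mem) (A : ℕ) (i j v : ℤ) (A' : ℕ) (i' j' : ℤ) :
    wr m A i j v (A', i', j') = if A' = A ∧ i' = i ∧ j' = j then v else m (A', i', j') := by
  classical
  rw [wr, Finsupp.update_apply]
  simp

theorem Run.set_wr {W : ℕ} {m : Mem} {A : ℕ} {i j e : Expr} (v : ℤ) (hv : e.eval m = v)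
    (h : |v| < 2 ^ W) : Run W (.set A i j e) m (wr m A (i.eval m) (j.eval m) v) := by
  subst hv
  exact .set (bitLen_le_iff.2 h)

/-- `for x := 0, …, e - 1 do p`; the body `p` may change neither `x` nor the value of `e`. -/
def Cmd.for (x : ℕ) (e : Expr) (p : Cmd) : Cmd :=
  .seq (.assign x (.lit 0)) (.loop (.sub e (.var x)) (.seq p (.assign x (.add (.var x) (.lit 1)))))

/-- The invariant rule for counting loops. -/
theorem Run.for_of_invariant {W x : ℕ} {e : Expr} {p : Cmd} {m₀ : Mem} (n : ℕ) (hn : n ≤ W)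
    (he : e.eval m₀ = n) (hpx : p.writes x = false) (I : ℕ → Mem → Prop)
    (hind : ∀ m : Mem, (∀ A, (Cmd.for x e p).writes A = false → ∀ i j, m (A, i, j) = m₀ (A, i, j)) →
      e.eval m = e.eval m₀)
    (h0 : I 0 (wr m₀ x 0 0 0))
    (hs : ∀ k < n, ∀ m : Mem, (∀ A, (Cmd.for x e p).writes A = false →
      ∀ i j, m (A, i, j) = m₀ (A, i, j)) → m (x, 0, 0) = k → I k m →
      ∃ m₁, Run W p m m₁ ∧ I (k + 1) (wr m₁ x 0 0 ((k + 1 : ℕ) : ℤ))) :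
    ∃ m', Run W (.for x e p) m₀ m' ∧ I n m' := by
  classical
  have hex : ∀ k : ℕ, ∀ m : Mem, ∃ m₁ : Mem, k < n → (∀ A, (Cmd.for x e p).writes A = false →
      ∀ i j, m (A, i, j) = m₀ (A, i, j)) → m (x, 0, 0) = k → I k m →
      Run W p m m₁ ∧ I (k + 1) (wr m₁ x 0 0 ((k + 1 : ℕ) : ℤ)) := by
    intro k m
    by_cases h : k < n ∧ (∀ A, (Cmd.for x e p).writes A = false →
      ∀ i j, m (A, i, j) = m₀ (A, i, j)) ∧ m (x, 0, 0) = k ∧ I k m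
    · obtain ⟨m₁, hm₁⟩ := hs k h.1 m h.2.1 h.2.2.1 h.2.2.2
      exact ⟨m₁, fun _ _ _ _ => hm₁⟩
    · exact ⟨m, fun h1 h2 h3 h4 => absurd ⟨h1, h2, h3, h4⟩ h⟩
  choose F hF using hex
  let R : ℕ → Mem := fun i =>
    Nat.rec (wr m₀ x 0 0 0) (fun k m => wr (F k m) x 0 0 ((k + 1 : ℕ) : ℤ)) i
  have hR : ∀ k ≤ n, (∀ A, (Cmd.for x e p).writes A = false →
      ∀ i j, R k (A, i, j) = m₀ (A, i, j)) ∧ R k (x, 0, 0) = k ∧ I k (R k) := by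
    intro k
    induction k with
    | zero =>
      refine fun _ => ⟨fun A hA i j => ?_, by simp [R], h0⟩
      simp only [Cmd.for, Cmd.writes, Bool.or_eq_false_iff, beq_eq_false_iff_ne, ne_eq] at hA
      simp [R, Ne.symm hA.1]
    | succ k ih =>
      intro hk
      obtain ⟨h1, h2, h3⟩ := ih (by omega)
      obtain ⟨h4, h5⟩ := hF k (R k) (by omega) h1 h2 h3
      refine ⟨fun A hA i j => ?_, by simp [R], h5⟩
      have hA' := hA
      simp only [Cmd.for, Cmd.writes, Bool.or_eq_false_iff, beq_eq_false_iff_ne, ne_eq] at hA'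
      change wr (F k (R k)) x 0 0 _ (A, i, j) = _
      rw [wr_apply, if_neg (fun h => hA'.1 h.1.symm), h4.frame hA'.2.1, h1 A hA]
  refine ⟨R n, .seq (m₁ := wr m₀ x 0 0 0) (Run.set_wr 0 rfl (by simp)) ?_, (hR n le_rfl).2.2⟩
  refine Run.loop n R hn (fun k hk => ?_) (fun k hk => ?_) ?_
  · obtain ⟨h1, h2, h3⟩ := hR k hk.le
    simp only [Expr.eval] at *
    rw [hind _ h1, h2, he]
    omega
  · obtain ⟨h1, h2, h3⟩ := hR k hk.le
    obtain ⟨h4, h5⟩ := hF k (R k) hk h1 h2 h3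
    refine .seq h4 ?_
    have h6 : F k (R k) (x, 0, 0) = k := by rw [h4.frame hpx, h2]
    refine Run.set_wr ((k + 1 : ℕ) : ℤ) ?_ ?_
    · simp [Expr.eval, h6]
    · rw [Nat.abs_cast]
      exact_mod_cast (Nat.lt_two_pow_self).trans_le (Nat.pow_le_pow_right (by omega) (by omega))
  · obtain ⟨h1, h2, h3⟩ := hR n le_rfl
    simp only [Expr.eval] at *
    rw [hind _ h1, h2, he]
    omega

/-! ### Fraction-free elimination -/

/-- The state of the fraction-free Gauss-Jordan elimination on the columns `< j` of the matrix `X`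
with `b` rows. With respect to a non-singular square block of `X` with determinant `d`, whose rows
`P s` are the pivot rows, the columns `T · (P s)` are those combinations of the columns of the block
that are equal to `d` in row `P s` and to zero in the other pivot rows. The columns of `T` at the
other rows are zero. The equations in the last clause determine `T` by Cramer's rule. -/
def CramerInv (b j : ℕ) (X T : ℕ → ℕ → ℤ) (d : ℤ) : Prop :=
  d ≠ 0 ∧ ∃ (ι : Type) (_ : Fintype ι) (_ : DecidableEq ι) (P J : ι → ℕ),
    (∀ s, P s < b) ∧ (∀ s, J s < j) ∧ (Matrix.of fun s t => X (P s) (J t)).det = d ∧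
    (∀ p < b, p ∉ Set.range P → ∀ i < b, T i p = 0) ∧
    ∀ j' < j, ∀ i < b, ∑ p ∈ Finset.range b, T i p * X p j' = d * X i j'

theorem cramerInv_zero {b : ℕ} {X T : ℕ → ℕ → ℤ} (hT : ∀ i < b, ∀ p < b, T i p = 0) :
    CramerInv b 0 X T 1 :=
  ⟨one_ne_zero, Empty, inferInstance, inferInstance, Empty.elim, Empty.elim, fun s => s.elim,
    fun s => s.elim, by simp, fun p hp _ i hi => hT i hi p hp, fun j' hj => by omega⟩

section

variable {b : ℕ} {ι : Type} [Fintype ι] {P : ι → ℕ}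

theorem injective_of_det_ne_zero [DecidableEq ι] {X : ℕ → ℕ → ℤ} {J : ι → ℕ}
    (h : (Matrix.of fun s t => X (P s) (J t)).det ≠ 0) :
    Function.Injective P := by
  intro s s' hs
  by_contra hne
  refine h (Matrix.det_zero_of_row_eq hne ?_)
  ext t
  simp [hs]

/-- Sums over all rows reduce to sums over the pivot rows. -/
theorem sum_eq_sum_pivots (hP : ∀ s, P s < b) (hinj : Function.Injective P) {y : ℕ → ℤ}
    (hy : ∀ p < b, p ∉ Set.range P → y p = 0) :
    ∑ p ∈ Finset.range b, y p = ∑ s, y (P s) := by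
  classical
  rw [← Finset.sum_image (f := y) (s := Finset.univ) (g := P) (fun _ _ _ _ h => hinj h)]
  symm
  refine Finset.sum_subset (fun p hp => ?_) (fun p hp hp' => hy p (Finset.mem_range.1 hp) ?_)
  · obtain ⟨s, -, rfl⟩ := Finset.mem_image.1 hp
    exact Finset.mem_range.2 (hP s)
  · rintro ⟨s, rfl⟩
    exact hp' (Finset.mem_image_of_mem _ (Finset.mem_univ s))

end

/-- A column that the pivots already generate leaves the elimination unchanged. -/
theorem CramerInv.succ_of_eq_zero {b j : ℕ} {X T : ℕ → ℕ → ℤ} {d : ℤ} (h : CramerInv b j X T d)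
    (hc : ∀ i < b, d * X i j - ∑ p ∈ Finset.range b, X p j * T i p = 0) :
    CramerInv b (j + 1) X T d := by
  obtain ⟨hd, ι, _, _, P, J, hP, hJ, hdet, h0, hT⟩ := h
  refine ⟨hd, ι, _, _, P, J, hP, fun s => (hJ s).trans (Nat.lt_succ_self j), hdet, h0,
    fun j' hj' i hi => ?_⟩
  rcases Nat.lt_succ_iff_lt_or_eq.1 hj' with h | rfl
  · exact hT j' h i hi
  · rw [← sub_eq_zero, ← neg_eq_zero, neg_sub, ← hc i hi]
    simp only [mul_comm]

/-- The elimination step with a new pivot in row `l`. The division by `d` is exact, because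
the quotients are, by Cramer's rule, integer combinations of the cofactors of the new block. -/
theorem CramerInv.succ_of_ne_zero {b j : ℕ} {X T T' : ℕ → ℕ → ℤ} {d : ℤ} (h : CramerInv b j X T d)
    {c : ℕ → ℤ} (hc : ∀ i < b, c i = d * X i j - ∑ p ∈ Finset.range b, X p j * T i p)
    {l : ℕ} (hl : l < b) (hcl : c l ≠ 0)
    (hT' : ∀ i < b, ∀ p < b, T' i p = if p = l then c i else (c l * T i p - T l p * c i) / d) :
    CramerInv b (j + 1) X T' (c l) := by
  obtain ⟨hd, ι, _, _, P, J, hP, hJ, hdet, h0, hT⟩ := h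
  have hinj : Function.Injective P := injective_of_det_ne_zero (J := J) (hdet.symm ▸ hd)
  have hsum : ∀ i < b, ∀ x : ℕ → ℤ,
      ∑ p ∈ Finset.range b, T i p * x p = ∑ s, T i (P s) * x (P s) := fun i hi x =>
    sum_eq_sum_pivots hP hinj fun p hp hp' => by rw [h0 p hp hp' i hi, zero_mul]
  have hcs : ∀ i < b, ∑ s, T i (P s) * X (P s) j = d * X i j - c i := by
    intro i hi
    rw [hc i hi, ← hsum i hi fun p => X p j]
    simp only [mul_comm, sub_sub_cancel]
  have hTs : ∀ i < b, ∀ t, ∑ s, T i (P s) * X (P s) (J t) = d * X i (J t) := fun i hi t => by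
    rw [← hsum i hi fun p => X p (J t)]
    exact hT _ (hJ t) i hi
  set A := Matrix.of fun s t => X (P s) (J t) with hA
  -- bordered by row `l` and column `j`, the block has determinant `c l`, the next `d`
  let P' : ι ⊕ Unit → ℕ := Sum.elim P fun _ => l
  let J' : ι ⊕ Unit → ℕ := Sum.elim J fun _ => j
  set A' := Matrix.of fun s t => X (P' s) (J' t) with hA'
  have hblock : A' = Matrix.fromBlocks A (Matrix.of fun s _ => X (P s) j)
      (Matrix.of fun _ t => X l (J t)) (Matrix.of fun _ _ => X l j) := by
    ext s t
    rcases s with s | s <;> rcases t with t | t <;> rfl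
  have hdet' : A'.det = c l := by
    have h1 : Matrix.fromBlocks (1 : Matrix ι ι ℤ) 0 (Matrix.of fun (_ : Unit) s => - T l (P s))
        (Matrix.of fun _ _ => d) * A' = Matrix.fromBlocks A (Matrix.of fun s _ => X (P s) j) 0
          (Matrix.of fun (_ : Unit) (_ : Unit) => c l) := by
      rw [hblock, Matrix.fromBlocks_multiply]
      congr 1
      · simp
      · simp
      · ext u t
        have := hTs l hl t
        simp only [Matrix.add_apply, Matrix.mul_apply, Matrix.of_apply, hA, neg_mul,
          Finset.sum_neg_distrib, Finset.univ_unique, Finset.sum_singleton, Matrix.zero_apply]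
        rw [this]; ring
      · ext u t
        have := hcs l hl
        simp only [Matrix.add_apply, Matrix.mul_apply, Matrix.of_apply, neg_mul,
          Finset.sum_neg_distrib, Finset.univ_unique, Finset.sum_singleton]
        rw [this]; ring
    have h2 := congrArg Matrix.det h1
    rw [Matrix.det_mul, Matrix.det_fromBlocks_zero₁₂, Matrix.det_fromBlocks_zero₂₁, hdet] at h2
    simp only [Matrix.det_one, one_mul, Matrix.det_unique, Matrix.of_apply] at h2
    exact mul_left_cancel₀ hd h2
  have hlP : l ∉ Set.range P := by
    rintro ⟨s, rfl⟩
    refine hcl ?_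
    have hne : (Matrix.vecMul (fun s' => T (P s) (P s') - if s' = s then d else 0) A) = 0 := by
      ext t
      simp only [Matrix.vecMul, dotProduct, hA, Matrix.of_apply, sub_mul, Finset.sum_sub_distrib,
        ite_mul, zero_mul, Finset.sum_ite_eq', Finset.mem_univ, if_true, Pi.zero_apply]
      rw [hTs _ hl, sub_self]
    have h3 := Matrix.eq_zero_of_vecMul_eq_zero (hdet.symm ▸ hd) hne
    have h4 := hcs _ hl
    have h5 : ∀ s', T (P s) (P s') = if s' = s then d else 0 := fun s' =>
      sub_eq_zero.1 (congrFun h3 s')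
    simp only [h5, ite_mul, zero_mul, Finset.sum_ite_eq', Finset.mem_univ, if_true] at h4
    linarith
  -- exactness of the division
  have hexact : ∀ i < b, ∀ s, d ∣ c l * T i (P s) - T l (P s) * c i := by
    intro i hi s
    let r : ι ⊕ Unit → ℤ := fun t => X i (J' t)
    let y := Matrix.vecMul r A'.adjugate
    let z : ι ⊕ Unit → ℤ := Sum.elim (fun s => c l * T i (P s) - T l (P s) * c i) fun _ => d * c i
    have hy : Matrix.vecMul y A' = c l • r := by
      rw [Matrix.vecMul_vecMul, Matrix.adjugate_mul, hdet', Matrix.vecMul_smul, Matrix.vecMul_one]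
    have hz : Matrix.vecMul z A' = (d * c l) • r := by
      ext t
      simp only [Matrix.vecMul, dotProduct, Fintype.sum_sum_type, z, Sum.elim_inl, Sum.elim_inr,
        hA', Matrix.of_apply, P', Finset.univ_unique, Finset.sum_singleton, sub_mul,
        Finset.sum_sub_distrib, Pi.smul_apply, smul_eq_mul, r, mul_assoc,
        ← Finset.mul_sum]
      have h6 : ∀ i' < b, ∑ s, T i' (P s) * X (P s) (J' t)
          = d * X i' (J' t) - (if t.isRight then c i' else 0) := by
        intro i' hi'
        rcases t with t | t
        · simpa [J'] using hTs i' hi' t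
        · simpa [J'] using hcs i' hi'
      have h7 : ∑ s, T l (P s) * (c i * X (P s) (J' t))
          = c i * ∑ s, T l (P s) * X (P s) (J' t) := by
        rw [Finset.mul_sum]
        exact Finset.sum_congr rfl fun _ _ => by ring
      rw [h7, h6 i hi, h6 l hl]
      rcases t with t | t <;> simp <;> ring
    have h8 : Matrix.vecMul (d • y - z) A' = 0 := by
      rw [Matrix.sub_vecMul, Matrix.smul_vecMul, hy, hz, smul_smul, sub_self]
    have h9 := congrFun (Matrix.eq_zero_of_vecMul_eq_zero (hdet'.symm ▸ hcl) h8) (.inl s)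
    exact ⟨y (.inl s), (sub_eq_zero.1 h9).symm⟩
  have hmul : ∀ i < b, ∀ p < b,
      d * T' i p = c l * T i p - T l p * c i + if p = l then d * c i else 0 := by
    intro i hi p hp
    rw [hT' i hi p hp]
    split_ifs with hpl
    · subst hpl
      rw [h0 p hp hlP i hi, h0 p hp hlP p hp]; ring
    · rw [add_zero]
      by_cases hpP : p ∈ Set.range P
      · obtain ⟨s, rfl⟩ := hpP
        exact Int.mul_ediv_cancel' (hexact i hi s)
      · rw [h0 p hp hpP i hi, h0 p hp hpP l hl]; simp
  refine ⟨hcl, ι ⊕ Unit, inferInstance, inferInstance, P', J', ?_, ?_, hdet', ?_, ?_⟩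
  · rintro (s | s)
    exacts [hP s, hl]
  · rintro (s | s)
    exacts [(hJ s).trans (Nat.lt_succ_self j), Nat.lt_succ_self j]
  · intro p hp hpP' i hi
    have hpl : p ≠ l := fun h => hpP' ⟨.inr (), h.symm⟩
    have hpP : p ∉ Set.range P := fun ⟨s, hs⟩ => hpP' ⟨.inl s, hs⟩
    rw [hT' i hi p hp, if_neg hpl, h0 p hp hpP i hi, h0 p hp hpP l hl]
    simp
  · intro j' hj' i hi
    refine mul_left_cancel₀ hd ?_
    rw [Finset.mul_sum]
    have h10 : ∀ p ∈ Finset.range b, d * (T' i p * X p j') = c l * (T i p * X p j')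
        - c i * (T l p * X p j') + if p = l then d * c i * X p j' else 0 := by
      intro p hp
      rw [← mul_assoc, hmul i hi p (Finset.mem_range.1 hp)]
      split_ifs <;> ring
    rw [Finset.sum_congr rfl h10, Finset.sum_add_distrib, Finset.sum_sub_distrib,
      Finset.sum_ite_eq', if_pos (Finset.mem_range.2 hl), ← Finset.mul_sum, ← Finset.mul_sum]
    rcases Nat.lt_succ_iff_lt_or_eq.1 hj' with h | rfl
    · rw [hT j' h i hi, hT j' h l hl]; ring
    · rw [hsum i hi fun p => X p j', hsum l hl fun p => X p j', hcs i hi, hcs l hl]; ring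

/-- What the elimination provides in the end: an integer `d ≠ 0` and, for every pivot row `p`
(those with `T p p ≠ 0`), an integer combination `T · p` of the columns of `X` that is equal to `d`
in row `p` and zero in the other pivot rows; the pivot coordinates determine all others. -/
structure IsCramer (b n : ℕ) (X T : ℕ → ℕ → ℤ) (d : ℤ) : Prop where
  ne_zero : d ≠ 0
  col_eq_zero : ∀ p < b, T p p = 0 → ∀ i < b, T i p = 0
  pivot : ∀ p < b, T p p ≠ 0 → ∀ w < b, T w w ≠ 0 → T w p = if w = p then d else 0
  sum_eq : ∀ j < n, ∀ i < b, ∑ p ∈ Finset.range b, T i p * X p j = d * X i j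
  exists_comb : ∀ p < b, ∃ z : ℕ → ℤ, ∀ i < b, T i p = ∑ j ∈ Finset.range n, X i j * z j

theorem CramerInv.eq_sum_adjugate {b j : ℕ} {X T : ℕ → ℕ → ℤ} {d : ℤ} {ι : Type} [Fintype ι]
    [DecidableEq ι] {P J : ι → ℕ} (hd : d ≠ 0) (hP : ∀ s, P s < b) (hJ : ∀ s, J s < j)
    (hdet : (Matrix.of fun s t => X (P s) (J t)).det = d)
    (h0 : ∀ p < b, p ∉ Set.range P → ∀ i < b, T i p = 0)
    (hT : ∀ j' < j, ∀ i < b, ∑ p ∈ Finset.range b, T i p * X p j' = d * X i j')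
    {i : ℕ} (hi : i < b) (s : ι) :
    T i (P s) = ∑ t, X i (J t) * (Matrix.of fun s t => X (P s) (J t)).adjugate t s := by
  have hinj : Function.Injective P := injective_of_det_ne_zero (J := J) (hdet.symm ▸ hd)
  set A := Matrix.of fun s t => X (P s) (J t) with hA
  have h1 : Matrix.vecMul (fun s => T i (P s)) A = d • fun t => X i (J t) := by
    ext t
    rw [Pi.smul_apply, smul_eq_mul, ← hT _ (hJ t) i hi,
      sum_eq_sum_pivots hP hinj fun p hp hp' => by rw [h0 p hp hp' i hi, zero_mul]]
    rfl
  have h2 := congrArg (fun v => Matrix.vecMul v A.adjugate) h1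
  simp only [Matrix.vecMul_vecMul, Matrix.mul_adjugate, hdet, Matrix.vecMul_smul, Matrix.vecMul_one,
    Matrix.smul_vecMul] at h2
  have h3 := congrFun h2 s
  simp only [Pi.smul_apply, smul_eq_mul] at h3
  exact mul_left_cancel₀ hd h3

theorem CramerInv.isCramer {b n : ℕ} {X T : ℕ → ℕ → ℤ} {d : ℤ} (h : CramerInv b n X T d) :
    IsCramer b n X T d := by
  obtain ⟨hd, ι, _, _, P, J, hP, hJ, hdet, h0, hT⟩ := h
  have hinj : Function.Injective P := injective_of_det_ne_zero (J := J) (hdet.symm ▸ hd)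
  have hpiv : ∀ s s', T (P s) (P s') = if s' = s then d else 0 := by
    intro s
    have hne : (Matrix.vecMul (fun s' => T (P s) (P s') - if s' = s then d else 0)
        (Matrix.of fun s t => X (P s) (J t))) = 0 := by
      ext t
      simp only [Matrix.vecMul, dotProduct, Matrix.of_apply, sub_mul, Finset.sum_sub_distrib,
        ite_mul, zero_mul, Finset.sum_ite_eq', Finset.mem_univ, if_true, Pi.zero_apply]
      rw [← hT _ (hJ t) _ (hP s), sum_eq_sum_pivots hP hinj fun p hp hp' => by
        rw [h0 p hp hp' _ (hP s), zero_mul], sub_self]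
    have h3 := Matrix.eq_zero_of_vecMul_eq_zero (hdet.symm ▸ hd) hne
    exact fun s' => sub_eq_zero.1 (congrFun h3 s')
  have hmem : ∀ p < b, T p p ≠ 0 → p ∈ Set.range P := fun p hp h => by
    by_contra hp'
    exact h (h0 p hp hp' p hp)
  refine ⟨hd, fun p hp h => ?_, fun p hp h w hw h' => ?_, hT, fun p hp => ?_⟩
  · refine h0 p hp ?_
    rintro ⟨s, rfl⟩
    rw [hpiv, if_pos rfl] at h
    exact hd h
  · obtain ⟨s, rfl⟩ := hmem p hp h
    obtain ⟨s', rfl⟩ := hmem w hw h'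
    rw [hpiv]
    simp only [hinj.eq_iff, eq_comm]
  · by_cases hpP : p ∈ Set.range P
    · obtain ⟨s, rfl⟩ := hpP
      refine ⟨fun j => ∑ t, if J t = j then
        (Matrix.of fun s t => X (P s) (J t)).adjugate t s else 0, fun i hi => ?_⟩
      rw [CramerInv.eq_sum_adjugate hd hP hJ hdet h0 hT hi s]
      simp only [Finset.mul_sum]
      rw [Finset.sum_comm]
      refine Finset.sum_congr rfl fun t _ => ?_
      simp only [mul_ite, mul_zero, Finset.sum_ite_eq, Finset.mem_range, hJ, if_true]
    · exact ⟨0, fun i hi => by simp [h0 p hp hpP i hi]⟩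

theorem CramerInv.abs_le {b j : ℕ} {X T : ℕ → ℕ → ℤ} {d : ℤ} (h : CramerInv b j X T d) {B : ℤ}
    (hB : 1 ≤ B) (hX : ∀ i < b, ∀ j' < j, |X i j'| ≤ B) :
    |d| ≤ b.factorial * B ^ b ∧ ∀ i < b, ∀ p < b, |T i p| ≤ b * (B * (b.factorial * B ^ b)) := by
  obtain ⟨hd, ι, _, _, P, J, hP, hJ, hdet, h0, hT⟩ := h
  have hinj : Function.Injective P := injective_of_det_ne_zero (J := J) (hdet.symm ▸ hd)
  have hcard : Fintype.card ι ≤ b := by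
    simpa using Fintype.card_le_of_injective (fun s => (⟨P s, hP s⟩ : Fin b))
      fun s s' h => hinj (by simpa using h)
  have hle : ((Fintype.card ι).factorial : ℤ) * B ^ Fintype.card ι ≤ b.factorial * B ^ b := by
    have h1 : ((Fintype.card ι).factorial : ℤ) ≤ b.factorial := by
      exact_mod_cast Nat.factorial_le hcard
    exact mul_le_mul h1 (pow_le_pow_right₀ hB hcard) (by positivity) (by positivity)
  have hdetle : ∀ A : Matrix ι ι ℤ, (∀ s t, |A s t| ≤ B) → |A.det| ≤ b.factorial * B ^ b := by
    intro A hA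
    have := Matrix.det_le (abv := AbsoluteValue.abs) (x := B) hA
    rw [nsmul_eq_mul] at this
    exact this.trans hle
  refine ⟨hdet ▸ hdetle _ fun s t => hX _ (hP s) _ (hJ t), fun i hi p hp => ?_⟩
  by_cases hpP : p ∈ Set.range P
  · obtain ⟨s, rfl⟩ := hpP
    rw [CramerInv.eq_sum_adjugate hd hP hJ hdet h0 hT hi s]
    have hterm : ∀ t ∈ (Finset.univ : Finset ι),
        |X i (J t) * (Matrix.of fun s t => X (P s) (J t)).adjugate t s|
          ≤ B * (b.factorial * B ^ b) := by
      intro t _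
      rw [abs_mul, Matrix.adjugate_apply]
      refine mul_le_mul (hX i hi _ (hJ t)) (hdetle _ fun u v => ?_) (abs_nonneg _) (by omega)
      rw [Matrix.updateRow_apply]
      split_ifs with h
      · rw [Pi.single_apply]
        split_ifs
        · simpa using hB
        · simp only [abs_zero]; omega
      · exact hX _ (hP u) _ (hJ v)
    refine (Finset.abs_sum_le_sum_abs _ _).trans ((Finset.sum_le_sum hterm).trans ?_)
    rw [Finset.sum_const, Finset.card_univ, nsmul_eq_mul]
    refine mul_le_mul_of_nonneg_right (by exact_mod_cast hcard) ?_
    positivity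
  · rw [h0 p hp hpP i hi, abs_zero]
    positivity

/-! ### Triangular bases of lattices that contain a diagonal lattice -/

/-- The lattice of all integer vectors that are congruent, coordinatewise modulo `D`, to an integer
combination of the first `j` columns of `X`. -/
def netLattice {m : ℕ} (D : Fin m → ℤ) (X : ℕ → ℕ → ℤ) (j : ℕ) : Submodule ℤ (Fin m → ℤ) where
  carrier := {x | ∃ z : ℕ → ℤ, ∀ u : Fin m, D u ∣ x u - ∑ j' ∈ Finset.range j, X u j' * z j'}
  zero_mem' := ⟨0, fun u => by simp⟩
  add_mem' := by
    rintro x y ⟨z, hz⟩ ⟨z', hz'⟩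
    refine ⟨z + z', fun u => ?_⟩
    have := dvd_add (hz u) (hz' u)
    simp only [Pi.add_apply, mul_add, Finset.sum_add_distrib]
    refine this.trans (dvd_of_eq ?_)
    ring
  smul_mem' := by
    rintro k x ⟨z, hz⟩
    refine ⟨k • z, fun u => ?_⟩
    have := dvd_mul_of_dvd_right (hz u) k
    simp only [Pi.smul_apply, smul_eq_mul, mul_left_comm _ k, ← Finset.mul_sum]
    refine this.trans (dvd_of_eq ?_)
    ring

section

variable {m : ℕ} {D : Fin m → ℤ} {X : ℕ → ℕ → ℤ} {S : Fin m → Fin m → ℤ} {Λ : Submodule ℤ (Fin m → ℤ)}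

theorem single_mem_netLattice (j : ℕ) (u : Fin m) : Pi.single u (D u) ∈ netLattice D X j := by
  refine ⟨0, fun w => ?_⟩
  rcases eq_or_ne w u with rfl | h
  · simp
  · simp [Pi.single_eq_of_ne h]

theorem netLattice_succ {j : ℕ} {c : Fin m → ℤ} (hc : ∀ u, D u ∣ c u - X u j) :
    netLattice D X (j + 1) = netLattice D X j ⊔ Submodule.span ℤ {c} := by
  apply le_antisymm
  · rintro x ⟨z, hz⟩
    rw [Submodule.mem_sup]
    refine ⟨x - z j • c, ⟨z, fun u => ?_⟩, z j • c,
      Submodule.smul_mem _ _ (Submodule.mem_span_singleton_self c), by simp⟩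
    have h1 := hz u
    rw [Finset.sum_range_succ] at h1
    have h2 := dvd_sub h1 (dvd_mul_of_dvd_right (hc u) (z j))
    simp only [Pi.sub_apply, Pi.smul_apply, smul_eq_mul]
    refine h2.trans (dvd_of_eq ?_)
    ring
  · refine sup_le ?_ ?_
    · rintro x ⟨z, hz⟩
      refine ⟨Function.update z j 0, fun u => ?_⟩
      rw [Finset.sum_range_succ, Function.update_self, mul_zero, add_zero]
      have h1 : ∑ j' ∈ Finset.range j, X u j' * Function.update z j 0 j'
          = ∑ j' ∈ Finset.range j, X u j' * z j' := by
        refine Finset.sum_congr rfl fun j' hj' => ?_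
        rw [Function.update_of_ne (Finset.mem_range.1 hj').ne]
      rw [h1]
      exact hz u
    · rw [Submodule.span_singleton_le_iff_mem]
      refine ⟨Pi.single j 1, fun u => ?_⟩
      rw [Finset.sum_range_succ, Finset.sum_eq_zero, Pi.single_eq_same, mul_one, zero_add]
      · exact hc u
      · intro j' hj'
        rw [Pi.single_eq_of_ne (Finset.mem_range.1 hj').ne, mul_zero]

/-- The vectors `S w` form a lower triangular basis of the lattice `Λ`, with entries reduced
modulo `D`. -/
structure IsTriangular (D : Fin m → ℤ) (S : Fin m → Fin m → ℤ) (Λ : Submodule ℤ (Fin m → ℤ)) :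
    Prop where
  pos : ∀ w, 0 < S w w
  zero : ∀ w u, u < w → S w u = 0
  bound : ∀ w u, 0 ≤ S w u ∧ S w u ≤ D u
  span : Submodule.span ℤ (Set.range S) = Λ

/-- The state of the elimination in row `i`: the vectors `S w` are lower triangular, the vector `c`
vanishes above row `i`, and together they generate `Λ`. The vectors `S w` with `w > i` have not yet
been changed; they generate the diagonal vectors below row `i`, so that entries of `c` in these rows
may be reduced modulo `D`. -/
structure EuclidInv (D : Fin m → ℤ) (Λ : Submodule ℤ (Fin m → ℤ)) (i : ℕ) (S : Fin m → Fin m → ℤ)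
    (c : Fin m → ℤ) : Prop where
  pos : ∀ w, 0 < S w w
  zero : ∀ w u, u < w → S w u = 0
  bound : ∀ w u, 0 ≤ S w u ∧ S w u ≤ D u
  zero_col : ∀ u : Fin m, (u : ℕ) < i → c u = 0
  bound_col : ∀ u, 0 ≤ c u ∧ c u < D u
  span : Submodule.span ℤ (insert c (Set.range S)) = Λ
  single_mem : ∀ u : Fin m, i < u → Pi.single u (D u) ∈ Submodule.span ℤ (S '' {w | u ≤ w})

/-- In a combination of lower triangular vectors, the coordinate of the first vector that occurs. -/
theorem sum_smul_apply_of_lower (hz : ∀ w u, u < w → S w u = 0) {a : Fin m → ℤ} {k : Fin m}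
    (ha : ∀ w < k, a w = 0) : (∑ w, a w • S w) k = a k * S k k := by
  rw [Finset.sum_apply, Finset.sum_eq_single k]
  · simp
  · intro w _ hw
    rcases lt_or_gt_of_ne hw with h | h
    · simp [ha w h]
    · simp [hz w k h]
  · simp

theorem coeff_eq_zero_of_lower (hp : ∀ w, 0 < S w w) (hz : ∀ w u, u < w → S w u = 0)
    {a : Fin m → ℤ} {k : ℕ} (h : ∀ u : Fin m, (u : ℕ) < k → (∑ w, a w • S w) u = 0) :
    ∀ u : Fin m, (u : ℕ) < k → a u = 0 := by
  intro u
  induction u using WellFoundedLT.induction with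
  | _ u ih =>
    intro hu
    have h1 := h u hu
    rw [sum_smul_apply_of_lower hz fun w hw => ih w hw (lt_trans hw hu)] at h1
    exact (mul_eq_zero.1 h1).resolve_right (hp u).ne'

theorem mem_span_image_of_lower (hp : ∀ w, 0 < S w w) (hz : ∀ w u, u < w → S w u = 0)
    {x : Fin m → ℤ} (hx : x ∈ Submodule.span ℤ (Set.range S)) {k : Fin m}
    (h : ∀ u < k, x u = 0) : x ∈ Submodule.span ℤ (S '' {w | k ≤ w}) := by
  obtain ⟨a, rfl⟩ := (Submodule.mem_span_range_iff_exists_fun ℤ).1 hx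
  have ha := coeff_eq_zero_of_lower (k := k) hp hz h
  refine Submodule.sum_mem _ fun w _ => ?_
  rcases lt_or_ge w k with hw | hw
  · rw [ha w hw, zero_smul]; exact Submodule.zero_mem _
  · exact Submodule.smul_mem _ _ (Submodule.subset_span ⟨w, hw, rfl⟩)

theorem IsTriangular.euclidInv (h : IsTriangular D S Λ) (hD : ∀ u, Pi.single u (D u) ∈ Λ)
    {c : Fin m → ℤ} (hc : ∀ u, 0 ≤ c u ∧ c u < D u) :
    EuclidInv D (Λ ⊔ Submodule.span ℤ {c}) 0 S c where
  pos := h.pos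
  zero := h.zero
  bound := h.bound
  zero_col := fun u hu => absurd hu (Nat.not_lt_zero _)
  bound_col := hc
  span := by rw [Submodule.span_insert, h.span, sup_comm]
  single_mem := fun u _ => mem_span_image_of_lower h.pos h.zero (h.span.symm ▸ hD u)
    fun w hw => Pi.single_eq_of_ne hw.ne _

theorem EuclidInv.isTriangular {c : Fin m → ℤ} (h : EuclidInv D Λ m S c) :
    IsTriangular D S Λ where
  pos := h.pos
  zero := h.zero
  bound := h.bound
  span := by
    have hc : c = 0 := funext fun u => h.zero_col u u.2
    rw [← h.span, hc, Submodule.span_insert_zero]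

theorem EuclidInv.succ {c : Fin m → ℤ} {i : ℕ} (h : EuclidInv D Λ i S c)
    (hc : ∀ u : Fin m, (u : ℕ) = i → c u = 0) : EuclidInv D Λ (i + 1) S c where
  pos := h.pos
  zero := h.zero
  bound := h.bound
  zero_col := fun u hu => (Nat.lt_succ_iff_lt_or_eq.1 hu).elim (h.zero_col u) (hc u)
  bound_col := h.bound_col
  span := h.span
  single_mem := fun u hu => h.single_mem u (by omega)

/-- A division step of the Euclidean algorithm on row `i`. -/
theorem EuclidInv.step {c : Fin m → ℤ} {i : Fin m} (h : EuclidInv D Λ i S c) (hci : 0 < c i)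
    {S' : Fin m → Fin m → ℤ} {c' : Fin m → ℤ} (hS' : S' = Function.update S i c)
    (hc' : ∀ u, c' u = (S i u - S i i / c i * c u) % D u) :
    EuclidInv D Λ i S' c' ∧ c' i = S i i % c i := by
  subst hS'
  have hDpos : ∀ u, 0 < D u := fun u => (h.bound_col u).1.trans_lt (h.bound_col u).2
  have hi : S i i - S i i / c i * c i = S i i % c i := by
    rw [Int.emod_def, mul_comm]
  have hc'i : c' i = S i i % c i := by
    rw [hc', hi]
    exact Int.emod_eq_of_lt (Int.emod_nonneg _ hci.ne')
      ((Int.emod_lt_of_pos _ hci).trans (h.bound_col i).2)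
  have hlt : ∀ u < i, S i u - S i i / c i * c u = 0 := fun u hu => by
    rw [h.zero i u hu, h.zero_col u hu]; simp
  -- the new vector differs from `S i - (S i i / c i) • c` by diagonal vectors below row `i`
  have hmem : S i - (S i i / c i) • c - c' ∈
      Submodule.span ℤ (S '' {w | i < w}) := by
    have h1 : S i - (S i i / c i) • c - c'
        = ∑ u, ((S i u - S i i / c i * c u) / D u) • Pi.single u (D u) := by
      ext w
      rw [Finset.sum_apply, Finset.sum_eq_single w]
      · simp only [Pi.sub_apply, Pi.smul_apply, smul_eq_mul, hc', Pi.single_eq_same]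
        rw [Int.emod_def]; ring
      · intro u _ hu
        simp [Pi.single_eq_of_ne hu.symm]
      · simp
    rw [h1]
    refine Submodule.sum_mem _ fun u _ => ?_
    rcases lt_trichotomy u i with hu | rfl | hu
    · rw [hlt u hu]; simp
    · rw [hi, Int.ediv_eq_zero_of_lt (Int.emod_nonneg _ hci.ne')
        ((Int.emod_lt_of_pos _ hci).trans (h.bound_col u).2)]
      simp
    · refine Submodule.smul_mem _ _ (Submodule.span_mono ?_ (h.single_mem u hu))
      exact Set.image_mono fun w hw => lt_of_lt_of_le hu hw
  have himage : ∀ u, i < u → Function.update S i c '' {w | u ≤ w} = S '' {w | u ≤ w} := by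
    intro u hu
    refine Set.image_congr fun w hw => ?_
    exact Function.update_of_ne (hu.trans_le hw).ne' _ _
  have himage' : Function.update S i c '' {w | i < w} = S '' {w | i < w} := by
    refine Set.image_congr fun w hw => ?_
    exact Function.update_of_ne (ne_of_gt hw) _ _
  refine ⟨⟨fun w => ?_, fun w u hu => ?_, fun w u => ?_, fun u hu => ?_, fun u => ?_, ?_,
    fun u hu => ?_⟩, hc'i⟩
  · rcases eq_or_ne w i with rfl | hw
    · rwa [Function.update_self]
    · rw [Function.update_of_ne hw]; exact h.pos w
  · rcases eq_or_ne w i with rfl | hw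
    · rw [Function.update_self]; exact h.zero_col u hu
    · rw [Function.update_of_ne hw]; exact h.zero w u hu
  · rcases eq_or_ne w i with rfl | hw
    · rw [Function.update_self]; exact ⟨(h.bound_col u).1, (h.bound_col u).2.le⟩
    · rw [Function.update_of_ne hw]; exact h.bound w u
  · rw [hc', hlt u hu, Int.zero_emod]
  · rw [hc']
    exact ⟨Int.emod_nonneg _ (hDpos u).ne', Int.emod_lt_of_pos _ (hDpos u)⟩
  · rw [← h.span]
    set U := Submodule.span ℤ (insert c' (Set.range (Function.update S i c))) with hU
    set U₀ := Submodule.span ℤ (insert c (Set.range S)) with hU₀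
    have hcU₀ : c ∈ U₀ := Submodule.subset_span (Set.mem_insert _ _)
    have hSU₀ : ∀ w, S w ∈ U₀ := fun w =>
      Submodule.subset_span (Set.mem_insert_of_mem _ ⟨w, rfl⟩)
    have hcU : c ∈ U := Submodule.subset_span
      (Set.mem_insert_of_mem _ ⟨i, Function.update_self _ _ _⟩)
    have hSU : ∀ w ≠ i, S w ∈ U := fun w hw => Submodule.subset_span
      (Set.mem_insert_of_mem _ ⟨w, Function.update_of_ne hw _ _⟩)
    have hmemU₀ : S i - (S i i / c i) • c - c' ∈ U₀ :=
      Submodule.span_le.2 (by rintro _ ⟨w, -, rfl⟩; exact hSU₀ w) hmem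
    have hmemU : S i - (S i i / c i) • c - c' ∈ U :=
      Submodule.span_le.2 (by rintro _ ⟨w, hw, rfl⟩; exact hSU w (ne_of_gt hw)) hmem
    apply le_antisymm
    · refine Submodule.span_le.2 (Set.insert_subset ?_ ?_)
      · have := U₀.sub_mem (U₀.sub_mem (hSU₀ i) (U₀.smul_mem (S i i / c i) hcU₀)) hmemU₀
        simpa using this
      · rintro _ ⟨w, rfl⟩
        rcases eq_or_ne w i with rfl | hw
        · rw [Function.update_self]; exact hcU₀
        · rw [Function.update_of_ne hw]; exact hSU₀ w
    · refine Submodule.span_le.2 (Set.insert_subset hcU ?_)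
      rintro _ ⟨w, rfl⟩
      rcases eq_or_ne w i with rfl | hw
      · have hc'U : c' ∈ U := Submodule.subset_span (Set.mem_insert _ _)
        have := U.add_mem (U.add_mem hmemU hc'U) (U.smul_mem (S w w / c w) hcU)
        simpa using this
      · exact hSU w hw
  · rw [himage u hu]
    exact h.single_mem u hu

/-- The diagonal matrix is the initial triangular basis. -/
theorem isTriangular_diagonal (hD : ∀ u, 0 < D u) :
    IsTriangular D (fun w => Pi.single w (D w)) (netLattice D X 0) where
  pos := fun w => by simpa using hD w
  zero := fun w u hu => by simp [Pi.single_eq_of_ne hu.ne]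
  bound := fun w u => by
    rcases eq_or_ne u w with rfl | h
    · simp [(hD u).le]
    · simp [Pi.single_eq_of_ne h, (hD u).le]
  span := by
    apply le_antisymm
    · refine Submodule.span_le.2 ?_
      rintro _ ⟨w, rfl⟩
      exact single_mem_netLattice 0 w
    · rintro x ⟨z, hz⟩
      have h1 : x = ∑ u, (x u / D u) • Pi.single u (D u) := by
        ext w
        rw [Finset.sum_apply, Finset.sum_eq_single w]
        · have := hz w
          simp only [Finset.range_zero, Finset.sum_empty, sub_zero] at this
          simp [Int.ediv_mul_cancel this]
        · intro u _ hu
          simp [Pi.single_eq_of_ne hu.symm]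
        · simp
      rw [h1]
      exact Submodule.sum_mem _ fun u _ => Submodule.smul_mem _ _ (Submodule.subset_span ⟨u, rfl⟩)

theorem IsTriangular.dvd (h : IsTriangular D S Λ) (hD : ∀ u, Pi.single u (D u) ∈ Λ) (k : Fin m) :
    S k k ∣ D k := by
  obtain ⟨a, ha⟩ := (Submodule.mem_span_range_iff_exists_fun ℤ).1 (h.span.symm ▸ hD k)
  have h1 := coeff_eq_zero_of_lower (k := k) h.pos h.zero (a := a) fun u hu => by
    rw [ha, Pi.single_eq_of_ne (ne_of_lt (show u < k from hu))]
  have h2 := sum_smul_apply_of_lower h.zero (k := k) h1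
  rw [ha, Pi.single_eq_same] at h2
  exact ⟨a k, by rw [h2, mul_comm]⟩

/-- The number of values of the digit of row `k`. -/
theorem IsTriangular.digits_pos (h : IsTriangular D S Λ) (k : Fin m) : 0 < D k / S k k :=
  Int.le_ediv_of_mul_le (h.pos k) (by simpa using (h.bound k k).2)

/-- Every element of the lattice is a combination of the triangular basis in which the coefficients
of the rows in `R` are reduced, up to multiples of the diagonal vectors of these rows. -/
theorem IsTriangular.exists_digits (h : IsTriangular D S Λ) (hD : ∀ u, Pi.single u (D u) ∈ Λ)
    (R : Fin m → Prop) {x : Fin m → ℤ} (hx : x ∈ Λ) :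
    ∃ n κ : Fin m → ℤ, x = ∑ w, n w • S w + ∑ u, κ u • Pi.single u (D u) ∧
      (∀ u, ¬ R u → κ u = 0) ∧ ∀ w, R w → 0 ≤ n w ∧ n w < D w / S w w := by
  classical
  have hΛS : ∀ w, S w ∈ Λ := fun w => h.span ▸ Submodule.subset_span ⟨w, rfl⟩
  have key : ∀ k ≤ m, ∃ n κ : Fin m → ℤ,
      (∀ u : Fin m, (u : ℕ) < k →
        (x - (∑ w, n w • S w + ∑ u, κ u • Pi.single u (D u))) u = 0) ∧
      (∀ u, ¬ R u → κ u = 0) ∧ (∀ w, R w → 0 ≤ n w ∧ n w < D w / S w w) ∧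
      ∀ w : Fin m, k ≤ w → n w = 0 := by
    intro k
    induction k with
    | zero =>
      exact fun _ => ⟨0, 0, fun u hu => absurd hu (Nat.not_lt_zero _), fun _ _ => rfl,
        fun w _ => ⟨le_rfl, h.digits_pos w⟩, fun _ _ => rfl⟩
    | succ k ih =>
      intro hk
      obtain ⟨n, κ, h1, h2, h3, h4⟩ := ih (by omega)
      set y := x - (∑ w, n w • S w + ∑ u, κ u • Pi.single u (D u)) with hy
      have hyΛ : y ∈ Λ := Λ.sub_mem hx (Λ.add_mem
        (Submodule.sum_mem _ fun w _ => Λ.smul_mem _ (hΛS w))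
        (Submodule.sum_mem _ fun u _ => Λ.smul_mem _ (hD u)))
      obtain ⟨a, ha⟩ := (Submodule.mem_span_range_iff_exists_fun ℤ).1 (h.span.symm ▸ hyΛ)
      set k' : Fin m := ⟨k, hk⟩ with hk'
      have h5 : y k' = a k' * S k' k' := by
        rw [← ha]
        refine sum_smul_apply_of_lower h.zero fun w hw => ?_
        exact coeff_eq_zero_of_lower (k := k) h.pos h.zero (fun u hu => by rw [ha]; exact h1 u hu)
          w hw
      have hsingle : ∀ (r : ℤ) (B : Fin m → Fin m → ℤ) (f : Fin m → ℤ),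
          ∑ w, (f + Pi.single k' r : Fin m → ℤ) w • B w = ∑ w, f w • B w + r • B k' := by
        intro r B f
        simp only [Pi.add_apply, add_smul, Finset.sum_add_distrib]
        congr 1
        rw [Finset.sum_eq_single k', Pi.single_eq_same]
        · intro w _ hw
          rw [Pi.single_eq_of_ne hw, zero_smul]
        · simp
      have hzero : ∀ r t : ℤ, y k' - (r * S k' k' + t * D k') = 0 → ∀ u : Fin m, (u : ℕ) < k + 1 →
          (x - (∑ w, (n + Pi.single k' r : Fin m → ℤ) w • S w
            + ∑ u, (κ + Pi.single k' t : Fin m → ℤ) u • Pi.single u (D u))) u = 0 := by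
        intro r t hrt u hu
        rw [hsingle r S n, hsingle t (fun u => Pi.single u (D u)) κ]
        have h6 : x - (∑ w, n w • S w + r • S k'
            + (∑ u, κ u • Pi.single u (D u) + t • Pi.single k' (D k')))
            = y - (r • S k' + t • Pi.single k' (D k')) := by rw [hy]; abel
        rw [h6]
        rcases Nat.lt_succ_iff_lt_or_eq.1 hu with hu | hu
        · have hne : u < k' := hu
          simp [h1 u hu, h.zero k' u hne, Pi.single_eq_of_ne hne.ne]
        · have hue : u = k' := Fin.ext hu
          subst hue
          simpa using hrt
      by_cases hR : R k'
      · have hdvd := Int.ediv_mul_cancel (h.dvd hD k')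
        refine ⟨n + Pi.single k' (a k' % (D k' / S k' k')),
          κ + Pi.single k' (a k' / (D k' / S k' k')), hzero _ _ ?_, fun u hu => ?_, fun w hw => ?_,
          fun w hw => ?_⟩
        · have h7 := Int.emod_add_mul_ediv (a k') (D k' / S k' k')
          rw [h5]
          linear_combination (-S k' k') * h7 + (a k' / (D k' / S k' k')) * hdvd
        · rw [Pi.add_apply, h2 u hu, Pi.single_eq_of_ne (by rintro rfl; exact hu hR), add_zero]
        · rcases eq_or_ne w k' with rfl | hne
          · rw [Pi.add_apply, h4 _ le_rfl, Pi.single_eq_same, zero_add]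
            exact ⟨Int.emod_nonneg _ (h.digits_pos _).ne', Int.emod_lt_of_pos _ (h.digits_pos _)⟩
          · rw [Pi.add_apply, Pi.single_eq_of_ne hne, add_zero]
            exact h3 w hw
        · rw [Pi.add_apply, h4 w (by omega), Pi.single_eq_of_ne, add_zero]
          rintro rfl
          exact absurd hw (by simp [hk'])
      · refine ⟨n + Pi.single k' (a k'), κ + Pi.single k' 0, hzero _ _ ?_, fun u hu => ?_,
          fun w hw => ?_, fun w hw => ?_⟩
        · rw [h5]; ring
        · simpa using h2 u hu
        · rw [Pi.add_apply, Pi.single_eq_of_ne (by rintro rfl; exact hR hw), add_zero]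
          exact h3 w hw
        · rw [Pi.add_apply, h4 w (by omega), Pi.single_eq_of_ne, add_zero]
          rintro rfl
          exact absurd hw (by simp [hk'])
  obtain ⟨n, κ, h1, h2, h3, -⟩ := key m le_rfl
  exact ⟨n, κ, sub_eq_zero.1 (funext fun u => h1 u u.2), h2, h3⟩

/-- The reduced coefficients are unique. -/
theorem IsTriangular.digits_unique (h : IsTriangular D S Λ) (hD : ∀ u, Pi.single u (D u) ∈ Λ)
    {R : Fin m → Prop} {n n' κ : Fin m → ℤ} (hn : ∀ w, R w → 0 ≤ n w ∧ n w < D w / S w w)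
    (hn' : ∀ w, R w → 0 ≤ n' w ∧ n' w < D w / S w w) (hκ : ∀ u, ¬ R u → κ u = 0)
    (heq : ∑ w, n w • S w - ∑ w, n' w • S w = ∑ u, κ u • Pi.single u (D u)) : n = n' := by
  rw [← Finset.sum_sub_distrib] at heq
  simp only [← sub_smul] at heq
  funext k
  induction k using WellFoundedLT.induction with
  | _ k ih =>
    have h1 := sum_smul_apply_of_lower h.zero (a := n - n') (k := k)
      fun w hw => sub_eq_zero.2 (ih w hw)
    simp only [Pi.sub_apply] at h1
    rw [heq, Finset.sum_apply, Finset.sum_eq_single k] at h1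
    · simp only [Pi.smul_apply, Pi.single_eq_same, smul_eq_mul] at h1
      by_cases hR : R k
      · have hdvd := Int.ediv_mul_cancel (h.dvd hD k)
        rw [← hdvd, ← mul_assoc] at h1
        have h2 := mul_right_cancel₀ (h.pos k).ne' h1
        have h3 : n k - n' k = 0 := by
          refine Int.eq_zero_of_abs_lt_dvd ⟨κ k, by rw [← h2, mul_comm]⟩ (abs_lt.2 ⟨?_, ?_⟩)
          · linarith [(hn k hR).1, (hn' k hR).2]
          · linarith [(hn k hR).2, (hn' k hR).1]
        exact sub_eq_zero.1 h3
      · rw [hκ k hR, zero_mul] at h1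
        exact sub_eq_zero.1 ((mul_eq_zero.1 h1.symm).resolve_right (h.pos k).ne')
    · intro w _ hw
      simp [Pi.single_eq_of_ne hw.symm]
    · simp

end

/-! ### Digit systems -/

/-- Every element of `M` has a unique expansion in which the coefficients of the `v k` are arbitrary
integers and the coefficient of the torsion element `f j` is a digit in `{0, …, h j - 1}`. -/
structure DigitSystem {G : Type*} [AddCommGroup G] {r n : ℕ} (M : AddSubgroup G) (v : Fin r → G)
    (f : Fin n → G) (h : Fin n → ℤ) : Prop where
  v_mem : ∀ k, v k ∈ M
  f_mem : ∀ j, f j ∈ M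
  pos : ∀ j, 0 < h j
  exists_digits : ∀ x ∈ M, ∃ (y : Fin r → ℤ) (d : Fin n → ℤ), (∀ j, 0 ≤ d j ∧ d j < h j) ∧
    x = ∑ k, y k • v k + ∑ j, d j • f j
  unique : ∀ (y y' : Fin r → ℤ) (d d' : Fin n → ℤ), (∀ j, 0 ≤ d j ∧ d j < h j) →
    (∀ j, 0 ≤ d' j ∧ d' j < h j) →
    ∑ k, y k • v k + ∑ j, d j • f j = ∑ k, y' k • v k + ∑ j, d' j • f j → y = y' ∧ d = d'
  torsion : ∀ j, ∃ N : ℕ, 0 < N ∧ N • f j = 0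

section

variable {G : Type*} [AddCommGroup G] {r n : ℕ} {M : AddSubgroup G} {v : Fin r → G}
  {f : Fin n → G} {h : Fin n → ℤ}

theorem mem_closure_range_iff_exists_sum {k : ℕ} {w : Fin k → G} {x : G} :
    x ∈ AddSubgroup.closure (Set.range w) ↔ ∃ y : Fin k → ℤ, x = ∑ i, y i • w i := by
  rw [← Submodule.span_int_eq_addSubgroupClosure, Submodule.mem_toAddSubgroup,
    Submodule.mem_span_range_iff_exists_fun]
  simp only [eq_comm]

theorem DigitSystem.linearIndependent (hS : DigitSystem M v f h) : LinearIndependent ℤ v := by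
  rw [Fintype.linearIndependent_iff]
  intro y hy
  have h0 : ∀ j, 0 ≤ (0 : Fin n → ℤ) j ∧ (0 : Fin n → ℤ) j < h j := fun j => ⟨le_rfl, hS.pos j⟩
  exact congrFun (hS.unique y 0 0 0 h0 h0 (by simp [hy])).1

theorem DigitSystem.eq_zero_of_nsmul (hS : DigitSystem M v f h) {x : G}
    (hx : x ∈ AddSubgroup.closure (Set.range v)) {N : ℕ} (hN : 0 < N) (hNx : N • x = 0) :
    x = 0 := by
  obtain ⟨y, rfl⟩ := mem_closure_range_iff_exists_sum.1 hx
  have h1 : ∑ k, ((N : ℤ) * y k) • v k = 0 := by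
    rw [← hNx, Finset.smul_sum]
    exact Finset.sum_congr rfl fun k _ => by rw [mul_smul, natCast_zsmul]
  have h2 := Fintype.linearIndependent_iff.1 hS.linearIndependent _ h1
  refine Finset.sum_eq_zero fun k _ => ?_
  rw [(mul_eq_zero.1 (h2 k)).resolve_left (by exact_mod_cast hN.ne'), zero_smul]

theorem DigitSystem.exists_nsmul_eq_zero (hS : DigitSystem M v f h) {x : G}
    (hx : x ∈ AddSubgroup.closure (Set.range f)) : ∃ N : ℕ, 0 < N ∧ N • x = 0 := by
  have h1 : AddSubgroup.closure (Set.range f) ≤ AddCommGroup.torsion G := by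
    rw [AddSubgroup.closure_le]
    rintro _ ⟨j, rfl⟩
    exact isOfFinAddOrder_iff_nsmul_eq_zero.2 (hS.torsion j)
  exact isOfFinAddOrder_iff_nsmul_eq_zero.1 (h1 hx)

theorem DigitSystem.disjoint (hS : DigitSystem M v f h) :
    AddSubgroup.closure (Set.range f) ⊓ AddSubgroup.closure (Set.range v) = ⊥ := by
  rw [eq_bot_iff]
  rintro x ⟨hf, hv⟩
  obtain ⟨N, hN, hNx⟩ := hS.exists_nsmul_eq_zero hf
  exact hS.eq_zero_of_nsmul hv hN hNx

theorem DigitSystem.sup_eq (hS : DigitSystem M v f h) :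
    AddSubgroup.closure (Set.range f) ⊔ AddSubgroup.closure (Set.range v) = M := by
  apply le_antisymm
  · refine sup_le ?_ ?_ <;> rw [AddSubgroup.closure_le]
    · rintro _ ⟨j, rfl⟩
      exact hS.f_mem j
    · rintro _ ⟨k, rfl⟩
      exact hS.v_mem k
  · intro x hx
    obtain ⟨y, d, -, rfl⟩ := hS.exists_digits x hx
    rw [add_comm]
    exact AddSubgroup.add_mem_sup (mem_closure_range_iff_exists_sum.2 ⟨d, rfl⟩)
      (mem_closure_range_iff_exists_sum.2 ⟨y, rfl⟩)

theorem DigitSystem.mem_closure_iff (hS : DigitSystem M v f h) {x : G} :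
    x ∈ AddSubgroup.closure (Set.range f) ↔
      ∃ d : Fin n → ℤ, (∀ j, 0 ≤ d j ∧ d j < h j) ∧ x = ∑ j, d j • f j := by
  refine ⟨fun hx => ?_, fun ⟨d, _, hd⟩ => mem_closure_range_iff_exists_sum.2 ⟨d, hd⟩⟩
  obtain ⟨y, d, hd, hxd⟩ := hS.exists_digits x (hS.sup_eq ▸ AddSubgroup.mem_sup_left hx)
  refine ⟨d, hd, ?_⟩
  have h1 : ∑ k, y k • v k ∈ AddSubgroup.closure (Set.range f) := by
    have h2 : ∑ k, y k • v k = x - ∑ j, d j • f j := by rw [hxd]; abel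
    rw [h2]
    exact AddSubgroup.sub_mem _ hx (mem_closure_range_iff_exists_sum.2 ⟨d, rfl⟩)
  have h3 : ∑ k, y k • v k ∈ (⊥ : AddSubgroup G) :=
    hS.disjoint ▸ ⟨h1, mem_closure_range_iff_exists_sum.2 ⟨y, rfl⟩⟩
  rw [AddSubgroup.mem_bot.1 h3, zero_add] at hxd
  exact hxd

theorem DigitSystem.finite_closure (hS : DigitSystem M v f h) :
    (AddSubgroup.closure (Set.range f) : Set G).Finite := by
  have h1 : (Set.pi Set.univ fun j => Set.Ico 0 (h j) : Set (Fin n → ℤ)).Finite :=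
    Set.Finite.pi fun j => Set.finite_Ico 0 (h j)
  refine (h1.image fun d => ∑ j, d j • f j).subset fun x hx => ?_
  obtain ⟨d, hd, rfl⟩ := hS.mem_closure_iff.1 hx
  exact ⟨d, fun j _ => hd j, rfl⟩

end

/-! ### Group elements in coordinates -/

section

variable {a b c : ℕ} {N : Fin c → ℕ}

/-- The position of a factor in the order in which the elimination treats the factors: those equal
to `ℤ` are first, then come the finite ones, then the circles. -/
def innerIndex : Row a b c → ℕ
  | .inr (.inl i) => i
  | .inr (.inr i) => b + i
  | .inl i => b + c + i

theorem innerIndex_lt (ρ : Row a b c) : innerIndex ρ < a + b + c := by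
  rcases ρ with i | i | i <;> simp only [innerIndex] <;> have := i.2 <;> omega

theorem rowIndex_eq (ρ : Row a b c) :
    rowIndex ρ = (((a + innerIndex ρ) % (a + b + c) : ℕ) : ℤ) := by
  rcases ρ with i | i | i <;> simp only [rowIndex, innerIndex] <;> have := i.2
  · rw [show a + (b + c + i.val) = i + (a + b + c) by ring, Nat.add_mod_right,
      Nat.mod_eq_of_lt (by omega)]
  · rw [Nat.mod_eq_of_lt (by omega)]; push_cast; rfl
  · rw [Nat.mod_eq_of_lt (by omega)]; push_cast; ring

/-- The group element with the integer coordinates `y`; those of circles are multiples of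
`1 / q`. -/
noncomputable def elemOf (N : Fin c → ℕ) (q : ℤ) : (ℕ → ℤ) →+ ElemGroup a b N where
  toFun y := (fun i => (((y (b + c + i) : ℝ) / (q : ℝ) : ℝ) : UnitAddCircle), fun i => y i,
    fun i => (y (b + i) : ZMod (N i)))
  map_zero' := by ext <;> simp
  map_add' y z := by
    ext <;> simp [add_div]

theorem Congruent.unique {y : Row a b c → ℝ} {g g' : ElemGroup a b N} (h : Congruent y g)
    (h' : Congruent y g') : g = g' := by
  obtain ⟨h1, h2, h3⟩ := h
  obtain ⟨h1', h2', h3'⟩ := h'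
  refine Prod.ext (funext fun i => (h1 i).symm.trans (h1' i)) (Prod.ext (funext fun i => ?_)
    (funext fun i => ?_))
  · exact_mod_cast (h2 i).symm.trans (h2' i)
  · obtain ⟨k, hk, hk'⟩ := h3 i
    obtain ⟨l, hl, hl'⟩ := h3' i
    rw [← hk', ← hl', show k = l by exact_mod_cast hk.symm.trans hl]

/-- The denominators of the coordinates: `q` for the circles and `1` for the other factors. -/
def rowDen (b c : ℕ) (q : ℤ) (t : ℕ) : ℤ := if t < b + c then 1 else q

theorem rowDen_pos {q : ℤ} (hq : 0 < q) (t : ℕ) : 0 < rowDen b c q t := by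
  rw [rowDen]; split_ifs
  exacts [one_pos, hq]

theorem congruent_elemOf (q : ℤ) (y : ℕ → ℤ) :
    Congruent (fun ρ : Row a b c => (y (innerIndex ρ) : ℝ) / (rowDen b c q (innerIndex ρ) : ℝ))
      (elemOf N q y) := by
  refine ⟨fun i => ?_, fun i => ?_, fun i => ⟨y (b + i), ?_, rfl⟩⟩
  · simp [innerIndex, rowDen, elemOf]
  · have : (i : ℕ) < b + c := by omega
    simp [innerIndex, rowDen, elemOf, this]
  · simp [innerIndex, rowDen]

/-- The moduli of the coordinates: `q` for the circles, `N i` for the finite factors, and, by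
convention, `1` for the factors `ℤ`. -/
def rowMod {c : ℕ} (b : ℕ) (N : Fin c → ℕ) (q : ℤ) (t : ℕ) : ℤ :=
  if t < b then 1 else if h : t - b < c then N ⟨t - b, h⟩ else q

theorem rowMod_pos (hN : ∀ i, 0 < N i) {q : ℤ} (hq : 0 < q) (t : ℕ) : 0 < rowMod b N q t := by
  rw [rowMod]
  split_ifs
  exacts [one_pos, by exact_mod_cast hN _, hq]

theorem elemOf_eq_zero_iff {q : ℤ} (hq : 0 < q) (y : ℕ → ℤ) :
    (elemOf N q y : ElemGroup a b N) = 0 ↔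
      (∀ i < b, y i = 0) ∧ ∀ u, b ≤ u → u < a + b + c → rowMod b N q u ∣ y u := by
  have hq' : (q : ℝ) ≠ 0 := by exact_mod_cast hq.ne'
  have htorus : ∀ x : ℤ, (((x : ℝ) / (q : ℝ) : ℝ) : UnitAddCircle) = 0 ↔ q ∣ x := by
    intro x
    rw [AddCircle.coe_eq_zero_iff]
    constructor
    · rintro ⟨k, hk⟩
      refine ⟨k, ?_⟩
      rw [zsmul_one, eq_div_iff hq'] at hk
      exact_mod_cast (hk.symm.trans (mul_comm _ _))
    · rintro ⟨k, rfl⟩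
      refine ⟨k, ?_⟩
      push_cast
      rw [zsmul_one, mul_div_cancel_left₀ _ hq']
  constructor
  · intro h
    have h1 := congrArg Prod.fst h
    have h2 := congrArg (fun g => g.2.1) h
    have h3 := congrArg (fun g => g.2.2) h
    refine ⟨fun i hi => congrFun h2 ⟨i, hi⟩, fun u hu hu' => ?_⟩
    rw [rowMod, if_neg (by omega)]
    split_ifs with huc
    · have := congrFun h3 ⟨u - b, huc⟩
      simp only [elemOf, AddMonoidHom.coe_mk, ZeroHom.coe_mk, Prod.snd_zero, Pi.zero_apply,
        Nat.add_sub_cancel' hu] at this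
      exact_mod_cast (ZMod.intCast_zmod_eq_zero_iff_dvd _ _).1 this
    · have := congrFun h1 ⟨u - (b + c), by omega⟩
      simp only [elemOf, AddMonoidHom.coe_mk, ZeroHom.coe_mk, Prod.fst_zero, Pi.zero_apply,
        Nat.add_sub_cancel' (show b + c ≤ u by omega)] at this
      exact (htorus _).1 this
  · rintro ⟨h1, h2⟩
    refine Prod.ext (funext fun i => ?_) (Prod.ext (funext fun i => h1 i i.2) (funext fun i => ?_))
    · have := h2 (b + c + i) (by omega) (by omega)
      rw [rowMod, if_neg (by omega), dif_neg (by omega)] at this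
      exact (htorus _).2 this
    · have := h2 (b + i) (by omega) (by omega)
      rw [rowMod, if_neg (by omega), dif_pos (by omega)] at this
      simp only [Nat.add_sub_cancel_left] at this
      exact (ZMod.intCast_zmod_eq_zero_iff_dvd _ _).2 this

theorem exists_nsmul_elemOf_eq_zero (hN : ∀ i, 0 < N i) {q : ℤ} (hq : 0 < q) (y : ℕ → ℤ)
    (hy : (elemOf N q y : ElemGroup a b N).2.1 = 0) :
    ∃ k : ℕ, 0 < k ∧ k • (elemOf N q y : ElemGroup a b N) = 0 := by
  refine ⟨q.toNat * ∏ i, N i, Nat.mul_pos (by omega) (Finset.prod_pos fun i _ => hN i), ?_⟩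
  rw [← map_nsmul, elemOf_eq_zero_iff hq]
  refine ⟨fun i hi => ?_, fun u hu hu' => ?_⟩
  · have : y i = 0 := congrFun hy ⟨i, hi⟩
    simp [this]
  · rw [Pi.smul_apply, nsmul_eq_mul, rowMod, if_neg (by omega)]
    push_cast
    rw [Int.toNat_of_nonneg hq.le]
    split_ifs with h
    · exact Dvd.dvd.mul_right (Dvd.dvd.mul_left
        (Finset.dvd_prod_of_mem (fun i => (N i : ℤ)) (Finset.mem_univ _)) _) _
    · exact Dvd.dvd.mul_right (dvd_mul_right _ _) _

theorem groupNorm_le_sum (g : ElemGroup a b N) :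
    groupNorm g ≤ ∑ i, ‖g.1 i‖ + ∑ i, |(g.2.1 i : ℝ)| + ∑ i, |(((g.2.2 i).valMinAbs : ℤ) : ℝ)| := by
  have h1 := Finset.sum_sq_le_sq_sum_of_nonneg (s := Finset.univ) (f := fun i => ‖g.1 i‖)
    fun i _ => norm_nonneg _
  have h2 := Finset.sum_sq_le_sq_sum_of_nonneg (s := Finset.univ) (f := fun i => |(g.2.1 i : ℝ)|)
    fun i _ => abs_nonneg _
  have h3 := Finset.sum_sq_le_sq_sum_of_nonneg (s := Finset.univ)
    (f := fun i => |(((g.2.2 i).valMinAbs : ℤ) : ℝ)|) fun i _ => abs_nonneg _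
  have h4 : 0 ≤ ∑ i, ‖g.1 i‖ := Finset.sum_nonneg fun i _ => norm_nonneg _
  have h5 : 0 ≤ ∑ i, |(g.2.1 i : ℝ)| := Finset.sum_nonneg fun i _ => abs_nonneg _
  have h6 : 0 ≤ ∑ i, |(((g.2.2 i).valMinAbs : ℤ) : ℝ)| := Finset.sum_nonneg fun i _ => abs_nonneg _
  simp only [sq_abs] at h2 h3
  rw [groupNorm, Real.sqrt_le_left (by positivity)]
  nlinarith [mul_nonneg h4 h5, mul_nonneg h4 h6, mul_nonneg h5 h6]

theorem abs_le_groupNorm (g : ElemGroup a b N) (i : Fin b) : |(g.2.1 i : ℝ)| ≤ groupNorm g := by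
  rw [groupNorm]
  refine Real.le_sqrt_of_sq_le ?_
  rw [sq_abs]
  have h1 := Finset.single_le_sum (f := fun i => (g.2.1 i : ℝ) ^ 2) (fun i _ => sq_nonneg _)
    (Finset.mem_univ i)
  have h2 : 0 ≤ ∑ i, ‖g.1 i‖ ^ 2 := Finset.sum_nonneg fun i _ => sq_nonneg _
  have h3 : 0 ≤ ∑ i, (((g.2.2 i).valMinAbs : ℤ) : ℝ) ^ 2 := Finset.sum_nonneg fun i _ => sq_nonneg _
  linarith

/-! ### Consequences of the existence of a matrix representation -/

section

variable {α β : ℕ} {E : Matrix (Row a b c) (Col α β) ℚ}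
  {φ : (Fin α → ℝ) × (Fin β → ℤ) →+ ElemGroup a b N}

theorem exists_int_of_congruent {y : Row a b c → ℝ} {g : ElemGroup a b N} (h : Congruent y g)
    (ρ : Fin b ⊕ Fin c) : ∃ k : ℤ, y (.inr ρ) = k := by
  rcases ρ with i | i
  · exact ⟨_, h.2.1 i⟩
  · obtain ⟨k, hk, -⟩ := h.2.2 i
    exact ⟨k, hk⟩

theorem IsMatrixRep.eq_zero (h : IsMatrixRep E φ) (ρ : Fin b ⊕ Fin c) (j : Fin α) :
    E (.inr ρ) (.inl j) = 0 := by
  by_contra hne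
  have hne' : (E (.inr ρ) (.inl j) : ℝ) ≠ 0 := by exact_mod_cast hne
  -- a real multiple of a non-zero entry takes the value `1 / 2`
  obtain ⟨k, hk⟩ := exists_int_of_congruent
    (h (Pi.single j (1 / (2 * (E (.inr ρ) (.inl j) : ℝ))), 0)) ρ
  simp only [Matrix.mulVec, dotProduct, Matrix.map_apply, realTuple, Fintype.sum_sum_type,
    Sum.elim_inl, Sum.elim_inr, Pi.zero_apply, Int.cast_zero, mul_zero, Finset.sum_const_zero,
    add_zero] at hk
  rw [Finset.sum_eq_single j (fun j' _ hj' => by rw [Pi.single_eq_of_ne hj', mul_zero])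
    (by simp), Pi.single_eq_same] at hk
  have h2 : (E (.inr ρ) (.inl j) : ℝ) * (1 / (2 * (E (.inr ρ) (.inl j) : ℝ))) = 1 / 2 := by
    field_simp
  rw [h2] at hk
  have h3 : (1 : ℤ) = 2 * k := by
    have : (1 : ℝ) = 2 * k := by linarith
    exact_mod_cast this
  omega

theorem IsMatrixRep.den_eq_one (h : IsMatrixRep E φ) (ρ : Fin b ⊕ Fin c) (j : Col α β) :
    (E (.inr ρ) j).den = 1 := by
  rcases j with j | j
  · rw [h.eq_zero]; rfl
  · obtain ⟨k, hk⟩ := exists_int_of_congruent (h (0, Pi.single j 1)) ρ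
    simp only [Matrix.mulVec, dotProduct, Matrix.map_apply, realTuple, Fintype.sum_sum_type,
      Sum.elim_inl, Sum.elim_inr, Pi.zero_apply, mul_zero, Finset.sum_const_zero, zero_add] at hk
    rw [Finset.sum_eq_single j (fun j' _ hj' => by rw [Pi.single_eq_of_ne hj']; simp)
      (by simp), Pi.single_eq_same, Int.cast_one, mul_one] at hk
    have : E (.inr ρ) (.inr j) = k := by exact_mod_cast hk
    rw [this]; rfl

end

end

/-! ### The net -/

/-- The combination of the first `n` columns of `X` with the coefficients `z`. -/
def colComb (X : ℕ → ℕ → ℤ) (n : ℕ) : (ℕ → ℤ) →+ (ℕ → ℤ) where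
  toFun z u := ∑ j ∈ Finset.range n, X u j * z j
  map_zero' := by ext; simp
  map_add' y z := by ext; simp [mul_add, Finset.sum_add_distrib]

theorem colComb_apply (X : ℕ → ℕ → ℤ) (n : ℕ) (z : ℕ → ℤ) (u : ℕ) :
    colComb X n z u = ∑ j ∈ Finset.range n, X u j * z j := rfl

/-- The group generated by the elements whose coordinates are the columns of `X`. -/
noncomputable def netGroup (a b : ℕ) {c : ℕ} (N : Fin c → ℕ) (q : ℤ) (X : ℕ → ℕ → ℤ) (n : ℕ) :
    AddSubgroup (ElemGroup a b N) :=
  ((elemOf N q).comp (colComb X n)).range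

/-- The position of a column of a matrix representation. -/
def colNat {α β : ℕ} : Col α β → ℕ
  | .inl j => j
  | .inr j => α + j

theorem colIndex_eq {α β : ℕ} (j : Col α β) : colIndex j = (colNat j : ℤ) := by
  rcases j with j | j <;> simp [colIndex, colNat]

theorem colNat_lt {α β : ℕ} (j : Col α β) : colNat j < α + β := by
  rcases j with j | j <;> simp only [colNat] <;> have := j.2 <;> omega

theorem sum_range_eq_sum_col {α β : ℕ} {M : Type*} [AddCommMonoid M] (g : ℕ → M) :
    ∑ j ∈ Finset.range (α + β), g j = ∑ j : Col α β, g (colNat j) := by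
  rw [Finset.sum_range_add, Fintype.sum_sum_type, ← Fin.sum_univ_eq_sum_range,
    ← Fin.sum_univ_eq_sum_range]
  rfl

/-- The scale of a column: the real coordinates are restricted to multiples of `1 / K`. -/
def colScale {α β : ℕ} (K : ℤ) : Col α β → ℤ
  | .inl _ => K
  | .inr _ => 1

section

variable {a b c α β : ℕ} {N : Fin c → ℕ} {E : Matrix (Row a b c) (Col α β) ℚ}
  {φ : (Fin α → ℝ) × (Fin β → ℤ) →+ ElemGroup a b N} {q K : ℤ} {X : ℕ → ℕ → ℤ}

/-- The integer matrix `X` is obtained from `E` by dividing the real columns by `K` and then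
multiplying the rows of the circles by `q`. -/
def IsScaled (E : Matrix (Row a b c) (Col α β) ℚ) (q K : ℤ) (X : ℕ → ℕ → ℤ) : Prop :=
  0 < q ∧ 0 < K ∧ ∀ ρ j, (X (innerIndex ρ) (colNat j) : ℚ) * colScale K j
    = rowDen b c q (innerIndex ρ) * E ρ j

theorem IsScaled.apply_eq (hX : IsScaled E q K X) (hφ : IsMatrixRep E φ) (z : ℕ → ℤ) :
    φ (fun j => (z j : ℝ) / K, fun j => z (α + j)) = elemOf N q (colComb X (α + β) z) := by
  obtain ⟨hq, hK, hX⟩ := hX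
  refine (hφ _).unique ?_
  convert congruent_elemOf q (colComb X (α + β) z) using 2 with ρ
  have hden : (rowDen b c q (innerIndex ρ) : ℝ) ≠ 0 := by
    exact_mod_cast (rowDen_pos hq _).ne'
  have hK' : (K : ℝ) ≠ 0 := by exact_mod_cast hK.ne'
  rw [eq_div_iff hden, colComb_apply, sum_range_eq_sum_col, Matrix.mulVec, dotProduct,
    Finset.sum_mul, Int.cast_sum]
  refine Finset.sum_congr rfl fun j _ => ?_
  have h1 : (X (innerIndex ρ) (colNat j) : ℝ) * (colScale K j : ℝ)
      = (rowDen b c q (innerIndex ρ) : ℝ) * (E ρ j : ℝ) := by exact_mod_cast hX ρ j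
  rcases j with j | j
  · simp only [colScale] at h1
    simp only [Matrix.map_apply, realTuple, Sum.elim_inl, colNat, Int.cast_mul] at h1 ⊢
    field_simp
    linear_combination (-(z j : ℝ)) * h1
  · simp only [colScale, Int.cast_one, mul_one] at h1
    simp only [Matrix.map_apply, realTuple, Sum.elim_inr, Int.cast_mul]
    rw [h1]
    simp only [colNat]
    ring

theorem IsScaled.netGroup_le (hX : IsScaled E q K X) (hφ : IsMatrixRep E φ) :
    netGroup a b N q X (α + β) ≤ φ.range := by
  rintro _ ⟨z, rfl⟩
  exact ⟨_, hX.apply_eq hφ z⟩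

theorem IsScaled.map_int_mem (hX : IsScaled E q K X) (hφ : IsMatrixRep E φ) (y : Fin β → ℤ) :
    φ (0, y) ∈ netGroup a b N q X (α + β) := by
  refine ⟨fun t => if h : α ≤ t ∧ t < α + β then y ⟨t - α, by omega⟩ else 0, ?_⟩
  rw [AddMonoidHom.comp_apply, ← hX.apply_eq hφ]
  congr 1
  refine Prod.ext (funext fun j => ?_) (funext fun j => ?_)
  · have : ¬ (α ≤ (j : ℕ) ∧ (j : ℕ) < α + β) := by omega
    simp [this]
  · have : α ≤ α + (j : ℕ) ∧ α + (j : ℕ) < α + β := by omega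
    simp

theorem IsMatrixRep.apply_real_snd (hφ : IsMatrixRep E φ) (x : Fin α → ℝ) :
    (φ (x, 0)).2.1 = 0 ∧ (φ (x, 0)).2.2 = 0 := by
  have hrow : ∀ ρ : Fin b ⊕ Fin c,
      (E.map (fun q : ℚ => (q : ℝ))).mulVec (realTuple (x, 0)) (.inr ρ) = 0 := by
    intro ρ
    simp [Matrix.mulVec, dotProduct, realTuple, Fintype.sum_sum_type, hφ.eq_zero]
  obtain ⟨-, h2, h3⟩ := hφ (x, 0)
  refine ⟨funext fun i => ?_, funext fun i => ?_⟩
  · have := (h2 i).symm.trans (hrow (.inl i))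
    exact_mod_cast this
  · obtain ⟨k, hk, hk'⟩ := h3 i
    have : k = 0 := by exact_mod_cast hk.symm.trans (hrow (.inr i))
    rw [← hk', this]; simp

/-- Rounding the real coordinates to multiples of `1 / K` moves the image only little. -/
theorem IsScaled.exists_near (hX : IsScaled E q K X) (hφ : IsMatrixRep E φ) {ε : ℝ}
    (hε : ∑ i, ∑ j, |(E (.inl i) (.inl j) : ℝ)| ≤ ε * K) {h : ElemGroup a b N} (hh : h ∈ φ.range) :
    ∃ x ∈ netGroup a b N q X (α + β), groupNorm (h - x) ≤ ε := by
  obtain ⟨⟨x, y⟩, rfl⟩ := hh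
  have hK : (0 : ℝ) < K := by exact_mod_cast hX.2.1
  let z : ℕ → ℤ := fun t => if h : t < α then ⌊x ⟨t, h⟩ * K⌋ else
    if h : t - α < β then y ⟨t - α, h⟩ else 0
  have hz : ∀ j : Fin β, z (α + j) = y j := fun j => by simp [z]
  have hzx : ∀ j : Fin α, z j = ⌊x j * K⌋ := fun j => by simp [z]
  refine ⟨_, ⟨z, rfl⟩, ?_⟩
  rw [AddMonoidHom.comp_apply, ← hX.apply_eq hφ, ← map_sub]
  have hsub : ((x, y) : (Fin α → ℝ) × (Fin β → ℤ)) - ((fun j => (z j : ℝ) / K, fun j => z (α + j)) :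
      (Fin α → ℝ) × (Fin β → ℤ))
      = (fun j => x j - (z j : ℝ) / K, 0) := by
    refine Prod.ext rfl (funext fun j => ?_)
    simp [hz]
  rw [hsub]
  set w : Fin α → ℝ := fun j => x j - (z j : ℝ) / K with hw
  have hwle : ∀ j, |w j| ≤ 1 / K := by
    intro j
    have h1 := Int.floor_le (x j * K)
    have h2 := Int.lt_floor_add_one (x j * K)
    have h3 : w j = (x j * K - ⌊x j * K⌋) / K := by
      rw [hw]; simp only [hzx]; field_simp
    rw [h3, abs_div, abs_of_pos hK]
    gcongr
    rw [abs_le]; constructor <;> linarith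
  obtain ⟨h0, h0'⟩ := hφ.apply_real_snd w
  refine (groupNorm_le_sum _).trans ?_
  simp only [h0, h0', Pi.zero_apply, Int.cast_zero, abs_zero, Finset.sum_const_zero, add_zero,
    ZMod.valMinAbs_zero]
  have h4 : ∀ i, ‖(φ (w, 0)).1 i‖ ≤ ∑ j, |(E (.inl i) (.inl j) : ℝ)| * (1 / K) := by
    intro i
    rw [← (hφ (w, 0)).1 i]
    refine ((QuotientAddGroup.norm_mk_le_norm (S := AddSubgroup.zmultiples (1 : ℝ)))).trans ?_
    simp only [Matrix.mulVec, dotProduct, Matrix.map_apply, realTuple, Fintype.sum_sum_type,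
      Sum.elim_inl, Sum.elim_inr, Pi.zero_apply, Int.cast_zero, mul_zero, Finset.sum_const_zero,
      add_zero, Real.norm_eq_abs]
    refine (Finset.abs_sum_le_sum_abs _ _).trans (Finset.sum_le_sum fun j _ => ?_)
    rw [abs_mul]
    exact mul_le_mul_of_nonneg_left (hwle j) (abs_nonneg _)
  refine (Finset.sum_le_sum fun i _ => h4 i).trans ?_
  simp only [← Finset.sum_mul]
  rw [mul_one_div, div_le_iff₀ hK]
  exact hε

theorem IsScaled.isEpsNet (hX : IsScaled E q K X) (hφ : IsMatrixRep E φ) {ε : ℝ}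
    (hε : ∑ i, ∑ j, |(E (.inl i) (.inl j) : ℝ)| ≤ ε * K) {r n : ℕ} {v : Fin r → ElemGroup a b N}
    {f : Fin n → ElemGroup a b N} {h : Fin n → ℤ}
    (hS : DigitSystem (netGroup a b N q X (α + β)) v f h) :
    IsEpsNet ε φ.range (netGroup a b N q X (α + β)) := by
  refine ⟨hX.netGroup_le hφ, ?_, fun h hh => hX.exists_near hφ hε hh⟩
  rw [← hS.sup_eq]
  exact AddSubgroup.FG.sup
    ((AddSubgroup.fg_iff _).2 ⟨_, rfl, Set.finite_range f⟩)
    ((AddSubgroup.fg_iff _).2 ⟨_, rfl, Set.finite_range v⟩)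

theorem IsScaled.isNetDecomp (hX : IsScaled E q K X) (hφ : IsMatrixRep E φ) (hN : ∀ i, 0 < N i)
    (hcl : IsClosed (φ.range : Set (ElemGroup a b N))) {r n : ℕ} {v : Fin r → ElemGroup a b N}
    {f : Fin n → ElemGroup a b N} {h : Fin n → ℤ}
    (hS : DigitSystem (netGroup a b N q X (α + β)) v f h) (hf : ∀ j, (f j).2.1 = 0) :
    IsNetDecomp φ.range (netGroup a b N q X (α + β)) (AddSubgroup.closure (Set.range f))
      (AddSubgroup.closure (Set.range v)) := by
  let π : ElemGroup a b N →+ (Fin b → ℤ) :=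
    (AddMonoidHom.fst _ _).comp (AddMonoidHom.snd _ _)
  have hπ : ∀ g, π g = g.2.1 := fun _ => rfl
  have hfπ : AddSubgroup.closure (Set.range f) ≤ π.ker := by
    rw [AddSubgroup.closure_le]
    rintro _ ⟨j, rfl⟩
    exact hf j
  have hvM : AddSubgroup.closure (Set.range v) ≤ netGroup a b N q X (α + β) :=
    hS.sup_eq ▸ le_sup_right
  have hfM : AddSubgroup.closure (Set.range f) ≤ netGroup a b N q X (α + β) :=
    hS.sup_eq ▸ le_sup_left
  -- elements of the free part are determined by their coordinates in `ℤ`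
  have hker : ∀ x ∈ AddSubgroup.closure (Set.range v), x.2.1 = 0 → x = 0 := by
    intro x hx hx0
    obtain ⟨z, rfl⟩ := hvM hx
    obtain ⟨k, hk, hk0⟩ := exists_nsmul_elemOf_eq_zero hN hX.1 _ hx0
    exact hS.eq_zero_of_nsmul hx hk hk0
  have hfree : TorsionFree (AddSubgroup.closure (Set.range v)) :=
    fun x hx k hk hkx => hS.eq_zero_of_nsmul hx hk hkx
  refine ⟨φ.range ⊓ π.ker, AddSubgroup.closure (Set.range v), ⟨⟨?_, ?_⟩, ?_, ?_⟩,
    ⟨hS.sup_eq, hS.disjoint⟩, le_inf (hfM.trans (hX.netGroup_le hφ)) hfπ, hS.finite_closure, le_rfl,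
    (AddSubgroup.fg_iff _).2 ⟨_, rfl, Set.finite_range v⟩, hfree⟩
  · refine le_antisymm (sup_le inf_le_left (hvM.trans (hX.netGroup_le hφ))) ?_
    rintro _ ⟨⟨x, y⟩, rfl⟩
    obtain ⟨yv, d, -, hyd⟩ := hS.exists_digits _ (hX.map_int_mem hφ y)
    have h1 : φ (x, y) = (φ (x, 0) + ∑ j, d j • f j) + ∑ k, yv k • v k := by
      rw [add_assoc, add_comm (∑ j, d j • f j), ← hyd, ← map_add]
      simp
    rw [h1]
    have h2 : ∑ j, d j • f j ∈ AddSubgroup.closure (Set.range f) :=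
      mem_closure_range_iff_exists_sum.2 ⟨d, rfl⟩
    refine AddSubgroup.add_mem_sup (AddSubgroup.add_mem _ ⟨⟨_, rfl⟩, ?_⟩
      ⟨hX.netGroup_le hφ (hfM h2), hfπ h2⟩) (mem_closure_range_iff_exists_sum.2 ⟨yv, rfl⟩)
    exact (hφ.apply_real_snd x).1
  · rw [eq_bot_iff]
    rintro x ⟨⟨-, hx⟩, hxv⟩
    exact hker x hxv hx
  · have : ∀ i, NeZero (N i) := fun i => ⟨(hN i).ne'⟩
    have hK : IsCompact ((Set.univ : Set (Fin a → UnitAddCircle)) ×ˢ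
        (({0} : Set (Fin b → ℤ)) ×ˢ (Set.univ : Set ((i : Fin c) → ZMod (N i))))) :=
      isCompact_univ.prod (isCompact_singleton.prod isCompact_univ)
    convert hK.inter_left hcl using 1
    ext g
    simp [AddMonoidHom.mem_ker, hπ]
  · rcases eq_or_ne (AddSubgroup.closure (Set.range v)) ⊥ with h0 | h0
    · exact Or.inl h0
    · refine Or.inr ⟨hfree, fun R => ?_⟩
      obtain ⟨⟨x, hx⟩, hx0'⟩ := AddSubgroup.ne_bot_iff_exists_ne_zero.1 h0
      have hx0 : x ≠ 0 := fun h => hx0' (Subtype.ext h)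
      obtain ⟨i, hi⟩ : ∃ i, x.2.1 i ≠ 0 := by
        by_contra! hall
        exact hx0 (hker x hx (funext hall))
      obtain ⟨k, hk⟩ := exists_nat_gt R
      refine ⟨k • x, AddSubgroup.nsmul_mem _ hx k, hk.trans_le ?_⟩
      refine le_trans ?_ (abs_le_groupNorm _ i)
      have h2 : (k • x).2.1 i = k * x.2.1 i := by
        rw [← hπ, map_nsmul, hπ, Pi.smul_apply, nsmul_eq_mul]
      rw [h2, Int.cast_mul, Int.cast_natCast, abs_mul, Nat.abs_cast]
      have h1 : (1 : ℝ) ≤ |(x.2.1 i : ℝ)| := by exact_mod_cast Int.one_le_abs hi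
      exact le_mul_of_one_le_right (Nat.cast_nonneg k) h1

end

/-! ### The digit system given by a triangular basis -/

/-- The coordinates of a vector whose coordinates in non-pivot rows have been ignored: for the
factors `ℤ` they are recovered from the pivot coordinates. -/
def completeCoords (b : ℕ) (T : ℕ → ℕ → ℤ) (d : ℤ) (x : ℕ → ℤ) (u : ℕ) : ℤ :=
  if u < b then (∑ w ∈ Finset.range b, T u w * x w) / d else x u

/-- The moduli of the elimination: a multiple of all moduli of the group and of `d ^ 2` for the
pivot rows, and the modulus of the group (or `1` for a factor `ℤ`) for the other rows. -/
def netMod {c : ℕ} (b : ℕ) (N : Fin c → ℕ) (q Q d : ℤ) (T : ℕ → ℕ → ℤ) (u : ℕ) : ℤ :=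
  if T u u = 0 then rowMod b N q u else Q * d * d

section

variable {a b c n : ℕ} {N : Fin c → ℕ} {q Q d : ℤ} {X T : ℕ → ℕ → ℤ}

theorem netMod_pos (hN : ∀ i, 0 < N i) (hq : 0 < q) (hQ : 0 < Q) (hd : d ≠ 0) (u : ℕ) :
    0 < netMod b N q Q d T u := by
  rw [netMod]
  split_ifs
  · exact rowMod_pos hN hq u
  · rw [mul_assoc]
    exact mul_pos hQ (mul_self_pos.2 hd)

/-- The combination `z` of the columns of `X` has, up to the moduli of the group, the coordinates
recovered from `x`. -/
def Represents (a : ℕ) {c : ℕ} (b n : ℕ) (N : Fin c → ℕ) (q d : ℤ) (X T : ℕ → ℕ → ℤ)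
    (x z : ℕ → ℤ) : Prop :=
  (∀ i < b, ∑ w ∈ Finset.range b, T i w * x w = d * colComb X n z i) ∧
  ∀ u, b ≤ u → u < a + b + c → rowMod b N q u ∣ x u - colComb X n z u

theorem Represents.sum {ι : Type*} [Fintype ι] {x z : ι → ℕ → ℤ} (k : ι → ℤ)
    (h : ∀ i, Represents a b n N q d X T (x i) (z i)) :
    Represents a b n N q d X T (∑ i, k i • x i) (∑ i, k i • z i) := by
  refine ⟨fun i hi => ?_, fun u hu hu' => ?_⟩
  · simp only [map_sum, map_zsmul, Finset.sum_apply, Pi.smul_apply, smul_eq_mul, Finset.mul_sum]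
    rw [Finset.sum_comm]
    refine Finset.sum_congr rfl fun j _ => ?_
    simp only [mul_left_comm _ (k j), ← Finset.mul_sum, (h j).1 i hi]
  · simp only [map_sum, map_zsmul, Finset.sum_apply, Pi.smul_apply, smul_eq_mul,
      ← Finset.sum_sub_distrib, ← mul_sub]
    exact Finset.dvd_sum fun j _ => Dvd.dvd.mul_left ((h j).2 u hu hu') _

theorem Represents.elemOf_eq {x z : ℕ → ℤ} (h : Represents a b n N q d X T x z) (hq : 0 < q)
    (hd : d ≠ 0) : (elemOf N q (completeCoords b T d x) : ElemGroup a b N)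
      = elemOf N q (colComb X n z) := by
  rw [← sub_eq_zero, ← map_sub, elemOf_eq_zero_iff hq]
  refine ⟨fun i hi => ?_, fun u hu hu' => ?_⟩
  · rw [Pi.sub_apply, completeCoords, if_pos hi, h.1 i hi, Int.mul_ediv_cancel_left _ hd, sub_self]
  · rw [Pi.sub_apply, completeCoords, if_neg (by omega)]
    exact h.2 u hu hu'

/-- A congruence modulo `netMod` can be lifted to an exact equality in the pivot rows: the columns
of `T`, multiplied by `Q d`, are lattice vectors with entry `Q d ^ 2` in one pivot row that are
trivial in the finite factors and in the circles. -/
theorem exists_represents (hT : IsCramer b n X T d) (hT0 : ∀ u, b ≤ u → T u u = 0)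
    (hQ : ∀ u, b ≤ u → u < a + b + c → rowMod b N q u ∣ Q) {x : ℕ → ℤ}
    (hx : (fun u : Fin (a + b + c) => x u) ∈
      netLattice (fun u : Fin (a + b + c) => netMod b N q Q d T u) X n) :
    ∃ z, Represents a b n N q d X T x z := by
  obtain ⟨z₀, hz₀⟩ := hx
  have hk : ∀ u : ℕ, ∃ k : ℤ, u < a + b + c →
      x u = colComb X n z₀ u + netMod b N q Q d T u * k := by
    intro u
    by_cases hu : u < a + b + c
    · obtain ⟨k, hk⟩ := hz₀ ⟨u, hu⟩
      exact ⟨k, fun _ => by rw [← hk, colComb_apply]; simp⟩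
    · exact ⟨0, fun h => absurd h hu⟩
  choose k hk using hk
  have hy : ∀ p : ℕ, ∃ y : ℕ → ℤ, p < b → ∀ i < b, T i p = colComb X n y i := by
    intro p
    by_cases hp : p < b
    · obtain ⟨y, hy⟩ := hT.exists_comb p hp
      exact ⟨y, fun _ => hy⟩
    · exact ⟨0, fun h => absurd h hp⟩
  choose y hy using hy
  have hcomb : ∀ u, colComb X n (z₀ + ∑ p ∈ Finset.range b, (if T p p = 0 then 0 else
      Q * d * k p) • y p) u = colComb X n z₀ u + ∑ p ∈ Finset.range b,
        (if T p p = 0 then 0 else Q * d * k p) * colComb X n (y p) u := by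
    intro u
    simp only [map_add, map_sum, map_zsmul, Pi.add_apply, Finset.sum_apply, Pi.smul_apply,
      smul_eq_mul]
  refine ⟨z₀ + ∑ p ∈ Finset.range b, (if T p p = 0 then 0 else Q * d * k p) • y p,
    fun i hi => ?_, fun u hu hu' => ?_⟩
  · rw [hcomb, mul_add, Finset.mul_sum]
    have h1 : ∑ w ∈ Finset.range b, T i w * colComb X n z₀ w = d * colComb X n z₀ i := by
      simp only [colComb_apply, Finset.mul_sum]
      rw [Finset.sum_comm]
      refine Finset.sum_congr rfl fun j hj => ?_
      rw [← mul_assoc, ← hT.sum_eq j (Finset.mem_range.1 hj) i hi, Finset.sum_mul]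
      exact Finset.sum_congr rfl fun w _ => by ring
    rw [← h1, ← Finset.sum_add_distrib]
    refine Finset.sum_congr rfl fun w hw => ?_
    have hw' := Finset.mem_range.1 hw
    rw [hk w (by omega), mul_add, netMod, ← hy w hw' i hi]
    split_ifs with h0
    · rw [hT.col_eq_zero w hw' h0 i hi]; ring
    · ring
  · have h2 : x u - colComb X n z₀ u = rowMod b N q u * k u := by
      rw [hk u hu', netMod, if_pos (hT0 u hu)]; ring
    rw [hcomb, ← sub_sub, h2]
    refine dvd_sub (dvd_mul_right _ _) (Finset.dvd_sum fun p _ => ?_)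
    split_ifs
    · simp
    · exact Dvd.dvd.mul_right (Dvd.dvd.mul_right (Dvd.dvd.mul_right (hQ u hu hu') _) _) _

/-- The coordinates of a trivial group element are multiples of the moduli in the non-pivot rows,
and zero in the pivot rows. -/
theorem exists_eq_sum_single (hT : IsCramer b n X T d) (hT0 : ∀ u, b ≤ u → T u u = 0) (hq : 0 < q)
    {x : ℕ → ℤ} (hx : ∃ z, Represents a b n N q d X T x z)
    (h0 : (elemOf N q (completeCoords b T d x) : ElemGroup a b N) = 0) :
    ∃ κ : Fin (a + b + c) → ℤ, (∀ u : Fin (a + b + c), T u u ≠ 0 → κ u = 0) ∧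
      (fun u : Fin (a + b + c) => x u)
        = ∑ u : Fin (a + b + c), κ u • Pi.single u (netMod b N q Q d T u) := by
  have hpiv : ∀ p, T p p ≠ 0 → x p = 0 := by
    intro p hp
    have hpb : p < b := by
      by_contra h
      exact hp (hT0 p (by omega))
    obtain ⟨h1, h2⟩ := (elemOf_eq_zero_iff hq _).1 h0
    obtain ⟨z, hz⟩ := hx
    have h3 := h1 p hpb
    rw [completeCoords, if_pos hpb, hz.1 p hpb, Int.mul_ediv_cancel_left _ hT.ne_zero] at h3
    have h4 := hz.1 p hpb
    rw [h3, mul_zero, Finset.sum_eq_single p] at h4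
    · rw [hT.pivot p hpb hp p hpb hp, if_pos rfl] at h4
      exact (mul_eq_zero.1 h4).resolve_left hT.ne_zero
    · intro w hw hwp
      have hw' := Finset.mem_range.1 hw
      by_cases hw0 : T w w = 0
      · rw [hT.col_eq_zero w hw' hw0 p hpb, zero_mul]
      · rw [hT.pivot w hw' hw0 p hpb hp, if_neg (Ne.symm hwp), zero_mul]
    · exact fun h => absurd (Finset.mem_range.2 hpb) h
  have hdvd : ∀ u < a + b + c, T u u = 0 → rowMod b N q u ∣ x u := by
    intro u hu hu0
    rcases lt_or_ge u b with h | h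
    · rw [rowMod, if_pos h]; exact one_dvd _
    · have := ((elemOf_eq_zero_iff hq _).1 h0).2 u h hu
      rwa [completeCoords, if_neg (by omega)] at this
  refine ⟨fun u => x u / netMod b N q Q d T u, fun u hu => by simp [hpiv u hu], ?_⟩
  ext u
  rw [Finset.sum_apply, Finset.sum_eq_single u]
  · simp only [Pi.smul_apply, Pi.single_eq_same, smul_eq_mul]
    by_cases hu : T u u = 0
    · rw [netMod, if_pos hu, Int.ediv_mul_cancel (hdvd u u.2 hu)]
    · simp [hpiv u hu]
  · intro w _ hw
    simp [Pi.single_eq_of_ne hw.symm]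
  · simp

/-- The basis vectors of the non-pivot rows among the first `b` have only the digit `0`; those of
the pivot rows give the free generators and those of the remaining rows the torsion generators. -/
theorem digitSystem_of_isTriangular (hN : ∀ i, 0 < N i) (hq : 0 < q) (hQ0 : 0 < Q)
    (hT : IsCramer b n X T d) (hT0 : ∀ u, b ≤ u → T u u = 0)
    (hQ : ∀ u, b ≤ u → u < a + b + c → rowMod b N q u ∣ Q) {S : ℕ → ℕ → ℤ}
    (hS : IsTriangular (fun u : Fin (a + b + c) => netMod b N q Q d T u)
      (fun w u : Fin (a + b + c) => S u w)
      (netLattice (fun u : Fin (a + b + c) => netMod b N q Q d T u) X n))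
    {r : ℕ} {p : Fin r → ℕ} (hpb : ∀ k, p k < b) (hp0 : ∀ k, T (p k) (p k) ≠ 0)
    (hpinj : Function.Injective p) (hpsurj : ∀ w < b, T w w ≠ 0 → ∃ k, p k = w) :
    DigitSystem (netGroup a b N q X n)
      (fun k => elemOf N q (completeCoords b T d fun u => S u (p k)))
      (fun j : Fin (a + c) => elemOf N q (completeCoords b T d fun u => S u (b + j)))
      (fun j => netMod b N q Q d T (b + j) / S (b + j) (b + j)) ∧
    ∀ j : Fin (a + c), (elemOf N q (completeCoords b T d fun u => S u (b + j)) :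
      ElemGroup a b N).2.1 = 0 := by
  set D : Fin (a + b + c) → ℤ := fun u => netMod b N q Q d T u with hD
  set Λ := netLattice D X n with hΛ
  let g : Fin (a + b + c) → ElemGroup a b N := fun w =>
    elemOf N q (completeCoords b T d fun u => S u w)
  have hDpos : ∀ u, 0 < D u := fun u => netMod_pos hN hq hQ0 hT.ne_zero u
  have hDΛ : ∀ u, Pi.single u (D u) ∈ Λ := single_mem_netLattice n
  have hSΛ : ∀ w : Fin (a + b + c), (fun u : Fin (a + b + c) => S u w) ∈ Λ := fun w => by
    rw [← hS.span]; exact Submodule.subset_span ⟨w, rfl⟩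
  have hrep : ∀ w : Fin (a + b + c), ∃ z, Represents a b n N q d X T (fun u => S u w) z := fun w =>
    exists_represents hT hT0 hQ (hSΛ w)
  choose z hz using hrep
  have hgM : ∀ w, g w ∈ netGroup a b N q X n := fun w => ⟨z w, ((hz w).elemOf_eq hq hT.ne_zero).symm⟩
  -- the elements of the net in terms of the triangular basis
  have hsum : ∀ k : Fin (a + b + c) → ℤ,
      (∃ z, Represents a b n N q d X T (∑ w : Fin (a + b + c), k w • fun u => S u w) z) ∧
      elemOf N q (completeCoords b T d (∑ w : Fin (a + b + c), k w • fun u => S u w))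
        = ∑ w, k w • g w := by
    intro k
    have h1 := Represents.sum k hz
    refine ⟨⟨_, h1⟩, ?_⟩
    rw [h1.elemOf_eq hq hT.ne_zero, map_sum, map_sum]
    refine Finset.sum_congr rfl fun w _ => ?_
    rw [map_zsmul, map_zsmul, ← (hz w).elemOf_eq hq hT.ne_zero]
  have hres : ∀ k : Fin (a + b + c) → ℤ,
      (fun u : Fin (a + b + c) => (∑ w : Fin (a + b + c), k w • fun u => S u w) u)
        = ∑ w : Fin (a + b + c), k w • fun u : Fin (a + b + c) => S u w := by
    intro k
    ext u
    simp
  -- the rows that carry generators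
  let e : Fin r ⊕ Fin (a + c) → Fin (a + b + c) :=
    Sum.elim (fun k => ⟨p k, by have := hpb k; omega⟩) (fun j => ⟨b + j, by omega⟩)
  have he : Function.Injective e := by
    rintro (i | i) (j | j) h <;> simp only [e, Sum.elim_inl, Sum.elim_inr, Fin.mk.injEq] at h
    · rw [hpinj h]
    · have := hpb i; omega
    · have := hpb j; omega
    · rw [show i = j from Fin.ext (by omega)]
  have hrange : ∀ w, w ∉ Set.range e → (w : ℕ) < b ∧ T w w = 0 := by
    intro w hw
    have hwb : (w : ℕ) < b := by
      by_contra h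
      exact hw ⟨.inr ⟨w - b, by omega⟩, Fin.ext (by simp [e]; omega)⟩
    refine ⟨hwb, ?_⟩
    by_contra h
    obtain ⟨k, hk⟩ := hpsurj w hwb h
    exact hw ⟨.inl k, Fin.ext hk⟩
  have hsplit : ∀ k : Fin (a + b + c) → ℤ, (∀ w, w ∉ Set.range e → k w = 0) →
      ∑ w, k w • g w = ∑ i, k (e (.inl i)) • g (e (.inl i))
        + ∑ j, k (e (.inr j)) • g (e (.inr j)) := by
    intro k hk
    rw [← Fintype.sum_sum_type (fun s => k (e s) • g (e s))]
    symm
    refine Fintype.sum_of_injective e he _ _ (fun w hw => ?_) fun s => rfl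
    rw [hk w hw, zero_smul]
  have hinr : ∀ j : Fin (a + c), T (e (.inr j)) (e (.inr j)) = 0 := fun j => hT0 _ (by simp [e])
  have hZ : ∀ j : Fin (a + c), (g (e (.inr j))).2.1 = 0 := by
    intro j
    funext i
    have h1 : completeCoords b T d (fun u => S u (e (.inr j))) i = 0 := by
      rw [completeCoords, if_pos i.2, Finset.sum_eq_zero, Int.zero_ediv]
      intro w hw
      have hw' := Finset.mem_range.1 hw
      have := hS.zero (e (.inr j)) ⟨w, by omega⟩ (Fin.lt_def.2 (by simp [e]; omega))
      simp only at this
      rw [this, mul_zero]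
    exact h1
  refine ⟨⟨fun k => hgM (e (.inl k)), fun j => hgM (e (.inr j)), fun j => hS.digits_pos (e (.inr j)),
    ?_, ?_, fun j => ?_⟩, hZ⟩
  · rintro _ ⟨y, rfl⟩
    have hx : (fun u : Fin (a + b + c) => colComb X n y u) ∈ Λ := ⟨y, fun u => by
      simp [colComb_apply]⟩
    obtain ⟨k, κ, hk, hκ, hkd⟩ := hS.exists_digits hDΛ (fun u => T u u = 0) hx
    have hk0 : ∀ w, w ∉ Set.range e → k w = 0 := by
      intro w hw
      obtain ⟨hwb, hw0⟩ := hrange w hw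
      have h1 := hkd w hw0
      have h2 : D w = 1 := by simp only [hD, netMod, if_pos hw0, rowMod, if_pos hwb]
      have h3 := hS.pos w
      have h4 : D w / S w w ≤ 1 := by
        rw [h2]
        exact Int.ediv_le_self _ (by norm_num)
      omega
    refine ⟨fun i => k (e (.inl i)), fun j => k (e (.inr j)), fun j => hkd _ (hinr j), ?_⟩
    refine Eq.trans ?_ (hsplit k hk0)
    rw [← (hsum k).2, AddMonoidHom.comp_apply, ← sub_eq_zero, ← map_sub, elemOf_eq_zero_iff hq]
    obtain ⟨⟨z', hz'⟩, -⟩ := hsum k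
    have hdiff : ∀ u : Fin (a + b + c), colComb X n y u
        - (∑ w : Fin (a + b + c), k w • fun u => S u w) (u : ℕ) = κ u * D u := by
      intro u
      have h5 := congrFun hk u
      have h6 : (∑ w, κ w • (Pi.single w (D w) : Fin (a + b + c) → ℤ)) u = κ u * D u := by
        rw [Finset.sum_apply, Finset.sum_eq_single u
          (fun w _ hw => by simp [Pi.single_eq_of_ne hw.symm]) (by simp)]
        simp
      rw [Pi.add_apply, h6] at h5
      rw [h5, ← hres k]; ring
    refine ⟨fun i hi => ?_, fun u hu hu' => ?_⟩
    · have h6 : ∑ w ∈ Finset.range b, T i w * colComb X n y w = d * colComb X n y i := by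
        simp only [colComb_apply, Finset.mul_sum]
        rw [Finset.sum_comm]
        refine Finset.sum_congr rfl fun j hj => ?_
        rw [← mul_assoc, ← hT.sum_eq j (Finset.mem_range.1 hj) i hi, Finset.sum_mul]
        exact Finset.sum_congr rfl fun w _ => by ring
      have h7 : ∑ w ∈ Finset.range b, T i w * (∑ w : Fin (a + b + c), k w • fun u => S u w) w
          = d * colComb X n y i := by
        rw [← h6]
        refine Finset.sum_congr rfl fun w hw => ?_
        have hw' := Finset.mem_range.1 hw
        by_cases h0 : T w w = 0
        · rw [hT.col_eq_zero w hw' h0 i hi, zero_mul, zero_mul]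
        · have := hdiff ⟨w, by omega⟩
          rw [hκ _ h0, zero_mul, sub_eq_zero] at this
          simp only at this
          rw [this]
      rw [Pi.sub_apply, completeCoords, if_pos hi, h7, Int.mul_ediv_cancel_left _ hT.ne_zero,
        sub_self]
    · rw [Pi.sub_apply, completeCoords, if_neg (by omega), hdiff ⟨u, hu'⟩]
      simp only [hD, netMod, if_pos (hT0 u hu)]
      exact dvd_mul_left _ _
  · intro y y' k k' hk hk' heq
    -- extend the coefficients to all rows
    let ν : Fin (a + b + c) → ℤ := Function.extend e (Sum.elim y k) 0
    let ν' : Fin (a + b + c) → ℤ := Function.extend e (Sum.elim y' k') 0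
    have hν : ∀ s, ν (e s) = Sum.elim y k s := he.extend_apply _ _
    have hν' : ∀ s, ν' (e s) = Sum.elim y' k' s := he.extend_apply _ _
    have hν0 : ∀ w, w ∉ Set.range e → ν w = 0 := fun w hw => Function.extend_apply' _ _ _ hw
    have hν0' : ∀ w, w ∉ Set.range e → ν' w = 0 := fun w hw => Function.extend_apply' _ _ _ hw
    have hrg : ∀ (μ : Fin (a + b + c) → ℤ) (κ : Fin (a + c) → ℤ),
        (∀ w, w ∉ Set.range e → μ w = 0) → (∀ j, μ (e (.inr j)) = κ j) →
        (∀ j : Fin (a + c), 0 ≤ κ j ∧ κ j < netMod b N q Q d T (b + j) / S (b + j) (b + j)) →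
        ∀ w : Fin (a + b + c), T w w = 0 → 0 ≤ μ w ∧ μ w < D w / S w w := by
      intro μ κ h0 h1 h2 w hw
      by_cases hwe : w ∈ Set.range e
      · obtain ⟨s | j, rfl⟩ := hwe
        · exact absurd hw (hp0 s)
        · rw [h1]; exact h2 j
      · rw [h0 w hwe]; exact ⟨le_rfl, hS.digits_pos w⟩
    have hzero : ∑ w, (ν - ν') w • g w = 0 := by
      simp only [Pi.sub_apply, sub_smul, Finset.sum_sub_distrib]
      rw [hsplit ν hν0, hsplit ν' hν0', sub_eq_zero]
      simp only [hν, hν', Sum.elim_inl, Sum.elim_inr]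
      exact heq
    rw [← (hsum (ν - ν')).2] at hzero
    obtain ⟨κ, hκ, hκeq⟩ := exists_eq_sum_single (Q := Q) hT hT0 hq (hsum (ν - ν')).1 hzero
    rw [hres] at hκeq
    simp only [Pi.sub_apply, sub_smul, Finset.sum_sub_distrib] at hκeq
    have hνν' : ν = ν' := hS.digits_unique hDΛ (R := fun w => T w w = 0)
      (hrg ν k hν0 (fun j => hν _) hk) (hrg ν' k' hν0' (fun j => hν' _) hk') (fun u hu => hκ u hu)
      hκeq
    refine ⟨funext fun i => ?_, funext fun j => ?_⟩
    · have := hν (.inl i)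
      rw [hνν', hν'] at this
      exact this.symm
    · have := hν (.inr j)
      rw [hνν', hν'] at this
      exact this.symm
  · exact exists_nsmul_elemOf_eq_zero hN hq _ (hZ j)

end

/-! ### Rules for common kinds of loops -/

theorem Run.set_cell {W : ℕ} {m : Mem} {A : ℕ} {i j e : Expr} (i' j' v : ℤ) (hi : i.eval m = i')
    (hj : j.eval m = j') (hv : e.eval m = v) (h : |v| < 2 ^ W) :
    Run W (.set A i j e) m (wr m A i' j' v) := by
  subst hi hj
  exact Run.set_wr v hv h

theorem Run.assign {W : ℕ} {m : Mem} {A : ℕ} {e : Expr} (v : ℤ) (hv : e.eval m = v)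
    (h : |v| < 2 ^ W) : Run W (.assign A e) m (wr m A 0 0 v) :=
  Run.set_cell 0 0 v rfl rfl hv h

/-- A loop that writes the cells `(A, idx k, jdx k)`, one after the other. -/
theorem Run.for_set {W x A : ℕ} {ne i j f : Expr} {m₀ : Mem} (n : ℕ) (hn : n ≤ W)
    (hne : ne.eval m₀ = n) (hxA : A ≠ x) (hrx : ne.reads x = false) (hrA : ne.reads A = false)
    (idx jdx val : ℕ → ℤ)
    (hinj : ∀ k < n, ∀ k' < n, idx k = idx k' → jdx k = jdx k' → k = k')
    (heval : ∀ k < n, ∀ m : Mem, (∀ B i' j', B ≠ x →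
      (∀ k' < k, ¬ (B = A ∧ i' = idx k' ∧ j' = jdx k')) → m (B, i', j') = m₀ (B, i', j')) →
      m (x, 0, 0) = k → i.eval m = idx k ∧ j.eval m = jdx k ∧ f.eval m = val k)
    (hval : ∀ k < n, |val k| < 2 ^ W) :
    ∃ m', Run W (.for x ne (.set A i j f)) m₀ m' ∧ (∀ k < n, m' (A, idx k, jdx k) = val k) ∧
      ∀ B i' j', B ≠ x → (∀ k < n, ¬ (B = A ∧ i' = idx k ∧ j' = jdx k)) →
        m' (B, i', j') = m₀ (B, i', j') := by
  refine Run.for_of_invariant n hn hne (by simp [Cmd.writes, hxA]) (fun k m =>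
    (∀ k' < k, m (A, idx k', jdx k') = val k') ∧ ∀ B i' j', B ≠ x →
      (∀ k' < k, ¬ (B = A ∧ i' = idx k' ∧ j' = jdx k')) → m (B, i', j') = m₀ (B, i', j'))
    (fun m hm => ?_) ⟨fun k' hk' => absurd hk' (Nat.not_lt_zero _), fun B i' j' hB _ => ?_⟩
    (fun k hk m _ hx hI => ?_)
  · refine Expr.eval_congr fun B hB => hm B ?_
    simp only [Cmd.for, Cmd.writes, Bool.or_eq_false_iff, beq_eq_false_iff_ne, ne_eq]
    refine ⟨?_, ?_, ?_⟩ <;> rintro rfl <;> simp_all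
  · simp [hB]
  · obtain ⟨h1, h2, h3⟩ := heval k hk m hI.2 hx
    refine ⟨_, Run.set_cell _ _ _ h1 h2 h3 (hval k hk), fun k' hk' => ?_, fun B i' j' hB hnot => ?_⟩
    · rw [wr_apply, if_neg (by simp [hxA]), wr_apply]
      rcases Nat.lt_succ_iff_lt_or_eq.1 hk' with h | rfl
      · rw [if_neg, hI.1 k' h]
        rintro ⟨-, h4, h5⟩
        exact h.ne (hinj k' (by omega) k hk h4 h5)
      · simp
    · rw [wr_apply, if_neg (by simp [hB]), wr_apply, if_neg (hnot k (by omega))]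
      exact hI.2 B i' j' hB fun k' hk' => hnot k' (by omega)

/-- A loop that accumulates a sum in the variable `A`. -/
theorem Run.for_sum {W x A : ℕ} {ne f : Expr} {m₀ : Mem} (n : ℕ) (hn : n ≤ W)
    (hne : ne.eval m₀ = n) (hxA : A ≠ x) (hrx : ne.reads x = false) (hrA : ne.reads A = false)
    (val : ℕ → ℤ)
    (heval : ∀ k < n, ∀ m : Mem, (∀ B i' j', B ≠ x → B ≠ A → m (B, i', j') = m₀ (B, i', j')) →
      m (x, 0, 0) = k → f.eval m = val k)
    (hval : ∀ k ≤ n, |m₀ (A, 0, 0) + ∑ k' ∈ Finset.range k, val k'| < 2 ^ W) :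
    ∃ m', Run W (.for x ne (.assign A (.var A + f))) m₀ m' ∧
      m' (A, 0, 0) = m₀ (A, 0, 0) + ∑ k ∈ Finset.range n, val k ∧
      ∀ B i' j', B ≠ x → B ≠ A → m' (B, i', j') = m₀ (B, i', j') := by
  refine Run.for_of_invariant n hn hne (by simp [Cmd.writes, hxA]) (fun k m =>
    m (A, 0, 0) = m₀ (A, 0, 0) + ∑ k' ∈ Finset.range k, val k' ∧
      ∀ B i' j', B ≠ x → B ≠ A → m (B, i', j') = m₀ (B, i', j'))
    (fun m hm => ?_) ⟨by simp [hxA], fun B i' j' hB _ => by simp [hB]⟩ (fun k hk m _ hx hI => ?_)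
  · refine Expr.eval_congr fun B hB => hm B ?_
    simp only [Cmd.for, Cmd.writes, Bool.or_eq_false_iff, beq_eq_false_iff_ne, ne_eq]
    refine ⟨?_, ?_, ?_⟩ <;> rintro rfl <;> simp_all
  · refine ⟨_, Run.assign (m₀ (A, 0, 0) + ∑ k' ∈ Finset.range (k + 1), val k') ?_ (hval _ hk), ?_,
      fun B i' j' hB hA => ?_⟩
    · simp only [Expr.eval_add, Expr.eval_get, Expr.eval_lit, hI.1, heval k hk m hI.2 hx,
        Finset.sum_range_succ, add_assoc]
    · simp [hxA]
    · simp [hB, hA, hI.2 B i' j' hB hA]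

/-- The rule for loops that decrease a natural number. -/
theorem Run.while_of_measure {W : ℕ} {e : Expr} {p : Cmd} (I : Mem → Prop) (μ : Mem → ℕ)
    (hstep : ∀ m, I m → 0 < e.eval m → ∃ m', Run W p m m' ∧ I m' ∧ μ m' < μ m)
    {m₀ : Mem} (h0 : I m₀) (hμ : μ m₀ ≤ W) :
    ∃ m', Run W (.loop e p) m₀ m' ∧ I m' ∧ ¬ 0 < e.eval m' := by
  have key : ∀ n : ℕ, ∀ m, I m → μ m ≤ n → ∃ (k : ℕ) (M : ℕ → Mem), k ≤ n ∧ M 0 = m ∧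
      (∀ i < k, 0 < e.eval (M i)) ∧ (∀ i < k, Run W p (M i) (M (i + 1))) ∧
      ¬ 0 < e.eval (M k) ∧ I (M k) := by
    intro n
    induction n with
    | zero =>
      intro m hm hn
      by_cases he : 0 < e.eval m
      · obtain ⟨m', -, -, h⟩ := hstep m hm he
        omega
      · exact ⟨0, fun _ => m, le_rfl, rfl, by simp, by simp, he, hm⟩
    | succ n ih =>
      intro m hm hn
      by_cases he : 0 < e.eval m
      · obtain ⟨m', h1, h2, h3⟩ := hstep m hm he
        obtain ⟨k, M, hk, rfl, hpos, hrun, hend, hI⟩ := ih m' h2 (by omega)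
        refine ⟨k + 1, fun i => Nat.casesOn i m M, by omega, rfl, fun i hi => ?_, fun i hi => ?_,
          hend, hI⟩
        · cases i with
          | zero => exact he
          | succ i => exact hpos i (by omega)
        · cases i with
          | zero => exact h1
          | succ i => exact hrun i (by omega)
      · exact ⟨0, fun _ => m, Nat.zero_le _, rfl, by simp, by simp, he, hm⟩
  obtain ⟨k, M, hk, rfl, hpos, hrun, hend, hI⟩ := key W m₀ h0 hμ
  exact ⟨M k, .loop k M hk hpos hrun hend, hI, hend⟩

/-! ### The scales -/

/-- The commands of a list, one after the other. -/
def Cmd.block : List Cmd → Cmd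
  | [] => .skip
  | c :: cs => .seq c (.block cs)

theorem Run.nil {W : ℕ} (m : Mem) : Run W (.block []) m m := .skip m

theorem Run.cons {W : ℕ} {c : Cmd} {cs : List Cmd} {m m₁ m₂ : Mem} (h : Run W c m m₁)
    (hs : Run W (.block cs) m₁ m₂) : Run W (.block (c :: cs)) m m₂ := .seq h hs

/-- Computes the numbers `m` (variable 20) and `n` (21) of rows and columns, the product of all
denominators (22), the number `1 + ∑ num ^ 2` (23), the scale `K` of the real columns (24), the
scale `q` of the circles (25) and the product `Q` of all moduli (26). -/
def scalesCmd : Cmd := .block [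
  .assign 20 (.get 0 0 0 + .get 0 1 0 + .get 0 2 0),
  .assign 21 (.get 0 3 0 + .get 0 4 0),
  .assign 22 1,
  .assign 23 1,
  .for 30 (.var 20) (.for 31 (.var 21) (.block [
    .assign 22 (.var 22 * .get 3 (.var 30) (.var 31)),
    .assign 23 (.var 23 + .get 2 (.var 30) (.var 31) * .get 2 (.var 30) (.var 31))])),
  .assign 24 (.get 0 5 0 * .var 23),
  .assign 25 (.var 22 * .var 24),
  .assign 26 (.var 25),
  .for 30 (.get 0 2 0) (.assign 26 (.var 26 * .get 1 (.var 30) 0))]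

theorem scalesCmd_run {W m n c k : ℕ} {m₀ : Mem} {num den : ℕ → ℕ → ℤ} {N : ℕ → ℤ}
    (hm : m₀ (0, 0, 0) + m₀ (0, 1, 0) + m₀ (0, 2, 0) = m) (hn : m₀ (0, 3, 0) + m₀ (0, 4, 0) = n)
    (hc : m₀ (0, 2, 0) = c) (hk : m₀ (0, 5, 0) = k)
    (hnum : ∀ i < m, ∀ j < n, m₀ (2, i, j) = num i j)
    (hden : ∀ i < m, ∀ j < n, m₀ (3, i, j) = den i j) (hN : ∀ i < c, m₀ (1, i, 0) = N i)
    (hden0 : ∀ i < m, ∀ j < n, 0 < den i j) (hN0 : ∀ i < c, 0 < N i) (hk0 : 0 < k)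
    (hmW : m ≤ W) (hnW : n ≤ W) (hcW : c ≤ W)
    (hW : (∏ i ∈ Finset.range m, ∏ j ∈ Finset.range n, den i j)
      * (k * (1 + ∑ i ∈ Finset.range m, ∑ j ∈ Finset.range n, num i j * num i j))
      * ∏ i ∈ Finset.range c, N i < 2 ^ W) :
    ∃ m', Run W scalesCmd m₀ m' ∧ m' (20, 0, 0) = m ∧ m' (21, 0, 0) = n ∧
      m' (24, 0, 0) = k * (1 + ∑ i ∈ Finset.range m, ∑ j ∈ Finset.range n, num i j * num i j) ∧
      m' (25, 0, 0) = (∏ i ∈ Finset.range m, ∏ j ∈ Finset.range n, den i j)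
        * (k * (1 + ∑ i ∈ Finset.range m, ∑ j ∈ Finset.range n, num i j * num i j)) ∧
      m' (26, 0, 0) = (∏ i ∈ Finset.range m, ∏ j ∈ Finset.range n, den i j)
        * (k * (1 + ∑ i ∈ Finset.range m, ∑ j ∈ Finset.range n, num i j * num i j))
        * ∏ i ∈ Finset.range c, N i := by
  set R : ℕ → ℤ := fun i => ∏ j ∈ Finset.range n, den i j with hR
  set S : ℕ → ℤ := fun i => ∑ j ∈ Finset.range n, num i j * num i j with hS
  have hR0 : ∀ i ∈ Finset.range m, 0 < R i := fun i hi => Finset.prod_pos fun j hj =>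
    hden0 i (Finset.mem_range.1 hi) j (Finset.mem_range.1 hj)
  have hP0 : 0 < ∏ i ∈ Finset.range m, R i := Finset.prod_pos hR0
  have hS0 : ∀ i, 0 ≤ S i := fun i => Finset.sum_nonneg fun j _ => mul_self_nonneg _
  have hsum0 : 0 ≤ ∑ i ∈ Finset.range m, S i := Finset.sum_nonneg fun i _ => hS0 i
  have hNP0 : 0 < ∏ i ∈ Finset.range c, N i :=
    Finset.prod_pos fun i hi => hN0 i (Finset.mem_range.1 hi)
  have hk1 : (1 : ℤ) ≤ k := by exact_mod_cast hk0
  -- every number that occurs is at most the last one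
  have hQ : (∏ i ∈ Finset.range m, R i) * (k * (1 + ∑ i ∈ Finset.range m, S i)) < 2 ^ W :=
    (le_mul_of_one_le_right (by positivity) hNP0).trans_lt hW
  have hK : k * (1 + ∑ i ∈ Finset.range m, S i) < 2 ^ W :=
    (le_mul_of_one_le_left (by positivity) hP0).trans_lt hQ
  have hsum : 1 + ∑ i ∈ Finset.range m, S i < 2 ^ W :=
    (le_mul_of_one_le_left (by positivity) hk1).trans_lt hK
  have hP : ∏ i ∈ Finset.range m, R i < 2 ^ W :=
    (le_mul_of_one_le_right hP0.le (by nlinarith)).trans_lt hQ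
  have hpartP : ∀ i < m, ∀ j ≤ n, 0 < (∏ i' ∈ Finset.range i, R i') * ∏ j' ∈ Finset.range j, den i j' ∧
      (∏ i' ∈ Finset.range i, R i') * ∏ j' ∈ Finset.range j, den i j' < 2 ^ W := by
    intro i hi j hj
    have h1 : 0 < ∏ i' ∈ Finset.range i, R i' := Finset.prod_pos fun i' hi' =>
      hR0 i' (Finset.mem_range.2 ((Finset.mem_range.1 hi').trans hi))
    have h2 : 0 < ∏ j' ∈ Finset.range j, den i j' := Finset.prod_pos fun j' hj' =>
      hden0 i hi j' ((Finset.mem_range.1 hj').trans_le hj)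
    refine ⟨mul_pos h1 h2, lt_of_le_of_lt (Int.le_of_dvd hP0 ?_) hP⟩
    refine dvd_trans ?_ (Finset.prod_dvd_prod_of_subset (Finset.range (i + 1)) _ R
      (Finset.range_subset_range.2 hi))
    rw [Finset.prod_range_succ]
    exact mul_dvd_mul_left _ (Finset.prod_dvd_prod_of_subset _ _ _ (Finset.range_subset_range.2 hj))
  have hpartS : ∀ i < m, ∀ j ≤ n, 0 ≤ 1 + ∑ i' ∈ Finset.range i, S i'
        + ∑ j' ∈ Finset.range j, num i j' * num i j' ∧
      1 + ∑ i' ∈ Finset.range i, S i' + ∑ j' ∈ Finset.range j, num i j' * num i j' < 2 ^ W := by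
    intro i hi j hj
    have h1 : 0 ≤ ∑ i' ∈ Finset.range i, S i' := Finset.sum_nonneg fun i _ => hS0 i
    have h2 : 0 ≤ ∑ j' ∈ Finset.range j, num i j' * num i j' :=
      Finset.sum_nonneg fun j _ => mul_self_nonneg _
    refine ⟨by positivity, lt_of_le_of_lt ?_ hsum⟩
    have h3 : ∑ j' ∈ Finset.range j, num i j' * num i j' ≤ S i :=
      Finset.sum_le_sum_of_subset_of_nonneg (Finset.range_subset_range.2 hj)
        fun j _ _ => mul_self_nonneg _
    have h4 : ∑ i' ∈ Finset.range (i + 1), S i' ≤ ∑ i ∈ Finset.range m, S i :=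
      Finset.sum_le_sum_of_subset_of_nonneg (Finset.range_subset_range.2 hi) fun i _ _ => hS0 i
    rw [Finset.sum_range_succ] at h4
    linarith
  have hsmall : ∀ t : ℕ, t ≤ W → |(t : ℤ)| < 2 ^ W := fun t ht => by
    rw [Nat.abs_cast]
    exact_mod_cast (Nat.lt_two_pow_self).trans_le (Nat.pow_le_pow_right (by norm_num) ht)
  have hone : |(1 : ℤ)| < 2 ^ W := by
    rw [abs_one]
    exact lt_of_le_of_lt (by linarith) hsum
  set m₁ := wr (wr (wr (wr m₀ 20 0 0 m) 21 0 0 n) 22 0 0 1) 23 0 0 1 with hm₁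
  obtain ⟨m₂, hr₂, h22, h23⟩ := Run.for_of_invariant (W := W) (x := 30) (e := .var 20)
    (p := .for 31 (.var 21) (.block [
      .assign 22 (.var 22 * .get 3 (.var 30) (.var 31)),
      .assign 23 (.var 23 + .get 2 (.var 30) (.var 31) * .get 2 (.var 30) (.var 31))]))
    (m₀ := m₁) m hmW (by simp [hm₁]) rfl
    (fun i m => m (22, 0, 0) = ∏ i' ∈ Finset.range i, R i' ∧
      m (23, 0, 0) = 1 + ∑ i' ∈ Finset.range i, S i')
    (fun m' h => Expr.eval_congr fun A hA => h A (by simp [Expr.reads] at hA; subst hA; rfl))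
    (by simp [hm₁]) (by
    intro i hi m' hfr hx ⟨h22, h23⟩
    obtain ⟨m'', hr, h22', h23'⟩ := Run.for_of_invariant (W := W) (x := 31) (e := .var 21)
      (p := (.block [
        .assign 22 (.var 22 * .get 3 (.var 30) (.var 31)),
        .assign 23 (.var 23 + .get 2 (.var 30) (.var 31) * .get 2 (.var 30) (.var 31))]))
      (m₀ := m') n hnW (by simp [hfr 21 rfl, hm₁]) rfl
      (fun j m => m (22, 0, 0) = (∏ i' ∈ Finset.range i, R i') * ∏ j' ∈ Finset.range j, den i j' ∧
        m (23, 0, 0) = 1 + ∑ i' ∈ Finset.range i, S i'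
          + ∑ j' ∈ Finset.range j, num i j' * num i j')
      (fun m' h => Expr.eval_congr fun A hA => h A (by simp [Expr.reads] at hA; subst hA; rfl))
      (by simp [h22, h23]) (by
      intro j hj m'' hfr' hx' ⟨h22', h23'⟩
      have h3 : m'' (3, i, j) = den i j := by
        rw [hfr' 3 rfl, hfr 3 rfl, ← hden i hi j hj]; simp [hm₁]
      have h2 : m'' (2, i, j) = num i j := by
        rw [hfr' 2 rfl, hfr 2 rfl, ← hnum i hi j hj]; simp [hm₁]
      have hx30 : m'' (30, 0, 0) = i := by rw [hfr' 30 rfl, hx]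
      refine ⟨_, .cons (Run.assign ((∏ i' ∈ Finset.range i, R i')
        * ∏ j' ∈ Finset.range (j + 1), den i j') ?_ ?_) (.cons (Run.assign
        (1 + ∑ i' ∈ Finset.range i, S i' + ∑ j' ∈ Finset.range (j + 1), num i j' * num i j') ?_ ?_)
        (.nil _)), ?_⟩
      · simp [h22', hx30, hx', h3, Finset.prod_range_succ, mul_assoc]
      · rw [abs_of_pos (hpartP i hi _ hj).1]; exact (hpartP i hi _ hj).2
      · simp [h23', hx30, hx', h2, Finset.sum_range_succ, add_assoc]
      · rw [abs_of_nonneg (hpartS i hi _ hj).1]; exact (hpartS i hi _ hj).2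
      · simp)
    refine ⟨m'', hr, ?_⟩
    simp [h22', h23', Finset.prod_range_succ, Finset.sum_range_succ, hR, hS, add_assoc])
  set K := k * (1 + ∑ i ∈ Finset.range m, S i) with hKdef
  set q := (∏ i ∈ Finset.range m, R i) * K with hqdef
  have hK0 : 0 ≤ K := by positivity
  have hq0 : 0 ≤ q := by positivity
  have h24 : m₂ (0, 5, 0) = k := by rw [hr₂.frame rfl, ← hk]; simp [hm₁]
  set m₃ := wr (wr (wr m₂ 24 0 0 K) 25 0 0 q) 26 0 0 q with hm₃
  obtain ⟨m₄, hr₄, h26⟩ := Run.for_of_invariant (W := W) (x := 30) (e := .get 0 2 0)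
    (p := .assign 26 (.var 26 * .get 1 (.var 30) 0)) (m₀ := m₃) c hcW
    (by simp [hm₃, hr₂.frame (A := 0) rfl, hm₁, hc]) rfl
    (fun i m => m (26, 0, 0) = q * ∏ i' ∈ Finset.range i, N i')
    (fun m' h => Expr.eval_congr fun A hA => h A (by simp [Expr.reads] at hA; subst hA; rfl))
    (by simp [hm₃]) (by
    intro i hi m' hfr hx h26
    have h1 : m' (1, i, 0) = N i := by
      rw [hfr 1 rfl, ← hN i hi]; simp [hm₃, hr₂.frame (A := 1) rfl, hm₁]
    have h2 : 0 ≤ ∏ i' ∈ Finset.range (i + 1), N i' := Finset.prod_nonneg fun i' hi' =>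
      (hN0 i' ((Finset.mem_range.1 hi').trans_le hi)).le
    refine ⟨_, Run.assign (q * ∏ i' ∈ Finset.range (i + 1), N i') ?_ ?_, ?_⟩
    · simp [h26, hx, h1, Finset.prod_range_succ, mul_assoc]
    · rw [abs_of_nonneg (mul_nonneg hq0 h2)]
      refine lt_of_le_of_lt (mul_le_mul_of_nonneg_left (Int.le_of_dvd hNP0 ?_) hq0) hW
      exact Finset.prod_dvd_prod_of_subset _ _ _ (Finset.range_subset_range.2 hi)
    · simp)
  refine ⟨m₄, ?_, ?_, ?_, ?_, ?_, h26⟩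
  · refine .cons (Run.assign (m : ℤ) ?_ (hsmall m hmW)) <|
      .cons (Run.assign (n : ℤ) ?_ (hsmall n hnW)) <| .cons (Run.assign 1 ?_ hone) <|
      .cons (Run.assign 1 ?_ hone) <| .cons hr₂ <| .cons (Run.assign K ?_ ?_) <|
      .cons (Run.assign q ?_ ?_) <| .cons (Run.assign q ?_ ?_) <| .cons hr₄ (.nil _)
    · simp [hm]
    · simp [hn]
    · simp
    · simp
    · simp [h24, h23, hKdef]
    · rw [abs_of_nonneg hK0]; exact hK
    · simp [h22, hqdef]
    · rw [abs_of_nonneg hq0]; exact hQ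
    · simp
    · rw [abs_of_nonneg hq0]; exact hQ
  · rw [hr₄.frame rfl]; simp [hm₃, hr₂.frame (A := 20) rfl, hm₁]
  · rw [hr₄.frame rfl]; simp [hm₃, hr₂.frame (A := 21) rfl, hm₁]
  · rw [hr₄.frame rfl]; simp [hm₃]
  · rw [hr₄.frame rfl]; simp [hm₃]

/-! ### The scaled matrix -/

/-- Computes the scale of every column (array 40), the common denominator (41) and the modulus (42)
of every row, and the entries of the scaled matrix (43). The rows are sorted so that the factors
`ℤ` come first and the factors `𝕋` come last. -/
def entriesCmd : Cmd := .block [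
  .for 31 (.var 21) (.ite (.get 0 3 0 - .var 31) (.set 40 (.var 31) 0 (.var 24))
    (.set 40 (.var 31) 0 1)),
  .for 32 (.var 20) (.block [
    .ite (.get 0 1 0 - .var 32)
      (.block [.set 42 (.var 32) 0 1, .set 41 (.var 32) 0 1])
      (.ite (.get 0 1 0 + .get 0 2 0 - .var 32)
        (.block [.set 42 (.var 32) 0 (.get 1 (.var 32 - .get 0 1 0) 0), .set 41 (.var 32) 0 1])
        (.block [.set 42 (.var 32) 0 (.var 25), .set 41 (.var 32) 0 (.var 25)])),
    .for 31 (.var 21) (.set 43 (.var 32) (.var 31)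
      (.get 2 ((.get 0 0 0 + .var 32) % .var 20) (.var 31)
        * (.get 41 (.var 32) 0 / .get 3 ((.get 0 0 0 + .var 32) % .var 20) (.var 31))
        / .get 40 (.var 31) 0))])]

theorem entriesCmd_run {W a b c α m n : ℕ} {m₀ : Mem} {num den : ℕ → ℕ → ℤ} {N : ℕ → ℤ} {K q : ℤ}
    (ha : m₀ (0, 0, 0) = a) (hb : m₀ (0, 1, 0) = b) (hc : m₀ (0, 2, 0) = c) (hα : m₀ (0, 3, 0) = α)
    (hm : m₀ (20, 0, 0) = m) (hn : m₀ (21, 0, 0) = n) (hK : m₀ (24, 0, 0) = K)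
    (hq : m₀ (25, 0, 0) = q) (hmabc : m = a + b + c)
    (hnum : ∀ i < m, ∀ j < n, m₀ (2, i, j) = num i j)
    (hden : ∀ i < m, ∀ j < n, m₀ (3, i, j) = den i j) (hN : ∀ i < c, m₀ (1, i, 0) = N i)
    (hmW : m ≤ W) (hnW : n ≤ W) (hKW : |K| < 2 ^ W) (hqW : |q| < 2 ^ W)
    (hNW : ∀ i < c, |N i| < 2 ^ W) (hW1 : 1 ≤ W) {dn Nm : ℕ → ℤ} {X : ℕ → ℕ → ℤ}
    (hdn : ∀ t < m, dn t = if t < b + c then 1 else q)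
    (hNm : ∀ t < m, Nm t = if t < b then 1 else if t < b + c then N (t - b) else q)
    (hX : ∀ t < m, ∀ j < n, X t j = num ((a + t) % m) j * (dn t / den ((a + t) % m) j)
      / if j < α then K else 1)
    (hXW : ∀ t < m, ∀ j < n, |X t j| < 2 ^ W) :
    ∃ m', Run W entriesCmd m₀ m' ∧ (∀ t < m, m' (41, t, 0) = dn t) ∧
      (∀ t < m, m' (42, t, 0) = Nm t) ∧ ∀ t < m, ∀ j < n, m' (43, t, j) = X t j := by
  have hone : |(1 : ℤ)| < 2 ^ W := by
    rw [abs_one]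
    exact one_lt_pow₀ (by norm_num) (by omega)
  obtain ⟨m₁, hr₁, h40⟩ := Run.for_of_invariant (W := W) (x := 31) (e := .var 21)
    (p := .ite (.get 0 3 0 - .var 31) (.set 40 (.var 31) 0 (.var 24)) (.set 40 (.var 31) 0 1))
    (m₀ := m₀) n hnW (by simp [hn]) rfl
    (fun j m => ∀ j' < j, m (40, (j' : ℕ), 0) = if j' < α then K else 1)
    (fun m' h => Expr.eval_congr fun A hA => h A (by simp [Expr.reads] at hA; subst hA; rfl))
    (by simp) (by
    intro j hj m' hfr hx hI
    have hα' : m' (0, 3, 0) = α := by rw [hfr 0 rfl, hα]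
    by_cases h : j < α
    · refine ⟨_, .ite_pos (by simp [hα', hx, h]) (Run.set_cell j 0 K (by simp [hx]) (by simp)
        (by simp [hfr 24 rfl, hK]) hKW), fun j' hj' => ?_⟩
      rcases Nat.lt_succ_iff_lt_or_eq.1 hj' with h' | rfl
      · simp [hI j' h', h'.ne]
      · simp [h]
    · refine ⟨_, .ite_neg (by simp [hα', hx]; omega) (Run.set_cell j 0 1 (by simp [hx]) (by simp)
        (by simp) hone), fun j' hj' => ?_⟩
      rcases Nat.lt_succ_iff_lt_or_eq.1 hj' with h' | rfl
      · simp [hI j' h', h'.ne]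
      · simp [h])
  obtain ⟨m₂, hr₂, h41, h42, h43⟩ := Run.for_of_invariant (W := W) (x := 32) (e := .var 20)
    (p := .block [
    .ite (.get 0 1 0 - .var 32)
      (.block [.set 42 (.var 32) 0 1, .set 41 (.var 32) 0 1])
      (.ite (.get 0 1 0 + .get 0 2 0 - .var 32)
        (.block [.set 42 (.var 32) 0 (.get 1 (.var 32 - .get 0 1 0) 0), .set 41 (.var 32) 0 1])
        (.block [.set 42 (.var 32) 0 (.var 25), .set 41 (.var 32) 0 (.var 25)])),
    .for 31 (.var 21) (.set 43 (.var 32) (.var 31)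
      (.get 2 ((.get 0 0 0 + .var 32) % .var 20) (.var 31)
        * (.get 41 (.var 32) 0 / .get 3 ((.get 0 0 0 + .var 32) % .var 20) (.var 31))
        / .get 40 (.var 31) 0))])
    (m₀ := m₁) m hmW (by simp [hr₁.frame (A := 20) rfl, hm]) rfl
    (fun t m => (∀ t' < t, m (41, (t' : ℕ), 0) = dn t') ∧ (∀ t' < t, m (42, (t' : ℕ), 0) = Nm t') ∧
      ∀ t' < t, ∀ j < n, m (43, (t' : ℕ), (j : ℕ)) = X t' j)
    (fun m' h => Expr.eval_congr fun A hA => h A (by simp [Expr.reads] at hA; subst hA; rfl))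
    (by simp) (by
    rintro t ht m' hfr hx ⟨h41, h42, h43⟩
    have hb' : m' (0, 1, 0) = b := by rw [hfr 0 rfl, hr₁.frame rfl, hb]
    have hc' : m' (0, 2, 0) = c := by rw [hfr 0 rfl, hr₁.frame rfl, hc]
    have hq' : m' (25, 0, 0) = q := by rw [hfr 25 rfl, hr₁.frame rfl, hq]
    -- the entries of the row that belong to the factor alone
    have hrow : ∃ m'', Run W (.ite (.get 0 1 0 - .var 32)
        (.block [.set 42 (.var 32) 0 1, .set 41 (.var 32) 0 1])
        (.ite (.get 0 1 0 + .get 0 2 0 - .var 32)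
          (.block [.set 42 (.var 32) 0 (.get 1 (.var 32 - .get 0 1 0) 0), .set 41 (.var 32) 0 1])
          (.block [.set 42 (.var 32) 0 (.var 25), .set 41 (.var 32) 0 (.var 25)]))) m' m'' ∧
        m'' = wr (wr m' 42 t 0 (Nm t)) 41 t 0 (dn t) := by
      refine ⟨_, ?_, rfl⟩
      by_cases h1 : t < b
      · have hd : dn t = 1 := by rw [hdn t ht, if_pos (by omega)]
        have hN' : Nm t = 1 := by rw [hNm t ht, if_pos h1]
        rw [hd, hN']
        exact .ite_pos (by simp [hb', hx, h1]) (.cons (Run.set_cell t 0 1 (by simp [hx]) (by simp)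
          (by simp) hone) (.cons (Run.set_cell t 0 1 (by simp [hx]) (by simp) (by simp) hone)
          (.nil _)))
      by_cases h2 : t < b + c
      · have hd : dn t = 1 := by rw [hdn t ht, if_pos (by omega)]
        have hN' : Nm t = N (t - b) := by rw [hNm t ht, if_neg h1, if_pos h2]
        rw [hd, hN']
        refine .ite_neg (by simp [hb', hx]; omega) (.ite_pos (by simp [hb', hc', hx]; omega) (.cons
          (Run.set_cell t 0 _ (by simp [hx]) (by simp) ?_ (hNW (t - b) (by omega)))
          (.cons (Run.set_cell t 0 1 (by simp [hx]) (by simp) (by simp) hone) (.nil _))))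
        rw [← hN (t - b) (by omega), Nat.cast_sub (by omega)]
        simp [hb', hx, hfr 1 rfl, hr₁.frame (A := 1) rfl]
      · have hd : dn t = q := by rw [hdn t ht, if_neg h2]
        have hN' : Nm t = q := by rw [hNm t ht, if_neg h1, if_neg h2]
        rw [hd, hN']
        exact .ite_neg (by simp [hb', hx]; omega) (.ite_neg (by simp [hb', hc', hx]; omega) (.cons
          (Run.set_cell t 0 q (by simp [hx]) (by simp) (by simp [hq']) hqW)
          (.cons (Run.set_cell t 0 q (by simp [hx]) (by simp) (by simp [hq']) hqW) (.nil _))))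
    obtain ⟨m'', hr, hm''⟩ := hrow
    have hx'' : m'' (32, 0, 0) = t := by simp [hm'', hx]
    obtain ⟨m₃, hr₃, h3, hfr₃⟩ := Run.for_set (W := W) (x := 31) (A := 43) (ne := .var 21)
      (i := .var 32) (j := .var 31)
      (f := .get 2 ((.get 0 0 0 + .var 32) % .var 20) (.var 31)
        * (.get 41 (.var 32) 0 / .get 3 ((.get 0 0 0 + .var 32) % .var 20) (.var 31))
        / .get 40 (.var 31) 0) (m₀ := m'') n hnW
      (by simp [hm'', hfr 21 rfl, hr₁.frame (A := 21) rfl, hn]) (by norm_num) rfl rfl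
      (fun _ => t) (fun j => j) (fun j => X t j) (by simp) (by
      intro j hj m₄ hm₄ hx₄
      have e32 : m₄ (32, 0, 0) = t := by rw [hm₄ _ _ _ (by norm_num) (by simp), hx'']
      have ea : m₄ (0, 0, 0) = a := by
        rw [hm₄ _ _ _ (by norm_num) (by simp)]
        simp [hm'', hfr 0 rfl, hr₁.frame (A := 0) rfl, ha]
      have em : m₄ (20, 0, 0) = m := by
        rw [hm₄ _ _ _ (by norm_num) (by simp)]
        simp [hm'', hfr 20 rfl, hr₁.frame (A := 20) rfl, hm]
      have e41 : m₄ (41, t, 0) = dn t := by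
        rw [hm₄ _ _ _ (by norm_num) (by simp)]
        simp [hm'']
      have e40 : m₄ (40, j, 0) = if j < α then K else 1 := by
        rw [hm₄ _ _ _ (by norm_num) (by simp)]
        simp [hm'', hfr 40 rfl, h40 j hj]
      have hlt : (a + t) % m < m := Nat.mod_lt _ (by omega)
      have e2 : m₄ (2, ((a : ℤ) + t) % m, j) = num ((a + t) % m) j := by
        rw [hm₄ _ _ _ (by norm_num) (by simp), ← hnum _ hlt j hj]
        simp [hm'', hfr 2 rfl, hr₁.frame (A := 2) rfl]
      have e3 : m₄ (3, ((a : ℤ) + t) % m, j) = den ((a + t) % m) j := by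
        rw [hm₄ _ _ _ (by norm_num) (by simp), ← hden _ hlt j hj]
        simp [hm'', hfr 3 rfl, hr₁.frame (A := 3) rfl]
      refine ⟨by simp [e32], by simp [hx₄], ?_⟩
      rw [hX t ht j hj]
      simp [hx₄, e32, ea, em, e2, e3, e41, e40]) (fun j hj => hXW t ht j hj)
    refine ⟨m₃, .cons hr (.cons hr₃ (.nil _)), fun t' ht' => ?_, fun t' ht' => ?_,
      fun t' ht' j hj => ?_⟩
    · rw [wr_apply, if_neg (by simp), hfr₃ _ _ _ (by norm_num) (by simp), hm'', wr_apply]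
      rcases Nat.lt_succ_iff_lt_or_eq.1 ht' with h | rfl
      · simp [h.ne, h41 t' h]
      · simp
    · rw [wr_apply, if_neg (by simp), hfr₃ _ _ _ (by norm_num) (by simp), hm'']
      rcases Nat.lt_succ_iff_lt_or_eq.1 ht' with h | rfl
      · simp [h.ne, h42 t' h]
      · simp
    · rw [wr_apply, if_neg (by simp)]
      rcases Nat.lt_succ_iff_lt_or_eq.1 ht' with h | rfl
      · rw [hfr₃ _ _ _ (by norm_num) (by simp [h.ne]), hm'']
        simp [h43 t' h j hj]
      · exact h3 j hj)
  exact ⟨m₂, .cons hr₁ (.cons hr₂ (.nil _)), h41, h42, h43⟩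

/-! ### The rows of the integer factors -/

/-- Computes, for column `j` of the matrix 43 (`j` in variable 31), the errors
`c i = d * X i j - ∑ p < b, X p j * T i p` (array 52), with `d` in variable 50 and `T` in array
56. -/
def residueCmd : Cmd :=
  .for 30 (.get 0 1 0) (.block [
    .assign 51 0,
    .for 34 (.get 0 1 0)
      (.assign 51 (.var 51 + .get 43 (.var 34) (.var 31) * .get 56 (.var 30) (.var 34))),
    .set 52 (.var 30) 0 (.var 50 * .get 43 (.var 30) (.var 31) - .var 51)])

theorem abs_sum_range_le {n k : ℕ} (hk : k ≤ n) {f : ℕ → ℤ} {B : ℤ} (hB : 0 ≤ B)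
    (h : ∀ i < n, |f i| ≤ B) : |∑ i ∈ Finset.range k, f i| ≤ n * B :=
  calc |∑ i ∈ Finset.range k, f i| ≤ ∑ i ∈ Finset.range k, |f i| := Finset.abs_sum_le_sum_abs _ _
    _ ≤ ∑ _i ∈ Finset.range k, B :=
        Finset.sum_le_sum fun i hi => h i ((Finset.mem_range.1 hi).trans_le hk)
    _ = k * B := by simp
    _ ≤ n * B := by gcongr

theorem residueCmd_run {W b j : ℕ} {m₀ : Mem} {X T : ℕ → ℕ → ℤ} {d B Z : ℤ}
    (hb : m₀ (0, 1, 0) = b) (hj : m₀ (31, 0, 0) = j) (hd : m₀ (50, 0, 0) = d)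
    (hX : ∀ i < b, m₀ (43, i, j) = X i j) (hT : ∀ i < b, ∀ p < b, m₀ (56, i, p) = T i p)
    (hXB : ∀ i < b, |X i j| ≤ B) (hTZ : ∀ i < b, ∀ p < b, |T i p| ≤ Z) (hdZ : |d| ≤ Z)
    (hbW : b ≤ W) (hW : Z * B + b * (B * Z) < 2 ^ W) :
    ∃ m', Run W residueCmd m₀ m' ∧
      ∀ i < b, m' (52, i, 0) = d * X i j - ∑ p ∈ Finset.range b, X p j * T i p := by
  have hZ : 0 ≤ Z := (abs_nonneg d).trans hdZ
  refine Run.for_of_invariant (W := W) b hbW (by simp [hb]) rfl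
    (fun i m => ∀ i' < i, m (52, (i' : ℕ), 0) = d * X i' j
      - ∑ p ∈ Finset.range b, X p j * T i' p)
    (fun m' h => Expr.eval_congr fun A hA => h A (by simp [Expr.reads] at hA; subst hA; rfl))
    (by simp) ?_
  intro i hi m hfr hx hI
  have hB : 0 ≤ B := (abs_nonneg _).trans (hXB i hi)
  have hterm : ∀ p < b, |X p j * T i p| ≤ B * Z := fun p hp => by
    rw [abs_mul]
    exact mul_le_mul (hXB p hp) (hTZ i hi p hp) (abs_nonneg _) hB
  have hsum : ∀ k ≤ b, |∑ p ∈ Finset.range k, X p j * T i p| ≤ b * (B * Z) := fun k hk =>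
    abs_sum_range_le hk (by positivity) hterm
  have hdX : |d * X i j| ≤ Z * B := by
    rw [abs_mul]
    exact mul_le_mul hdZ (hXB i hi) (abs_nonneg _) hZ
  have hZB : 0 ≤ Z * B := by positivity
  obtain ⟨m₁, hr₁, hs₁, hfr₁⟩ := Run.for_sum (W := W) (x := 34) (A := 51) (ne := .get 0 1 0)
    (f := .get 43 (.var 34) (.var 31) * .get 56 (.var 30) (.var 34)) (m₀ := wr m 51 0 0 0) b hbW
    (by simp [hfr 0 rfl, hb]) (by norm_num) rfl rfl (fun p => X p j * T i p)
    (by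
      intro p hp m₂ hm₂ hx₂
      have e31 : m₂ (31, 0, 0) = j := by
        rw [hm₂ _ _ _ (by norm_num) (by norm_num)]; simp [hfr 31 rfl, hj]
      have e30 : m₂ (30, 0, 0) = i := by
        rw [hm₂ _ _ _ (by norm_num) (by norm_num)]; simp [hx]
      have e43 : m₂ (43, p, j) = X p j := by
        rw [hm₂ _ _ _ (by norm_num) (by norm_num)]; simp [hfr 43 rfl, hX p hp]
      have e56 : m₂ (56, i, p) = T i p := by
        rw [hm₂ _ _ _ (by norm_num) (by norm_num)]; simp [hfr 56 rfl, hT i hi p hp]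
      simp [hx₂, e31, e30, e43, e56])
    (fun k hk => by
      have := hsum k hk
      simp only [wr_apply, and_self, if_true, zero_add]
      linarith)
  refine ⟨_, .cons (Run.assign 0 (by simp) (by simp)) (.cons hr₁ (.cons
    (Run.set_cell i 0 (d * X i j - ∑ p ∈ Finset.range b, X p j * T i p) ?_ ?_ ?_ ?_) (.nil _))),
    fun i' hi' => ?_⟩
  · simp [hr₁.frame (A := 30) rfl, hx]
  · simp
  · simp [hr₁.frame (A := 30) rfl, hx, hr₁.frame (A := 50) rfl, hfr 50 rfl, hd,
      hr₁.frame (A := 43) rfl, hfr 43 rfl, hr₁.frame (A := 31) rfl, hfr 31 rfl, hj, hX i hi, hs₁]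
  · have := hsum b le_rfl
    have := abs_sub (d * X i j) (∑ p ∈ Finset.range b, X p j * T i p)
    linarith
  · rcases Nat.lt_succ_iff_lt_or_eq.1 hi' with h | rfl
    · simp [h.ne, hr₁.frame (A := 52) rfl, hI i' h]
    · simp

/-- Sets the variable 53 to `l + 1` for a position `l < b` with `c l ≠ 0` (array 52), and to `0` if
there is none. -/
def pivotCmd : Cmd := .block [
  .assign 53 0,
  .for 30 (.get 0 1 0) (.ite (.get 52 (.var 30) 0 * .get 52 (.var 30) 0)
    (.assign 53 (.var 30 + 1)) .skip)]

theorem pivotCmd_run {W b : ℕ} {m₀ : Mem} (hb : m₀ (0, 1, 0) = b) (hbW : b ≤ W) :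
    ∃ m', Run W pivotCmd m₀ m' ∧ ((m' (53, 0, 0) = 0 ∧ ∀ i < b, m₀ (52, (i : ℕ), 0) = 0) ∨
      ∃ l < b, m' (53, 0, 0) = l + 1 ∧ m₀ (52, (l : ℕ), 0) ≠ 0) := by
  obtain ⟨m', hr, h⟩ := Run.for_of_invariant (W := W) (x := 30) (e := .get 0 1 0)
    (p := .ite (.get 52 (.var 30) 0 * .get 52 (.var 30) 0) (.assign 53 (.var 30 + 1)) .skip)
    (m₀ := wr m₀ 53 0 0 0) b hbW (by simp [hb]) rfl
    (fun i m => (m (53, 0, 0) = 0 ∧ ∀ i' < i, m₀ (52, (i' : ℕ), 0) = 0) ∨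
      ∃ l < i, m (53, 0, 0) = l + 1 ∧ m₀ (52, (l : ℕ), 0) ≠ 0)
    (fun m' h => Expr.eval_congr fun A hA => h A (by simp [Expr.reads] at hA; subst hA; rfl))
    (by simp) (by
    intro i hi m hfr hx hI
    have e52 : m (52, i, 0) = m₀ (52, i, 0) := by rw [hfr 52 rfl]; simp
    by_cases h0 : m₀ (52, i, 0) = 0
    · refine ⟨m, .ite_neg (by simp [hx, e52, h0]) (.skip m), ?_⟩
      rcases hI with ⟨h1, h2⟩ | ⟨l, h1, h2, h3⟩
      · refine .inl ⟨by simp [h1], fun i' hi' => ?_⟩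
        rcases Nat.lt_succ_iff_lt_or_eq.1 hi' with h | rfl
        exacts [h2 i' h, h0]
      · exact .inr ⟨l, by omega, by simp [h2], h3⟩
    · refine ⟨_, .ite_pos ?_ (Run.assign (i + 1) (by simp [hx]) ?_), .inr ⟨i, by omega, ?_, h0⟩⟩
      · simp only [Expr.eval_mul, Expr.eval_get, Expr.eval_lit, Expr.eval_zero, hx, e52]
        exact mul_self_pos.2 h0
      · have : i + 1 < 2 ^ W := (Nat.lt_two_pow_self).trans_le' (show i + 1 ≤ W by omega)
        rw [abs_of_nonneg (by positivity)]
        exact_mod_cast this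
      · simp)
  exact ⟨m', .cons (Run.assign 0 (by simp) (by simp)) (.cons hr (.nil _)), h⟩

/-- The pivot step of fraction-free elimination at the position in variable 53, less one. -/
def eliminateCmd : Cmd := .block [
  .assign 54 (.get 52 (.var 53 - 1) 0),
  .for 34 (.get 0 1 0) (.block [
    .assign 55 (.get 56 (.var 53 - 1) (.var 34)),
    .for 30 (.get 0 1 0) (.set 56 (.var 30) (.var 34)
      ((.var 54 * .get 56 (.var 30) (.var 34) - .var 55 * .get 52 (.var 30) 0) / .var 50))]),
  .for 30 (.get 0 1 0) (.set 56 (.var 30) (.var 53 - 1) (.get 52 (.var 30) 0)),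
  .assign 50 (.var 54)]

theorem eliminateCmd_run {W b l : ℕ} {m₀ : Mem} {T : ℕ → ℕ → ℤ} {c : ℕ → ℤ} {d Z : ℤ}
    (hb : m₀ (0, 1, 0) = b) (hl : m₀ (53, 0, 0) = l + 1) (hlb : l < b) (hd : m₀ (50, 0, 0) = d)
    (hT : ∀ i < b, ∀ p < b, m₀ (56, i, p) = T i p) (hc : ∀ i < b, m₀ (52, i, 0) = c i)
    (hTZ : ∀ i < b, ∀ p < b, |T i p| ≤ Z) (hcZ : ∀ i < b, |c i| ≤ Z)
    (hbW : b ≤ W) (hZW : Z < 2 ^ W) (hW : 2 * (Z * Z) < 2 ^ W) :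
    ∃ m', Run W eliminateCmd m₀ m' ∧ m' (50, 0, 0) = c l ∧
      (∀ i < b, ∀ p < b, m' (56, i, p) = if p = l then c i else (c l * T i p - T l p * c i) / d) ∧
      ∀ u : ℕ, b ≤ u → m' (56, u, u) = m₀ (56, u, u) := by
  have hZ : 0 ≤ Z := (abs_nonneg _).trans (hcZ l hlb)
  have hval : ∀ i < b, ∀ p < b, |(c l * T i p - T l p * c i) / d| < 2 ^ W := by
    intro i hi p hp
    have h1 : |c l * T i p| ≤ Z * Z := by
      rw [abs_mul]; exact mul_le_mul (hcZ l hlb) (hTZ i hi p hp) (abs_nonneg _) hZ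
    have h2 : |T l p * c i| ≤ Z * Z := by
      rw [abs_mul]; exact mul_le_mul (hTZ l hlb p hp) (hcZ i hi) (abs_nonneg _) hZ
    have h3 := abs_sub (c l * T i p) (T l p * c i)
    have h4 : |(c l * T i p - T l p * c i) / d| ≤ |c l * T i p - T l p * c i| := by
      rw [Int.abs_eq_natAbs, Int.abs_eq_natAbs]
      exact_mod_cast Int.natAbs_ediv_le_natAbs _ d
    linarith
  obtain ⟨m₁, hr₁, hI₁, hU₁⟩ := Run.for_of_invariant (W := W) (x := 34) (e := .get 0 1 0)
    (p := .block [
      .assign 55 (.get 56 (.var 53 - 1) (.var 34)),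
      .for 30 (.get 0 1 0) (.set 56 (.var 30) (.var 34)
        ((.var 54 * .get 56 (.var 30) (.var 34) - .var 55 * .get 52 (.var 30) 0) / .var 50))])
    (m₀ := wr m₀ 54 0 0 (c l)) b hbW (by simp [hb]) rfl
    (fun p m => (∀ i < b, ∀ p' < b, m (56, (i : ℕ), (p' : ℕ))
      = if p' < p then (c l * T i p' - T l p' * c i) / d else T i p') ∧
      ∀ u : ℕ, b ≤ u → m (56, u, u) = m₀ (56, u, u))
    (fun m' h => Expr.eval_congr fun A hA => h A (by simp [Expr.reads] at hA; subst hA; rfl))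
    ⟨fun i hi p hp => by simp [hT i hi p hp], fun u hu => by simp⟩ (by
    rintro p hp m hfr hx ⟨hI, hU⟩
    obtain ⟨m₂, hr₂, h2, hfr₂⟩ := Run.for_set (W := W) (x := 30) (A := 56) (ne := .get 0 1 0)
      (i := .var 30) (j := .var 34)
      (f := (.var 54 * .get 56 (.var 30) (.var 34) - .var 55 * .get 52 (.var 30) 0) / .var 50)
      (m₀ := wr m 55 0 0 (T l p)) b hbW (by simp [hfr 0 rfl, hb]) (by norm_num) rfl rfl
      (fun i => i) (fun _ => p) (fun i => (c l * T i p - T l p * c i) / d)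
      (by simp) (by
      intro i hi m₃ hm₃ hx₃
      have e34 : m₃ (34, 0, 0) = p := by
        rw [hm₃ _ _ _ (by norm_num) (by simp)]; simp [hx]
      have e54 : m₃ (54, 0, 0) = c l := by
        rw [hm₃ _ _ _ (by norm_num) (by simp)]; simp [hfr 54 rfl]
      have e55 : m₃ (55, 0, 0) = T l p := by
        rw [hm₃ _ _ _ (by norm_num) (by simp)]; simp
      have e50 : m₃ (50, 0, 0) = d := by
        rw [hm₃ _ _ _ (by norm_num) (by simp)]; simp [hfr 50 rfl, hd]
      have e52 : m₃ (52, i, 0) = c i := by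
        rw [hm₃ _ _ _ (by norm_num) (by simp)]; simp [hfr 52 rfl, hc i hi]
      have e56 : m₃ (56, i, p) = T i p := by
        rw [hm₃ _ _ _ (by norm_num) (by simp; omega)]; simp [hI i hi p hp]
      simp [hx₃, e34, e54, e55, e50, e52, e56]) (fun i hi => hval i hi p hp)
    refine ⟨m₂, .cons (Run.assign (T l p) ?_ ((hTZ l hlb p hp).trans_lt hZW))
      (.cons hr₂ (.nil _)), fun i hi p' hp' => ?_, fun u hu => ?_⟩
    · simp [hx, hfr 53 rfl, hl, hI l hlb p hp]
    · rw [wr_apply, if_neg (by simp)]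
      rcases eq_or_ne p' p with rfl | hne
      · rw [h2 i hi, if_pos (by omega)]
      · rw [hfr₂ _ _ _ (by norm_num) (by simp [hne])]
        simp only [wr_apply]
        rw [if_neg (by simp), hI i hi p' hp']
        simp only [show p' < p + 1 ↔ p' < p by omega]
    · rw [wr_apply, if_neg (by simp), hfr₂ _ _ _ (by norm_num) (by simp; omega)]
      simp [hU u hu])
  obtain ⟨m₂, hr₂, h2, hfr₂⟩ := Run.for_set (W := W) (x := 30) (A := 56) (ne := .get 0 1 0)
    (i := .var 30) (j := .var 53 - 1) (f := .get 52 (.var 30) 0) (m₀ := m₁) b hbW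
    (by simp [hr₁.frame (A := 0) rfl, hb]) (by norm_num) rfl rfl (fun i => i) (fun _ => l) c
    (by simp) (by
    intro i hi m₃ hm₃ hx₃
    have e53 : m₃ (53, 0, 0) = l + 1 := by
      rw [hm₃ _ _ _ (by norm_num) (by simp), hr₁.frame rfl]; simp [hl]
    have e52 : m₃ (52, i, 0) = c i := by
      rw [hm₃ _ _ _ (by norm_num) (by simp), hr₁.frame rfl]; simp [hc i hi]
    simp [hx₃, e53, e52]) (fun i hi => (hcZ i hi).trans_lt hZW)
  refine ⟨_, .cons (Run.assign (c l) (by simp [hl, hc l hlb]) ((hcZ l hlb).trans_lt hZW))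
    (.cons hr₁ (.cons hr₂ (.cons (Run.assign (c l) ?_ ((hcZ l hlb).trans_lt hZW)) (.nil _)))),
    by simp, fun i hi p hp => ?_, fun u hu => ?_⟩
  · simp [hr₂.frame (A := 54) rfl, hr₁.frame (A := 54) rfl]
  · rw [wr_apply, if_neg (by simp)]
    rcases eq_or_ne p l with rfl | hne
    · rw [h2 i hi, if_pos rfl]
    · rw [hfr₂ _ _ _ (by norm_num) (by simp [hne]), hI₁ i hi p hp, if_pos hp, if_neg hne]
  · rw [wr_apply, if_neg (by simp), hfr₂ _ _ _ (by norm_num) (by simp; omega), hU₁ u hu]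

/-- Fraction-free elimination of the rows of the factors `ℤ`: computes the matrix `T` (array 56) and
the determinant `d` (variable 50) of `IsCramer`. -/
def cramerCmd : Cmd := .block [
  .assign 50 1,
  .for 31 (.var 21) (.block [residueCmd, pivotCmd, .ite (.var 53) eliminateCmd .skip])]

theorem cramerCmd_run {W b n : ℕ} {m₀ : Mem} {X : ℕ → ℕ → ℤ} {B Z : ℤ} (hb : m₀ (0, 1, 0) = b)
    (hn : m₀ (21, 0, 0) = n) (hX : ∀ i < b, ∀ j < n, m₀ (43, i, j) = X i j)
    (h56 : ∀ i p : ℕ, m₀ (56, i, p) = 0) (hB : 1 ≤ B) (hXB : ∀ i < b, ∀ j < n, |X i j| ≤ B)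
    (hdZ : b.factorial * B ^ b ≤ Z) (hTZ : b * (B * (b.factorial * B ^ b)) ≤ Z)
    (hbW : b ≤ W) (hnW : n ≤ W) (hW : 2 * ((Z * B + b * (B * Z)) * (Z * B + b * (B * Z))) < 2 ^ W) :
    ∃ (m' : Mem) (T : ℕ → ℕ → ℤ), Run W cramerCmd m₀ m' ∧
      (∀ i < b, ∀ p < b, m' (56, i, p) = T i p) ∧ (∀ u, b ≤ u → T u u = 0) ∧
      (∀ u : ℕ, m' (56, u, u) = T u u) ∧ CramerInv b n X T (m' (50, 0, 0)) := by
  have hZ1 : 1 ≤ Z := by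
    refine le_trans ?_ hdZ
    have h1 : (1 : ℤ) ≤ b.factorial := by exact_mod_cast b.factorial_pos
    nlinarith [one_le_pow₀ hB (n := b)]
  set Z' := Z * B + b * (B * Z) with hZ'
  have hbB : 0 ≤ b * (B * Z) := by positivity
  have hZZ' : Z ≤ Z' := by nlinarith
  have hZW : Z' < 2 ^ W := by nlinarith
  have hone : |(1 : ℤ)| < 2 ^ W := by rw [abs_one]; linarith
  obtain ⟨m', hr, hinv, hU⟩ := Run.for_of_invariant (W := W) (x := 31) (e := .var 21)
    (p := .block [residueCmd, pivotCmd, .ite (.var 53) eliminateCmd .skip])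
    (m₀ := wr m₀ 50 0 0 1) n hnW (by simp [hn]) rfl
    (fun j m => CramerInv b j X (fun i p => m (56, (i : ℕ), (p : ℕ))) (m (50, 0, 0)) ∧
      ∀ u : ℕ, b ≤ u → m (56, u, u) = 0)
    (fun m' h => Expr.eval_congr fun A hA => h A (by simp [Expr.reads] at hA; subst hA; rfl))
    ⟨by simpa using cramerInv_zero fun i hi p hp => h56 i p, fun u hu => by simp [h56]⟩ (by
    rintro j hj m hfr hx ⟨hinv, hU⟩
    obtain ⟨hd, hT⟩ := hinv.abs_le hB fun i hi j' hj' => hXB i hi j' (hj'.trans hj)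
    set T : ℕ → ℕ → ℤ := fun i p => m (56, (i : ℕ), (p : ℕ)) with hTdef
    obtain ⟨m₁, hr₁, hc⟩ := residueCmd_run (W := W) (b := b) (j := j) (X := X) (T := T)
      (d := m (50, 0, 0)) (B := B) (Z := Z) (m₀ := m) (by rw [hfr 0 rfl]; simp [hb]) hx rfl
      (fun i hi => by rw [hfr 43 rfl]; simp [hX i hi j hj]) (fun i hi p hp => rfl)
      (fun i hi => hXB i hi j hj) (fun i hi p hp => (hT i hi p hp).trans hTZ) (hd.trans hdZ) hbW
      hZW
    set c : ℕ → ℤ := fun i => m (50, 0, 0) * X i j - ∑ p ∈ Finset.range b, X p j * T i p with hcdef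
    have hcZ : ∀ i < b, |c i| ≤ Z' := by
      intro i hi
      have h1 : |m (50, 0, 0) * X i j| ≤ Z * B := by
        rw [abs_mul]
        exact mul_le_mul (hd.trans hdZ) (hXB i hi j hj) (abs_nonneg _) (by linarith)
      have h2 : |∑ p ∈ Finset.range b, X p j * T i p| ≤ b * (B * Z) := by
        refine abs_sum_range_le le_rfl (by positivity) fun p hp => ?_
        rw [abs_mul]
        exact mul_le_mul (hXB p hp j hj) ((hT i hi p hp).trans hTZ) (abs_nonneg _) (by linarith)
      exact (abs_sub _ _).trans (add_le_add h1 h2)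
    obtain ⟨m₂, hr₂, h2⟩ := pivotCmd_run (W := W) (b := b) (m₀ := m₁)
      (by rw [hr₁.frame rfl, hfr 0 rfl]; simp [hb]) hbW
    have h56' : ∀ i p : ℕ, m₂ (56, i, p) = T i p := fun i p => by
      rw [hr₂.frame rfl, hr₁.frame rfl]
    have h50' : m₂ (50, 0, 0) = m (50, 0, 0) := by rw [hr₂.frame rfl, hr₁.frame rfl]
    rcases h2 with ⟨h53, h0⟩ | ⟨l, hl, h53, hl0⟩
    · refine ⟨m₂, .cons hr₁ (.cons hr₂ (.cons (.ite_neg (by simp [h53]) (.skip _)) (.nil _))),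
        ?_, fun u hu => by simp [h56', hTdef, hU u hu]⟩
      simp only [wr_apply, h56', h50']
      exact hinv.succ_of_eq_zero fun i hi => (hc i hi).symm.trans (h0 i hi)
    · obtain ⟨m₃, hr₃, h50, h56'', hU₃⟩ := eliminateCmd_run (W := W) (b := b) (l := l) (T := T)
        (c := c) (d := m (50, 0, 0)) (Z := Z') (m₀ := m₂)
        (by rw [hr₂.frame rfl, hr₁.frame rfl, hfr 0 rfl]; simp [hb]) h53 hl h50'
        (fun i _ p _ => h56' i p) (fun i hi => by rw [hr₂.frame rfl, hc i hi])
        (fun i hi p hp => ((hT i hi p hp).trans hTZ).trans hZZ') hcZ hbW hZW hW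
      refine ⟨m₃, .cons hr₁ (.cons hr₂ (.cons (.ite_pos (by simp [h53]) hr₃) (.nil _))),
        ?_, fun u hu => ?_⟩
      · have h50'' : wr m₃ 31 0 0 ((j + 1 : ℕ) : ℤ) (50, 0, 0) = c l := by simp [h50]
        rw [h50'']
        refine hinv.succ_of_ne_zero (c := c) (fun i _ => rfl) hl ?_ fun i hi p hp => ?_
        · rwa [hc l hl] at hl0
        · simp [h56'' i hi p hp]
      · simp [hU₃ u hu, h56', hTdef, hU u hu])
  exact ⟨m', fun i p => m' (56, i, p), .cons (Run.assign 1 (by simp) hone) (.cons hr (.nil _)),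
    fun _ _ _ _ => rfl, hU, fun _ => rfl, hinv⟩

/-! ### The triangular basis -/

/-- One step of the Euclidean algorithm in row `i` (variable 30), between column `i` of the matrix
58 and the column 52: they become `c` and `S i - (S i i / c i) c`, reduced modulo the rows. -/
def euclidStepCmd : Cmd := .block [
  .assign 54 (.get 58 (.var 30) (.var 30) / .get 52 (.var 30) 0),
  .for 33 (.var 20) (.block [
    .assign 55 (.get 52 (.var 33) 0),
    .set 52 (.var 33) 0 ((.get 58 (.var 33) (.var 30) - .var 54 * .var 55) % .get 57 (.var 33) 0),
    .set 58 (.var 33) (.var 30) (.var 55)])]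

theorem euclidStepCmd_run {W M i : ℕ} {m₀ : Mem} {S : ℕ → ℕ → ℤ} {c D : ℕ → ℤ}
    (hM : m₀ (20, 0, 0) = M) (hi : m₀ (30, 0, 0) = i) (hiM : i < M)
    (hS : ∀ u < M, ∀ w < M, m₀ (58, u, w) = S u w) (hc : ∀ u < M, m₀ (52, u, 0) = c u)
    (hD : ∀ u < M, m₀ (57, u, 0) = D u) (hDW : ∀ u < M, D u < 2 ^ W)
    (hS0 : 0 ≤ S i i) (hSD : S i i ≤ D i) (hc0 : ∀ u < M, 0 ≤ c u) (hcD : ∀ u < M, c u < D u)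
    (hMW : M ≤ W) :
    ∃ m', Run W euclidStepCmd m₀ m' ∧
      (∀ u < M, m' (52, u, 0) = (S u i - S i i / c i * c u) % D u) ∧
      ∀ u < M, ∀ w < M, m' (58, u, w) = if w = i then c u else S u w := by
  set g := S i i / c i with hg
  have hg' : |g| < 2 ^ W := by
    rw [abs_of_nonneg (Int.ediv_nonneg hS0 (hc0 i hiM))]
    exact (Int.ediv_le_self _ hS0).trans_lt (hSD.trans_lt (hDW i hiM))
  obtain ⟨m', hr, h52, h58⟩ := Run.for_of_invariant (W := W) (x := 33) (e := .var 20)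
    (p := .block [
      .assign 55 (.get 52 (.var 33) 0),
      .set 52 (.var 33) 0 ((.get 58 (.var 33) (.var 30) - .var 54 * .var 55) % .get 57 (.var 33) 0),
      .set 58 (.var 33) (.var 30) (.var 55)])
    (m₀ := wr m₀ 54 0 0 g) M hMW (by simp [hM]) rfl
    (fun k m => (∀ u < M, m (52, (u : ℕ), 0) = if u < k then (S u i - g * c u) % D u else c u) ∧
      ∀ u < M, ∀ w < M, m (58, (u : ℕ), (w : ℕ)) = if u < k ∧ w = i then c u else S u w)
    (fun m' h => Expr.eval_congr fun A hA => h A (by simp [Expr.reads] at hA; subst hA; rfl))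
    ⟨fun u hu => by simp [hc u hu], fun u hu w hw => by simp [hS u hu w hw]⟩ (by
    rintro k hk m hfr hx ⟨h52, h58⟩
    have e30 : m (30, 0, 0) = i := by rw [hfr 30 rfl]; simp [hi]
    have e54 : m (54, 0, 0) = g := by rw [hfr 54 rfl]; simp
    have e57 : m (57, k, 0) = D k := by rw [hfr 57 rfl]; simp [hD k hk]
    have e52 : m (52, k, 0) = c k := by rw [h52 k hk, if_neg (lt_irrefl k)]
    have e58 : m (58, k, i) = S k i := by rw [h58 k hk i hiM, if_neg (by simp)]
    have hDk : 0 < D k := (hc0 k hk).trans_lt (hcD k hk)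
    have hck : |c k| < 2 ^ W := by
      rw [abs_of_nonneg (hc0 k hk)]
      exact (hcD k hk).trans (hDW k hk)
    refine ⟨_, .cons (Run.assign (c k) (by simp [hx, e52]) hck) (.cons (Run.set_cell k 0
      ((S k i - g * c k) % D k) (by simp [hx]) (by simp) (by simp [hx, e30, e54, e57, e58]) ?_)
      (.cons (Run.set_cell k i (c k) (by simp [hx]) (by simp [e30]) (by simp) hck) (.nil _))),
      fun u hu => ?_, fun u hu w hw => ?_⟩
    · rw [abs_of_nonneg (Int.emod_nonneg _ hDk.ne')]
      exact (Int.emod_lt_of_pos _ hDk).trans (hDW k hk)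
    · rcases eq_or_ne u k with rfl | hne
      · simp
      · simp [hne, h52 u hu, show u < k + 1 ↔ u < k by omega]
    · rcases eq_or_ne u k with rfl | hne
      · by_cases hwi : w = i
        · simp [hwi]
        · simp [hwi, h58 u hu w hw]
      · simp [hne, h58 u hu w hw, show u < k + 1 ↔ u < k by omega])
  refine ⟨m', .cons (Run.assign g ?_ hg') (.cons hr (.nil _)), fun u hu => ?_,
    fun u hu w hw => ?_⟩
  · simp [hi, hS i hiM i hiM, hc i hiM, hg]
  · rw [h52 u hu, if_pos hu]
  · simp [h58 u hu w hw, hu]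

/-- A bound for the number of steps of the Euclidean algorithm on `x` and `y`: the size of the
product drops in every step, except that the first step may only swap the two numbers. -/
def euclidMeasure (x y : ℤ) : ℕ := (x.natAbs * y.natAbs).size + if x < y then 1 else 0

theorem euclidMeasure_emod_lt {x y : ℤ} (hx : 0 < x) (hy : 0 < y) :
    euclidMeasure y (x % y) < euclidMeasure x y := by
  lift x to ℕ using hx.le
  lift y to ℕ using hy.le
  norm_cast at *
  have h0 : ¬ (y : ℤ) < ((x % y : ℕ) : ℤ) := by
    have := Nat.mod_lt x hy
    omega
  simp only [euclidMeasure, Int.natAbs_natCast, if_neg h0, add_zero]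
  rcases lt_or_ge x y with h | h
  · rw [Nat.mod_eq_of_lt h, if_pos (by exact_mod_cast h), mul_comm]
    omega
  · rw [if_neg (by exact_mod_cast h.not_gt), add_zero, Nat.lt_size]
    have hlt : 2 * (x % y) < x := by
      have h1 := Nat.mod_lt x hy
      have h2 := Nat.div_add_mod x y
      have h3 : 1 ≤ x / y := Nat.div_pos h hy
      nlinarith
    rcases Nat.eq_zero_or_pos (x % y) with hz | hz
    · simp only [hz, mul_zero, Nat.size_zero, pow_zero]
      exact Nat.mul_pos hx hy
    · have hpos : 0 < y * (x % y) := Nat.mul_pos hy hz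
      obtain ⟨k, hk⟩ := Nat.exists_eq_succ_of_ne_zero (Nat.size_pos.2 hpos).ne'
      have hk2 : 2 ^ k ≤ y * (x % y) := Nat.lt_size.1 (by omega)
      rw [hk, pow_succ]
      nlinarith

theorem euclidMeasure_le {x y D : ℤ} {W : ℕ} (hD : 0 < D) (hx : 0 ≤ x) (hy : 0 ≤ y) (hxD : x ≤ D)
    (hyD : y ≤ D) (hW : 2 * (D * D) < 2 ^ W) : euclidMeasure x y ≤ W := by
  obtain ⟨W, rfl⟩ := Nat.exists_eq_succ_of_ne_zero (n := W) (by
    rintro rfl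
    rw [pow_zero] at hW
    nlinarith)
  lift x to ℕ using hx
  lift y to ℕ using hy
  have h1 : (x * y : ℤ) ≤ D * D := mul_le_mul hxD hyD (by positivity) (by omega)
  have h2 : x * y < 2 ^ W := by
    have : (x * y : ℤ) < 2 ^ W := by rw [pow_succ] at hW; linarith
    exact_mod_cast this
  have h3 := Nat.size_le.2 h2
  rw [euclidMeasure, Int.natAbs_natCast, Int.natAbs_natCast]
  split_ifs <;> omega

/-- Computes the moduli of the rows (array 57), and the triangular basis (58) of the lattice
`netLattice` that they span together with the columns of the matrix 43. -/
def latticeCmd : Cmd := .block [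
  .for 32 (.var 20) (.block [
    .ite (.get 56 (.var 32) (.var 32) * .get 56 (.var 32) (.var 32))
      (.set 57 (.var 32) 0 (.var 26 * .var 50 * .var 50))
      (.set 57 (.var 32) 0 (.get 42 (.var 32) 0)),
    .set 58 (.var 32) (.var 32) (.get 57 (.var 32) 0)]),
  .for 31 (.var 21) (.block [
    .for 33 (.var 20)
      (.set 52 (.var 33) 0 (.get 43 (.var 33) (.var 31) % .get 57 (.var 33) 0)),
    .for 30 (.var 20) (.loop (.get 52 (.var 30) 0) euclidStepCmd)])]

theorem latticeCmd_run {W M n : ℕ} {m₀ : Mem} {X : ℕ → ℕ → ℤ} {t Nm D : ℕ → ℤ} {Q d : ℤ}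
    (hM : m₀ (20, 0, 0) = M) (hn : m₀ (21, 0, 0) = n) (hQ : m₀ (26, 0, 0) = Q)
    (hd : m₀ (50, 0, 0) = d) (hNm : ∀ u < M, m₀ (42, u, 0) = Nm u)
    (ht : ∀ u < M, m₀ (56, u, u) = t u) (hX : ∀ u < M, ∀ j < n, m₀ (43, u, j) = X u j)
    (h58 : ∀ u w : ℕ, m₀ (58, u, w) = 0)
    (hD : ∀ u < M, D u = if t u = 0 then Nm u else Q * d * d) (hD0 : ∀ u < M, 0 < D u)
    (hDW : ∀ u < M, 2 * (D u * D u) < 2 ^ W) (hMW : M ≤ W) (hnW : n ≤ W) :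
    ∃ m', Run W latticeCmd m₀ m' ∧ (∀ u < M, m' (57, u, 0) = D u) ∧
      IsTriangular (fun u : Fin M => D u) (fun w u : Fin M => m' (58, (u : ℕ), (w : ℕ)))
        (netLattice (fun u : Fin M => D u) X n) := by
  have hDW' : ∀ u < M, D u < 2 ^ W := fun u hu => by nlinarith [hDW u hu, hD0 u hu]
  obtain ⟨m₁, hr₁, h57, h58'⟩ := Run.for_of_invariant (W := W) (x := 32) (e := .var 20)
    (p := .block [
      .ite (.get 56 (.var 32) (.var 32) * .get 56 (.var 32) (.var 32))
        (.set 57 (.var 32) 0 (.var 26 * .var 50 * .var 50))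
        (.set 57 (.var 32) 0 (.get 42 (.var 32) 0)),
      .set 58 (.var 32) (.var 32) (.get 57 (.var 32) 0)])
    (m₀ := m₀) M hMW (by simp [hM]) rfl
    (fun k m => (∀ u < k, m (57, (u : ℕ), 0) = D u) ∧
      ∀ u w : ℕ, m (58, (u : ℕ), (w : ℕ)) = if u < k ∧ w = u then D u else 0)
    (fun m' h => Expr.eval_congr fun A hA => h A (by simp [Expr.reads] at hA; subst hA; rfl))
    ⟨by simp, fun u w => by simp [h58 u w]⟩ (by
    rintro k hk m hfr hx ⟨h57, h58'⟩
    have hDk : |D k| < 2 ^ W := by rw [abs_of_pos (hD0 k hk)]; exact hDW' k hk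
    have e56 : m (56, k, k) = t k := by rw [hfr 56 rfl, ht k hk]
    have hmod : Run W (.ite (.get 56 (.var 32) (.var 32) * .get 56 (.var 32) (.var 32))
        (.set 57 (.var 32) 0 (.var 26 * .var 50 * .var 50))
        (.set 57 (.var 32) 0 (.get 42 (.var 32) 0))) m (wr m 57 k 0 (D k)) := by
      by_cases h : t k = 0
      · refine .ite_neg (by simp [hx, e56, h]) (Run.set_cell k 0 _ (by simp [hx]) (by simp) ?_ hDk)
        rw [hD k hk, if_pos h]
        simp [hx, hfr 42 rfl, hNm k hk]
      · refine .ite_pos ?_ (Run.set_cell k 0 _ (by simp [hx]) (by simp) ?_ hDk)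
        · simp only [Expr.eval_mul, Expr.eval_get, Expr.eval_lit, hx, e56]
          exact mul_self_pos.2 h
        · rw [hD k hk, if_neg h]
          simp [hfr 26 rfl, hfr 50 rfl, hQ, hd]
    refine ⟨_, .cons hmod (.cons (Run.set_cell k k (D k) (by simp [hx]) (by simp [hx])
      (by simp [hx]) hDk) (.nil _)), fun u hu => ?_, fun u w => ?_⟩
    · rcases Nat.lt_succ_iff_lt_or_eq.1 hu with h | rfl
      · simp [h.ne, h57 u h]
      · simp
    · rcases eq_or_ne u k with rfl | hne
      · by_cases hw : w = u
        · simp [hw]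
        · simp [hw, h58' u w]
      · simp [hne, h58' u w, show u < k + 1 ↔ u < k by omega])
  obtain ⟨m₂, hr₂, h57₂, htri⟩ := Run.for_of_invariant (W := W) (x := 31) (e := .var 21)
    (p := .block [
      .for 33 (.var 20)
        (.set 52 (.var 33) 0 (.get 43 (.var 33) (.var 31) % .get 57 (.var 33) 0)),
      .for 30 (.var 20) (.loop (.get 52 (.var 30) 0) euclidStepCmd)])
    (m₀ := m₁) n hnW (by simp [hr₁.frame (A := 21) rfl, hn]) rfl
    (fun j m => (∀ u < M, m (57, (u : ℕ), 0) = D u) ∧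
      IsTriangular (fun u : Fin M => D u) (fun w u : Fin M => m (58, (u : ℕ), (w : ℕ)))
        (netLattice (fun u : Fin M => D u) X j))
    (fun m' h => Expr.eval_congr fun A hA => h A (by simp [Expr.reads] at hA; subst hA; rfl))
    ⟨fun u hu => by simp [h57 u hu], by
      have h := isTriangular_diagonal (D := fun u : Fin M => D u) (X := X) fun u => hD0 u u.2
      refine (congrArg (fun S => IsTriangular _ S _) ?_).mp h
      ext w u
      rcases eq_or_ne w u with rfl | hne
      · simp [h58']
      · simp [h58', hne.symm, Fin.val_ne_of_ne hne]⟩ (by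
    rintro j hj m hfr hx ⟨h57, htri⟩
    have eM : m (20, 0, 0) = M := by rw [hfr 20 rfl, hr₁.frame rfl, hM]
    obtain ⟨m₂, hr₂, h52, hfr₂⟩ := Run.for_set (W := W) (x := 33) (A := 52) (ne := .var 20)
      (i := .var 33) (j := 0) (f := .get 43 (.var 33) (.var 31) % .get 57 (.var 33) 0) (m₀ := m)
      M hMW (by simp [eM]) (by norm_num) rfl rfl (fun u => u) (fun _ => 0)
      (fun u => X u j % D u) (by simp) (by
      intro u hu m₃ hm₃ hx₃
      have e31 : m₃ (31, 0, 0) = j := by rw [hm₃ _ _ _ (by norm_num) (by simp), hx]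
      have e57 : m₃ (57, u, 0) = D u := by rw [hm₃ _ _ _ (by norm_num) (by simp), h57 u hu]
      have e43 : m₃ (43, u, j) = X u j := by
        rw [hm₃ _ _ _ (by norm_num) (by simp), hfr 43 rfl, hr₁.frame rfl, hX u hu j hj]
      simp [hx₃, e31, e57, e43]) (fun u hu => by
        rw [abs_of_nonneg (Int.emod_nonneg _ (hD0 u hu).ne')]
        exact (Int.emod_lt_of_pos _ (hD0 u hu)).trans (hDW' u hu))
    have hbound : ∀ u : Fin M, 0 ≤ X u j % D u ∧ X u j % D u < D u := fun u =>
      ⟨Int.emod_nonneg _ (hD0 u u.2).ne', Int.emod_lt_of_pos _ (hD0 u u.2)⟩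
    have hinv := htri.euclidInv (single_mem_netLattice j) hbound
    rw [← netLattice_succ fun u => (Int.ModEq.dvd (Int.mod_modEq (X u j) (D u)).symm)] at hinv
    set Λ := netLattice (fun u : Fin M => D u) X (j + 1) with hΛ
    obtain ⟨m₃, hr₃, h57₃, hinv₃⟩ := Run.for_of_invariant (W := W) (x := 30) (e := .var 20)
      (p := .loop (.get 52 (.var 30) 0) euclidStepCmd) (m₀ := m₂) M hMW
      (by simp [hr₂.frame (A := 20) rfl, eM]) rfl
      (fun i m => (∀ u < M, m (57, (u : ℕ), 0) = D u) ∧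
        EuclidInv (fun u : Fin M => D u) Λ i (fun w u : Fin M => m (58, (u : ℕ), (w : ℕ)))
          (fun u : Fin M => m (52, (u : ℕ), 0)))
      (fun m' h => Expr.eval_congr fun A hA => h A (by simp [Expr.reads] at hA; subst hA; rfl))
      ⟨fun u hu => by simp [hr₂.frame (A := 57) rfl, h57 u hu], by
        simp only [wr_apply]
        simpa [hr₂.frame (A := 58) rfl, h52] using hinv⟩ (by
      rintro i hi m' hfr' hx' ⟨h57', hinv'⟩
      obtain ⟨m₄, hr₄, ⟨e30, -, h57₄, hinv₄⟩, hend⟩ := Run.while_of_measure (W := W)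
        (e := .get 52 (.var 30) 0) (p := euclidStepCmd)
        (fun m => m (30, 0, 0) = i ∧ m (20, 0, 0) = M ∧ (∀ u < M, m (57, (u : ℕ), 0) = D u) ∧
          EuclidInv (fun u : Fin M => D u) Λ i (fun w u : Fin M => m (58, (u : ℕ), (w : ℕ)))
            (fun u : Fin M => m (52, (u : ℕ), 0)))
        (fun m => euclidMeasure (m (58, i, i)) (m (52, i, 0))) (by
        rintro m ⟨e30, e20, h57, hinv⟩ hpos
        have hpos' : 0 < m (52, i, 0) := by simpa [e30] using hpos
        obtain ⟨m₅, hr₅, h52₅, h58₅⟩ := euclidStepCmd_run (W := W) (M := M) (i := i)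
          (S := fun u w => m (58, (u : ℕ), (w : ℕ))) (c := fun u => m (52, (u : ℕ), 0)) (D := D)
          e20 e30 hi (fun _ _ _ _ => rfl) (fun _ _ => rfl) h57 hDW' (hinv.pos ⟨i, hi⟩).le
          (hinv.bound ⟨i, hi⟩ ⟨i, hi⟩).2 (fun u hu => (hinv.bound_col ⟨u, hu⟩).1)
          (fun u hu => (hinv.bound_col ⟨u, hu⟩).2) hMW
        obtain ⟨hstep, hstep'⟩ := hinv.step (i := ⟨i, hi⟩) hpos'
          (S' := fun w u : Fin M => m₅ (58, (u : ℕ), (w : ℕ)))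
          (c' := fun u : Fin M => m₅ (52, (u : ℕ), 0)) (by
            ext w u
            rw [h58₅ u u.2 w w.2, Function.update_apply]
            simp only [Fin.ext_iff]
            split_ifs <;> rfl) (fun u => h52₅ u u.2)
        refine ⟨m₅, hr₅, ⟨by rw [hr₅.frame rfl, e30], by rw [hr₅.frame rfl, e20],
          fun u hu => by rw [hr₅.frame rfl, h57 u hu], hstep⟩, ?_⟩
        have h1 : m₅ (58, i, i) = m (52, i, 0) := by rw [h58₅ i hi i hi, if_pos rfl]
        have h2 : m₅ (52, i, 0) = m (58, i, i) % m (52, i, 0) := hstep'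
        rw [h1, h2]
        exact euclidMeasure_emod_lt (hinv.pos ⟨i, hi⟩) hpos')
        (m₀ := m') ⟨hx', by rw [hfr' 20 rfl, hr₂.frame rfl, eM], h57', hinv'⟩
        (euclidMeasure_le (hD0 i hi) (hinv'.pos ⟨i, hi⟩).le (hinv'.bound_col ⟨i, hi⟩).1
          (hinv'.bound ⟨i, hi⟩ ⟨i, hi⟩).2 (hinv'.bound_col ⟨i, hi⟩).2.le (hDW i hi))
      refine ⟨m₄, hr₄, fun u hu => by simp [h57₄ u hu], ?_⟩
      have h0 : m₄ (52, i, 0) = 0 := by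
        refine le_antisymm ?_ (hinv₄.bound_col ⟨i, hi⟩).1
        simpa [e30] using hend
      have := hinv₄.succ fun u hu => by rw [hu]; exact h0
      simpa using this)
    refine ⟨m₃, .cons hr₂ (.cons hr₃ (.nil _)), fun u hu => by simp [h57₃ u hu], ?_⟩
    simpa using hinv₃.isTriangular)
  exact ⟨m₂, .cons hr₁ (.cons hr₂ (.nil _)), h57₂, htri⟩

/-! ### The output of the construction -/

/-- Computes the generators of the net in the original coordinates: in the rows of the factors `ℤ`
the matrix `T` is applied to the triangular basis, and the result is divided by `d` (array 61). -/
def coordsCmd : Cmd :=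
  .for 34 (.var 20) (.for 33 (.var 20) (.ite (.get 0 1 0 - .var 33)
    (.block [
      .assign 51 0,
      .for 35 (.get 0 1 0)
        (.assign 51 (.var 51 + .get 56 (.var 33) (.var 35) * .get 58 (.var 35) (.var 34))),
      .set 61 (.var 33) (.var 34) (.var 51 / .var 50)])
    (.set 61 (.var 33) (.var 34) (.get 58 (.var 33) (.var 34)))))

theorem coordsCmd_run {W M b : ℕ} {m₀ : Mem} {T S : ℕ → ℕ → ℤ} {d Z D : ℤ}
    (hM : m₀ (20, 0, 0) = M) (hb : m₀ (0, 1, 0) = b) (hbM : b ≤ M) (hd : m₀ (50, 0, 0) = d)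
    (hT : ∀ i < b, ∀ p < b, m₀ (56, i, p) = T i p)
    (hS : ∀ u < M, ∀ w < M, m₀ (58, u, w) = S u w)
    (hTZ : ∀ i < b, ∀ p < b, |T i p| ≤ Z) (hSD : ∀ u < M, ∀ w < M, |S u w| ≤ D) (hZ0 : 0 ≤ Z)
    (hD0 : 0 ≤ D) (hW : b * (Z * D) < 2 ^ W) (hDW : D < 2 ^ W) (hMW : M ≤ W) :
    ∃ m', Run W coordsCmd m₀ m' ∧ ∀ u < M, ∀ p < M,
      m' (61, u, p) = completeCoords b T d (fun w => S w p) u := by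
  set V : ℕ → ℕ → ℤ := fun u p => completeCoords b T d (fun w => S w p) u with hV
  refine Run.for_of_invariant (W := W) M hMW (by simp [hM]) rfl
    (fun p m => ∀ u < M, ∀ p' < p, m (61, (u : ℕ), (p' : ℕ)) = V u p')
    (fun m' h => Expr.eval_congr fun A hA => h A (by simp [Expr.reads] at hA; subst hA; rfl))
    (by simp) ?_
  intro p hp m hfr hx hI
  obtain ⟨m', hr, h⟩ := Run.for_of_invariant (W := W) (x := 33) (e := .var 20)
    (p := .ite (.get 0 1 0 - .var 33)
      (.block [
        .assign 51 0,
        .for 35 (.get 0 1 0)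
          (.assign 51 (.var 51 + .get 56 (.var 33) (.var 35) * .get 58 (.var 35) (.var 34))),
        .set 61 (.var 33) (.var 34) (.var 51 / .var 50)])
      (.set 61 (.var 33) (.var 34) (.get 58 (.var 33) (.var 34)))) (m₀ := m) M hMW
    (by simp [hfr 20 rfl, hM]) rfl
    (fun u m => (∀ u < M, ∀ p' < p, m (61, (u : ℕ), (p' : ℕ)) = V u p') ∧
      ∀ u' < u, m (61, (u' : ℕ), (p : ℕ)) = V u' p)
    (fun m' h => Expr.eval_congr fun A hA => h A (by simp [Expr.reads] at hA; subst hA; rfl))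
    ⟨fun u hu p' hp' => by simp [hI u hu p' hp'], by simp⟩ (by
    rintro u hu m' hfr' hx' ⟨hI', hI''⟩
    have e34 : m' (34, 0, 0) = p := by rw [hfr' 34 rfl, hx]
    have hb' : m' (0, 1, 0) = b := by rw [hfr' 0 rfl, hfr 0 rfl, hb]
    have hrun : ∃ m'', Run W (.ite (.get 0 1 0 - .var 33)
        (.block [
          .assign 51 0,
          .for 35 (.get 0 1 0)
            (.assign 51 (.var 51 + .get 56 (.var 33) (.var 35) * .get 58 (.var 35) (.var 34))),
          .set 61 (.var 33) (.var 34) (.var 51 / .var 50)])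
        (.set 61 (.var 33) (.var 34) (.get 58 (.var 33) (.var 34)))) m' (wr m'' 61 u p (V u p)) ∧
        ∀ i j, m'' (61, i, j) = m' (61, i, j) := by
      by_cases h : u < b
      · have hsum : ∀ k ≤ b, |∑ w ∈ Finset.range k, T u w * S w p| < 2 ^ W := fun k hk =>
          (abs_sum_range_le hk (mul_nonneg hZ0 hD0) fun w hw => by
            rw [abs_mul]
            exact mul_le_mul (hTZ u h w hw) (hSD w (by omega) p hp) (abs_nonneg _) hZ0).trans_lt hW
        obtain ⟨m₁, hr₁, hs₁, hfr₁⟩ := Run.for_sum (W := W) (x := 35) (A := 51)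
          (ne := .get 0 1 0) (f := .get 56 (.var 33) (.var 35) * .get 58 (.var 35) (.var 34))
          (m₀ := wr m' 51 0 0 0) b (by omega) (by simp [hb']) (by norm_num) rfl rfl
          (fun w => T u w * S w p) (by
          intro w hw m₂ hm₂ hx₂
          have e33 : m₂ (33, 0, 0) = u := by
            rw [hm₂ _ _ _ (by norm_num) (by norm_num)]; simp [hx']
          have e34 : m₂ (34, 0, 0) = p := by
            rw [hm₂ _ _ _ (by norm_num) (by norm_num)]; simp [e34]
          have e56 : m₂ (56, u, w) = T u w := by
            rw [hm₂ _ _ _ (by norm_num) (by norm_num)]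
            simp [hfr' 56 rfl, hfr 56 rfl, hT u h w hw]
          have e58 : m₂ (58, w, p) = S w p := by
            rw [hm₂ _ _ _ (by norm_num) (by norm_num)]
            simp [hfr' 58 rfl, hfr 58 rfl, hS w (by omega) p hp]
          simp [hx₂, e33, e34, e56, e58])
          (fun k hk => by
            simp only [wr_apply, and_self, if_true, zero_add]
            exact hsum k hk)
        refine ⟨m₁, .ite_pos (by simp [hb', hx', h]) (.cons (Run.assign 0 (by simp) (by simp))
          (.cons hr₁ (.cons (Run.set_cell u p (V u p) ?_ ?_ ?_ ?_) (.nil _)))),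
          fun i j => by rw [hr₁.frame rfl]; simp⟩
        · simp [hr₁.frame (A := 33) rfl, hx']
        · simp [hr₁.frame (A := 34) rfl, e34]
        · simp [hs₁, hr₁.frame (A := 50) rfl, hfr' 50 rfl, hfr 50 rfl, hd, hV, completeCoords, h]
        · simp only [hV, completeCoords, if_pos h]
          refine lt_of_le_of_lt ?_ (hsum b le_rfl)
          rw [Int.abs_eq_natAbs, Int.abs_eq_natAbs]
          exact_mod_cast Int.natAbs_ediv_le_natAbs _ d
      · refine ⟨m', .ite_neg (by simp [hb', hx']; omega) (Run.set_cell u p (V u p) (by simp [hx'])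
          (by simp [e34]) ?_ ?_), fun i j => rfl⟩
        · simp [hx', e34, hfr' 58 rfl, hfr 58 rfl, hS u hu p hp, hV, completeCoords, h]
        · simp only [hV, completeCoords, if_neg h]
          exact (hSD u hu p hp).trans_lt hDW
    obtain ⟨m'', hr, h61⟩ := hrun
    refine ⟨_, hr, fun u' hu' p' hp' => ?_, fun u' hu' => ?_⟩
    · simp [hp'.ne, h61, hI' u' hu' p' hp']
    · rcases Nat.lt_succ_iff_lt_or_eq.1 hu' with h | rfl
      · simp [h.ne, h61, hI'' u' h]
      · simp)
  refine ⟨m', hr, fun u hu p' hp' => ?_⟩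
  rcases Nat.lt_succ_iff_lt_or_eq.1 hp' with h' | rfl
  · simp [h.1 u hu p' h']
  · simp [h.2 u hu]

/-- Copies the column `e` of the array 61, with the denominators in array 41, into the column `k` of
the arrays `A` and `A + 1`; the rows return to their original order. -/
def copyColumnCmd (A : ℕ) (e k : Expr) : Cmd :=
  .for 33 (.var 20) (.block [
    .set A ((.get 0 0 0 + .var 33) % .var 20) k (.get 61 (.var 33) e),
    .set (A + 1) ((.get 0 0 0 + .var 33) % .var 20) k (.get 41 (.var 33) 0)])

theorem add_mod_injOn {a M u u' : ℕ} (hu : u < M) (hu' : u' < M)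
    (h : (a + u) % M = (a + u') % M) : u = u' := by
  have h1 : u ≡ u' [MOD M] := Nat.ModEq.add_left_cancel' a h
  rwa [Nat.ModEq, Nat.mod_eq_of_lt hu, Nat.mod_eq_of_lt hu'] at h1

theorem copyColumnCmd_run {W A M a : ℕ} {e k : Expr} {m₀ : Mem} {V dn : ℕ → ℤ} {e' k' : ℤ}
    (hA0 : 0 < A) (hA : A < 19)
    (hM : m₀ (20, 0, 0) = M) (ha : m₀ (0, 0, 0) = a) (hMW : M ≤ W)
    (he : ∀ m : Mem, (∀ B, B ≠ 33 → B ≠ A → B ≠ A + 1 → ∀ i j, m (B, i, j) = m₀ (B, i, j)) →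
      e.eval m = e' ∧ k.eval m = k')
    (hV : ∀ u < M, m₀ (61, u, e') = V u) (hdn : ∀ u < M, m₀ (41, u, 0) = dn u)
    (hVW : ∀ u < M, |V u| < 2 ^ W) (hdnW : ∀ u < M, |dn u| < 2 ^ W) :
    ∃ m', Run W (copyColumnCmd A e k) m₀ m' ∧
      (∀ u < M, m' (A, ((a + u) % M : ℕ), k') = V u) ∧
      (∀ u < M, m' (A + 1, ((a + u) % M : ℕ), k') = dn u) ∧
      ∀ B i j, B ≠ 33 → (B = A → j ≠ k') → (B = A + 1 → j ≠ k') →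
        m' (B, i, j) = m₀ (B, i, j) := by
  refine Run.for_of_invariant (W := W) M hMW (by simp [hM])
    (by simp [Cmd.writes, Cmd.block]; omega)
    (fun u m => (∀ u' < u, m (A, ((a + u') % M : ℕ), k') = V u') ∧
      (∀ u' < u, m (A + 1, ((a + u') % M : ℕ), k') = dn u') ∧
      ∀ B i j, B ≠ 33 → (B = A → j ≠ k') → (B = A + 1 → j ≠ k') → m (B, i, j) = m₀ (B, i, j))
    (fun m' h => Expr.eval_congr fun B hB => h B (by
      simp [Expr.reads] at hB; subst hB; simp [Cmd.for, Cmd.writes, Cmd.block]; omega))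
    ⟨by simp, by simp, fun B i j hB _ _ => by simp [hB]⟩ ?_
  rintro u hu m hfr hx ⟨h1, h2, h3⟩
  have hfr' : ∀ B, B ≠ 33 → B ≠ A → B ≠ A + 1 → ∀ i j, m (B, i, j) = m₀ (B, i, j) :=
    fun B hB hBA hBA' i j => h3 B i j hB (fun h => absurd h hBA) (fun h => absurd h hBA')
  obtain ⟨he₁, hk₁⟩ := he m hfr'
  have e20 : m (20, 0, 0) = M := by rw [hfr' 20 (by omega) (by omega) (by omega), hM]
  have e0 : m (0, 0, 0) = a := by rw [hfr' 0 (by omega) (by omega) (by omega), ha]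
  have e61 : m (61, u, e') = V u := by rw [hfr' 61 (by omega) (by omega) (by omega), hV u hu]
  have e41 : m (41, u, 0) = dn u := by rw [hfr' 41 (by omega) (by omega) (by omega), hdn u hu]
  have hne : ∀ u' < M, u' ≠ u → ((((a + u') % M : ℕ)) : ℤ) ≠ (((a + u) % M : ℕ) : ℤ) :=
    fun u' hu' hne h => hne (add_mod_injOn hu' hu (by exact_mod_cast h))
  have hk₂ : k.eval (wr m A ((a + u) % M : ℕ) k' (V u)) = k' := (he _ fun B hB hBA hBA' i j => by
    rw [wr_apply, if_neg (by simp [hBA]), hfr' B hB hBA hBA']).2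
  refine ⟨_, .cons (Run.set_cell ((a + u) % M : ℕ) k' (V u) (by simp [e20, e0, hx]) hk₁
    (by simp [hx, he₁, e61]) (hVW u hu)) (.cons (Run.set_cell ((a + u) % M : ℕ) k' (dn u) ?_ hk₂ ?_
    (hdnW u hu)) (.nil _)), fun u' hu' => ?_, fun u' hu' => ?_, fun B i j hB hBA hBA' => ?_⟩
  · simp [e20, e0, hx, hA0.ne, show (20 : ℕ) ≠ A by omega, show (33 : ℕ) ≠ A by omega]
  · simp [hx, e41, show (41 : ℕ) ≠ A by omega, show (33 : ℕ) ≠ A by omega]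
  · rcases Nat.lt_succ_iff_lt_or_eq.1 hu' with h | rfl
    · have := hne u' (by omega) h.ne
      simp only [wr_apply, this, false_and, and_false, if_false]
      rw [if_neg (by omega), h1 u' h]
    · simp only [wr_apply, and_self, if_true]
      rw [if_neg (by omega), if_neg (by omega)]
  · rcases Nat.lt_succ_iff_lt_or_eq.1 hu' with h | rfl
    · have := hne u' (by omega) h.ne
      simp only [wr_apply, this, false_and, and_false, if_false]
      rw [if_neg (by omega), h2 u' h]
    · simp only [wr_apply, and_self, if_true]
      rw [if_neg (by omega)]
  · rw [wr_apply, if_neg (by tauto), wr_apply, if_neg (by tauto), wr_apply, if_neg (by tauto)]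
    exact h3 B i j hB hBA hBA'

/-- Writes the output: the generators of the finite part are the columns `b, …, m - 1`, the basis of
the free part consists of the columns of the pivots. The number of pivots ends up in variable
59. -/
def outputCmd : Cmd := .block [
  .for 31 (.get 0 0 0 + .get 0 2 0) (copyColumnCmd 6 (.get 0 1 0 + .var 31) (.var 31)),
  .assign 59 0,
  .for 34 (.get 0 1 0) (.ite (.get 56 (.var 34) (.var 34) * .get 56 (.var 34) (.var 34))
    (.block [copyColumnCmd 8 (.var 34) (.var 59), .assign 59 (.var 59 + 1)]) .skip),
  .set 5 0 0 (.get 0 0 0 + .get 0 2 0),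
  .set 5 1 0 (.var 59)]

theorem outputCmd_run {W M a b c : ℕ} {m₀ : Mem} {V : ℕ → ℕ → ℤ} {t dn : ℕ → ℤ}
    (hM : m₀ (20, 0, 0) = M) (ha : m₀ (0, 0, 0) = a) (hb : m₀ (0, 1, 0) = b)
    (hc : m₀ (0, 2, 0) = c) (hMabc : M = a + b + c)
    (ht : ∀ p < b, m₀ (56, p, p) = t p) (hdn : ∀ u < M, m₀ (41, u, 0) = dn u)
    (hV : ∀ u < M, ∀ p < M, m₀ (61, u, p) = V u p) (hVW : ∀ u < M, ∀ p < M, |V u p| < 2 ^ W)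
    (hdnW : ∀ u < M, |dn u| < 2 ^ W) (hMW : M ≤ W) :
    ∃ m', Run W outputCmd m₀ m' ∧ m' (5, 0, 0) = ((a + c : ℕ) : ℤ) ∧
      m' (5, 1, 0) = Nat.count (fun p => t p ≠ 0) b ∧
      m' (59, 0, 0) = Nat.count (fun p => t p ≠ 0) b ∧
      (∀ j < a + c, ∀ u < M, m' (6, ((a + u) % M : ℕ), j) = V u (b + j) ∧
        m' (7, ((a + u) % M : ℕ), j) = dn u) ∧
      ∀ p < b, t p ≠ 0 → ∀ u < M,
        m' (8, ((a + u) % M : ℕ), (Nat.count (fun p => t p ≠ 0) p : ℕ)) = V u p ∧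
        m' (9, ((a + u) % M : ℕ), (Nat.count (fun p => t p ≠ 0) p : ℕ)) = dn u := by
  have hsmall : ∀ t : ℕ, t ≤ W → |(t : ℤ)| < 2 ^ W := fun t ht => by
    rw [Nat.abs_cast]
    exact_mod_cast (Nat.lt_two_pow_self).trans_le (Nat.pow_le_pow_right (by norm_num) ht)
  obtain ⟨m₁, hr₁, h6⟩ := Run.for_of_invariant (W := W) (x := 31) (e := .get 0 0 0 + .get 0 2 0)
    (p := copyColumnCmd 6 (.get 0 1 0 + .var 31) (.var 31)) (m₀ := m₀) (a + c) (by omega)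
    (by simp [ha, hc]) rfl
    (fun j m => ∀ j' < j, ∀ u < M, m (6, ((a + u) % M : ℕ), (j' : ℕ)) = V u (b + j') ∧
        m (7, ((a + u) % M : ℕ), (j' : ℕ)) = dn u)
    (fun m' h => Expr.eval_congr fun A hA => h A (by
      obtain rfl : 0 = A := by simpa [Expr.reads] using hA
      rfl))
    (by simp) (by
    intro j hj m hfr hx hI
    obtain ⟨m', hr, h6, h7, hfr'⟩ := copyColumnCmd_run (W := W) (A := 6) (M := M) (a := a)
      (e := .get 0 1 0 + .var 31) (k := .var 31) (m₀ := m) (V := fun u => V u (b + j)) (dn := dn)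
      (e' := ((b + j : ℕ) : ℤ)) (k' := j) (by norm_num) (by norm_num) (by rw [hfr 20 rfl, hM])
      (by rw [hfr 0 rfl, ha]) hMW (fun m' h => by
        have e0 : m' (0, 1, 0) = b := by rw [h 0 (by omega) (by omega) (by omega), hfr 0 rfl, hb]
        have e31 : m' (31, 0, 0) = j := by rw [h 31 (by omega) (by omega) (by omega), hx]
        simp [e0, e31])
      (fun u hu => by rw [hfr 61 rfl, hV u hu _ (by omega)]) (fun u hu => by rw [hfr 41 rfl, hdn u hu])
      (fun u hu => hVW u hu _ (by omega)) hdnW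
    refine ⟨m', hr, fun j' hj' u hu => ?_⟩
    simp only [wr_apply, Nat.reduceEqDiff, false_and, if_false]
    rcases Nat.lt_succ_iff_lt_or_eq.1 hj' with h | rfl
    · rw [hfr' 6 _ _ (by norm_num) (by simp [h.ne]) (by simp),
        hfr' 7 _ _ (by norm_num) (by simp) (by simp [h.ne])]
      exact hI j' h u hu
    · exact ⟨h6 u hu, h7 u hu⟩)
  have e0₁ : ∀ i j, m₁ (0, i, j) = m₀ (0, i, j) := fun i j => hr₁.frame rfl i j
  obtain ⟨m₂, hr₂, h59, h8⟩ := Run.for_of_invariant (W := W) (x := 34) (e := .get 0 1 0)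
    (p := .ite (.get 56 (.var 34) (.var 34) * .get 56 (.var 34) (.var 34))
      (.block [copyColumnCmd 8 (.var 34) (.var 59), .assign 59 (.var 59 + 1)]) .skip)
    (m₀ := wr m₁ 59 0 0 0) b (by omega) (by simp [e0₁, hb]) rfl
    (fun p m => m (59, 0, 0) = Nat.count (fun p => t p ≠ 0) p ∧
      ∀ p' < p, t p' ≠ 0 → ∀ u < M,
        m (8, ((a + u) % M : ℕ), (Nat.count (fun p => t p ≠ 0) p' : ℕ)) = V u p' ∧
        m (9, ((a + u) % M : ℕ), (Nat.count (fun p => t p ≠ 0) p' : ℕ)) = dn u)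
    (fun m' h => Expr.eval_congr fun A hA => h A (by simp [Expr.reads] at hA; subst hA; rfl))
    (by simp) (by
    rintro p hp m hfr hx ⟨h59, h8⟩
    have e56 : m (56, p, p) = t p := by rw [hfr 56 rfl]; simp [hr₁.frame (A := 56) rfl, ht p hp]
    by_cases h0 : t p = 0
    · refine ⟨m, .ite_neg (by simp [hx, e56, h0]) (.skip m), ?_, fun p' hp' hp0 u hu => ?_⟩
      · simp [h59, Nat.count_succ, h0]
      · rcases Nat.lt_succ_iff_lt_or_eq.1 hp' with h | rfl
        · simpa using h8 p' h hp0 u hu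
        · exact absurd h0 hp0
    · obtain ⟨m', hr, h6, h7, hfr'⟩ := copyColumnCmd_run (W := W) (A := 8) (M := M) (a := a)
        (e := .var 34) (k := .var 59) (m₀ := m) (V := fun u => V u p) (dn := dn)
        (e' := p) (k' := (Nat.count (fun p => t p ≠ 0) p : ℕ)) (by norm_num) (by norm_num)
        (by rw [hfr 20 rfl]; simp [hr₁.frame (A := 20) rfl, hM])
        (by rw [hfr 0 rfl]; simp [e0₁, ha]) hMW (fun m' h => by
          have e59 := (h 59 (by omega) (by omega) (by omega) 0 0).trans h59
          have e34 : m' (34, 0, 0) = p := by rw [h 34 (by omega) (by omega) (by omega), hx]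
          exact ⟨e34, e59⟩)
        (fun u hu => by
          rw [hfr 61 rfl]; simp [hr₁.frame (A := 61) rfl, hV u hu p (by omega)])
        (fun u hu => by rw [hfr 41 rfl]; simp [hr₁.frame (A := 41) rfl, hdn u hu])
        (fun u hu => hVW u hu _ (by omega)) hdnW
      have hcount : Nat.count (fun p => t p ≠ 0) (p + 1) = Nat.count (fun p => t p ≠ 0) p + 1 := by
        rw [Nat.count_succ, if_pos h0]
      have hcle : Nat.count (fun p => t p ≠ 0) (p + 1) ≤ p + 1 := Nat.count_le _
      refine ⟨_, .ite_pos ?_ (.cons hr (.cons (Run.assign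
        (Nat.count (fun p => t p ≠ 0) (p + 1) : ℕ) ?_ (hsmall _ (by omega))) (.nil _))), by simp,
        fun p' hp' hp0 u hu => ?_⟩
      · simp only [Expr.eval_mul, Expr.eval_get, Expr.eval_lit, hx, e56]
        exact mul_self_pos.2 h0
      · rw [hcount]
        simp only [Expr.eval_add, Expr.eval_get, Expr.eval_lit, Expr.eval_one, hr.frame (A := 59) rfl,
          h59]
        norm_cast
      · simp only [wr_apply, Nat.reduceEqDiff, false_and, if_false]
        rcases Nat.lt_succ_iff_lt_or_eq.1 hp' with h | rfl
        · have hlt := Nat.count_strict_mono (p := fun p => t p ≠ 0) hp0 h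
          rw [hfr' 8 _ _ (by norm_num) (fun _ => by exact_mod_cast hlt.ne) (by simp),
            hfr' 9 _ _ (by norm_num) (by simp) (fun _ => by exact_mod_cast hlt.ne)]
          exact h8 p' h hp0 u hu
        · exact ⟨h6 u hu, h7 u hu⟩)
  have e0₂ : ∀ i j, m₂ (0, i, j) = m₀ (0, i, j) := fun i j => by rw [hr₂.frame rfl]; simp [e0₁]
  have hcle : Nat.count (fun p => t p ≠ 0) b ≤ b := Nat.count_le _
  refine ⟨_, .cons hr₁ (.cons (Run.assign 0 (by simp) (by simp)) (.cons hr₂ (.cons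
    (Run.set_cell 0 0 ((a + c : ℕ) : ℤ) (by simp) (by simp) (by simp [e0₂, ha, hc])
      (hsmall _ (by omega))) (.cons
    (Run.set_cell 1 0 (Nat.count (fun p => t p ≠ 0) b : ℕ) (by simp) (by simp) (by simp [h59])
      (hsmall _ (by omega))) (.nil _))))), by simp, by simp, by simp [h59], fun j hj u hu => ?_,
      fun p hp hp0 u hu => ?_⟩
  · simp only [wr_apply, Nat.reduceEqDiff, false_and, if_false]
    rw [hr₂.frame rfl, hr₂.frame rfl]
    simpa using h6 j hj u hu
  · simpa using h8 p hp hp0 u hu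

/-! ### Runs with random draws -/

theorem uniformOfFintype_map_equiv {α β : Type*} [Fintype α] [Nonempty α] [Fintype β] [Nonempty β]
    (e : α ≃ β) : (PMF.uniformOfFintype α).map e = PMF.uniformOfFintype β := by
  classical
  ext b
  rw [PMF.map_apply, tsum_eq_single (e.symm b)]
  · simp [Fintype.card_congr e]
  · intro a ha
    rw [if_neg]
    rintro rfl
    simp at ha

theorem uniformOfFintype_bind_map {α β γ : Type*} [Fintype α] [Nonempty α] [Fintype β] [Nonempty β]
    (f : α → β → γ) :
    (PMF.uniformOfFintype α).bind (fun a => (PMF.uniformOfFintype β).map (f a))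
      = (PMF.uniformOfFintype (α × β)).map (fun p => f p.1 p.2) := by
  have h : (PMF.uniformOfFintype α).bind (fun a => (PMF.uniformOfFintype β).map (Prod.mk a))
      = PMF.uniformOfFintype (α × β) := by
    classical
    ext ⟨a, b⟩
    rw [PMF.bind_apply, tsum_eq_single a]
    · rw [PMF.map_apply, tsum_eq_single b]
      · simp [ENNReal.mul_inv]
      · intro b' hb'
        simp [hb'.symm]
    · intro a' ha'
      rw [PMF.map_apply]
      simp [ha'.symm]
  rw [← h, PMF.map_bind]
  simp only [PMF.map_comp]
  rfl

/-- `Draws W c m M`: started on the memory `m`, the command `c` ends with the memory `M ω`, for a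
uniformly distributed `ω`; the time is bounded as for deterministic runs. -/
def Draws (W : ℕ) (c : Cmd) (m : Mem) {Ω : Type} [Fintype Ω] [Nonempty Ω] (M : Ω → Mem) : Prop :=
  (∀ ω p, bitLen (M ω p) ≤ W) ∧ ∀ s : State, s.mem = m → ∃ S : Ω → State,
    (∀ ω, (S ω).mem = M ω ∧ (S ω).time ≤ s.time + c.timeBound W ∧
      ∀ b, s.MemLe b → (S ω).MemLe b) ∧
    ∀ fuel > W, exec fuel c s = (PMF.uniformOfFintype Ω).map (fun ω => some (S ω))

theorem Run.draws {W : ℕ} {c : Cmd} {m m' : Mem} (h : Run W c m m')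
    (hm : ∀ p, bitLen (m p) ≤ W) : Draws W c m (fun _ : Unit => m') := by
  obtain ⟨h1, h2⟩ := h.exec_eq hm
  refine ⟨fun _ => h1, fun s hs => ?_⟩
  obtain ⟨s', h3, -, h4, h5, h6⟩ := h2 s hs
  refine ⟨fun _ => s', fun _ => ⟨h3, h4, h5⟩, fun fuel hf => ?_⟩
  rw [h6 fuel hf]
  exact (PMF.map_const (PMF.uniformOfFintype Unit) (some s')).symm

theorem Draws.seq {W : ℕ} {p q : Cmd} {m : Mem} {Ω Ω' : Type} [Fintype Ω] [Nonempty Ω]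
    [Fintype Ω'] [Nonempty Ω'] {M : Ω → Mem} {M' : Ω → Ω' → Mem} (hp : Draws W p m M)
    (hq : ∀ ω, Draws W q (M ω) (M' ω)) :
    Draws W (.seq p q) m (fun ω : Ω × Ω' => M' ω.1 ω.2) := by
  refine ⟨fun ω => (hq ω.1).1 ω.2, fun s hs => ?_⟩
  obtain ⟨S, hS, he⟩ := hp.2 s hs
  choose S' hS' he' using fun ω => (hq ω).2 (S ω) (hS ω).1
  refine ⟨fun ω => S' ω.1 ω.2, fun ω => ⟨(hS' ω.1 ω.2).1, ?_, fun b hb =>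
    (hS' ω.1 ω.2).2.2 b ((hS ω.1).2.2 b hb)⟩, fun fuel hf => ?_⟩
  · have h1 := (hS ω.1).2.1
    have h2 := (hS' ω.1 ω.2).2.1
    change (S' ω.1 ω.2).time ≤ _
    rw [Cmd.timeBound]
    omega
  · rw [exec, he fuel hf, PMF.bind_map]
    refine Eq.trans ?_ (uniformOfFintype_bind_map fun ω ω' => some (S' ω ω'))
    congr 1
    funext ω
    exact he' ω fuel hf

/-- A loop that fills the cells `(A, k, 0)`, `k < n`, with random elements of
`{0, …, g k}`. -/
theorem Draws.for_rand {W x A : ℕ} {ne e : Expr} {m₀ : Mem} (n : ℕ) (hn : n ≤ W) (g : ℕ → ℕ)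
    (hxA : A ≠ x) (hne : ∀ m : Mem, (∀ B, B ≠ x → B ≠ A → ∀ i j, m (B, i, j) = m₀ (B, i, j)) →
      ne.eval m = n)
    (he : ∀ k < n, ∀ m : Mem, (∀ B, B ≠ x → B ≠ A → ∀ i j, m (B, i, j) = m₀ (B, i, j)) →
      m (x, 0, 0) = k → e.eval m = g k + 1)
    (hg : ∀ k < n, ((g k : ℕ) : ℤ) < 2 ^ W) (hm₀ : ∀ p, bitLen (m₀ p) ≤ W) :
    ∃ M : ((k : Fin n) → Fin (g k + 1)) → Mem,
      Draws W (.for x ne (.rand A (.var x) (.lit 0) e)) m₀ M ∧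
      (∀ ω B, B ≠ x → B ≠ A → ∀ i j, M ω (B, i, j) = m₀ (B, i, j)) ∧
      ∀ ω (k : Fin n), M ω (A, (k : ℕ), 0) = ((ω k : ℕ) : ℤ) := by
  classical
  set test : Expr := .sub ne (.var x) with htest
  set body : Cmd := .seq (.rand A (.var x) (.lit 0) e) (.assign x (.add (.var x) (.lit 1)))
    with hbody
  -- the iterations that remain, from iteration `i` on
  have key : ∀ r i : ℕ, i + r = n → ∀ g' : ℕ → ℕ, (∀ k, g' k = g (i + k)) → ∀ m : Mem,
      (∀ B, B ≠ x → B ≠ A → ∀ u v, m (B, u, v) = m₀ (B, u, v)) → m (x, 0, 0) = i →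
      (∀ p, bitLen (m p) ≤ W) → ∃ M : ((k : Fin r) → Fin (g' k + 1)) → Mem,
        (∀ ω B, B ≠ x → B ≠ A → ∀ u v, M ω (B, u, v) = m₀ (B, u, v)) ∧
        (∀ ω (k : Fin r), M ω (A, ((i + k : ℕ) : ℤ), 0) = ((ω k : ℕ) : ℤ)) ∧
        (∀ ω, ∀ j < i, M ω (A, (j : ℕ), 0) = m (A, (j : ℕ), 0)) ∧
        (∀ ω p, bitLen (M ω p) ≤ W) ∧ ∀ s : State, s.mem = m →
          ∃ S : ((k : Fin r) → Fin (g' k + 1)) → State,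
          (∀ ω, (S ω).mem = M ω ∧ (S ω).time ≤ s.time
            + (r * ((test.costFactor + 1) * (W + 1) ^ 2 + body.timeBound W)
              + (test.costFactor + 1) * (W + 1) ^ 2) ∧ ∀ b, s.MemLe b → (S ω).MemLe b) ∧
          ∀ fuel > W, ∀ n' > r, loopExec test (exec fuel body) n' s
            = (PMF.uniformOfFintype ((k : Fin r) → Fin (g' k + 1))).map (fun ω => some (S ω)) := by
    have hone : 1 ≤ (W + 1) ^ 2 := Nat.one_le_pow _ _ (by omega)
    have hcost : ∀ m : Mem, (∀ p, bitLen (m p) ≤ W) → test.cost m + 1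
        ≤ (test.costFactor + 1) * (W + 1) ^ 2 := fun m hm => by
      have := test.cost_le hm
      rw [add_mul, one_mul]
      omega
    intro r
    induction r with
    | zero =>
      intro i hi g' hg' m hfr hx hm
      refine ⟨fun _ => m, fun _ => hfr, fun _ k => k.elim0, fun _ _ _ => rfl, fun _ => hm,
        fun s hs => ⟨fun _ => s.charge (test.cost s.mem + 1), fun _ => ⟨hs, ?_,
          fun b hb => hb.charge _⟩, fun fuel hf n' hn' => ?_⟩⟩
      · have := hcost s.mem (by rwa [hs])
        simp only [State.charge]
        omega
      · obtain ⟨n', rfl⟩ := Nat.exists_eq_succ_of_ne_zero (by omega : n' ≠ 0)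
        rw [loopExec, if_neg]
        · exact (PMF.map_const (PMF.uniformOfFintype ((k : Fin 0) → Fin (g' k + 1)))
            (some (s.charge (test.cost s.mem + 1)))).symm
        rw [hs, htest, Expr.eval, hne m hfr, Expr.eval_get, Expr.eval_lit, hx]
        omega
    | succ r ih =>
      intro i hi g' hg' m hfr hx hm
      have hev : e.eval m = g' 0 + 1 := by rw [he i (by omega) m hfr hx, hg', add_zero]
      have hev' : (e.eval m - 1).toNat = g' 0 := by rw [hev]; simp
      -- the memory after a draw and after the whole iteration
      set m₁ : Fin (g' 0 + 1) → Mem := fun y => m.update (A, i, 0) ((y : ℕ) : ℤ) with hm₁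
      set m₂ : Fin (g' 0 + 1) → Mem := fun y => wr (m₁ y) x 0 0 ((i + 1 : ℕ) : ℤ) with hm₂
      have hm₁W : ∀ y p, bitLen (m₁ y p) ≤ W := fun y p => by
        rw [hm₁]
        simp only [Finsupp.update_apply]
        split_ifs
        · rw [bitLen_le_iff, Nat.abs_cast]
          have h1 := hg i (by omega)
          have h2 : ((y : ℕ) : ℤ) ≤ g i := by
            have h3 := y.2
            have h4 := hg' 0
            rw [add_zero] at h4
            omega
          linarith
        · exact hm p
      have hrun : ∀ y, Run W (.assign x (.add (.var x) (.lit 1))) (m₁ y) (m₂ y) := fun y => by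
        refine Run.assign ((i + 1 : ℕ) : ℤ) ?_ ?_
        · simp [Expr.eval, hm₁, Finsupp.update_apply, hxA.symm, hx]
        · rw [Nat.abs_cast]
          exact_mod_cast (Nat.lt_two_pow_self).trans_le
            (Nat.pow_le_pow_right (by norm_num) (by omega))
      have hm₂A : ∀ y B, B ≠ x → ∀ u v, m₂ y (B, u, v)
          = if B = A ∧ u = i ∧ v = 0 then ((y : ℕ) : ℤ) else m (B, u, v) := fun y B hB u v => by
        simp [hm₂, hm₁, hB, Finsupp.update_apply]
      have hex := fun y => ih (i + 1) (by omega) (fun k => g' (k + 1))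
        (fun k => by rw [hg']; congr 1; omega) (m₂ y)
        (fun B hB hBA u v => by rw [hm₂A y B hB, if_neg (by simp [hBA]), hfr B hB hBA])
        (by simp [hm₂]) ((hrun y).exec_eq (hm₁W y)).1
      choose M hM hMA hMold hMW hMS using hex
      obtain ⟨E, hE0, hES⟩ : ∃ E : Fin (g' 0 + 1) × ((k : Fin r) → Fin (g' (k + 1) + 1)) ≃
          ((k : Fin (r + 1)) → Fin (g' k + 1)), (∀ ω, ((E.symm ω).1 : ℕ) = ω 0) ∧
          ∀ ω (k : Fin r), ((E.symm ω).2 k : ℕ) = ω k.succ :=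
        ⟨Fin.consEquiv (fun k : Fin (r + 1) => Fin (g' k + 1)), fun _ => rfl, fun _ _ => rfl⟩
      refine ⟨fun ω => M (E.symm ω).1 (E.symm ω).2, fun ω => hM _ _, fun ω k => ?_,
        fun ω j hj => ?_, fun ω => hMW _ _, fun s hs => ?_⟩
      · refine Fin.cases ?_ (fun k => ?_) k
        · have := hMold (E.symm ω).1 (E.symm ω).2 i (by omega)
          rw [hm₂A _ A hxA, if_pos ⟨rfl, rfl, rfl⟩, hE0] at this
          exact this
        · have := hMA (E.symm ω).1 (E.symm ω).2 k
          have h2 : i + ((k.succ : Fin (r + 1)) : ℕ) = i + 1 + k := by rw [Fin.val_succ]; omega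
          rw [h2, this, hES]
      · rw [hMold (E.symm ω).1 (E.symm ω).2 j (by omega), hm₂A _ A hxA, if_neg]
        rintro ⟨-, h, -⟩
        have : j = i := by exact_mod_cast h
        omega
      · subst hs
        set s₀ := s.charge (test.cost s.mem + 1) with hs₀
        set s₁ : Fin (g' 0 + 1) → State := fun y =>
          ((s₀.charge (writeCost s.mem (.var x) (.lit 0) e (e.eval s.mem))).write
            (A, (Expr.var x).eval s.mem, (Expr.lit 0).eval s.mem) ((y : ℕ) : ℤ)).record y with hs₁
        have hs₁m : ∀ y, (s₁ y).mem = m₁ y := fun y => by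
          simp [hs₁, hs₀, hm₁, State.record, State.write, State.charge, hx]
        choose s₂ hs₂m _ hs₂t hs₂b hs₂e using fun y =>
          ((hrun y).exec_eq (hm₁W y)).2 (s₁ y) (hs₁m y)
        choose S hS hSe using fun y => hMS y (s₂ y) (hs₂m y)
        refine ⟨fun ω => S (E.symm ω).1 (E.symm ω).2, fun ω => ⟨(hS _ _).1, ?_, fun b hb => ?_⟩,
          fun fuel hf n' hn' => ?_⟩
        · have h1 := (hS (E.symm ω).1 (E.symm ω).2).2.1
          have h2 := hs₂t (E.symm ω).1
          have h3 : (s₁ (E.symm ω).1).time = s.time + (test.cost s.mem + 1)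
            + writeCost s.mem (.var x) (.lit 0) e (e.eval s.mem) := rfl
          have h4 := writeCost_le hm (.var x) (.lit 0) e
          have h5 := hcost s.mem hm
          have h6 : body.timeBound W = writeFactor (.var x) (.lit 0) e * (W + 1) ^ 2
            + (Cmd.assign x (.add (.var x) (.lit 1))).timeBound W := rfl
          change (S (E.symm ω).1 (E.symm ω).2).time ≤ _
          rw [add_mul r 1, one_mul]
          omega
        · refine (hS _ _).2.2 b (hs₂b _ b ?_)
          have h1 : ((s₀.charge (writeCost s₀.mem (.var x) (.lit 0) e (e.eval s₀.mem))).write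
              (A, (Expr.var x).eval s₀.mem, (Expr.lit 0).eval s₀.mem)
              (((E.symm ω).1 : ℕ) : ℤ)).MemLe b := by
            refine (hb.charge _).charge_write A _ _ e (bitLen_mono ?_)
            have h2 : e.eval s₀.mem = g' 0 + 1 := hev
            rw [h2, Nat.abs_cast, abs_of_nonneg (by positivity)]
            have := (E.symm ω).1.2
            exact_mod_cast this.le
          exact h1
        · obtain ⟨n', rfl⟩ := Nat.exists_eq_succ_of_ne_zero (by omega : n' ≠ 0)
          have hpos : 0 < test.eval s.mem := by
            rw [htest, Expr.eval, hne _ hfr, Expr.eval_get, Expr.eval_lit, hx]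
            omega
          have hexec : exec fuel body s₀
              = (PMF.uniformOfFintype (Fin (g' 0 + 1))).map (fun y => some (s₂ y)) := by
            have h1 : exec fuel (.rand A (.var x) (.lit 0) e) s₀
                = (PMF.uniformOfFintype (Fin (g' 0 + 1))).map (fun y => some (s₁ y)) := by
              have h2 : ∀ N, N = g' 0 → ∀ F : ℕ → Option State,
                  (PMF.uniformOfFintype (Fin (N + 1))).map (fun y : Fin (N + 1) => F y.val)
                    = (PMF.uniformOfFintype (Fin (g' 0 + 1))).map
                      (fun y : Fin (g' 0 + 1) => F y.val) := by
                rintro _ rfl F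
                rfl
              rw [exec]
              exact h2 _ hev' (fun y => some (((s₀.charge (writeCost s.mem (.var x) (.lit 0) e
                (e.eval s.mem))).write (A, (Expr.var x).eval s.mem, (Expr.lit 0).eval s.mem)
                  (y : ℤ)).record y))
            rw [hbody, exec, h1, PMF.bind_map, ← PMF.bind_pure_comp]
            congr 1
            funext y
            exact hs₂e y fuel hf
          rw [loopExec, if_pos hpos, hexec, PMF.bind_map]
          have h3 : (PMF.uniformOfFintype (Fin (g' 0 + 1))).bind
              ((fun o => o.elim (PMF.pure none) (loopExec test (exec fuel body) n')) ∘
                fun y => some (s₂ y))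
              = (PMF.uniformOfFintype (Fin (g' 0 + 1))).bind (fun y =>
                (PMF.uniformOfFintype ((k : Fin r) → Fin (g' (k + 1) + 1))).map
                  (fun ω => some (S y ω))) := by
            congr 1
            funext y
            exact hSe y fuel hf n' (by omega)
          rw [h3, uniformOfFintype_bind_map (fun y ω => some (S y ω)),
            ← uniformOfFintype_map_equiv E, PMF.map_comp]
          congr 1
          funext p
          simp
  have hwr : ∀ B, B ≠ x → B ≠ A → ∀ u v, wr m₀ x 0 0 0 (B, u, v) = m₀ (B, u, v) :=
    fun B hB _ u v => by simp [hB]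
  have hrun : Run W (.assign x (.lit 0)) m₀ (wr m₀ x 0 0 0) := Run.assign 0 rfl (by simp)
  obtain ⟨M, h1, h2, -, h4, h5⟩ := key n 0 (by omega) g (by simp) _ hwr (by simp)
    (hrun.exec_eq hm₀).1
  refine ⟨M, ⟨h4, fun s hs => ?_⟩, h1, fun ω k => by simpa using h2 ω k⟩
  obtain ⟨s', hs'm, -, hs't, hs'b, hs'e⟩ := (hrun.exec_eq hm₀).2 s hs
  obtain ⟨S, hS, hSe⟩ := h5 s' hs'm
  refine ⟨S, fun ω => ⟨(hS ω).1, ?_, fun b hb => (hS ω).2.2 b (hs'b b hb)⟩, fun fuel hf => ?_⟩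
  · have h6 : (Cmd.for x ne (.rand A (.var x) (.lit 0) e)).timeBound W
        = (Cmd.assign x (.lit 0)).timeBound W
          + (W * ((test.costFactor + 1) * (W + 1) ^ 2 + body.timeBound W)
            + (test.costFactor + 1) * (W + 1) ^ 2) := rfl
    have h7 : n * ((test.costFactor + 1) * (W + 1) ^ 2 + body.timeBound W)
        ≤ W * ((test.costFactor + 1) * (W + 1) ^ 2 + body.timeBound W) := by gcongr
    have h8 := (hS ω).2.1
    omega
  · rw [Cmd.for, exec, hs'e fuel hf, PMF.pure_bind, Option.elim, exec]
    exact hSe fuel hf fuel (by omega)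

/-! ### Sampling -/

/-- A family of pairwise distinct group elements, one for each outcome of the draws, is sampled
uniformly and without collisions. -/
theorem Draws.samples {a b c : ℕ} {N : Fin c → ℕ} {W T : ℕ} {p : Cmd} {m₀ : Mem} {Ω : Type}
    [Fintype Ω] [Nonempty Ω] {M : Ω → Mem} (h : Draws W p m₀ M) {g : Ω → ElemGroup a b N}
    (hg : Function.Injective g) (hM : ∀ ω, Holds (M ω) 10 0 (g ω))
    (hT : memBits m₀ + p.timeBound W ≤ T) : Samples p m₀ T (Set.range g) := by
  classical
  obtain ⟨S, hS, he⟩ := h.2 (start m₀) rfl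
  let out : State → ElemGroup a b N := fun s =>
    if h : ∃ x : ElemGroup a b N, Holds s.mem 10 0 x then h.choose else 0
  have hout : ∀ ω, Holds (S ω).mem 10 0 (out (S ω)) ∧ out (S ω) = g ω := fun ω => by
    have h1 : Holds (S ω).mem 10 0 (g ω) := by rw [(hS ω).1]; exact hM ω
    have h2 : ∃ x : ElemGroup a b N, Holds (S ω).mem 10 0 x := ⟨_, h1⟩
    have h3 : out (S ω) = h2.choose := dif_pos h2
    rw [h3]
    exact ⟨h2.choose_spec, h2.choose_spec.2.unique h1.2⟩
  have hsupp : ∀ s ∈ ((PMF.uniformOfFintype Ω).map S).support, ∃ ω, S ω = s := fun s hs => by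
    rw [PMF.mem_support_map_iff] at hs
    obtain ⟨ω, -, h⟩ := hs
    exact ⟨ω, h⟩
  refine ⟨W + 1, (PMF.uniformOfFintype Ω).map S, out, ?_, fun s hs => ?_, ?_,
    fun s hs s' hs' heq => ?_⟩
  · rw [he _ (Nat.lt_succ_self W), PMF.map_comp]
    rfl
  · obtain ⟨ω, rfl⟩ := hsupp s hs
    obtain ⟨-, h2, h3⟩ := hS ω
    have h4 := (h3 (memBits m₀) ⟨le_rfl, le_rfl⟩).2
    have h5 : (start m₀).time = 0 := rfl
    exact ⟨by omega, by omega, (hout ω).1⟩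
  · have h1 : ((PMF.uniformOfFintype Ω).map S).map out = (PMF.uniformOfFintype Ω).map g := by
      rw [PMF.map_comp]
      congr 1
      funext ω
      exact (hout ω).2
    rw [h1]
    refine ⟨Set.finite_range g, Set.range_nonempty g, fun x => ?_⟩
    rw [PMF.map_apply, ← Nat.card_coe_set_eq, Nat.card_range_of_injective hg, Nat.card_eq_fintype_card]
    by_cases hx : x ∈ Set.range g
    · obtain ⟨ω, rfl⟩ := hx
      rw [Set.indicator_of_mem (Set.mem_range_self ω), tsum_eq_single ω]
      · simp
      · intro ω' hω'
        rw [if_neg fun h => hω' (hg h).symm]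
    · rw [Set.indicator_of_notMem hx, ENNReal.tsum_eq_zero]
      intro ω
      rw [if_neg]
      rintro rfl
      exact hx (Set.mem_range_self ω)
  · obtain ⟨ω, rfl⟩ := hsupp s hs
    obtain ⟨ω', rfl⟩ := hsupp s' hs'
    rw [(hout ω).2, (hout ω').2] at heq
    rw [hg heq]

/-- Draws the digits of the element of the finite part. -/
def drawFiniteCmd : Cmd := .for 31 (.get 0 0 0 + .get 0 2 0) (.rand 12 (.var 31) (.lit 0)
  (.get 57 (.get 0 1 0 + .var 31) 0 / .get 58 (.get 0 1 0 + .var 31) (.get 0 1 0 + .var 31)))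

/-- Draws the coefficients of the element of the free part, shifted by `Δ`. -/
def drawFreeCmd : Cmd :=
  .for 31 (.var 59) (.rand 13 (.var 31) (.lit 0) (2 * .get 4 (.var 31) 0 + 1))

/-- Combines the digits in the arrays 12 and 13 with the generators in the arrays 6 and 8. -/
def combineCmd : Cmd :=
  .for 33 (.var 20) (.block [
    .assign 51 0,
    .for 31 (.get 0 0 0 + .get 0 2 0) (.assign 51 (.var 51
      + .get 12 (.var 31) 0 * .get 6 ((.get 0 0 0 + .var 33) % .var 20) (.var 31))),
    .for 31 (.var 59) (.assign 51 (.var 51 + (.get 13 (.var 31) 0 - .get 4 (.var 31) 0)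
      * .get 8 ((.get 0 0 0 + .var 33) % .var 20) (.var 31))),
    .set 10 ((.get 0 0 0 + .var 33) % .var 20) 0 (.var 51),
    .set 11 ((.get 0 0 0 + .var 33) % .var 20) 0 (.get 41 (.var 33) 0)])

theorem combineCmd_run {W M a c r : ℕ} {m₀ : Mem} {F V : ℕ → ℕ → ℤ} {x y Δ dn : ℕ → ℤ}
    {Bx By D : ℤ} (hM : m₀ (20, 0, 0) = M) (ha : m₀ (0, 0, 0) = a) (hc : m₀ (0, 2, 0) = c)
    (hr : m₀ (59, 0, 0) = r) (hdn : ∀ u < M, m₀ (41, u, 0) = dn u)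
    (hF : ∀ u < M, ∀ j < a + c, m₀ (6, ((a + u) % M : ℕ), j) = F u j)
    (hV : ∀ u < M, ∀ k < r, m₀ (8, ((a + u) % M : ℕ), k) = V u k)
    (hx : ∀ j < a + c, m₀ (12, j, 0) = x j) (hy : ∀ k < r, m₀ (13, k, 0) = y k)
    (hΔ : ∀ k < r, m₀ (4, k, 0) = Δ k) (hFD : ∀ u < M, ∀ j < a + c, |F u j| ≤ D)
    (hVD : ∀ u < M, ∀ k < r, |V u k| ≤ D) (hxB : ∀ j < a + c, |x j| ≤ Bx)
    (hyB : ∀ k < r, |y k - Δ k| ≤ By) (hBx : 0 ≤ Bx) (hBy : 0 ≤ By) (hD0 : 0 ≤ D)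
    (hdnW : ∀ u < M, |dn u| < 2 ^ W) (hMW : M ≤ W) (hacW : a + c ≤ W) (hrW : r ≤ W)
    (hW : (a + c : ℕ) * (Bx * D) + r * (By * D) < 2 ^ W) :
    ∃ m', Run W combineCmd m₀ m' ∧ ∀ u < M,
      m' (10, ((a + u) % M : ℕ), 0) = ∑ j ∈ Finset.range (a + c), x j * F u j
        + ∑ k ∈ Finset.range r, (y k - Δ k) * V u k ∧
      m' (11, ((a + u) % M : ℕ), 0) = dn u := by
  refine Run.for_of_invariant (W := W) M hMW (by simp [hM]) rfl
    (fun u m => ∀ u' < u, m (10, ((a + u') % M : ℕ), 0) = ∑ j ∈ Finset.range (a + c), x j * F u' j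
        + ∑ k ∈ Finset.range r, (y k - Δ k) * V u' k ∧
      m (11, ((a + u') % M : ℕ), 0) = dn u')
    (fun m' h => Expr.eval_congr fun A hA => h A (by simp [Expr.reads] at hA; subst hA; rfl))
    (by simp) ?_
  intro u hu m hfr hx33 hI
  have hs1 : ∀ k ≤ a + c, |∑ j ∈ Finset.range k, x j * F u j| ≤ (a + c : ℕ) * (Bx * D) :=
    fun k hk => abs_sum_range_le hk (by positivity) fun j hj => by
      rw [abs_mul]
      exact mul_le_mul (hxB j hj) (hFD u hu j hj) (abs_nonneg _) hBx
  have hs2 : ∀ k ≤ r, |∑ j ∈ Finset.range k, (y j - Δ j) * V u j| ≤ r * (By * D) :=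
    fun k hk => abs_sum_range_le hk (by positivity) fun j hj => by
      rw [abs_mul]
      exact mul_le_mul (hyB j hj) (hVD u hu j hj) (abs_nonneg _) hBy
  have hr0 : 0 ≤ (r : ℤ) * (By * D) := by positivity
  have e0 : ∀ i j, m (0, i, j) = m₀ (0, i, j) := fun i j => hfr 0 rfl i j
  have e20 : m (20, 0, 0) = M := by rw [hfr 20 rfl, hM]
  obtain ⟨m₁, hr₁, hs₁, hfr₁⟩ := Run.for_sum (W := W) (x := 31) (A := 51)
    (ne := .get 0 0 0 + .get 0 2 0)
    (f := .get 12 (.var 31) 0 * .get 6 ((.get 0 0 0 + .var 33) % .var 20) (.var 31))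
    (m₀ := wr m 51 0 0 0) (a + c) hacW (by simp [e0, ha, hc]) (by norm_num) rfl rfl
    (fun j => x j * F u j) (by
      intro j hj m₂ hm₂ hx₂
      have h33 : m₂ (33, 0, 0) = u := by
        rw [hm₂ _ _ _ (by norm_num) (by norm_num)]; simp [hx33]
      have h0 : m₂ (0, 0, 0) = a := by
        rw [hm₂ _ _ _ (by norm_num) (by norm_num)]; simp [e0, ha]
      have h20 : m₂ (20, 0, 0) = M := by
        rw [hm₂ _ _ _ (by norm_num) (by norm_num)]; simp [e20]
      have h12 : m₂ (12, j, 0) = x j := by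
        rw [hm₂ _ _ _ (by norm_num) (by norm_num)]; simp [hfr 12 rfl, hx j hj]
      have h6 : m₂ (6, ((a : ℤ) + u) % M, j) = F u j := by
        rw [hm₂ _ _ _ (by norm_num) (by norm_num), ← hF u hu j hj]; simp [hfr 6 rfl]
      simp [hx₂, h33, h0, h20, h12, h6])
    (fun k hk => by
      have := hs1 k hk
      simp only [wr_apply, and_self, if_true, zero_add]
      linarith)
  obtain ⟨m₂, hr₂, hs₂, hfr₂⟩ := Run.for_sum (W := W) (x := 31) (A := 51)
    (ne := .var 59) (f := (.get 13 (.var 31) 0 - .get 4 (.var 31) 0)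
      * .get 8 ((.get 0 0 0 + .var 33) % .var 20) (.var 31))
    (m₀ := m₁) r hrW (by simp [hr₁.frame (A := 59) rfl, hfr 59 rfl, hr]) (by norm_num) rfl rfl
    (fun k => (y k - Δ k) * V u k) (by
      intro j hj m₂ hm₂ hx₂
      have h33 : m₂ (33, 0, 0) = u := by
        rw [hm₂ _ _ _ (by norm_num) (by norm_num), hr₁.frame rfl]; simp [hx33]
      have h0 : m₂ (0, 0, 0) = a := by
        rw [hm₂ _ _ _ (by norm_num) (by norm_num), hr₁.frame rfl]; simp [e0, ha]
      have h20 : m₂ (20, 0, 0) = M := by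
        rw [hm₂ _ _ _ (by norm_num) (by norm_num), hr₁.frame rfl]; simp [e20]
      have h13 : m₂ (13, j, 0) = y j := by
        rw [hm₂ _ _ _ (by norm_num) (by norm_num), hr₁.frame rfl]; simp [hfr 13 rfl, hy j hj]
      have h4 : m₂ (4, j, 0) = Δ j := by
        rw [hm₂ _ _ _ (by norm_num) (by norm_num), hr₁.frame rfl]; simp [hfr 4 rfl, hΔ j hj]
      have h8 : m₂ (8, ((a : ℤ) + u) % M, j) = V u j := by
        rw [hm₂ _ _ _ (by norm_num) (by norm_num), hr₁.frame rfl, ← hV u hu j hj]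
        simp [hfr 8 rfl]
      simp [hx₂, h33, h0, h20, h13, h4, h8])
    (fun k hk => by
      have h1 := hs1 (a + c) le_rfl
      have h2 := hs2 k hk
      have h3 := abs_add_le (∑ j ∈ Finset.range (a + c), x j * F u j)
        (∑ j ∈ Finset.range k, (y j - Δ j) * V u j)
      rw [hs₁]
      simp only [wr_apply, and_self, if_true, zero_add]
      linarith)
  have hs : m₂ (51, 0, 0) = ∑ j ∈ Finset.range (a + c), x j * F u j
      + ∑ k ∈ Finset.range r, (y k - Δ k) * V u k := by rw [hs₂, hs₁]; simp
  have h0 : m₂ (0, 0, 0) = a := by rw [hr₂.frame rfl, hr₁.frame rfl]; simp [e0, ha]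
  have h20 : m₂ (20, 0, 0) = M := by rw [hr₂.frame rfl, hr₁.frame rfl]; simp [e20]
  have h33 : m₂ (33, 0, 0) = u := by rw [hr₂.frame rfl, hr₁.frame rfl]; simp [hx33]
  have h41 : m₂ (41, u, 0) = dn u := by
    rw [hr₂.frame rfl, hr₁.frame rfl]; simp [hfr 41 rfl, hdn u hu]
  have hne : ∀ u' < u, ((((a + u') % M : ℕ)) : ℤ) ≠ (((a + u) % M : ℕ) : ℤ) :=
    fun u' hu' h => hu'.ne (add_mod_injOn (by omega) hu (by exact_mod_cast h))
  refine ⟨_, .cons (Run.assign 0 (by simp) (by simp)) (.cons hr₁ (.cons hr₂ (.cons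
    (Run.set_cell ((a + u) % M : ℕ) 0 _ (by simp [h0, h33, h20]) (by simp) (by simpa using hs) ?_)
    (.cons (Run.set_cell ((a + u) % M : ℕ) 0 (dn u) (by simp [h0, h33, h20]) (by simp)
      (by simp [h33, h41]) (hdnW u hu)) (.nil _))))), fun u' hu' => ?_⟩
  · have h1 := hs1 (a + c) le_rfl
    have h2 := hs2 r le_rfl
    have h3 := abs_add_le (∑ j ∈ Finset.range (a + c), x j * F u j)
      (∑ j ∈ Finset.range r, (y j - Δ j) * V u j)
    linarith
  · rcases Nat.lt_succ_iff_lt_or_eq.1 hu' with h | rfl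
    · have := hne u' h
      simp only [wr_apply, this, Nat.reduceEqDiff, false_and, and_false, if_false]
      rw [hr₂.frame rfl, hr₂.frame rfl, hr₁.frame rfl, hr₁.frame rfl]
      simpa using hI u' h
    · simp

/-! ### The input -/

section Input

variable {a b c α β : ℕ} {N : Fin c → ℕ} {E : Matrix (Row a b c) (Col α β) ℚ} {k : ℕ}

theorem rowIndex_injective : Function.Injective (rowIndex : Row a b c → ℤ) := by
  rintro (i | i | i) (j | j | j) h <;> simp only [rowIndex] at h <;>
    (congr 2; omega)

theorem colIndex_injective : Function.Injective (colIndex : Col α β → ℤ) := by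
  rintro (i | i) (j | j) h <;> simp only [colIndex] at h <;>
    first | (congr 1; ext; omega) | omega

theorem exists_rowIndex_eq {t : ℕ} (ht : t < a + b + c) : ∃ ρ : Row a b c, rowIndex ρ = t := by
  rcases lt_or_ge t a with h | h
  · exact ⟨.inl ⟨t, h⟩, rfl⟩
  rcases lt_or_ge t (a + b) with h' | h'
  · exact ⟨.inr (.inl ⟨t - a, by omega⟩), by simp only [rowIndex]; omega⟩
  · exact ⟨.inr (.inr ⟨t - a - b, by omega⟩), by simp only [rowIndex]; omega⟩

theorem exists_colIndex_eq {t : ℕ} (ht : t < α + β) : ∃ j : Col α β, colIndex j = t := by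
  rcases lt_or_ge t α with h | h
  · exact ⟨.inl ⟨t, h⟩, rfl⟩
  · exact ⟨.inr ⟨t - α, by omega⟩, by simp only [colIndex]; omega⟩

theorem sum_single_apply (A : ℕ) (f : Row a b c → Col α β → ℤ) (ρ : Row a b c) (j : Col α β) :
    (∑ i, ∑ j', Finsupp.single ((A, rowIndex i, colIndex j') : Cell) (f i j'))
      (A, rowIndex ρ, colIndex j) = f ρ j := by
  rw [Finsupp.finsetSum_apply, Finset.sum_eq_single ρ, Finsupp.finsetSum_apply,
    Finset.sum_eq_single j]
  · simp
  · intro j' _ hj'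
    exact Finsupp.single_eq_of_ne fun h => hj' (colIndex_injective (Prod.ext_iff.1
      (Prod.ext_iff.1 h).2).2.symm)
  · simp
  · intro i _ hi
    rw [Finsupp.finsetSum_apply]
    refine Finset.sum_eq_zero fun j' _ => Finsupp.single_eq_of_ne fun h => hi ?_
    exact rowIndex_injective (Prod.ext_iff.1 (Prod.ext_iff.1 h).2).1.symm
  · simp

theorem sum_single_apply_of_ne {A B : ℕ} (h : B ≠ A) (f : Row a b c → Col α β → ℤ) (i j : ℤ) :
    (∑ i, ∑ j', Finsupp.single ((A, rowIndex i, colIndex j') : Cell) (f i j')) (B, i, j) = 0 := by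
  simp [h.symm]

theorem sum_single_fin_apply (A : ℕ) {n : ℕ} (f : Fin n → ℤ) (i : Fin n) :
    (∑ i : Fin n, Finsupp.single ((A, ((i : ℕ) : ℤ), 0) : Cell) (f i)) (A, ((i : ℕ) : ℤ), 0) = f i := by
  rw [Finsupp.finsetSum_apply, Finset.sum_eq_single i]
  · simp
  · intro i' _ hi'
    refine Finsupp.single_eq_of_ne fun h => hi' ?_
    have h1 := (Prod.ext_iff.1 (Prod.ext_iff.1 h).2).1
    exact Fin.ext (by simpa using h1.symm)
  · simp

theorem sum_single_fin_apply_of_ne {A B : ℕ} (h : B ≠ A) {n : ℕ} (f : Fin n → ℤ) (i j : ℤ) :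
    (∑ i : Fin n, Finsupp.single ((A, ((i : ℕ) : ℤ), 0) : Cell) (f i)) (B, i, j) = 0 := by
  simp [h.symm]

theorem inputMem_zero (i : ℤ) : inputMem N E k (0, i, 0) = if i = 0 then (a : ℤ) else
    if i = 1 then (b : ℤ) else if i = 2 then (c : ℤ) else if i = 3 then (α : ℤ) else
    if i = 4 then (β : ℤ) else if i = 5 then (k : ℤ) else 0 := by
  simp only [inputMem, Finsupp.add_apply, Finsupp.single_apply, Prod.mk.injEq, true_and, and_true,
    sum_single_fin_apply_of_ne (show 0 ≠ 1 by norm_num),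
    sum_single_apply_of_ne (show 0 ≠ 2 by norm_num),
    sum_single_apply_of_ne (show 0 ≠ 3 by norm_num), add_zero, eq_comm (b := i)]
  split_ifs <;> simp_all

theorem inputMem_moduli (i : Fin c) : inputMem N E k (1, (i : ℕ), 0) = N i := by
  simp only [inputMem, Finsupp.add_apply, sum_single_fin_apply,
    sum_single_apply_of_ne (show 1 ≠ 2 by norm_num),
    sum_single_apply_of_ne (show 1 ≠ 3 by norm_num)]
  simp

theorem inputMem_num (ρ : Row a b c) (j : Col α β) :
    inputMem N E k (2, rowIndex ρ, colIndex j) = (E ρ j).num := by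
  simp only [inputMem, Finsupp.add_apply, sum_single_apply,
    sum_single_fin_apply_of_ne (show 2 ≠ 1 by norm_num),
    sum_single_apply_of_ne (show 2 ≠ 3 by norm_num)]
  simp

theorem inputMem_den (ρ : Row a b c) (j : Col α β) :
    inputMem N E k (3, rowIndex ρ, colIndex j) = (E ρ j).den := by
  simp only [inputMem, Finsupp.add_apply, sum_single_apply,
    sum_single_fin_apply_of_ne (show 3 ≠ 1 by norm_num),
    sum_single_apply_of_ne (show 3 ≠ 2 by norm_num)]
  simp

theorem inputMem_eq_zero {A : ℕ} (hA : 4 ≤ A) (i j : ℤ) : inputMem N E k (A, i, j) = 0 := by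
  simp only [inputMem, Finsupp.add_apply, sum_single_fin_apply_of_ne (show A ≠ 1 by omega),
    sum_single_apply_of_ne (show A ≠ 2 by omega), sum_single_apply_of_ne (show A ≠ 3 by omega)]
  simp [show (0 : ℕ) ≠ A by omega]

theorem edgeMem_apply {r : ℕ} (Δ : Fin r → ℕ) (i : Fin r) : edgeMem Δ (4, (i : ℕ), 0) = Δ i :=
  sum_single_fin_apply 4 (fun i => (Δ i : ℤ)) i

theorem edgeMem_eq_zero {r : ℕ} (Δ : Fin r → ℕ) {A : ℕ} (hA : A ≠ 4) (i j : ℤ) :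
    edgeMem Δ (A, i, j) = 0 :=
  sum_single_fin_apply_of_ne hA (fun i => (Δ i : ℤ)) i j

/-! ### The size of the input -/

theorem memBits_add_le (m m' : Mem) : memBits (m + m') ≤ memBits m + memBits m' := by
  classical
  set f : Cell → ℤ → ℕ := fun p v =>
    if v = 0 then 0 else bitLen p.2.1 + bitLen p.2.2 + bitLen v + 1 with hf
  have h : ∀ (x : Mem) (U : Finset Cell), x.support ⊆ U → memBits x = ∑ p ∈ U, f p (x p) := by
    intro x U hU
    rw [← Finset.sum_subset hU fun p _ hp => by simp [hf, Finsupp.notMem_support_iff.1 hp]]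
    refine Finset.sum_congr rfl fun p hp => ?_
    simp only [hf, if_neg (Finsupp.mem_support_iff.1 hp)]
  rw [h (m + m') (m.support ∪ m'.support) Finsupp.support_add,
    h m _ Finset.subset_union_left, h m' _ Finset.subset_union_right, ← Finset.sum_add_distrib]
  refine Finset.sum_le_sum fun p _ => ?_
  have := bitLen_add (m p) (m' p)
  simp only [hf, Finsupp.add_apply]
  split_ifs <;> simp_all
  omega

theorem memBits_sum_le {ι : Type*} (U : Finset ι) (g : ι → Mem) :
    memBits (∑ i ∈ U, g i) ≤ ∑ i ∈ U, memBits (g i) := by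
  classical
  induction U using Finset.induction_on with
  | empty => simp [memBits]
  | insert i U hi ih =>
    rw [Finset.sum_insert hi, Finset.sum_insert hi]
    exact (memBits_add_le _ _).trans (by omega)

theorem memBits_single_le (p : Cell) (v : ℤ) :
    memBits (Finsupp.single p v) ≤ bitLen p.2.1 + bitLen p.2.2 + bitLen v + 1 := by
  rcases eq_or_ne v 0 with rfl | hv
  · simp [memBits]
  · rw [memBits, Finsupp.sum, Finsupp.support_single p hv, Finset.sum_singleton,
      Finsupp.single_eq_same]

theorem bitLen_le_of_lt {t s : ℕ} (h : t ≤ s) : bitLen (t : ℤ) ≤ s := (bitLen_natCast_le t).trans h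

theorem size_le_maxBits {n : ℕ} (x : Fin n → ℕ) (i : Fin n) : (x i).size ≤ maxBits x :=
  Finset.le_sup (f := fun i => (x i).size) (Finset.mem_univ i)

theorem bits_le_matrixBits (E : Matrix (Row a b c) (Col α β) ℚ) (ρ : Row a b c) (j : Col α β) :
    bitLen (E ρ j).num + (E ρ j).den.size ≤ matrixBits E :=
  (Finset.le_sup (f := fun j => bitLen (E ρ j).num + (E ρ j).den.size) (Finset.mem_univ j)).trans
    (Finset.le_sup (f := fun i => Finset.univ.sup
      fun j => bitLen (E i j).num + (E i j).den.size) (Finset.mem_univ ρ))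

theorem bitLen_natCast (t : ℕ) : bitLen (t : ℤ) = t.size := by simp [bitLen]

theorem memBits_inputMem_le : memBits (inputMem N E k) ≤ 60 * (1 + inputSize N E k) ^ 3 := by
  set s := 1 + inputSize N E k with hs
  have hs' : s = 1 + ((a + b + c) + α + β + maxBits N + matrixBits E + k.size) := rfl
  have hone : ∀ (i : ℕ) (v : ℕ), i < 6 → v.size ≤ s →
      memBits (Finsupp.single ((0, (i : ℤ), 0) : Cell) (v : ℤ)) ≤ s + 6 := by
    intro i v hi hv
    refine (memBits_single_le _ _).trans ?_
    have := bitLen_le_of_lt (show i ≤ 5 by omega)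
    simp only [bitLen_zero, bitLen_natCast] at this ⊢
    omega
  have hsz : ∀ t : ℕ, t < s → t.size ≤ s := fun t ht => by
    rw [← bitLen_natCast]; exact bitLen_le_of_lt ht.le
  have hN : memBits (∑ i : Fin c, Finsupp.single ((1, ((i : ℕ) : ℤ), 0) : Cell) (N i : ℤ))
      ≤ s * (3 * s) := by
    refine (memBits_sum_le _ _).trans ((Finset.sum_le_card_nsmul _ _ (3 * s) fun i _ => ?_).trans ?_)
    · refine (memBits_single_le _ _).trans ?_
      have h1 := bitLen_le_of_lt (show (i : ℕ) ≤ s by omega)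
      have h2 := size_le_maxBits N i
      simp only [bitLen_zero, bitLen_natCast] at *
      omega
    · rw [Finset.card_univ, Fintype.card_fin, smul_eq_mul]
      exact Nat.mul_le_mul_right _ (by omega)
  have hE : ∀ (A : ℕ) (f : Row a b c → Col α β → ℤ), (∀ ρ j, bitLen (f ρ j) ≤ matrixBits E) →
      memBits (∑ ρ, ∑ j, Finsupp.single ((A, rowIndex ρ, colIndex j) : Cell) (f ρ j))
        ≤ s * (s * (4 * s)) := by
    intro A f hf
    refine (memBits_sum_le _ _).trans ((Finset.sum_le_card_nsmul _ _ (s * (4 * s))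
      fun ρ _ => ?_).trans ?_)
    · refine (memBits_sum_le _ _).trans ((Finset.sum_le_card_nsmul _ _ (4 * s)
        fun j _ => ?_).trans ?_)
      · refine (memBits_single_le _ _).trans ?_
        have h1 := hf ρ j
        have hρ : (a + innerIndex ρ) % (a + b + c) < a + b + c :=
          Nat.mod_lt _ (by have := innerIndex_lt ρ; omega)
        have h2 : bitLen (rowIndex ρ) ≤ s := by
          rw [rowIndex_eq]; exact bitLen_le_of_lt (by omega)
        have h3 : bitLen (colIndex j) ≤ s := by
          have := colNat_lt j
          rw [colIndex_eq]; exact bitLen_le_of_lt (by omega)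
        simp only
        omega
      · rw [Finset.card_univ, Fintype.card_sum, Fintype.card_fin, Fintype.card_fin, smul_eq_mul]
        exact Nat.mul_le_mul_right _ (by omega)
    · rw [Finset.card_univ, Fintype.card_sum, Fintype.card_sum, Fintype.card_fin, Fintype.card_fin,
        Fintype.card_fin, smul_eq_mul]
      exact Nat.mul_le_mul_right _ (by omega)
  have h0 := hone 0 a (by norm_num) (hsz a (by omega))
  have h1 := hone 1 b (by norm_num) (hsz b (by omega))
  have h2 := hone 2 c (by norm_num) (hsz c (by omega))
  have h3 := hone 3 α (by norm_num) (hsz α (by omega))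
  have h4 := hone 4 β (by norm_num) (hsz β (by omega))
  have h5 := hone 5 k (by norm_num) (by omega)
  have h6 := hE 2 (fun ρ j => (E ρ j).num) fun ρ j => by
    have := bits_le_matrixBits E ρ j; omega
  have h7 := hE 3 (fun ρ j => ((E ρ j).den : ℤ)) fun ρ j => by
    have := bits_le_matrixBits E ρ j; rw [bitLen_natCast]; omega
  simp only [Nat.cast_zero, Nat.cast_one, Nat.cast_ofNat] at h0 h1 h2 h3 h4 h5
  have hsum : memBits (inputMem N E k) ≤ (s + 6) + (s + 6) + (s + 6) + (s + 6) + (s + 6) + (s + 6)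
      + s * (3 * s) + s * (s * (4 * s)) + s * (s * (4 * s)) := by
    rw [inputMem]
    clear_value s
    refine (memBits_add_le _ _).trans (add_le_add ?_ h7)
    refine (memBits_add_le _ _).trans (add_le_add ?_ h6)
    refine (memBits_add_le _ _).trans (add_le_add ?_ hN)
    refine (memBits_add_le _ _).trans (add_le_add ?_ h5)
    refine (memBits_add_le _ _).trans (add_le_add ?_ h4)
    refine (memBits_add_le _ _).trans (add_le_add ?_ h3)
    refine (memBits_add_le _ _).trans (add_le_add ?_ h2)
    exact (memBits_add_le _ _).trans (add_le_add h0 h1)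
  have hs1 : 1 ≤ s := by omega
  have e1 : s ≤ s ^ 3 := Nat.le_self_pow (by norm_num) s
  have e2 : s ^ 2 ≤ s ^ 3 := Nat.pow_le_pow_right hs1 (by norm_num)
  nlinarith

theorem memBits_edgeMem_le {r : ℕ} (Δ : Fin r → ℕ) :
    memBits (edgeMem Δ) ≤ r * (r + maxBits Δ + 1) := by
  refine (memBits_sum_le _ _).trans ((Finset.sum_le_card_nsmul _ _ (r + maxBits Δ + 1)
    fun i _ => ?_).trans ?_)
  · refine (memBits_single_le _ _).trans ?_
    have h1 := bitLen_le_of_lt (show (i : ℕ) ≤ r by omega)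
    have h2 := size_le_maxBits Δ i
    simp only [bitLen_zero, bitLen_natCast] at *
    omega
  · simp

theorem bitLen_le_memBits (m : Mem) (p : Cell) : bitLen (m p) ≤ memBits m := by
  by_cases hp : p ∈ m.support
  · refine le_trans ?_ (Finset.single_le_sum (f := fun p => bitLen p.2.1 + bitLen p.2.2
      + bitLen (m p) + 1) (fun _ _ => Nat.zero_le _) hp)
    omega
  · simp [Finsupp.notMem_support_iff.1 hp]

end Input

/-! ### The construction -/

/-- The program that constructs the net. -/
def constructCmd : Cmd :=
  .block [scalesCmd, entriesCmd, cramerCmd, latticeCmd, coordsCmd, outputCmd]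

/-- What the memory holds after the construction, besides the output: the matrices `T`, `S` and the
scale `q` that describe the net. -/
structure Constructed {a b c : ℕ} (N : Fin c → ℕ) (n s : ℕ) (q Q d : ℤ) (X T S : ℕ → ℕ → ℤ)
    (m : Mem) : Prop where
  pos_q : 0 < q
  pos_Q : 0 < Q
  rowMod_dvd : ∀ u, b ≤ u → u < a + b + c → rowMod b N q u ∣ Q
  cramer : IsCramer b n X T d
  diag_eq_zero : ∀ u, b ≤ u → T u u = 0
  triangular : IsTriangular (fun u : Fin (a + b + c) => netMod b N q Q d T u)
    (fun w u : Fin (a + b + c) => S u w)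
    (netLattice (fun u : Fin (a + b + c) => netMod b N q Q d T u) X n)
  netMod_le : ∀ u < a + b + c, netMod b N q Q d T u ≤ 2 ^ (16 * s ^ 3)
  coords_le : ∀ u < a + b + c, ∀ p < a + b + c,
    |completeCoords b T d (fun w => S w p) u| ≤ 2 ^ (21 * s ^ 3)
  rowDen_lt : ∀ u < a + b + c, |rowDen b c q u| < 2 ^ (40 * s ^ 3)
  mem_a : m (0, 0, 0) = a
  mem_b : m (0, 1, 0) = b
  mem_c : m (0, 2, 0) = c
  mem_m : m (20, 0, 0) = (a + b + c : ℕ)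
  mem_count : m (59, 0, 0) = Nat.count (fun p => T p p ≠ 0) b
  mem_den : ∀ u < a + b + c, m (41, u, 0) = rowDen b c q u
  mem_mod : ∀ u < a + b + c, m (57, u, 0) = netMod b N q Q d T u
  mem_basis : ∀ u < a + b + c, ∀ w < a + b + c, m (58, u, w) = S u w
  out_n : m (5, 0, 0) = (a + c : ℕ)
  out_r : m (5, 1, 0) = Nat.count (fun p => T p p ≠ 0) b
  out_f : ∀ j < a + c, ∀ u < a + b + c,
    m (6, ((a + u) % (a + b + c) : ℕ), j) = completeCoords b T d (fun w => S w (b + j)) u ∧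
    m (7, ((a + u) % (a + b + c) : ℕ), j) = rowDen b c q u
  out_v : ∀ p < b, T p p ≠ 0 → ∀ u < a + b + c,
    m (8, ((a + u) % (a + b + c) : ℕ), (Nat.count (fun p => T p p ≠ 0) p : ℕ))
      = completeCoords b T d (fun w => S w p) u ∧
    m (9, ((a + u) % (a + b + c) : ℕ), (Nat.count (fun p => T p p ≠ 0) p : ℕ)) = rowDen b c q u

theorem prod_le_two_pow {n s : ℕ} {f : ℕ → ℤ} (h : ∀ i < n, 0 ≤ f i ∧ f i ≤ 2 ^ s) :
    ∏ i ∈ Finset.range n, f i ≤ 2 ^ (s * n) := by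
  rw [pow_mul]
  calc ∏ i ∈ Finset.range n, f i ≤ ∏ _i ∈ Finset.range n, (2 ^ s : ℤ) :=
        Finset.prod_le_prod (fun i hi => (h i (Finset.mem_range.1 hi)).1)
          fun i hi => (h i (Finset.mem_range.1 hi)).2
    _ = (2 ^ s) ^ n := by simp

theorem natCast_le_two_pow {t s : ℕ} (h : t ≤ s) : (t : ℤ) ≤ 2 ^ s := by
  exact_mod_cast (h.trans Nat.lt_two_pow_self.le)

/-- The run of the construction, on memories whose entries have at most `s` bits. The sizes of the
numbers grow from phase to phase, up to `40 s ^ 3` bits. -/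
theorem constructCmd_run {a b c α n k s : ℕ} {N : Fin c → ℕ} {m₀ : Mem} (hN : ∀ i, 0 < N i)
    (ha : m₀ (0, 0, 0) = a) (hb : m₀ (0, 1, 0) = b) (hc : m₀ (0, 2, 0) = c)
    (hα : m₀ (0, 3, 0) = α) (hn : m₀ (0, 3, 0) + m₀ (0, 4, 0) = n) (hk : m₀ (0, 5, 0) = k)
    (hNm : ∀ i : Fin c, m₀ (1, (i : ℕ), 0) = N i) (h56 : ∀ i j, m₀ (56, i, j) = 0)
    (h58 : ∀ i j, m₀ (58, i, j) = 0) (hk0 : 0 < k) {num den : ℕ → ℕ → ℤ}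
    (hnum : ∀ i < a + b + c, ∀ j < n, m₀ (2, (i : ℕ), (j : ℕ)) = num i j)
    (hden : ∀ i < a + b + c, ∀ j < n, m₀ (3, (i : ℕ), (j : ℕ)) = den i j)
    (hden0 : ∀ i < a + b + c, ∀ j < n, 0 < den i j)
    (hdens : ∀ i < a + b + c, ∀ j < n, den i j ≤ 2 ^ s)
    (hnums : ∀ i < a + b + c, ∀ j < n, |num i j| ≤ 2 ^ s) (hNs : ∀ i, (N i : ℤ) ≤ 2 ^ s)
    (hks : (k : ℤ) ≤ 2 ^ s) (hms : a + b + c ≤ s) (hns : n ≤ s) (hs1 : 1 ≤ s) {P K q : ℤ}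
    (hP : P = ∏ i ∈ Finset.range (a + b + c), ∏ j ∈ Finset.range n, den i j)
    (hK : K = k * (1 + ∑ i ∈ Finset.range (a + b + c), ∑ j ∈ Finset.range n, num i j * num i j))
    (hq : q = P * K) :
    ∃ (m' : Mem) (Q d : ℤ) (T S : ℕ → ℕ → ℤ), Run (40 * s ^ 3) constructCmd m₀ m' ∧
      Constructed (a := a) (b := b) N n s q Q d (fun t j => num ((a + t) % (a + b + c)) j
        * (rowDen b c q t / den ((a + t) % (a + b + c)) j) / if j < α then K else 1) T S m' := by
  set M := a + b + c with hM
  set W := 40 * s ^ 3 with hW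
  -- with these, `omega` compares the exponents, as linear functions of `s`, `s ^ 2` and `s ^ 3`
  have e1 : s ≤ s ^ 2 := Nat.le_self_pow (by norm_num) s
  have e2 : s ^ 2 ≤ s ^ 3 := Nat.pow_le_pow_right hs1 (by norm_num)
  have e3 : s * s * s = s ^ 3 := by ring
  have e4 : s * s = s ^ 2 := by ring
  have hpow : ∀ {x y : ℕ}, x ≤ y → (2 : ℤ) ^ x ≤ 2 ^ y := fun h =>
    pow_le_pow_right₀ (by norm_num) h
  have hpowlt : ∀ {x y : ℕ}, x < y → (2 : ℤ) ^ x < 2 ^ y := fun h =>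
    pow_lt_pow_right₀ (by norm_num) h
  have hsW : s ≤ W := by omega
  have hss : (s : ℤ) ≤ 2 ^ s := natCast_le_two_pow le_rfl
  -- the moduli as a function on `ℕ`; the scales have at most `8 s ^ 3` bits
  set N' : ℕ → ℤ := fun i => if h : i < c then N ⟨i, h⟩ else 1 with hN'
  have hN'0 : ∀ i, 0 < N' i := fun i => by
    simp only [hN']
    split_ifs
    · exact_mod_cast hN _
    · norm_num
  have hN's : ∀ i < c, N' i ≤ 2 ^ s := fun i hi => by simp only [hN', dif_pos hi]; exact hNs _
  have hk1 : (1 : ℤ) ≤ k := by exact_mod_cast hk0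
  have hP0 : 0 < P := by
    rw [hP]
    exact Finset.prod_pos fun i hi => Finset.prod_pos fun j hj =>
      hden0 i (Finset.mem_range.1 hi) j (Finset.mem_range.1 hj)
  have hPs : P ≤ 2 ^ (s ^ 3) := by
    rw [hP]
    refine (prod_le_two_pow (s := s * n) fun i hi => ⟨(Finset.prod_pos fun j hj =>
      hden0 i hi j (Finset.mem_range.1 hj)).le, prod_le_two_pow fun j hj =>
        ⟨(hden0 i hi j hj).le, hdens i hi j hj⟩⟩).trans (hpow ?_)
    calc s * n * M ≤ s * s * s := by gcongr
      _ = s ^ 3 := e3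
  have hsq0 : 0 ≤ ∑ i ∈ Finset.range M, ∑ j ∈ Finset.range n, num i j * num i j :=
    Finset.sum_nonneg fun i _ => Finset.sum_nonneg fun j _ => mul_self_nonneg _
  have hsqs : 1 + ∑ i ∈ Finset.range M, ∑ j ∈ Finset.range n, num i j * num i j
      ≤ 2 ^ (5 * s) := by
    have h1 : ∑ i ∈ Finset.range M, ∑ j ∈ Finset.range n, num i j * num i j
        ≤ M * (n * (2 ^ s * 2 ^ s)) := by
      calc ∑ i ∈ Finset.range M, ∑ j ∈ Finset.range n, num i j * num i j
          ≤ ∑ _i ∈ Finset.range M, ∑ _j ∈ Finset.range n, (2 ^ s * 2 ^ s : ℤ) := by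
            refine Finset.sum_le_sum fun i hi => Finset.sum_le_sum fun j hj => ?_
            have := hnums i (Finset.mem_range.1 hi) j (Finset.mem_range.1 hj)
            rw [← abs_mul_abs_self]
            gcongr
        _ = M * (n * (2 ^ s * 2 ^ s)) := by simp
    have h2 : (M : ℤ) * (n * (2 ^ s * 2 ^ s)) ≤ 2 ^ s * (2 ^ s * (2 ^ s * 2 ^ s)) := by
      gcongr
      exacts [natCast_le_two_pow hms, natCast_le_two_pow hns]
    have h3 : (2 : ℤ) ^ s * (2 ^ s * (2 ^ s * 2 ^ s)) = 2 ^ (4 * s) := by ring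
    have h4 : (2 : ℤ) ^ (4 * s + 1) ≤ 2 ^ (5 * s) := hpow (by omega)
    have h5 : (1 : ℤ) ≤ 2 ^ (4 * s) := one_le_pow₀ (by norm_num)
    rw [pow_succ] at h4
    linarith
  have hK0 : 0 < K := by rw [hK]; positivity
  have hKs : K ≤ 2 ^ (6 * s) := by
    rw [hK, show 6 * s = s + 5 * s by ring, pow_add]
    gcongr
  have hq0 : 0 < q := by rw [hq]; positivity
  have hqs : q ≤ 2 ^ (7 * s ^ 3) := by
    rw [hq]
    refine (mul_le_mul hPs hKs hK0.le (by positivity)).trans ?_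
    rw [← pow_add]
    exact hpow (by omega)
  set Q : ℤ := q * ∏ i ∈ Finset.range c, N' i with hQ
  have hNP0 : 0 < ∏ i ∈ Finset.range c, N' i := Finset.prod_pos fun i _ => hN'0 i
  have hQ0 : 0 < Q := by positivity
  have hQs : Q ≤ 2 ^ (8 * s ^ 3) := by
    have h1 : ∏ i ∈ Finset.range c, N' i ≤ 2 ^ (s * c) :=
      prod_le_two_pow fun i hi => ⟨(hN'0 i).le, hN's i hi⟩
    refine (mul_le_mul hqs h1 hNP0.le (by positivity)).trans ?_
    rw [← pow_add]
    refine hpow ?_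
    have : s * c ≤ s * s := by gcongr; omega
    omega
  obtain ⟨m₁, hr₁, f20, f21, f24, f25, f26⟩ := scalesCmd_run (W := W) (m := M) (n := n) (c := c)
    (k := k) (m₀ := m₀) (num := num) (den := den) (N := N') (by rw [ha, hb, hc, hM]; push_cast; ring)
    hn hc hk hnum hden (fun i hi => by simp only [hN', dif_pos hi]; exact hNm ⟨i, hi⟩) hden0
    (fun i _ => hN'0 i) hk0 (by omega) (by omega) (by omega) (by
      rw [← hP, ← hK, ← hq, ← hQ]
      exact hQs.trans_lt (hpowlt (by omega)))
  rw [← hK] at f24 f25 f26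
  rw [← hP, ← hq] at f25 f26
  -- the rows of the factors `ℤ`, which enter the elimination, are not scaled and keep entries of
  -- `s` bits
  set X : ℕ → ℕ → ℤ := fun t j => num ((a + t) % M) j * (rowDen b c q t / den ((a + t) % M) j)
    / if j < α then K else 1 with hX
  have hdns : ∀ t, 0 < rowDen b c q t ∧ rowDen b c q t ≤ 2 ^ (7 * s ^ 3) := fun t => by
    refine ⟨rowDen_pos hq0 t, ?_⟩
    rw [rowDen]
    split_ifs
    · exact one_le_pow₀ (by norm_num)
    · exact hqs
  have hXs : ∀ t < M, ∀ j < n, |X t j| ≤ 2 ^ s * rowDen b c q t := by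
    intro t ht j hj
    have hlt : (a + t) % M < M := Nat.mod_lt _ (by omega)
    have h1 : |X t j| ≤ |num ((a + t) % M) j * (rowDen b c q t / den ((a + t) % M) j)| := by
      rw [hX, Int.abs_eq_natAbs, Int.abs_eq_natAbs]
      exact_mod_cast Int.natAbs_ediv_le_natAbs _ _
    refine h1.trans ?_
    rw [abs_mul]
    refine mul_le_mul (hnums _ hlt j hj) ?_ (abs_nonneg _) (by positivity)
    rw [abs_of_nonneg (Int.ediv_nonneg (hdns t).1.le (hden0 _ hlt j hj).le)]
    exact Int.ediv_le_self _ (hdns t).1.le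
  have hdnW : ∀ t < M, |rowDen b c q t| < 2 ^ W := fun t _ => by
    rw [abs_of_pos (hdns t).1]
    exact (hdns t).2.trans_lt (hpowlt (by omega))
  set Nm : ℕ → ℤ := fun t => rowMod b N q t with hNm'
  have hg0 : ∀ i j, m₁ (0, i, j) = m₀ (0, i, j) := fun i j => hr₁.frame rfl i j
  obtain ⟨m₂, hr₂, f41, f42, f43⟩ := entriesCmd_run (W := W) (a := a) (b := b) (c := c) (α := α)
    (m := M) (n := n) (m₀ := m₁) (num := num) (den := den) (N := N') (K := K) (q := q)
    (by rw [hg0, ha]) (by rw [hg0, hb]) (by rw [hg0, hc]) (by rw [hg0, hα]) f20 f21 f24 f25 rfl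
    (fun i hi j hj => by rw [hr₁.frame rfl, hnum i hi j hj])
    (fun i hi j hj => by rw [hr₁.frame rfl, hden i hi j hj])
    (fun i hi => by
      rw [hr₁.frame rfl]; simp only [hN', dif_pos hi]; exact hNm ⟨i, hi⟩)
    (by omega) (by omega)
    (by rw [abs_of_pos hK0]; exact hKs.trans_lt (hpowlt (by omega)))
    (by rw [abs_of_pos hq0]; exact hqs.trans_lt (hpowlt (by omega)))
    (fun i hi => by
      rw [abs_of_pos (hN'0 i)]; exact (hN's i hi).trans_lt (hpowlt (by omega)))
    (by omega) (dn := rowDen b c q) (Nm := Nm) (X := X) (fun t _ => rfl)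
    (fun t ht => by
      simp only [hNm', rowMod, hN']
      by_cases h1 : t < b
      · simp [h1]
      by_cases h2 : t < b + c
      · rw [if_neg h1, if_neg h1, if_pos h2, dif_pos (by omega), dif_pos (by omega)]
      · rw [if_neg h1, if_neg h1, if_neg h2, dif_neg (by omega)])
    (fun t _ j _ => rfl)
    (fun t ht j hj => by
      refine (hXs t ht j hj).trans_lt ?_
      refine (mul_le_mul_of_nonneg_left (hdns t).2 (by positivity)).trans_lt ?_
      rw [← pow_add]
      exact hpowlt (by omega))
  -- by the Leibniz formula, the minors that the elimination computes have at most `4 s ^ 2` bits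
  have hXZ : ∀ i < b, ∀ j < n, |X i j| ≤ 2 ^ s := fun i hi j hj => by
    refine (hXs i (by omega) j hj).trans ?_
    rw [rowDen, if_pos (by omega), mul_one]
  have hbs : (b : ℤ) ≤ 2 ^ s := natCast_le_two_pow (by omega)
  have hfac : (b.factorial : ℤ) * (2 ^ s) ^ b ≤ 2 ^ (2 * s ^ 2) := by
    have h1 : (b.factorial : ℤ) ≤ (2 ^ s) ^ b := by
      calc (b.factorial : ℤ) ≤ (b : ℤ) ^ b := by exact_mod_cast Nat.factorial_le_pow b
        _ ≤ (2 ^ s) ^ b := by gcongr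
    have h2 : ((2 : ℤ) ^ s) ^ b ≤ 2 ^ (s ^ 2) := by
      rw [← pow_mul]
      refine hpow ?_
      calc s * b ≤ s * s := by gcongr; omega
        _ = s ^ 2 := e4
    refine (mul_le_mul (h1.trans h2) h2 (by positivity) (by positivity)).trans ?_
    rw [← pow_add]
    exact hpow (by omega)
  have hfac' : (b : ℤ) * (2 ^ s * (b.factorial * (2 ^ s) ^ b)) ≤ 2 ^ (4 * s ^ 2) := by
    have h1 : (b : ℤ) * (2 ^ s * (b.factorial * (2 ^ s) ^ b))
        ≤ 2 ^ s * (2 ^ s * 2 ^ (2 * s ^ 2)) := by gcongr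
    refine h1.trans ?_
    rw [← pow_add, ← pow_add]
    exact hpow (by omega)
  have hZ' : (2 : ℤ) ^ (4 * s ^ 2) * 2 ^ s + b * (2 ^ s * 2 ^ (4 * s ^ 2)) ≤ 2 ^ (7 * s ^ 2) := by
    have h1 : (2 : ℤ) ^ (4 * s ^ 2) * 2 ^ s ≤ 2 ^ (6 * s ^ 2) := by
      rw [← pow_add]; exact hpow (by omega)
    have h2 : (b : ℤ) * (2 ^ s * 2 ^ (4 * s ^ 2)) ≤ 2 ^ (6 * s ^ 2) := by
      calc (b : ℤ) * (2 ^ s * 2 ^ (4 * s ^ 2)) ≤ 2 ^ s * (2 ^ s * 2 ^ (4 * s ^ 2)) := by gcongr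
        _ ≤ 2 ^ (6 * s ^ 2) := by rw [← pow_add, ← pow_add]; exact hpow (by omega)
    have h3 : (2 : ℤ) ^ (6 * s ^ 2 + 1) ≤ 2 ^ (7 * s ^ 2) := hpow (by omega)
    rw [pow_succ] at h3
    linarith
  have hZ0 : (0 : ℤ) ≤ 2 ^ (4 * s ^ 2) * 2 ^ s + b * (2 ^ s * 2 ^ (4 * s ^ 2)) := by positivity
  have hg0' : ∀ i j, m₂ (0, i, j) = m₀ (0, i, j) := fun i j => by rw [hr₂.frame rfl, hg0]
  obtain ⟨m₃, T, hr₃, f56, hT0, f56', hinv⟩ := cramerCmd_run (W := W) (b := b) (n := n) (m₀ := m₂)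
    (X := X) (B := 2 ^ s) (Z := 2 ^ (4 * s ^ 2)) (by rw [hg0', hb])
    (by rw [hr₂.frame rfl, f21]) (fun i hi j hj => f43 i (by omega) j hj)
    (fun i p => by rw [hr₂.frame rfl, hr₁.frame rfl, h56]) (one_le_pow₀ (by norm_num)) hXZ
    (hfac.trans (hpow (by omega))) hfac' (by omega) (by omega) (by
      have h1 := mul_le_mul hZ' hZ' hZ0 (by positivity)
      rw [← pow_add 2 (7 * s ^ 2) (7 * s ^ 2)] at h1
      have h2 : (2 : ℤ) ^ (7 * s ^ 2 + 7 * s ^ 2 + 1) < 2 ^ W := hpowlt (by omega)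
      rw [pow_succ] at h2
      linarith)
  set d := m₃ (50, 0, 0) with hd
  obtain ⟨hds, hTs⟩ := hinv.abs_le (one_le_pow₀ (by norm_num)) hXZ
  have hcr := hinv.isCramer
  -- entries reduced modulo `D` have at most `16 s ^ 3` bits, their products `32 s ^ 3`
  set D : ℕ → ℤ := fun u => netMod b N q Q d T u with hD
  have hD0 : ∀ u, 0 < D u := fun u => netMod_pos hN hq0 hQ0 hcr.ne_zero u
  have hdvd : ∀ u, b ≤ u → u < M → rowMod b N q u ∣ Q := by
    intro u hu huM
    rw [rowMod, if_neg (by omega)]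
    split_ifs with h
    · refine dvd_mul_of_dvd_right ?_ _
      have h1 : (N ⟨u - b, h⟩ : ℤ) = N' (u - b) := by simp only [hN', dif_pos h]
      rw [h1]
      exact Finset.dvd_prod_of_mem _ (Finset.mem_range.2 h)
    · exact dvd_mul_right _ _
  have hDs : ∀ u < M, D u ≤ 2 ^ (16 * s ^ 3) := by
    intro u hu
    simp only [hD, netMod]
    split_ifs with h
    · by_cases hub : u < b
      · rw [rowMod, if_pos hub]; exact one_le_pow₀ (by norm_num)
      · exact (Int.le_of_dvd hQ0 (hdvd u (by omega) hu)).trans (hQs.trans (hpow (by omega)))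
    · have h1 : Q * d * d ≤ 2 ^ (8 * s ^ 3) * (2 ^ (2 * s ^ 2) * 2 ^ (2 * s ^ 2)) := by
        rw [mul_assoc, ← abs_mul_abs_self d]
        have := hds.trans hfac
        gcongr
      refine h1.trans ?_
      rw [← pow_add, ← pow_add]
      exact hpow (by omega)
  obtain ⟨m₄, hr₄, f57, htri⟩ := latticeCmd_run (W := W) (M := M) (n := n) (m₀ := m₃) (X := X)
    (t := fun u => T u u) (Nm := Nm) (D := D) (Q := Q) (d := d)
    (by rw [hr₃.frame rfl, hr₂.frame rfl, f20]) (by rw [hr₃.frame rfl, hr₂.frame rfl, f21])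
    (by rw [hr₃.frame rfl, hr₂.frame rfl, f26]) rfl
    (fun u hu => by rw [hr₃.frame rfl, f42 u hu]) (fun u _ => f56' u)
    (fun u hu j hj => by rw [hr₃.frame rfl, f43 u hu j hj])
    (fun u w => by rw [hr₃.frame rfl, hr₂.frame rfl, hr₁.frame rfl, h58])
    (fun u _ => rfl) (fun u _ => hD0 u)
    (fun u hu => by
      have h1 := mul_le_mul (hDs u hu) (hDs u hu) (hD0 u).le (by positivity)
      rw [← pow_add] at h1
      have h2 : (2 : ℤ) ^ (16 * s ^ 3 + 16 * s ^ 3 + 1) < 2 ^ W := hpowlt (by omega)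
      rw [pow_succ] at h2
      linarith)
    (by omega) (by omega)
  -- applying `T` to the reduced basis gives coordinates of at most `21 s ^ 3` bits
  set S : ℕ → ℕ → ℤ := fun u w => m₄ (58, (u : ℕ), (w : ℕ)) with hS
  have hSs : ∀ u < M, ∀ w < M, |S u w| ≤ 2 ^ (16 * s ^ 3) := fun u hu w hw => by
    obtain ⟨h1, h2⟩ := htri.bound ⟨w, hw⟩ ⟨u, hu⟩
    rw [abs_of_nonneg h1]
    exact h2.trans (hDs u hu)
  have hTs' : ∀ i < b, ∀ p < b, |T i p| ≤ 2 ^ (4 * s ^ 2) := fun i hi p hp =>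
    (hTs i hi p hp).trans hfac'
  have hcoord : (b : ℤ) * (2 ^ (4 * s ^ 2) * 2 ^ (16 * s ^ 3)) ≤ 2 ^ (21 * s ^ 3) := by
    calc (b : ℤ) * (2 ^ (4 * s ^ 2) * 2 ^ (16 * s ^ 3))
        ≤ 2 ^ s * (2 ^ (4 * s ^ 2) * 2 ^ (16 * s ^ 3)) := by gcongr
      _ ≤ 2 ^ (21 * s ^ 3) := by rw [← pow_add, ← pow_add]; exact hpow (by omega)
  have hg0'' : ∀ i j, m₄ (0, i, j) = m₀ (0, i, j) := fun i j => by
    rw [hr₄.frame rfl, hr₃.frame rfl, hg0']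
  have g20 : m₄ (20, 0, 0) = M := by rw [hr₄.frame rfl, hr₃.frame rfl, hr₂.frame rfl, f20]
  have g41 : ∀ u < M, m₄ (41, u, 0) = rowDen b c q u := fun u hu => by
    rw [hr₄.frame rfl, hr₃.frame rfl, f41 u hu]
  have hVs : ∀ u < M, ∀ p < M, |completeCoords b T d (fun w => S w p) u| ≤ 2 ^ (21 * s ^ 3) := by
    intro u hu p hp
    rw [completeCoords]
    split_ifs with h
    · refine le_trans ?_ hcoord
      have h1 : |(∑ w ∈ Finset.range b, T u w * S w p) / d|
          ≤ |∑ w ∈ Finset.range b, T u w * S w p| := by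
        rw [Int.abs_eq_natAbs, Int.abs_eq_natAbs]
        exact_mod_cast Int.natAbs_ediv_le_natAbs _ _
      refine h1.trans (abs_sum_range_le le_rfl (by positivity) fun w hw => ?_)
      rw [abs_mul]
      exact mul_le_mul (hTs' u h w hw) (hSs w (by omega) p hp) (abs_nonneg _) (by positivity)
    · exact (hSs u hu p hp).trans (hpow (by omega))
  obtain ⟨m₅, hr₅, f61⟩ := coordsCmd_run (W := W) (M := M) (b := b) (m₀ := m₄) (T := T) (S := S)
    (d := d) (Z := 2 ^ (4 * s ^ 2)) (D := 2 ^ (16 * s ^ 3)) g20 (by rw [hg0'', hb]) (by omega)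
    (by rw [hr₄.frame rfl]) (fun i hi p hp => by rw [hr₄.frame rfl, f56 i hi p hp])
    (fun _ _ _ _ => rfl) hTs' hSs (by positivity) (by positivity)
    (hcoord.trans_lt (hpowlt (by omega))) (hpowlt (by omega)) (by omega)
  have hg5 : ∀ i j, m₅ (0, i, j) = m₀ (0, i, j) := fun i j => by rw [hr₅.frame rfl, hg0'']
  obtain ⟨m₆, hr₆, o5, o5', o59, o6, o8⟩ := outputCmd_run (W := W) (M := M) (a := a) (b := b)
    (c := c) (m₀ := m₅) (V := fun u p => completeCoords b T d (fun w => S w p) u)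
    (t := fun p => T p p) (dn := rowDen b c q) (by rw [hr₅.frame rfl, g20]) (by rw [hg5, ha])
    (by rw [hg5, hb]) (by rw [hg5, hc]) rfl
    (fun p hp => by rw [hr₅.frame rfl, hr₄.frame rfl, f56'])
    (fun u hu => by rw [hr₅.frame rfl, g41 u hu]) f61
    (fun u hu p hp => (hVs u hu p hp).trans_lt (hpowlt (by omega))) hdnW (by omega)
  have hg6 : ∀ i j, m₆ (0, i, j) = m₀ (0, i, j) := fun i j => by rw [hr₆.frame rfl, hg5]
  refine ⟨m₆, Q, d, T, S, .cons hr₁ <| .cons hr₂ <| .cons hr₃ <| .cons hr₄ <| .cons hr₅ <|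
    .cons hr₆ <| .nil _, ?_⟩
  exact {
    pos_q := hq0
    pos_Q := hQ0
    rowMod_dvd := hdvd
    cramer := hcr
    diag_eq_zero := hT0
    triangular := htri
    netMod_le := hDs
    coords_le := hVs
    rowDen_lt := hdnW
    mem_a := by rw [hg6, ha]
    mem_b := by rw [hg6, hb]
    mem_c := by rw [hg6, hc]
    mem_m := by rw [hr₆.frame rfl, hr₅.frame rfl, g20]
    mem_count := o59
    mem_den := fun u hu => by rw [hr₆.frame rfl, hr₅.frame rfl, g41 u hu]
    mem_mod := fun u hu => by rw [hr₆.frame rfl, hr₅.frame rfl, f57 u hu]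
    mem_basis := fun u _ w _ => by rw [hr₆.frame rfl, hr₅.frame rfl]
    out_n := o5
    out_r := o5'
    out_f := o6
    out_v := o8 }

/-! ### The net of a matrix representation -/

section

variable {a b c α β k : ℕ} {N : Fin c → ℕ} {E : Matrix (Row a b c) (Col α β) ℚ}
  {φ : (Fin α → ℝ) × (Fin β → ℤ) →+ ElemGroup a b N}

/-- The matrix that the program computes from the entries of `E` is a scaled version of `E`: the
divisions are exact, because `q` is a multiple of all denominators, and the discrete rows of a
matrix representation are integral and vanish in the real columns. -/
theorem isScaled_of_eq (hφ : IsMatrixRep E φ) {num den : ℕ → ℕ → ℤ} {P K q : ℤ}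
    (hnum : ∀ ρ j, num ((a + innerIndex ρ) % (a + b + c)) (colNat j) = (E ρ j).num)
    (hden : ∀ ρ j, den ((a + innerIndex ρ) % (a + b + c)) (colNat j) = (E ρ j).den)
    (hP : ∀ ρ j, ((E ρ j).den : ℤ) ∣ P) (hP0 : 0 < P) (hK : 0 < K) (hq : q = P * K) :
    IsScaled E q K (fun t j => num ((a + t) % (a + b + c)) j
      * (rowDen b c q t / den ((a + t) % (a + b + c)) j) / if j < α then K else 1) := by
  refine ⟨by rw [hq]; positivity, hK, fun ρ j => ?_⟩
  have hd0 : ((E ρ j).den : ℚ) ≠ 0 := by exact_mod_cast (E ρ j).den_nz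
  have hd0' : ((E ρ j).den : ℤ) ≠ 0 := by exact_mod_cast (E ρ j).den_nz
  simp only [hnum, hden]
  rcases ρ with i | ρ
  · have hdn : rowDen b c q (innerIndex (.inl i : Row a b c)) = q := by
      simp [rowDen, innerIndex]
    obtain ⟨e, he⟩ := hP (.inl i) j
    rw [hdn, hq, he, mul_assoc, Int.mul_ediv_cancel_left _ hd0']
    have hE : (E (.inl i) j) * (E (.inl i) j).den = (E (.inl i) j).num := Rat.mul_den_eq_num _
    rcases j with j | j
    · rw [if_pos (by simp [colNat]), ← mul_assoc, Int.mul_ediv_cancel _ hK.ne']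
      simp only [colScale]
      push_cast
      rw [← hE]
      ring
    · rw [if_neg (by simp [colNat]), Int.ediv_one]
      simp only [colScale]
      push_cast
      rw [← hE]
      ring
  · have hdn : rowDen b c q (innerIndex (.inr ρ : Row a b c)) = 1 := by
      rcases ρ with i | i <;> simp [rowDen, innerIndex]
      omega
    rw [hdn, hφ.den_eq_one ρ j]
    have hE : ((E (.inr ρ) j).num : ℚ) = E (.inr ρ) j := by
      rw [← Rat.mul_den_eq_num, hφ.den_eq_one ρ j]; simp
    rcases j with j | j
    · simp [hφ.eq_zero ρ j]
    · rw [if_neg (by simp [colNat])]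
      simp [colScale, hE]

/-- The scale `K` of the real columns is large enough for a net of mesh `1 / k`. -/
theorem mul_sum_abs_le {num : ℕ → ℕ → ℤ} (hnum : ∀ ρ j, num ((a + innerIndex ρ) % (a + b + c))
    (colNat j) = (E ρ j).num) : (k : ℝ) * ∑ i, ∑ j, |(E (.inl i) (.inl j) : ℝ)|
      ≤ ((k * (1 + ∑ i ∈ Finset.range (a + b + c), ∑ j ∈ Finset.range (α + β),
        num i j * num i j) : ℤ) : ℝ) := by
  have h1 : ∀ (i : Fin a) (j : Fin α),
      |(E (.inl i) (.inl j) : ℝ)| ≤ ((num i j * num i j : ℤ) : ℝ) := by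
    intro i j
    have h2 := hnum (.inl i) (.inl j)
    rw [show (a + innerIndex (.inl i : Row a b c)) % (a + b + c) = i by
      rw [innerIndex, show a + (b + c + i) = i + (a + b + c) by ring, Nat.add_mod_right,
        Nat.mod_eq_of_lt (by omega)]] at h2
    rw [show num i j = (E (.inl i) (.inl j)).num from h2]
    set x := E (.inl i) (.inl j)
    have hd : (1 : ℚ) ≤ x.den := by exact_mod_cast x.den_pos
    have h3 : |x| ≤ |(x.num : ℚ)| := by
      rw [← Rat.mul_den_eq_num, abs_mul, abs_of_nonneg (by positivity : (0 : ℚ) ≤ x.den)]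
      exact le_mul_of_one_le_right (abs_nonneg _) hd
    have h4 : |x.num| ≤ x.num * x.num := by
      rw [← abs_mul_abs_self]
      rcases (abs_nonneg x.num).eq_or_lt with h | h
      · rw [← h]; simp
      · exact le_mul_of_one_le_left h.le h
    have h5 : |x| ≤ ((x.num * x.num : ℤ) : ℚ) := h3.trans (by exact_mod_cast h4)
    exact_mod_cast h5
  have h2 : ∑ i : Fin a, ∑ j : Fin α, |(E (.inl i) (.inl j) : ℝ)|
      ≤ ((∑ i ∈ Finset.range a, ∑ j ∈ Finset.range α, num i j * num i j : ℤ) : ℝ) := by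
    push_cast
    rw [Finset.sum_range]
    refine Finset.sum_le_sum fun i _ => ?_
    rw [Finset.sum_range]
    exact Finset.sum_le_sum fun j _ => by exact_mod_cast h1 i j
  have h3 : ∑ i ∈ Finset.range a, ∑ j ∈ Finset.range α, num i j * num i j
      ≤ ∑ i ∈ Finset.range (a + b + c), ∑ j ∈ Finset.range (α + β), num i j * num i j := by
    refine (Finset.sum_le_sum fun i _ => Finset.sum_le_sum_of_subset_of_nonneg
      (Finset.range_subset_range.2 (Nat.le_add_right α β)) fun j _ _ => mul_self_nonneg _).trans ?_
    exact Finset.sum_le_sum_of_subset_of_nonneg (Finset.range_subset_range.2 (by omega))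
      fun i _ _ => Finset.sum_nonneg fun j _ => mul_self_nonneg _
  have h4 := h2.trans (Int.cast_le.2 h3)
  push_cast at h4 ⊢
  gcongr
  linarith

theorem intAbs_le_two_pow {z : ℤ} {s : ℕ} (h : bitLen z ≤ s) : |z| ≤ 2 ^ s := by
  rw [Int.abs_eq_natAbs]
  exact_mod_cast (Nat.size_le.1 h).le

/-- On the input of the problem, the construction computes a scaled version of `E` and the data of a
net that belongs to it. -/
theorem exists_constructed (hN : ∀ i, 0 < N i) (hφ : IsMatrixRep E φ) (hk : 0 < k) :
    ∃ (m' : Mem) (q Q d K : ℤ) (X T S : ℕ → ℕ → ℤ),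
      Run (40 * (1 + inputSize N E k) ^ 3) constructCmd (inputMem N E k) m' ∧
      Constructed (a := a) (b := b) N (α + β) (1 + inputSize N E k) q Q d X T S m' ∧
      IsScaled E q K X ∧ (k : ℝ) * ∑ i, ∑ j, |(E (.inl i) (.inl j) : ℝ)| ≤ K := by
  set num : ℕ → ℕ → ℤ := fun i j => inputMem N E k (2, (i : ℕ), (j : ℕ)) with hnum
  set den : ℕ → ℕ → ℤ := fun i j => inputMem N E k (3, (i : ℕ), (j : ℕ)) with hden
  have hnumE : ∀ ρ j, num ((a + innerIndex ρ) % (a + b + c)) (colNat j) = (E ρ j).num :=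
    fun ρ j => by rw [← inputMem_num (N := N) (E := E) (k := k), rowIndex_eq, colIndex_eq]
  have hdenE : ∀ ρ j, den ((a + innerIndex ρ) % (a + b + c)) (colNat j) = (E ρ j).den :=
    fun ρ j => by rw [← inputMem_den (N := N) (E := E) (k := k), rowIndex_eq, colIndex_eq]
  have hex : ∀ i < a + b + c, ∀ j < α + β, ∃ (ρ : Row a b c) (l : Col α β),
      num i j = (E ρ l).num ∧ den i j = (E ρ l).den := by
    intro i hi j hj
    obtain ⟨ρ, hρ⟩ := exists_rowIndex_eq hi
    obtain ⟨l, hl⟩ := exists_colIndex_eq hj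
    exact ⟨ρ, l, by rw [← inputMem_num (N := N) (E := E) (k := k), hρ, hl],
      by rw [← inputMem_den (N := N) (E := E) (k := k), hρ, hl]⟩
  have hs : inputSize N E k
    = (a + b + c) + α + β + maxBits N + matrixBits E + k.size := rfl
  set s := 1 + inputSize N E k with hs'
  have hden0 : ∀ i < a + b + c, ∀ j < α + β, 0 < den i j := fun i hi j hj => by
    obtain ⟨ρ, l, -, h⟩ := hex i hi j hj
    rw [h]
    exact_mod_cast (E ρ l).den_pos
  set P := ∏ i ∈ Finset.range (a + b + c), ∏ j ∈ Finset.range (α + β), den i j with hP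
  set K := (k : ℤ) * (1 + ∑ i ∈ Finset.range (a + b + c), ∑ j ∈ Finset.range (α + β),
    num i j * num i j) with hK
  have hP0 : 0 < P := Finset.prod_pos fun i hi => Finset.prod_pos fun j hj =>
    hden0 i (Finset.mem_range.1 hi) j (Finset.mem_range.1 hj)
  have hsq : 0 ≤ ∑ i ∈ Finset.range (a + b + c), ∑ j ∈ Finset.range (α + β), num i j * num i j :=
    Finset.sum_nonneg fun i _ => Finset.sum_nonneg fun j _ => mul_self_nonneg _
  have hK0 : 0 < K := mul_pos (by exact_mod_cast hk) (by linarith)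
  obtain ⟨m', Q, d, T, S, hrun, hC⟩ := constructCmd_run (a := a) (b := b) (c := c) (α := α)
    (n := α + β) (k := k) (s := s) (N := N) (m₀ := inputMem N E k) hN
    (by simp [inputMem_zero]) (by simp [inputMem_zero]) (by simp [inputMem_zero])
    (by simp [inputMem_zero]) (by simp [inputMem_zero]) (by simp [inputMem_zero])
    inputMem_moduli (fun i j => inputMem_eq_zero (by norm_num) i j)
    (fun i j => inputMem_eq_zero (by norm_num) i j) hk (num := num) (den := den)
    (fun _ _ _ _ => rfl) (fun _ _ _ _ => rfl) hden0
    (fun i hi j hj => by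
      obtain ⟨ρ, l, -, h⟩ := hex i hi j hj
      rw [h]
      have := bits_le_matrixBits E ρ l
      exact_mod_cast (Nat.size_le.1 (by omega : (E ρ l).den.size ≤ s)).le)
    (fun i hi j hj => by
      obtain ⟨ρ, l, h, -⟩ := hex i hi j hj
      rw [h]
      have := bits_le_matrixBits E ρ l
      exact intAbs_le_two_pow (by omega))
    (fun i => by
      have := size_le_maxBits N i
      exact_mod_cast (Nat.size_le.1 (by omega : (N i).size ≤ s)).le)
    (by exact_mod_cast (Nat.size_le.1 (by omega : k.size ≤ s)).le)
    (by omega) (by omega) (by omega) hP hK rfl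
  refine ⟨m', P * K, Q, d, K, _, T, S, hrun, hC, isScaled_of_eq hφ hnumE hdenE (fun ρ j => ?_) hP0
    hK0 rfl, mul_sum_abs_le hnumE⟩
  rw [← hdenE]
  exact (Finset.dvd_prod_of_mem (fun l => den _ l) (Finset.mem_range.2 (colNat_lt j))).trans
    (Finset.dvd_prod_of_mem (fun i => ∏ l ∈ Finset.range (α + β), den i l)
      (Finset.mem_range.2 (Nat.mod_lt _ (by have := innerIndex_lt ρ; omega))))

theorem exists_count_eq {p : ℕ → Prop} [DecidablePred p] {b r : ℕ} (h : r < Nat.count p b) :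
    ∃ w < b, p w ∧ Nat.count p w = r := by
  induction b with
  | zero => simp at h
  | succ b ih =>
    by_cases hr : r < Nat.count p b
    · obtain ⟨w, hw, h1⟩ := ih hr
      exact ⟨w, hw.trans b.lt_succ_self, h1⟩
    · rw [Nat.count_succ] at h
      split_ifs at h with hb
      · exact ⟨b, b.lt_succ_self, hb, by omega⟩
      · omega

/-- The numbers written in an inner row are read at the outer index of the row. -/
theorem holds_of_eq {m : Mem} {A : ℕ} {j : ℤ} {q : ℤ} (hq : 0 < q) {y : ℕ → ℤ}
    (h : ∀ u < a + b + c, m (A, ((a + u) % (a + b + c) : ℕ), j) = y u)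
    (h' : ∀ u < a + b + c, m (A + 1, ((a + u) % (a + b + c) : ℕ), j) = rowDen b c q u) :
    Holds m A j (elemOf N q y : ElemGroup a b N) := by
  refine ⟨fun ρ => ?_, ?_⟩
  · rw [rowIndex_eq, h' _ (innerIndex_lt ρ)]
    exact rowDen_pos hq _
  · simp only [rowIndex_eq, h _ (innerIndex_lt _), h' _ (innerIndex_lt _)]
    exact congruent_elemOf q y

/-- The memory after the construction holds the generators of a digit system of the net. -/
theorem Constructed.exists_digitSystem {n s : ℕ} {q Q d : ℤ} {X T S : ℕ → ℕ → ℤ} {m : Mem}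
    (hC : Constructed (a := a) (b := b) N n s q Q d X T S m) (hN : ∀ i, 0 < N i) :
    ∃ (r : ℕ) (F V : ℕ → ℕ → ℤ), r ≤ b ∧ m (59, 0, 0) = r ∧
      (∀ j < a + c, ∀ u < a + b + c, m (6, ((a + u) % (a + b + c) : ℕ), j) = F u j ∧
        |F u j| ≤ 2 ^ (21 * s ^ 3)) ∧
      (∀ k < r, ∀ u < a + b + c, m (8, ((a + u) % (a + b + c) : ℕ), k) = V u k ∧
        |V u k| ≤ 2 ^ (21 * s ^ 3)) ∧
      DigitSystem (netGroup a b N q X n) (fun k : Fin r => elemOf N q fun u => V u k)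
        (fun j : Fin (a + c) => elemOf N q fun u => F u j)
        (fun j => netMod b N q Q d T (b + j) / S (b + j) (b + j)) ∧
      (∀ j : Fin (a + c), (elemOf N q (fun u => F u j) : ElemGroup a b N).2.1 = 0) ∧
      HoldsNet m (fun j : Fin (a + c) => (elemOf N q fun u => F u j : ElemGroup a b N))
        (fun k : Fin r => elemOf N q fun u => V u k) := by
  set r := Nat.count (fun p => T p p ≠ 0) b with hr
  have hex : ∀ k : Fin r, ∃ w < b, T w w ≠ 0 ∧ Nat.count (fun p => T p p ≠ 0) w = k :=
    fun k => exists_count_eq k.2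
  choose p hpb hp0 hpc using hex
  set F : ℕ → ℕ → ℤ := fun u j => completeCoords b T d (fun w => S w (b + j)) u with hF
  set V : ℕ → ℕ → ℤ := fun u k =>
    if h : k < r then completeCoords b T d (fun w => S w (p ⟨k, h⟩)) u else 0 with hV
  have hVk : ∀ (k : Fin r) u, V u k = completeCoords b T d (fun w => S w (p k)) u := fun k u => by
    simp only [hV, dif_pos k.2]
  obtain ⟨hD, hf⟩ := digitSystem_of_isTriangular hN hC.pos_q hC.pos_Q hC.cramer hC.diag_eq_zero
    hC.rowMod_dvd hC.triangular hpb hp0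
    (fun k l h => Fin.ext (by rw [← hpc k, ← hpc l, h]))
    (fun w hw h => by
      have hlt : Nat.count (fun p => T p p ≠ 0) w < r := Nat.count_strict_mono h hw
      exact ⟨⟨_, hlt⟩, Nat.count_injective (hp0 _) h (hpc ⟨_, hlt⟩)⟩)
  have hVf : ∀ k : Fin r, (elemOf N q (fun u => V u k) : ElemGroup a b N)
      = elemOf N q (completeCoords b T d fun u => S u (p k)) := fun k => by
    congr 1
    funext u
    exact hVk k u
  refine ⟨r, F, V, Nat.count_le _, hC.mem_count, fun j hj u hu => ⟨(hC.out_f j hj u hu).1,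
    hC.coords_le u hu _ (by omega)⟩, fun k hk u hu => ?_, ?_, hf, hC.out_n, hC.out_r, fun j => ?_,
    fun k => ?_⟩
  · have h1 := hC.out_v _ (hpb ⟨k, hk⟩) (hp0 ⟨k, hk⟩) u hu
    rw [hpc] at h1
    have h2 := hVk ⟨k, hk⟩ u
    simp only at h1 h2
    rw [h2]
    exact ⟨h1.1, hC.coords_le u hu _ (by have := hpb ⟨k, hk⟩; omega)⟩
  · simpa only [hVf] using hD
  · exact holds_of_eq hC.pos_q (fun u hu => (hC.out_f j j.2 u hu).1)
      fun u hu => (hC.out_f j j.2 u hu).2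
  · have h1 := fun u hu => hC.out_v _ (hpb k) (hp0 k) u hu
    simp only [hpc] at h1
    refine holds_of_eq hC.pos_q (fun u hu => ?_) fun u hu => (h1 u hu).2
    rw [(h1 u hu).1, hVk]

end

/-! ### The sampling program -/

section

variable {a b c : ℕ} {N : Fin c → ℕ}

section Digits

variable {M : AddSubgroup (ElemGroup a b N)} {r n : ℕ} {v : Fin r → ElemGroup a b N}
  {f : Fin n → ElemGroup a b N} {h : Fin n → ℤ} {g e : ℕ → ℕ} {Δ : Fin r → ℕ}

/-- The element with given random digits: the coefficients of the generators `f` are the digits, the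
coefficients of the basis `v` are shifted to range from `-Δ` to `Δ`. -/
def digitElem (v : Fin r → ElemGroup a b N) (f : Fin n → ElemGroup a b N) (Δ : Fin r → ℕ)
    (x : (j : Fin n) → Fin (g j + 1)) (y : (k : Fin r) → Fin (e k + 1)) : ElemGroup a b N :=
  ∑ k, (((y k : ℕ) : ℤ) - Δ k) • v k + ∑ j, ((x j : ℕ) : ℤ) • f j

theorem DigitSystem.digitElem_inj (hS : DigitSystem M v f h) (hg : ∀ j : Fin n, (g j : ℤ) + 1 = h j)
    {x x' : (j : Fin n) → Fin (g j + 1)} {y y' : (k : Fin r) → Fin (e k + 1)}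
    (hxy : digitElem v f Δ x y = digitElem v f Δ x' y') : x = x' ∧ y = y' := by
  have hx : ∀ (x : (j : Fin n) → Fin (g j + 1)) (j : Fin n),
      0 ≤ ((x j : ℕ) : ℤ) ∧ ((x j : ℕ) : ℤ) < h j := fun x j => by
    have := (x j).2
    have := hg j
    omega
  obtain ⟨h1, h2⟩ := hS.unique _ _ _ _ (hx x) (hx x') hxy
  refine ⟨funext fun j => Fin.ext ?_, funext fun k => Fin.ext ?_⟩
  · exact_mod_cast congrFun h2 j
  · have := congrFun h1 k
    omega

theorem DigitSystem.exists_digitElem_iff (hS : DigitSystem M v f h)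
    (hg : ∀ j : Fin n, (g j : ℤ) + 1 = h j) (he : ∀ k : Fin r, e k = 2 * Δ k)
    (z : ElemGroup a b N) :
    (∃ (x : (j : Fin n) → Fin (g j + 1)) (y : (k : Fin r) → Fin (e k + 1)),
      digitElem v f Δ x y = z) ↔ z ∈ deltaNet (AddSubgroup.closure (Set.range f)) v Δ := by
  constructor
  · rintro ⟨x, y, rfl⟩
    refine ⟨∑ j, ((x j : ℕ) : ℤ) • f j, hS.mem_closure_iff.2 ⟨_, fun j => ?_, rfl⟩, _,
      ⟨fun k => ((y k : ℕ) : ℤ) - Δ k, fun k => ?_, rfl⟩, add_comm _ _⟩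
    · have := (x j).2
      have := hg j
      omega
    · have := (y k).2
      have := he k
      rw [abs_le]
      constructor <;> dsimp only <;> omega
  · rintro ⟨_, hx, _, ⟨l, hl, rfl⟩, rfl⟩
    obtain ⟨d, hd, rfl⟩ := hS.mem_closure_iff.1 hx
    have hl' := fun k => abs_le.1 (hl k)
    refine ⟨fun j => ⟨(d j).toNat, ?_⟩, fun k => ⟨(l k + Δ k).toNat, ?_⟩, ?_⟩
    · have := hd j
      have := hg j
      omega
    · have := hl' k
      have := he k
      omega
    · rw [digitElem, add_comm]
      congr 1
      · refine Finset.sum_congr rfl fun j _ => ?_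
        simp only [Int.toNat_of_nonneg (hd j).1]
      · refine Finset.sum_congr rfl fun k _ => ?_
        have := hl' k
        simp only [Int.toNat_of_nonneg (by omega : 0 ≤ l k + Δ k), add_sub_cancel_right]

end Digits

theorem elemOf_comb {q : ℤ} {n r : ℕ} (x y : ℕ → ℤ) (F V : ℕ → ℕ → ℤ) :
    (elemOf N q (fun u => ∑ j ∈ Finset.range n, x j * F u j + ∑ k ∈ Finset.range r, y k * V u k) :
      ElemGroup a b N)
    = ∑ k : Fin r, y k • elemOf N q (fun u => V u k)
      + ∑ j : Fin n, x j • elemOf N q (fun u => F u j) := by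
  simp only [← map_zsmul, ← map_sum, ← map_add]
  congr 1
  funext u
  simp only [Pi.add_apply, Finset.sum_apply, Pi.smul_apply, smul_eq_mul, Finset.sum_range]
  exact add_comm _ _

/-- The program that samples from the net: it constructs the net, draws the digits and adds up. -/
def sampleCmd : Cmd := .seq constructCmd (.seq drawFiniteCmd (.seq drawFreeCmd combineCmd))

/-- The draws after the construction, on a memory that also holds `Δ` in the array `4`. -/
theorem Constructed.exists_draws {n s W r : ℕ} {q Q d : ℤ} {X T S F V : ℕ → ℕ → ℤ} {m m' : Mem}
    (hC : Constructed (a := a) (b := b) N n s q Q d X T S m) (hN : ∀ i, 0 < N i) (hrb : r ≤ b)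
    (hr : m (59, 0, 0) = r)
    (hF : ∀ j < a + c, ∀ u < a + b + c, m (6, ((a + u) % (a + b + c) : ℕ), j) = F u j ∧
      |F u j| ≤ 2 ^ (21 * s ^ 3))
    (hV : ∀ k < r, ∀ u < a + b + c, m (8, ((a + u) % (a + b + c) : ℕ), k) = V u k ∧
      |V u k| ≤ 2 ^ (21 * s ^ 3))
    (hpos : ∀ j : Fin (a + c), 0 < netMod b N q Q d T (b + j) / S (b + j) (b + j))
    {Δ : Fin r → ℕ} (hm : ∀ A ≠ 4, ∀ i j, m' (A, i, j) = m (A, i, j))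
    (hmΔ : ∀ k : Fin r, m' (4, (k : ℕ), 0) = Δ k) (hW : ∀ p, bitLen (m' p) ≤ W)
    (hms : a + b + c ≤ s) (hsW : 40 * s ^ 3 + s + maxBits Δ + 1 < W) :
    ∃ (g e : ℕ → ℕ) (M : ((j : Fin (a + c)) → Fin (g j + 1)) ×
        (((k : Fin r) → Fin (e k + 1)) × Unit) → Mem),
      (∀ j : Fin (a + c), (g j : ℤ) + 1 = netMod b N q Q d T (b + j) / S (b + j) (b + j)) ∧
      (∀ k : Fin r, e k = 2 * Δ k) ∧
      Draws W (.seq drawFiniteCmd (.seq drawFreeCmd combineCmd)) m' M ∧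
      ∀ ω, Holds (M ω) 10 0 (digitElem (fun k : Fin r => elemOf N q fun u => V u k)
        (fun j : Fin (a + c) => elemOf N q fun u => F u j) Δ ω.1 ω.2.1 : ElemGroup a b N) := by
  have hpow : ∀ {x y : ℕ}, x ≤ y → (2 : ℤ) ^ x ≤ 2 ^ y := fun h =>
    pow_le_pow_right₀ (by norm_num) h
  have hpowlt : ∀ {x y : ℕ}, x < y → (2 : ℤ) ^ x < 2 ^ y := fun h =>
    pow_lt_pow_right₀ (by norm_num) h
  set g : ℕ → ℕ := fun j => (netMod b N q Q d T (b + j) / S (b + j) (b + j) - 1).toNat with hgdef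
  set Δ' : ℕ → ℕ := fun k => if h : k < r then Δ ⟨k, h⟩ else 0 with hΔ'
  have hΔk : ∀ k : Fin r, Δ' k = Δ k := fun k => by simp only [hΔ', dif_pos k.2]
  have hΔs : ∀ k < r, (Δ' k : ℤ) < 2 ^ maxBits Δ := fun k hk => by
    rw [hΔk ⟨k, hk⟩]
    exact_mod_cast Nat.size_le.1 (size_le_maxBits Δ ⟨k, hk⟩)
  have hm4 : ∀ k < r, m' (4, k, 0) = Δ' k := fun k hk => by
    rw [hΔk ⟨k, hk⟩]; exact hmΔ ⟨k, hk⟩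
  have hg : ∀ j < a + c, (g j : ℤ) + 1 = netMod b N q Q d T (b + j) / S (b + j) (b + j) :=
    fun j hj => by
      have := hpos ⟨j, hj⟩
      simp only [hgdef] at this ⊢
      omega
  have hgs : ∀ j < a + c, (g j : ℤ) < 2 ^ (16 * s ^ 3) := fun j hj => by
    have h1 := Int.ediv_le_self (S (b + j) (b + j))
      (netMod_pos (b := b) hN hC.pos_q hC.pos_Q hC.cramer.ne_zero (T := T) (b + j)).le
    have h2 := hC.netMod_le (b + j) (by omega)
    have := hg j hj
    omega
  -- the digit `j` has `g j + 1` values, the number in the program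
  obtain ⟨M₁, hd₁, f₁, v₁⟩ := Draws.for_rand (W := W) (x := 31) (A := 12)
    (ne := .get 0 0 0 + .get 0 2 0)
    (e := .get 57 (.get 0 1 0 + .var 31) 0 / .get 58 (.get 0 1 0 + .var 31) (.get 0 1 0 + .var 31))
    (m₀ := m') (a + c) (by omega) g (by norm_num)
    (fun m₁ h₁ => by
      have e1 : m₁ (0, 0, 0) = a := by
        rw [h₁ _ (by norm_num) (by norm_num), hm _ (by norm_num), hC.mem_a]
      have e2 : m₁ (0, 2, 0) = c := by
        rw [h₁ _ (by norm_num) (by norm_num), hm _ (by norm_num), hC.mem_c]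
      simp [e1, e2])
    (fun j hj m₁ h₁ hx => by
      have e1 : m₁ (0, 1, 0) = b := by
        rw [h₁ _ (by norm_num) (by norm_num), hm _ (by norm_num), hC.mem_b]
      have e2 : m₁ (57, (b + j : ℤ), 0) = netMod b N q Q d T (b + j) := by
        rw [h₁ _ (by norm_num) (by norm_num), hm _ (by norm_num), ← hC.mem_mod _ (by omega)]
        push_cast; rfl
      have e3 : m₁ (58, (b + j : ℤ), (b + j : ℤ)) = S (b + j) (b + j) := by
        rw [h₁ _ (by norm_num) (by norm_num), hm _ (by norm_num),
          ← hC.mem_basis _ (by omega) _ (by omega)]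
        push_cast; rfl
      simp [hx, e1, e2, e3, hg j hj])
    (fun j hj => (hgs j hj).trans_le (hpow (by omega))) hW
  have k₁ : ∀ ω B, B ≠ 31 → B ≠ 12 → B ≠ 4 → ∀ i j, M₁ ω (B, i, j) = m (B, i, j) :=
    fun ω B h1 h2 h4 i j => by rw [f₁ ω B h1 h2, hm B h4]
  -- the coefficient `k`, shifted by `Δ k`, has `2 Δ k + 1` values
  have hex := fun ω => Draws.for_rand (W := W) (x := 31) (A := 13) (ne := .var 59)
    (e := 2 * .get 4 (.var 31) 0 + 1) (m₀ := M₁ ω) r (by omega) (fun k => 2 * Δ' k) (by norm_num)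
    (fun m₁ h₁ => by
      have e1 : m₁ (59, 0, 0) = r := by
        rw [h₁ _ (by norm_num) (by norm_num), k₁ _ _ (by norm_num) (by norm_num) (by norm_num), hr]
      simp [e1])
    (fun k hk m₁ h₁ hx => by
      have e1 : m₁ (4, (k : ℤ), 0) = Δ' k := by
        rw [h₁ _ (by norm_num) (by norm_num), f₁ _ _ (by norm_num) (by norm_num), hm4 k hk]
      simp [hx, e1])
    (fun k hk => by
      have h1 := hΔs k hk
      have h2 : (2 : ℤ) ^ (maxBits Δ + 1) ≤ 2 ^ W := hpow (by omega)
      rw [pow_succ] at h2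
      push_cast
      omega)
    (hd₁.1 ω)
  choose M₂ hd₂ f₂ v₂ using hex
  -- adding up gives the coordinates of `digitElem`
  have hrun : ∀ ω ω', ∃ m₃, Run W combineCmd (M₂ ω ω') m₃ ∧ Holds m₃ 10 0
      (digitElem (e := fun k => 2 * Δ' k) (fun k : Fin r => elemOf N q fun u => V u k)
        (fun j : Fin (a + c) => elemOf N q fun u => F u j) Δ ω ω' : ElemGroup a b N) := by
    intro ω ω'
    have k₂ : ∀ B, B ≠ 31 → B ≠ 12 → B ≠ 13 → B ≠ 4 → ∀ i j, M₂ ω ω' (B, i, j) = m (B, i, j) :=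
      fun B h1 h2 h3 h4 i j => by rw [f₂ ω ω' B h1 h3, k₁ ω B h1 h2 h4]
    have hlast : ((a + c : ℕ) : ℤ) * (2 ^ (16 * s ^ 3) * 2 ^ (21 * s ^ 3))
        + r * (2 ^ maxBits Δ * 2 ^ (21 * s ^ 3)) < 2 ^ W := by
      have h1 : ((a + c : ℕ) : ℤ) * (2 ^ (16 * s ^ 3) * 2 ^ (21 * s ^ 3)) ≤
          2 ^ s * (2 ^ (16 * s ^ 3) * 2 ^ (21 * s ^ 3)) := by
        gcongr
        exact natCast_le_two_pow (by omega)
      have h2 : (r : ℤ) * (2 ^ maxBits Δ * 2 ^ (21 * s ^ 3)) ≤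
          2 ^ s * (2 ^ maxBits Δ * 2 ^ (21 * s ^ 3)) := by
        gcongr
        exact natCast_le_two_pow (by omega)
      have h3 : (2 : ℤ) ^ s * (2 ^ (16 * s ^ 3) * 2 ^ (21 * s ^ 3))
          ≤ 2 ^ (38 * s ^ 3 + s + maxBits Δ) := by
        rw [← pow_add, ← pow_add]; exact hpow (by omega)
      have h4 : (2 : ℤ) ^ s * (2 ^ maxBits Δ * 2 ^ (21 * s ^ 3))
          ≤ 2 ^ (38 * s ^ 3 + s + maxBits Δ) := by
        rw [← pow_add, ← pow_add]; exact hpow (by omega)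
      have h5 : (2 : ℤ) ^ (38 * s ^ 3 + s + maxBits Δ + 1) < 2 ^ W := hpowlt (by omega)
      rw [pow_succ] at h5
      linarith
    set x : ℕ → ℤ := fun j => if h : j < a + c then ((ω ⟨j, h⟩ : ℕ) : ℤ) else 0 with hx
    set y : ℕ → ℤ := fun k => if h : k < r then ((ω' ⟨k, h⟩ : ℕ) : ℤ) else 0 with hy
    have hxj : ∀ j : Fin (a + c), x j = ((ω j : ℕ) : ℤ) := fun j => by simp only [hx, dif_pos j.2]
    have hyk : ∀ k : Fin r, y k = ((ω' k : ℕ) : ℤ) := fun k => by simp only [hy, dif_pos k.2]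
    obtain ⟨m₃, hr₃, h₃⟩ := combineCmd_run (W := W) (M := a + b + c) (a := a) (c := c) (r := r)
      (m₀ := M₂ ω ω') (F := F) (V := V) (x := x) (y := y) (Δ := fun k => Δ' k)
      (dn := rowDen b c q) (Bx := 2 ^ (16 * s ^ 3)) (By := 2 ^ maxBits Δ) (D := 2 ^ (21 * s ^ 3))
      (by rw [k₂ _ (by norm_num) (by norm_num) (by norm_num) (by norm_num), hC.mem_m])
      (by rw [k₂ _ (by norm_num) (by norm_num) (by norm_num) (by norm_num), hC.mem_a])
      (by rw [k₂ _ (by norm_num) (by norm_num) (by norm_num) (by norm_num), hC.mem_c])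
      (by rw [k₂ _ (by norm_num) (by norm_num) (by norm_num) (by norm_num), hr])
      (fun u hu => by
        rw [k₂ _ (by norm_num) (by norm_num) (by norm_num) (by norm_num), hC.mem_den u hu])
      (fun u hu j hj => by
        rw [k₂ _ (by norm_num) (by norm_num) (by norm_num) (by norm_num), (hF j hj u hu).1])
      (fun u hu k hk => by
        rw [k₂ _ (by norm_num) (by norm_num) (by norm_num) (by norm_num), (hV k hk u hu).1])
      (fun j hj => by
        rw [f₂ _ _ _ (by norm_num) (by norm_num), hxj ⟨j, hj⟩]
        exact v₁ ω ⟨j, hj⟩)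
      (fun k hk => by
        rw [hyk ⟨k, hk⟩]
        exact v₂ ω ω' ⟨k, hk⟩)
      (fun k hk => by
        rw [f₂ _ _ _ (by norm_num) (by norm_num), f₁ _ _ (by norm_num) (by norm_num), hm4 k hk])
      (fun u hu j hj => (hF j hj u hu).2) (fun u hu k hk => (hV k hk u hu).2)
      (fun j hj => by
        rw [hxj ⟨j, hj⟩, abs_of_nonneg (by positivity)]
        have h1 := (ω ⟨j, hj⟩).2
        have h2 := hgs j hj
        simp only at h1 ⊢
        omega)
      (fun k hk => by
        rw [hyk ⟨k, hk⟩]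
        have h1 := (ω' ⟨k, hk⟩).2
        have h2 := hΔs k hk
        simp only at h1 ⊢
        rw [abs_le]
        omega)
      (by positivity) (by positivity) (by positivity)
      (fun u hu => (hC.rowDen_lt u hu).trans_le (hpow (by omega)))
      (by omega) (by omega) (by omega) hlast
    refine ⟨m₃, hr₃, ?_⟩
    have h4 := holds_of_eq (N := N) (a := a) hC.pos_q (m := m₃) (A := 10) (j := 0)
      (fun u hu => (h₃ u hu).1) (fun u hu => (h₃ u hu).2)
    rw [elemOf_comb x (fun k => y k - Δ' k)] at h4
    simpa only [digitElem, hxj, hyk, hΔk] using h4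
  choose M₃ hr₃ h₃ using hrun
  exact ⟨g, fun k => 2 * Δ' k, fun ω => M₃ ω.1 ω.2.1, fun j => hg j j.2,
    fun k => by simp only [hΔk],
    hd₁.seq fun ω => (hd₂ ω).seq fun ω' => (hr₃ ω ω').draws ((hd₂ ω).1 ω'), fun ω => h₃ _ _⟩

end

/-! ### Time and memory -/

/-- With numbers of at most `64 s ^ 3` bits, time and memory are polynomial in `s`. -/
theorem Cmd.exists_bound (c : Cmd) :
    ∃ C d : ℕ, ∀ s, 1 ≤ s → 64 * s ^ 3 + c.timeBound (64 * s ^ 3) ≤ C * s ^ d := by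
  obtain ⟨C, d, h⟩ := c.exists_timeBound_le
  refine ⟨64 + C * 65 ^ d, 3 * d + 3, fun s hs => ?_⟩
  have h1 : 1 ≤ s ^ 3 := Nat.one_le_pow _ _ hs
  have h2 : (64 * s ^ 3 + 1) ^ d ≤ 65 ^ d * s ^ (3 * d) := by
    rw [pow_mul, ← mul_pow]
    gcongr
    omega
  calc 64 * s ^ 3 + c.timeBound (64 * s ^ 3)
      ≤ 64 * s ^ 3 + C * (65 ^ d * s ^ (3 * d)) :=
        Nat.add_le_add_left ((h _).trans (Nat.mul_le_mul_left _ h2)) _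
    _ ≤ 64 * s ^ (3 * d + 3) + C * (65 ^ d * s ^ (3 * d + 3)) := by
        gcongr <;> omega
    _ = (64 + C * 65 ^ d) * s ^ (3 * d + 3) := by ring

theorem Run.constructs {a b c n r : ℕ} {N : Fin c → ℕ} {W T : ℕ} {p : Cmd} {m₀ m : Mem}
    (h : Run W p m₀ m) (hm₀ : memBits m₀ ≤ W) {f : Fin n → ElemGroup a b N}
    {v : Fin r → ElemGroup a b N} (hm : HoldsNet m f v) (hT : W + p.timeBound W ≤ T) :
    Constructs p m₀ T f v := by
  obtain ⟨-, h⟩ := h.exec_eq fun q => (bitLen_le_memBits m₀ q).trans hm₀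
  obtain ⟨s, hs, -, ht, hb, he⟩ := h (start m₀) rfl
  have h0 : (start m₀).time = 0 := rfl
  have hp := (hb (memBits m₀) ⟨le_self_add, le_self_add⟩).2
  exact ⟨W + 1, s, he _ (Nat.lt_succ_self W), by omega, by omega, by rwa [hs]⟩

/-- The construction also runs in the presence of the additional input of the sampling program, and
the draws that follow produce every element of the net for exactly one choice of the digits. -/
theorem Constructed.samples {a b c α β k : ℕ} {N : Fin c → ℕ}
    {E : Matrix (Row a b c) (Col α β) ℚ} {n r : ℕ} {q Q d : ℤ} {X T S F V : ℕ → ℕ → ℤ} {m : Mem}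
    (hC : Constructed (a := a) (b := b) N n (1 + inputSize N E k) q Q d X T S m)
    (hN : ∀ i, 0 < N i)
    (hrun : Run (40 * (1 + inputSize N E k) ^ 3) constructCmd (inputMem N E k) m) (hrb : r ≤ b)
    (hr : m (59, 0, 0) = r)
    (hF : ∀ j < a + c, ∀ u < a + b + c, m (6, ((a + u) % (a + b + c) : ℕ), j) = F u j ∧
      |F u j| ≤ 2 ^ (21 * (1 + inputSize N E k) ^ 3))
    (hV : ∀ k' < r, ∀ u < a + b + c, m (8, ((a + u) % (a + b + c) : ℕ), k') = V u k' ∧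
      |V u k'| ≤ 2 ^ (21 * (1 + inputSize N E k) ^ 3))
    (hS : DigitSystem (netGroup a b N q X n) (fun k' : Fin r => elemOf N q fun u => V u k')
      (fun j : Fin (a + c) => elemOf N q fun u => F u j)
      (fun j => netMod b N q Q d T (b + j) / S (b + j) (b + j))) (Δ : Fin r → ℕ) {U : ℕ}
    (hU : 64 * (1 + inputSize N E k + maxBits Δ) ^ 3
      + sampleCmd.timeBound (64 * (1 + inputSize N E k + maxBits Δ) ^ 3) ≤ U) :
    Samples sampleCmd (inputMem N E k + edgeMem Δ) U
      (deltaNet (AddSubgroup.closure (Set.range fun j : Fin (a + c) =>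
        (elemOf N q fun u => F u j : ElemGroup a b N)))
        (fun k' : Fin r => elemOf N q fun u => V u k') Δ) := by
  have hsize : inputSize N E k
    = (a + b + c) + α + β + maxBits N + matrixBits E + k.size := rfl
  have hmem1 := memBits_inputMem_le (N := N) (E := E) (k := k)
  set s := 1 + inputSize N E k with hs
  set s' := s + maxBits Δ with hs'
  have hss : s ^ 3 ≤ s' ^ 3 := Nat.pow_le_pow_left (by omega) 3
  have e1 : s' ≤ s' ^ 3 := Nat.le_self_pow (by norm_num) s'
  have e2 : s' * s' ≤ s' ^ 3 := by
    rw [← sq]; exact Nat.pow_le_pow_right (by omega) (by norm_num)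
  have hmem : memBits (inputMem N E k + edgeMem Δ) ≤ 64 * s' ^ 3 := by
    have h1 := memBits_add_le (inputMem N E k) (edgeMem Δ)
    have h2 := memBits_edgeMem_le Δ
    have h3 : r * (r + maxBits Δ + 1) ≤ s' * s' := Nat.mul_le_mul (by omega) (by omega)
    omega
  have hW : 40 * s ^ 3 ≤ 64 * s' ^ 3 := by omega
  obtain ⟨m', hrun', hm'⟩ := (hrun.mono hW).congr (B := 4) rfl (n := inputMem N E k + edgeMem Δ)
    (fun A hA i j => by rw [Finsupp.add_apply, edgeMem_eq_zero Δ hA, add_zero])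
  have hdraw := hrun'.draws fun p => (bitLen_le_memBits _ p).trans hmem
  obtain ⟨g, e, M, hg, he, hM, hH⟩ := hC.exists_draws (W := 64 * s' ^ 3) hN hrb hr hF hV hS.pos
    (Δ := Δ) hm' (fun l => by
      rw [hrun'.frame rfl, Finsupp.add_apply, inputMem_eq_zero le_rfl, zero_add, edgeMem_apply])
    (hdraw.1 ()) (by omega) (by omega)
  have hall := hdraw.seq fun _ => hM
  refine (congrArg (Samples _ _ _) (Set.ext fun z => ?_)).mp (hall.samples (T := U) (g := fun ω => digitElem
    (fun k' : Fin r => elemOf N q fun u => V u k')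
    (fun j : Fin (a + c) => elemOf N q fun u => F u j) Δ ω.2.1 ω.2.2.1)
    (by
      rintro ⟨⟨⟩, x, y, ⟨⟩⟩ ⟨⟨⟩, x', y', ⟨⟩⟩ h
      obtain ⟨rfl, rfl⟩ := hS.digitElem_inj hg h
      rfl)
    (fun ω => hH ω.2) ((Nat.add_le_add_right hmem _).trans hU))
  rw [← hS.exists_digitElem_iff hg he]
  exact ⟨fun ⟨ω, h⟩ => ⟨ω.2.1, ω.2.2.1, h⟩, fun ⟨x, y, h⟩ => ⟨((), x, y, ()), h⟩⟩

end NetSampling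

theorem mainTheorem3 :
    ∃ (construct sample : NetSampling.Cmd) (C d : ℕ),
      ∀ (a b c α β : ℕ) (N : Fin c → ℕ), (∀ i, 0 < N i) →
      ∀ (E : Matrix (NetSampling.Row a b c) (NetSampling.Col α β) ℚ)
        (φ : (Fin α → ℝ) × (Fin β → ℤ) →+ NetSampling.ElemGroup a b N)
        (H : AddSubgroup (NetSampling.ElemGroup a b N)),
      IsClosed (H : Set (NetSampling.ElemGroup a b N)) →
      NetSampling.IsMatrixRep E φ → φ.range = H →
      ∀ ε : ℝ, 0 < ε →
      ∃ (M Mc Mf : AddSubgroup (NetSampling.ElemGroup a b N)) (n r : ℕ)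
        (f : Fin n → NetSampling.ElemGroup a b N) (v : Fin r → NetSampling.ElemGroup a b N),
        NetSampling.IsEpsNet ε H M ∧ NetSampling.IsNetDecomp H M Mc Mf ∧
        AddSubgroup.closure (Set.range f) = Mc ∧ NetSampling.IsZBasis v Mf ∧
        NetSampling.Constructs construct (NetSampling.inputMem N E ⌈1 / ε⌉₊)
          (C * (1 + NetSampling.inputSize N E ⌈1 / ε⌉₊) ^ d) f v ∧
        ∀ Δ : Fin r → ℕ,
          NetSampling.Samples sample
            (NetSampling.inputMem N E ⌈1 / ε⌉₊ + NetSampling.edgeMem Δ)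
            (C * (1 + NetSampling.inputSize N E ⌈1 / ε⌉₊ + NetSampling.maxBits Δ) ^ d)
            (NetSampling.deltaNet Mc v Δ) := by
  open NetSampling in
  obtain ⟨C₁, d₁, h₁⟩ := constructCmd.exists_bound
  obtain ⟨C₂, d₂, h₂⟩ := sampleCmd.exists_bound
  -- one polynomial that bounds both programs
  have hle : ∀ {C d s : ℕ}, C ≤ C₁ + C₂ → d ≤ d₁ + d₂ → 1 ≤ s →
      C * s ^ d ≤ (C₁ + C₂) * s ^ (d₁ + d₂) := fun hC hd hs =>
    Nat.mul_le_mul hC (Nat.pow_le_pow_right hs hd)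
  refine ⟨constructCmd, sampleCmd, C₁ + C₂, d₁ + d₂, ?_⟩
  intro a b c α β N hN E φ H hcl hφ hH ε hε
  subst hH
  have hk : 0 < ⌈1 / ε⌉₊ := Nat.ceil_pos.2 (by positivity)
  have hkε : 1 ≤ ε * ⌈1 / ε⌉₊ := by
    have := mul_le_mul_of_nonneg_left (Nat.le_ceil (1 / ε)) hε.le
    rwa [mul_one_div_cancel hε.ne'] at this
  generalize ⌈1 / ε⌉₊ = k at hk hkε ⊢
  obtain ⟨m, q, Q, d, K, X, T, S, hrun, hC, hX, hK⟩ := exists_constructed hN hφ hk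
  obtain ⟨r, F, V, hrb, hr, hF, hV, hS, hf, hnet⟩ := hC.exists_digitSystem hN
  have hεK : ∑ i, ∑ j, |(E (.inl i) (.inl j) : ℝ)| ≤ ε * K := by
    have h0 : 0 ≤ ∑ i, ∑ j, |(E (.inl i) (.inl j) : ℝ)| :=
      Finset.sum_nonneg fun i _ => Finset.sum_nonneg fun j _ => abs_nonneg _
    have h3 := mul_le_mul_of_nonneg_left hK hε.le
    have h4 := mul_le_mul_of_nonneg_right hkε h0
    linarith
  have hs : 40 * (1 + inputSize N E k) ^ 3 ≤ 64 * (1 + inputSize N E k) ^ 3 := by gcongr; norm_num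
  refine ⟨_, _, _, a + c, r, _, _, hX.isEpsNet hφ hεK hS, hX.isNetDecomp hφ hN hcl hS hf, rfl,
    ⟨hS.linearIndependent, rfl⟩, (hrun.mono hs).constructs
      (memBits_inputMem_le.trans (by gcongr; norm_num)) hnet
      ((h₁ _ (by omega)).trans (hle (by omega) (by omega) (by omega))), fun Δ => ?_⟩
  exact hC.samples hN hrun hrb hr hF hV hS Δ
    ((h₂ _ (by omega)).trans (hle (by omega) (by omega) (by omega)))
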